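/- Let $\mathbb F$ be an algebraically closed field with $\operatorname{char}\mathbb F\neq 2$, let $G$ be an abelian group (written multiplicatively), $G^\#=G\times\mathbb Z_2$, and let $p\colon G^\#\to\mathbb Z_2$ be the projection (parity). $G$-graded superalgebras are regarded as $G^\#$-graded algebras, and isomorphisms preserve the $G$-degree, the parity and the superinvolution. For a superalgebra $S$, $S^{\mathrm{sop}}$ is its superopposite, with product $\bar r\,\bar s=(-1)^{|r||s|}\overline{sr}$, and $S\times S^{\mathrm{sop}}$ carries the exchange superinvolution $(s_1,\bar s_2)\mapsto(s_2,\bar s_1)$. $M(m,n)$ is the matrix superalgebra with even part the block-diagonal and odd part the block-antidiagonal matrices, and $Q(n)\subseteq M(n,n)$ is the subsuperalgebra of the matrices $\begin{pmatrix}A&B\\B&A\end{pmatrix}$. A graded-simple (finite-dimensional) $G$-graded superalgebra is isomorphic to $\operatorname{End}_{D}(U)\cong M_k(D)$ with $D$ a graded-division superalgebra, unique up to isomorphism, and $U$ a graded right $D$-module of finite rank $k$; the grading is called odd if $D$ has a nonzero odd component. **Parameters.** Let $T\subseteq G^\#$ be a finite subgroup, $T^\pm$ its sets of even and odd elements, with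 $T\ne T^+$; we also write $T^+$ for the subgroup $\{h\in G: (h,\bar 0)\in T\}$ of $G$. Let $\tilde\beta\colon T\times T\to\{\pm1\}$ be a skew-symmetric bicharacter with $\tilde\beta(t,t)=(-1)^{p(t)}$, and put $\beta(s,t)=(-1)^{p(s)p(t)}\tilde\beta(s,t)$, $\beta^+=\beta|_{T^+\times T^+}$. Assume that $\operatorname{rad}\tilde\beta=\langle f\rangle$ with $e\neq f\in T^+$, that $T^+$ is an elementary $2$-group, and that $t^2=f$ for all $t\in T^-$. Let $t_p\in T$ be a parity element, i.e. $\tilde\beta(t_p,t)=(-1)^{p(t)}$ for all $t\in T$. For each such triple $(T,\tilde\beta,t_p)$ fix, once and for all, a subgroup $K\subseteq T^+$ with $T^+=(\operatorname{rad}\beta^+)\times K$, a decomposition $K=A\times B$ with $\beta$ trivial on $A$ and on $B$, and, if $t_p\in T^+$, an element $t_1\in T^-$ with $\beta(t_1,K)=1$. The associated graded-division superalgebra with superinvolution $(D,\varphi_0)=(C\otimes\operatorname{End}(V),\varphi_C\otimes\text{transposition})$ is defined as follows. * $V$ has basis $(e_b)_{b\in B}$, and $X_aX_b$ has degree $ab$,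 where $X_ae_{b'}=\beta(a,b')e_{b'}$, $X_be_{b'}=e_{bb'}$ ($a\in A$, $b\in B$). * If $t_p\in T^+$, then $C=M(1,1)\times M(1,1)^{\mathrm{sop}}$ with the exchange superinvolution, graded by $\langle t_p\rangle\times\langle t_1\rangle\cong\mathbb Z_2\times\mathbb Z_4$: writing $\tau=\begin{pmatrix}1&0\\0&-1\end{pmatrix}$, $u=\begin{pmatrix}0&1\\1&0\end{pmatrix}$, $v=\begin{pmatrix}0&-1\\1&0\end{pmatrix}$, the elements $(1,\bar1),(u,\bar u),(1,-\bar1),(u,-\bar u)$ have degrees $e,t_1,t_1^2,t_1^3$, and $(\tau,\bar\tau),(v,-\bar v),(\tau,-\bar\tau),(v,\bar v)$ have degrees $t_p,t_pt_1,t_pt_1^2,t_pt_1^3$. * If $t_p\in T^-$, then $C=Q(1)\times Q(1)^{\mathrm{sop}}$ with the exchange superinvolution, graded by $\langle t_p\rangle\cong\mathbb Z_4$: with $u=\begin{pmatrix}0&1\\1&0\end{pmatrix}\in Q(1)$, the elements $(1,\bar1),(u,\bar u),(1,-\bar1),(u,-\bar u)$ have degrees $e,t_p,t_p^2,t_p^3$.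 Then $D=\bigoplus_{t\in T}D_t$ with $\dim D_t=1$; let $\eta\colon T\to\{\pm1\}$ be given by $\varphi_0|_{D_t}=\eta(t)\,\mathrm{id}$. For $g_0\in G$, a nonzero finitely supported map $\kappa\colon G/T^+\to\mathbb Z_{\ge0}$ is called $g_0$-admissible if $\kappa(x)=\kappa(g_0^{-1}x^{-1})$ for all $x\in G/T^+$, and $\kappa(gT^+)$ is even whenever $g\in G$, $g_0g^2\in T^+$ and $\eta(g_0g^2)=-1$. **Models.** Let $\kappa$ be $g_0$-admissible. Choose $0\ne X_t\in D_t$ for $t\in T$ and a section $\xi\colon G/T^+\to G$ of the quotient map. Let $k=\sum_x\kappa(x)$ and let $U$ be the graded right $D$-module with a homogeneous basis consisting of $\kappa(x)$ elements of degree $(\xi(x),\bar0)$ for each $x\in\operatorname{supp}\kappa$. Let $\Phi\in M_k(D)$ be the block-diagonal matrix with one block for each unordered pair $\{x,y\}\subseteq\operatorname{supp}\kappa$ (possibly $x=y$) with $g_0xy=T^+$; with $t=g_0\xi(x)\xi(y)$, this block is: $I_{\kappa(x)}\otimes X_t$ if $x=y$, $\eta(t)=1$; $\begin{pmatrix}0&I_{\kappa(x)/2}\\-I_{\kappa(x)/2}&0\end{pmatrix}\otimes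 X_t$ if $x=y$, $\eta(t)=-1$; and $\begin{pmatrix}0&I_{\kappa(x)}\\\eta(t)I_{\kappa(x)}&0\end{pmatrix}\otimes X_t$ if $x\ne y$. The algebra $\operatorname{End}_D(U)=M_k(D)$ with its natural $G^\#$-grading (the matrix whose only nonzero entry is $d\in D_t$ in position $(i,j)$ has degree $\gamma_i\,t\,\gamma_j^{-1}$, where $\gamma_i$ is the degree of the $i$-th basis element) and the superinvolution $\varphi(X)=\Phi^{-1}\varphi_0(X^{\mathsf T})\Phi$ is denoted by $M^{\mathrm{ex}}(T,\tilde\beta,t_p,\kappa,g_0)$ if $t_p\in T^+$ and by $Q^{\mathrm{ex}}(T,\tilde\beta,t_p,\kappa,g_0)$ if $t_p\in T^-$. **Theorem.** Let $M(n,n)\times M(n,n)^{\mathrm{sop}}$ (respectively, $Q(n)\times Q(n)^{\mathrm{sop}}$), as a superalgebra with superinvolution, be endowed with an odd $G$-grading that makes it graded-simple. Then it is isomorphic, as a graded superalgebra with superinvolution, to some $M^{\mathrm{ex}}(T,\tilde\beta,t_p,\kappa,g_0)$ (respectively, $Q^{\mathrm{ex}}(T,\tilde\beta,t_p,\kappa,g_0)$)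 as above. Moreover, $M^{\mathrm{ex}}(T,\tilde\beta,t_p,\kappa,g_0)$ and $M^{\mathrm{ex}}(T',\tilde\beta',t_p',\kappa',g_0')$ (respectively, $Q^{\mathrm{ex}}(T,\tilde\beta,t_p,\kappa,g_0)$ and $Q^{\mathrm{ex}}(T',\tilde\beta',t_p',\kappa',g_0')$) are isomorphic, whatever the choices of $X_t$, $\xi$ and the ordering of the blocks in each of them, if and only if $T=T'$, $\tilde\beta=\tilde\beta'$, $t_p=t_p'$ and there is $g\in G$ such that $\kappa'=g\cdot\kappa$ and $g_0'=g^{-2}g_0$, where $(g\cdot\kappa)(x)=\kappa(g^{-1}x)$. -/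

import Mathlib

open scoped TensorProduct

noncomputable section

namespace GradedSuper

universe u v w

/-! ### Superalgebras, superopposites and the exchange superinvolution -/

section Super

variable {F : Type u} [Field F] {S : Type w} [Ring S] [Algebra F S]

/-- A `ℤ/2`-grading on an algebra, built from its two homogeneous projections. -/
@[reducible]
def superGradingOfProj (𝒮 : ZMod 2 → Submodule F S) (p : ZMod 2 → S →ₗ[F] S)
    (one_mem : (1 : S) ∈ 𝒮 0)
    (mul_mem : ∀ i j x y, x ∈ 𝒮 i → y ∈ 𝒮 j → x * y ∈ 𝒮 (i + j))
    (p_mem : ∀ i x, p i x ∈ 𝒮 i) (p_add : ∀ x, p 0 x + p 1 x = x)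
    (p_of_mem : ∀ i j x, x ∈ 𝒮 i → p j x = if i = j then x else 0) :
    GradedAlgebra 𝒮 where
  one_mem := one_mem
  mul_mem := fun {i j x y} hx hy => mul_mem i j x y hx hy
  decompose' := fun x =>
    DirectSum.of (fun i => 𝒮 i) 0 ((p 0).codRestrict (𝒮 0) (p_mem 0) x) +
      DirectSum.of (fun i => 𝒮 i) 1 ((p 1).codRestrict (𝒮 1) (p_mem 1) x)
  left_inv := fun x => by simp [p_add]
  right_inv := fun x => by
    have same : ∀ (i : ZMod 2) (x : 𝒮 i), (p i).codRestrict (𝒮 i) (p_mem i) (x : S) = x :=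
      fun i x => Subtype.ext ((p_of_mem i i x x.2).trans (if_pos rfl))
    have ne : ∀ (i j : ZMod 2) (x : 𝒮 i), i ≠ j →
        (p j).codRestrict (𝒮 j) (p_mem j) (x : S) = 0 :=
      fun i j x h => Subtype.ext ((p_of_mem i j x x.2).trans (if_neg h))
    induction x using DirectSum.induction_on with
    | zero => simp
    | of i x =>
      rw [DirectSum.coeAddMonoidHom_of]
      obtain rfl | rfl : i = 0 ∨ i = 1 := (show ∀ k : ZMod 2, k = 0 ∨ k = 1 by decide) i
      · change DirectSum.of (fun i => 𝒮 i) 0 _ + DirectSum.of (fun i => 𝒮 i) 1 _ = _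
        rw [same 0 x, ne 0 1 x (by decide), map_zero, add_zero]
      · change DirectSum.of (fun i => 𝒮 i) 0 _ + DirectSum.of (fun i => 𝒮 i) 1 _ = _
        rw [same 1 x, ne 1 0 x (by decide), map_zero, zero_add]
    | add x y hx hy =>
      conv_rhs => rw [← hx, ← hy]
      simp only [map_add]
      exact add_add_add_comm _ _ _ _

/-- The underlying type of the superopposite `Sˢᵒᵖ` of a superalgebra `S = 𝒮 0 ⊕ 𝒮 1`. -/
def SOp (_𝒮 : ZMod 2 → Submodule F S) : Type w := S

variable (𝒮 : ZMod 2 → Submodule F S)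

instance : AddCommGroup (SOp 𝒮) := inferInstanceAs (AddCommGroup S)

instance : Module F (SOp 𝒮) := inferInstanceAs (Module F S)

/-- The identity map `s ↦ s̄` from `S` to its superopposite. -/
def toSOp : S ≃ₗ[F] SOp 𝒮 := LinearEquiv.refl F S

variable [GradedAlgebra 𝒮]

/-- `r̄ s̄ = (-1)^{|r||s|} \overline{s r}` for homogeneous `r, s`, extended bilinearly. -/
def sopMul (r s : S) : S :=
  ∑ i : ZMod 2, ∑ j : ZMod 2,
    ((-1 : ℤˣ) ^ (i * j)) • (GradedAlgebra.proj 𝒮 j s * GradedAlgebra.proj 𝒮 i r)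

theorem sopMul_of_mem {i j : ZMod 2} {r s : S} (hr : r ∈ 𝒮 i) (hs : s ∈ 𝒮 j) :
    sopMul 𝒮 r s = ((-1 : ℤˣ) ^ (i * j)) • (s * r) := by
  unfold sopMul
  rw [Finset.sum_eq_single i, Finset.sum_eq_single j]
  · simp [GradedAlgebra.proj_apply, DirectSum.decompose_of_mem_same _ hr,
      DirectSum.decompose_of_mem_same _ hs]
  · intro k _ hk
    simp [GradedAlgebra.proj_apply, DirectSum.decompose_of_mem_ne _ hs hk.symm]
  · simp
  · intro k _ hk
    simp [GradedAlgebra.proj_apply, DirectSum.decompose_of_mem_ne _ hr hk.symm]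
  · simp

theorem sopMul_add (r s t : S) : sopMul 𝒮 r (s + t) = sopMul 𝒮 r s + sopMul 𝒮 r t := by
  simp only [sopMul, map_add, add_mul, smul_add, Finset.sum_add_distrib]

theorem add_sopMul (r s t : S) : sopMul 𝒮 (r + s) t = sopMul 𝒮 r t + sopMul 𝒮 s t := by
  simp only [sopMul, map_add, mul_add, smul_add, Finset.sum_add_distrib]

theorem sopMul_zero (r : S) : sopMul 𝒮 r 0 = 0 := by simp [sopMul]

theorem zero_sopMul (r : S) : sopMul 𝒮 0 r = 0 := by simp [sopMul]

theorem sopMul_smul (c : F) (r s : S) : sopMul 𝒮 r (c • s) = c • sopMul 𝒮 r s := by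
  simp only [sopMul, map_smul, smul_mul_assoc, Finset.smul_sum, smul_comm c]

theorem smul_sopMul (c : F) (r s : S) : sopMul 𝒮 (c • r) s = c • sopMul 𝒮 r s := by
  simp only [sopMul, map_smul, mul_smul_comm, Finset.smul_sum, smul_comm c]

theorem sopMul_units_smul (c : ℤˣ) (r s : S) : sopMul 𝒮 r (c • s) = c • sopMul 𝒮 r s := by
  rcases Int.units_eq_one_or c with rfl | rfl
  · simp
  · simpa using sopMul_smul 𝒮 (-1) r s

theorem units_smul_sopMul (c : ℤˣ) (r s : S) : sopMul 𝒮 (c • r) s = c • sopMul 𝒮 r s := by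
  rcases Int.units_eq_one_or c with rfl | rfl
  · simp
  · simpa using smul_sopMul 𝒮 (-1) r s

theorem sopMul_assoc (r s t : S) :
    sopMul 𝒮 (sopMul 𝒮 r s) t = sopMul 𝒮 r (sopMul 𝒮 s t) := by
  induction r using DirectSum.Decomposition.inductionOn 𝒮 with
  | zero => simp [zero_sopMul]
  | add r r' h h' => simp [add_sopMul, h, h']
  | @homogeneous i r =>
    induction s using DirectSum.Decomposition.inductionOn 𝒮 with
    | zero => simp [zero_sopMul, sopMul_zero]
    | add s s' h h' => simp [add_sopMul, sopMul_add, h, h']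
    | @homogeneous j s =>
      induction t using DirectSum.Decomposition.inductionOn 𝒮 with
      | zero => simp [sopMul_zero]
      | add t t' h h' => simp [sopMul_add, h, h']
      | @homogeneous k t =>
        rw [sopMul_of_mem 𝒮 r.2 s.2, sopMul_of_mem 𝒮 s.2 t.2, units_smul_sopMul,
          sopMul_units_smul, sopMul_of_mem 𝒮 (SetLike.mul_mem_graded s.2 r.2) t.2,
          sopMul_of_mem 𝒮 r.2 (SetLike.mul_mem_graded t.2 s.2), smul_smul, smul_smul,
          mul_assoc, ← uzpow_add, ← uzpow_add]
        congr 2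
        ring

theorem one_sopMul (r : S) : sopMul 𝒮 1 r = r := by
  induction r using DirectSum.Decomposition.inductionOn 𝒮 with
  | zero => simp [sopMul_zero]
  | add r r' h h' => simp [sopMul_add, h, h']
  | homogeneous r => rw [sopMul_of_mem 𝒮 SetLike.GradedOne.one_mem r.2]; simp

theorem sopMul_one (r : S) : sopMul 𝒮 r 1 = r := by
  induction r using DirectSum.Decomposition.inductionOn 𝒮 with
  | zero => simp [zero_sopMul]
  | add r r' h h' => simp [add_sopMul, h, h']
  | homogeneous r => rw [sopMul_of_mem 𝒮 r.2 SetLike.GradedOne.one_mem]; simp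

instance : Mul (SOp 𝒮) :=
  ⟨fun r s => toSOp 𝒮 (sopMul 𝒮 ((toSOp 𝒮).symm r) ((toSOp 𝒮).symm s))⟩

instance : One (SOp 𝒮) := ⟨toSOp 𝒮 1⟩

instance : Ring (SOp 𝒮) where
  __ := (inferInstance : AddCommGroup (SOp 𝒮))
  left_distrib r s t := sopMul_add 𝒮 r s t
  right_distrib r s t := add_sopMul 𝒮 r s t
  zero_mul r := zero_sopMul 𝒮 r
  mul_zero r := sopMul_zero 𝒮 r
  mul_assoc r s t := sopMul_assoc 𝒮 r s t
  one_mul r := one_sopMul 𝒮 r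
  mul_one r := sopMul_one 𝒮 r

instance : Algebra F (SOp 𝒮) :=
  Algebra.ofModule (fun c r s => smul_sopMul 𝒮 c r s) (fun c r s => sopMul_smul 𝒮 c r s)

/-- The underlying algebra of `S × Sˢᵒᵖ`. -/
abbrev Ex : Type w := S × SOp 𝒮

/-- The exchange superinvolution `(s₁, s̄₂) ↦ (s₂, s̄₁)` on `S × Sˢᵒᵖ`. -/
def exch : Ex 𝒮 →ₗ[F] Ex 𝒮 :=
  ((toSOp 𝒮).symm.toLinearMap ∘ₗ LinearMap.snd F S (SOp 𝒮)).prod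
    ((toSOp 𝒮).toLinearMap ∘ₗ LinearMap.fst F S (SOp 𝒮))

/-- The canonical `ℤ/2`-grading of `S × Sˢᵒᵖ`. -/
def exParity (i : ZMod 2) : Submodule F (Ex 𝒮) :=
  (𝒮 i).prod ((𝒮 i).map (toSOp 𝒮).toLinearMap)

/-- The element `(s, s̄)` of `S × Sˢᵒᵖ`. -/
def exPlus (s : S) : Ex 𝒮 := (s, toSOp 𝒮 s)

/-- The element `(s, -s̄)` of `S × Sˢᵒᵖ`. -/
def exMinus (s : S) : Ex 𝒮 := (s, -toSOp 𝒮 s)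

end Super

/-! ### The superalgebras `M(m,n)` and `Q(n)` -/

section MQ

variable (F : Type u) [Field F]

/-- The underlying algebra of `M(m,n)`. -/
abbrev M (m n : ℕ) : Type u := Matrix (Fin m ⊕ Fin n) (Fin m ⊕ Fin n) F

/-- Parity of a basis vector of `F^{m|n}`. -/
def vecParity {m n : ℕ} : Fin m ⊕ Fin n → ZMod 2 := Sum.elim (fun _ => 0) (fun _ => 1)

/-- Even matrices are block-diagonal, odd matrices are block-antidiagonal. -/
def mParity (m n : ℕ) (i : ZMod 2) : Submodule F (M F m n) where
  carrier := {X | ∀ a b, vecParity a + vecParity b ≠ i → X a b = 0}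
  add_mem' := fun hX hY a b h => by simp [hX a b h, hY a b h]
  zero_mem' := fun _ _ _ => rfl
  smul_mem' := fun c X hX a b h => by simp [hX a b h]

/-- The homogeneous projections of `M(m,n)`. -/
def mProj (m n : ℕ) (i : ZMod 2) : M F m n →ₗ[F] M F m n where
  toFun X := Matrix.of fun a b => if vecParity a + vecParity b = i then X a b else 0
  map_add' X Y := by ext a b; simp only [Matrix.of_apply, Matrix.add_apply]; split_ifs <;> simp
  map_smul' c X := by
    ext a b; simp only [Matrix.of_apply, Matrix.smul_apply, RingHom.id_apply]; split_ifs <;> simp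

theorem mParity_mul_mem {m n : ℕ} {i j : ZMod 2} {X Y : M F m n}
    (hX : X ∈ mParity F m n i) (hY : Y ∈ mParity F m n j) : X * Y ∈ mParity F m n (i + j) := by
  intro a b h
  rw [Matrix.mul_apply]
  refine Finset.sum_eq_zero fun c _ => ?_
  by_cases h1 : vecParity a + vecParity c = i
  · have h2 : vecParity c + vecParity b ≠ j := by
      intro h2
      apply h
      rw [← h1, ← h2, add_assoc, ← add_assoc (vecParity c), CharTwo.add_self_eq_zero, zero_add]
    rw [hY c b h2, mul_zero]
  · rw [hX a c h1, zero_mul]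

theorem one_mem_mParity (m n : ℕ) : (1 : M F m n) ∈ mParity F m n 0 := by
  intro a b h
  refine Matrix.one_apply_ne ?_
  rintro rfl
  exact h (CharTwo.add_self_eq_zero _)

theorem mProj_mem {m n : ℕ} (i : ZMod 2) (X : M F m n) : mProj F m n i X ∈ mParity F m n i :=
  fun _ _ h => if_neg h

theorem mProj_add {m n : ℕ} (X : M F m n) : mProj F m n 0 X + mProj F m n 1 X = X := by
  ext a b
  simp only [mProj, LinearMap.coe_mk, AddHom.coe_mk, Matrix.add_apply, Matrix.of_apply]
  obtain h | h := (show ∀ k : ZMod 2, k = 0 ∨ k = 1 by decide) (vecParity a + vecParity b) <;>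
    simp [h]

theorem mProj_of_mem {m n : ℕ} (i j : ZMod 2) (X : M F m n) (hX : X ∈ mParity F m n i) :
    mProj F m n j X = if i = j then X else 0 := by
  ext a b
  simp only [mProj, LinearMap.coe_mk, AddHom.coe_mk, Matrix.of_apply]
  have := hX a b
  split_ifs with h1 h2 h2
  · rfl
  · exact this (fun h => h2 (h.symm.trans h1))
  · exact (this (fun h => h1 (h.trans h2))).symm
  · rfl

instance (m n : ℕ) : GradedAlgebra (mParity F m n) :=
  superGradingOfProj _ (mProj F m n) (one_mem_mParity F m n)
    (fun _ _ _ _ => mParity_mul_mem F) (mProj_mem F) (mProj_add F) (mProj_of_mem F)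

/-- The queer superalgebra `Q(n) ⊆ M(n,n)`. -/
def Q (n : ℕ) : Subalgebra F (M F n n) where
  carrier := {X | ∃ A B : Matrix (Fin n) (Fin n) F, X = Matrix.fromBlocks A B B A}
  mul_mem' := by
    rintro _ _ ⟨A, B, rfl⟩ ⟨C, D, rfl⟩
    exact ⟨A * C + B * D, A * D + B * C, by
      rw [Matrix.fromBlocks_multiply, add_comm (B * C), add_comm (B * D)]⟩
  add_mem' := by
    rintro _ _ ⟨A, B, rfl⟩ ⟨C, D, rfl⟩
    exact ⟨A + C, B + D, by rw [Matrix.fromBlocks_add]⟩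
  algebraMap_mem' := fun r => ⟨algebraMap F _ r, 0, by
    ext a b; rcases a with a | a <;> rcases b with b | b <;>
      simp [Matrix.algebraMap_matrix_apply]⟩

/-- The `ℤ/2`-grading that `Q(n)` inherits from `M(n,n)`. -/
def qParity (n : ℕ) (i : ZMod 2) : Submodule F (Q F n) :=
  (mParity F n n i).comap (Q F n).val.toLinearMap

theorem mProj_mem_Q {n : ℕ} (i : ZMod 2) (X : Q F n) : mProj F n n i (X : M F n n) ∈ Q F n := by
  obtain ⟨X, A, B, rfl⟩ := X
  refine ⟨if i = 0 then A else 0, if i = 1 then B else 0, ?_⟩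
  ext a b
  rcases a with a | a <;> rcases b with b | b <;> fin_cases i <;>
    simp [mProj, vecParity]
  all_goals rfl

/-- The homogeneous projections of `Q(n)`. -/
def qProj (n : ℕ) (i : ZMod 2) : Q F n →ₗ[F] Q F n :=
  (mProj F n n i ∘ₗ (Q F n).val.toLinearMap).codRestrict (Subalgebra.toSubmodule (Q F n))
    (mProj_mem_Q F i)

instance (n : ℕ) : GradedAlgebra (qParity F n) :=
  superGradingOfProj _ (qProj F n) (one_mem_mParity F n n)
    (fun _ _ _ _ hX hY => mParity_mul_mem F hX hY)
    (fun i X => mProj_mem F i (X : M F n n))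
    (fun X => Subtype.ext (mProj_add F (X : M F n n)))
    (fun i j X hX => Subtype.ext <| by
      refine (mProj_of_mem F i j (X : M F n n) hX).trans ?_
      split_ifs <;> rfl)

end MQ

/-! ### Gradings by an abelian group -/

section Gradings

/-- `G^# = G × ℤ/2`; the second component (written multiplicatively) is the parity. A `G`-graded
superspace is the same as a `G^#`-graded space. -/
abbrev GSharp (G : Type v) : Type v := G × Multiplicative (ZMod 2)

/-- The parity `p(g, i) = i`. -/
def par {G : Type v} (γ : GSharp G) : ZMod 2 := Multiplicative.toAdd γ.2

variable {F : Type u} [Field F] {A : Type w} [Ring A] [Algebra F A] {G : Type v} [CommGroup G]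

/-- `A = ⨁ Γ g` is a grading of the algebra `A` by the group `H`. -/
structure IsGrading {H : Type*} [Group H] (Γ : H → Submodule F A) : Prop where
  indep : iSupIndep Γ
  span : ⨆ g, Γ g = ⊤
  mul_mem : ∀ g h a b, a ∈ Γ g → b ∈ Γ h → a * b ∈ Γ (g * h)

/-- `Γ` is a `G`-grading on the superalgebra with superinvolution `(A, φ)`, where
`A = 𝒮 0 ⊕ 𝒮 1`: each `Γ g` is a `ℤ/2`-graded subspace, and `φ` preserves degrees. -/
structure IsGradingOfSuperinv (𝒮 : ZMod 2 → Submodule F A) (φ : A → A) (Γ : G → Submodule F A) :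
    Prop extends IsGrading Γ where
  compat : ∀ g, Γ g = (Γ g ⊓ 𝒮 0) ⊔ (Γ g ⊓ 𝒮 1)
  map_mem : ∀ g a, a ∈ Γ g → φ a ∈ Γ g

/-- The `G^#`-grading of a `G`-graded superalgebra: `A_{(g,i)} = A_g ∩ A^i`. -/
def sharp (𝒮 : ZMod 2 → Submodule F A) (Γ : G → Submodule F A) (γ : GSharp G) : Submodule F A :=
  Γ γ.1 ⊓ 𝒮 (par γ)

/-- Graded-simplicity of a `G^#`-graded algebra: `A A ≠ 0` and the only two-sided ideals `I`
with `I = ⨁ (I ∩ A_γ)` are `0` and `A`. -/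
def IsGradedSimple (𝒜 : GSharp G → Submodule F A) : Prop :=
  (∃ a b : A, a * b ≠ 0) ∧
    ∀ I : Submodule F A, (∀ r a, a ∈ I → r * a ∈ I ∧ a * r ∈ I) → I = ⨆ γ, I ⊓ 𝒜 γ →
      I = ⊥ ∨ I = ⊤

/-- Graded-division superalgebras: every nonzero `G^#`-homogeneous element is invertible. -/
structure IsGradedDivision (𝒟 : GSharp G → Submodule F A) : Prop extends IsGrading 𝒟 where
  nontrivial : (1 : A) ≠ 0
  isUnit : ∀ γ d, d ∈ 𝒟 γ → d ≠ 0 → IsUnit d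

/-- The grading of `M_I(D) = End_D(U)`, where the graded right `D`-module `U` has a graded basis
with degrees `γ i`: the matrix with the single entry `d` in position `(i, j)` has degree
`γ_i (deg d) γ_j⁻¹`. -/
def matGrading {I : Type*} (𝒟 : GSharp G → Submodule F A) (γ : I → GSharp G) (g : GSharp G) :
    Submodule F (Matrix I I A) where
  carrier := {X | ∀ i j, X i j ∈ 𝒟 ((γ i)⁻¹ * g * γ j)}
  add_mem' := fun hX hY i j => add_mem (hX i j) (hY i j)
  zero_mem' := fun _ _ => zero_mem _
  smul_mem' := fun c _ hX i j => Submodule.smul_mem _ c (hX i j)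

/-- A graded-simple `A` is oddly graded if in `A ≅ End_D(U) = M_k(D)`, with `D` a graded-division
superalgebra, `D` is odd, that is, has a nonzero odd component. (A graded-simple Artinian `A`
has such a presentation, and the graded superalgebra `D` is unique up to isomorphism.) -/
def IsOddlyGraded {A : Type u} [Ring A] [Algebra F A] (𝒜 : GSharp G → Submodule F A) : Prop :=
  ∀ (D : Type u) [Ring D] [Algebra F D] (𝒟 : GSharp G → Submodule F D), IsGradedDivision 𝒟 →
    ∀ (k : ℕ) (γ : Fin k → GSharp G) (θ : A ≃ₐ[F] Matrix (Fin k) (Fin k) D),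
      (∀ g a, a ∈ 𝒜 g ↔ θ a ∈ matGrading 𝒟 γ g) → ∃ g, par g = 1 ∧ 𝒟 g ≠ ⊥

/-- Isomorphism of `G`-graded superalgebras with superinvolution. -/
def GradedIso {A B : Type*} [Ring A] [Algebra F A] [Ring B] [Algebra F B]
    (𝒜 : GSharp G → Submodule F A) (φ : A → A) (ℬ : GSharp G → Submodule F B) (ψ : B → B) : Prop :=
  ∃ θ : A ≃ₐ[F] B, (∀ γ a, a ∈ 𝒜 γ ↔ θ a ∈ ℬ γ) ∧ ∀ a, θ (φ a) = ψ (θ a)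

end Gradings

/-! ### The superalgebras with superinvolution `E(D, U, B)` for odd `D` and even `B` -/

section EDUB

variable {F : Type u} [Field F] {D : Type w} [Ring D] [Algebra F D] {G : Type v} [CommGroup G]

/-- `T⁺ = {h ∈ G | (h, 0) ∈ T}`, as a subgroup of `G`. -/
def plus (T : Subgroup (GSharp G)) : Subgroup G :=
  T.comap (MonoidHom.inl G (Multiplicative (ZMod 2)))

open Classical in
/-- The sign `η(t)` with `φ₀ = η(t)` on `D_t`. -/
def eta (𝒟 : GSharp G → Submodule F D) (φ₀ : D → D) (t : GSharp G) : ℤˣ :=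
  if ∀ d ∈ 𝒟 t, φ₀ d = d then 1 else -1

/-- `g₀`-admissibility of a nonzero finitely supported `κ : G/T⁺ → ℕ`. -/
structure IsAdmissible (T : Subgroup (GSharp G)) (𝒟 : GSharp G → Submodule F D) (φ₀ : D → D)
    (κ : (G ⧸ plus T) →₀ ℕ) (g₀ : G) : Prop where
  ne_zero : κ ≠ 0
  dual : ∀ x, κ x = κ ((g₀ : G ⧸ plus T)⁻¹ * x⁻¹)
  even : ∀ g : G, g₀ * g ^ 2 ∈ plus T → eta 𝒟 φ₀ (g₀ * g ^ 2, 1) = -1 → Even (κ (g : G ⧸ plus T))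

/-- The auxiliary choices in the construction of `(U, B)`: nonzero elements `X_t ∈ D_t`, a section
`ξ` of `G → G/T⁺`, and an ordering of `G/T⁺` in which the blocks are listed. -/
structure BlockChoice (T : Subgroup (GSharp G)) (𝒟 : GSharp G → Submodule F D) where
  X : T → D
  X_mem : ∀ t : T, X t ∈ 𝒟 (t : GSharp G)
  X_ne : ∀ t, X t ≠ 0
  ξ : G ⧸ plus T → G
  ξ_section : ∀ x, (ξ x : G ⧸ plus T) = x
  ord : LinearOrder (G ⧸ plus T)

/-- The basis of `U = ⨁_{x ∈ supp κ} (D^{κ(x)})^{[ξ(x)]}`. -/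
abbrev Idx {T : Subgroup (GSharp G)} (κ : (G ⧸ plus T) →₀ ℕ) : Type v :=
  Σ x : κ.support, Fin (κ x)

instance {T : Subgroup (GSharp G)} (κ : (G ⧸ plus T) →₀ ℕ) : DecidableEq (Idx κ) :=
  Classical.decEq _

section

variable {T : Subgroup (GSharp G)} {𝒟 : GSharp G → Submodule F D} (φ₀ : D → D)
  (c : BlockChoice T 𝒟) (κ : (G ⧸ plus T) →₀ ℕ) (g₀ : G)

/-- The degrees of the (even) basis elements of `U`. -/
def idxDegree (i : Idx κ) : GSharp G := (c.ξ i.1, 1)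

open Classical in
/-- The integer coefficients of the matrix `Φ`. The block at `(x, x)` is `I` if `s = 1` and
`J = [[0, I], [-I, 0]]` if `s = -1`; for `x ≠ y` paired by `B` and `x` listed before `y`, the block
at `(x, y)` is `I` and the block at `(y, x)` is `s I`. Here `s = η(g₀ ξ(x) ξ(y))`. -/
def phiCoeff (s : ℤˣ) (i j : Idx κ) : ℤ :=
  if i.1 = j.1 then
    if s = 1 then
      if (i.2 : ℕ) = j.2 then 1 else 0
    else
      if (j.2 : ℕ) = i.2 + κ i.1 / 2 then 1 else if (i.2 : ℕ) = j.2 + κ i.1 / 2 then -1 else 0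
  else
    if (i.2 : ℕ) = j.2 then
      if c.ord.lt i.1 j.1 then 1 else (s : ℤ)
    else 0

open Classical in
/-- The matrix `Φ` representing the sesquilinear form `B` of degree `g₀`. -/
def phi : Matrix (Idx κ) (Idx κ) D := Matrix.of fun i j =>
  if h : g₀ * c.ξ i.1 * c.ξ j.1 ∈ plus T then
    phiCoeff c κ (eta 𝒟 φ₀ (g₀ * c.ξ i.1 * c.ξ j.1, 1)) i j •
      c.X ⟨(g₀ * c.ξ i.1 * c.ξ j.1, 1), h⟩
  else 0

/-- The grading of `E(D, U, B) = M_k(D)`. -/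
def EGrading : GSharp G → Submodule F (Matrix (Idx κ) (Idx κ) D) :=
  matGrading 𝒟 (idxDegree c κ)

/-- The superinvolution `φ(X) = Φ⁻¹ φ₀(Xᵀ) Φ` of `E(D, U, B) = M_k(D)`. -/
def EInv (Y : Matrix (Idx κ) (Idx κ) D) : Matrix (Idx κ) (Idx κ) D :=
  Ring.inverse (phi φ₀ c κ g₀) * (Y.transpose.map φ₀) * phi φ₀ c κ g₀

end

end EDUB

/-! ### The parameters `(T, β̃, t_p)` and the standard realizations -/

section Params

variable (G : Type v) [CommGroup G]

/-- Triples `(T, β̃, t_p)` with `T ≠ T⁺`. -/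
@[ext]
structure OddTriple where
  T : Subgroup (GSharp G)
  finite : Finite T
  /-- the bicharacter `β̃ : T × T → {±1}` -/
  β : T →* T →* ℤˣ
  skew : ∀ s t, β s t = (β t s)⁻¹
  /-- `β(s, t) = (-1)^{p(s) p(t)} β̃(s, t)` is alternating -/
  diag : ∀ t : T, β t t = (-1) ^ par (t : GSharp G)
  /-- `rad β̃ = ⟨f⟩`, `e ≠ f ∈ T⁺`, `T⁺` is an elementary `2`-group, `t² = f` for `t ∈ T⁻` -/
  rad : ∃ f : T, f ≠ 1 ∧ par (f : GSharp G) = 0 ∧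
    (∀ t, (∀ s, β t s = 1) ↔ t ∈ Subgroup.zpowers f) ∧
    (∀ t : T, par (t : GSharp G) = 0 → t ^ 2 = 1) ∧
    (∀ t : T, par (t : GSharp G) = 1 → t ^ 2 = f)
  odd : ∃ t : T, par (t : GSharp G) = 1
  tp : T
  /-- `t_p` is a parity element -/
  tp_parity : ∀ t : T, β tp t = (-1) ^ par (t : GSharp G)

/-- The triples with `t_p ∈ T⁺`. -/
def OddTripleM : Type v := {P : OddTriple G // par (P.tp : GSharp G) = 0}

/-- The triples with `t_p ∈ T⁻`. -/
def OddTripleQ : Type v := {P : OddTriple G // par (P.tp : GSharp G) = 1}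

variable {G} (P : OddTriple G)

instance : Finite P.T := P.finite

/-- `T⁺` as a subgroup of `T`. -/
def OddTriple.even : Subgroup P.T :=
  ((MonoidHom.snd G (Multiplicative (ZMod 2))).comp P.T.subtype).ker

/-- `rad β⁺` as a subgroup of `T`. -/
def OddTriple.radPlus : Subgroup P.T where
  carrier := {t | t ∈ P.even ∧ ∀ s ∈ P.even, P.β t s = 1}
  mul_mem' := fun ha hb => ⟨mul_mem ha.1 hb.1, fun s hs => by
    rw [map_mul, MonoidHom.mul_apply, ha.2 s hs, hb.2 s hs, one_mul]⟩
  one_mem' := ⟨one_mem _, fun s _ => by rw [map_one, MonoidHom.one_apply]⟩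
  inv_mem' := fun ha => ⟨inv_mem ha.1, fun s hs => by
    rw [map_inv, MonoidHom.inv_apply, ha.2 s hs, inv_one]⟩

/-- A subgroup `K ⊆ T⁺` with `T⁺ = rad β⁺ × K`, and a decomposition `K = A × B` with `β` trivial
on `A` and on `B`, which determines a standard realization of type `M` associated to `K`. -/
structure KDecomp where
  K : Subgroup P.T
  K_inf : P.radPlus ⊓ K = ⊥
  K_sup : P.radPlus ⊔ K = P.even
  A : Subgroup P.T
  B : Subgroup P.T
  AB_inf : A ⊓ B = ⊥
  AB_sup : A ⊔ B = K
  A_triv : ∀ a ∈ A, ∀ a' ∈ A, P.β a a' = 1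
  B_triv : ∀ b ∈ B, ∀ b' ∈ B, P.β b b' = 1

/-- The choices for a standard realization in the case `t_p ∈ T⁺`. -/
structure RealizationM extends KDecomp P where
  t₁ : P.T
  t₁_odd : par (t₁ : GSharp G) = 1
  t₁_K : ∀ k ∈ K, P.β t₁ k = 1

variable {P}

instance (d : KDecomp P) : Fintype d.B := Fintype.ofFinite _

instance (d : KDecomp P) : DecidableEq d.B := Classical.decEq _

variable (F : Type u) [Field F]

/-- `X_a e_{b'} = β(a, b') e_{b'}`. -/
def clock (d : KDecomp P) (a : d.A) : Matrix d.B d.B F :=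
  Matrix.diagonal fun b' => (((P.β a b' : ℤˣ) : ℤ) : F)

/-- `X_b e_{b'} = e_{b b'}`. -/
def shift (d : KDecomp P) (b : d.B) : Matrix d.B d.B F :=
  Matrix.of fun c b' => if c = b * b' then 1 else 0

variable {F} {C : Type u} [Ring C] [Algebra F C]

/-- The algebra `C ⊗ End(V)`, where `V` has the basis `(e_b)`, `b ∈ B`. -/
abbrev Real (C : Type u) [Ring C] [Algebra F C] (d : KDecomp P) :=
  C ⊗[F] Matrix d.B d.B F

/-- The grading of `C ⊗ End(V)`, where `C` has the basis `(W j)` with degrees `deg j ∈ T`: the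
element `W_j ⊗ X_a X_b` has degree `(deg j) a b`. -/
def realGrading {J : Type} (W : J → C) (deg : J → P.T) (d : KDecomp P) (γ : GSharp G) :
    Submodule F (Real (F := F) C d) :=
  Submodule.span F {x | ∃ (j : J) (a : d.A) (b : d.B),
    ((deg j * a * b : P.T) : GSharp G) = γ ∧ x = W j ⊗ₜ[F] (clock F d a * shift F d b)}

/-- The superinvolution `φ_C ⊗ (transposition)`. -/
def realInv (φC : C →ₗ[F] C) (d : KDecomp P) : Real (F := F) C d → Real (F := F) C d :=
  TensorProduct.map φC (Matrix.transposeLinearEquiv d.B d.B F F).toLinearMap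

end Params

section Standard

variable (F : Type u) [Field F] {G : Type v} [CommGroup G]

/-- The homogeneous basis of the `ℤ/2 × ℤ/4`-graded superalgebra
`𝒪 = M(1,1) × M(1,1)ˢᵒᵖ`; the entry `(i, j)` has degree `(i, j)`. -/
def oBasis (ij : Fin 2 × Fin 4) : Ex (mParity F 1 1) :=
  ![![exPlus _ (Matrix.fromBlocks 1 0 0 1), exPlus _ (Matrix.fromBlocks 0 1 1 0),
      exMinus _ (Matrix.fromBlocks 1 0 0 1), exMinus _ (Matrix.fromBlocks 0 1 1 0)],
    ![exPlus _ (Matrix.fromBlocks 1 0 0 (-1)), exMinus _ (Matrix.fromBlocks 0 (-1) 1 0),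
      exMinus _ (Matrix.fromBlocks 1 0 0 (-1)), exPlus _ (Matrix.fromBlocks 0 (-1) 1 0)]]
    ij.1 ij.2

/-- The element `u ∈ Q(1)`, odd with `u² = 1`. -/
def qU : Q F 1 := ⟨Matrix.fromBlocks 0 1 1 0, 0, 1, rfl⟩

/-- The homogeneous basis of the `ℤ/4`-graded superalgebra `Q(1) × Q(1)ˢᵒᵖ ≅ F[ℤ/4]`; the
`j`-th entry has degree `j`. -/
def qBasis (j : Fin 4) : Ex (qParity F 1) :=
  ![exPlus _ 1, exPlus _ (qU F), exMinus _ 1, exMinus _ (qU F)] j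

variable {P : OddTriple G}

/-- The standard realization of type `M × Mˢᵒᵖ`, `t_p ∈ T⁺`: it is `𝒪 ⊗ End(V)`, with the
standard generators of `ℤ/2 × ℤ/4` identified with `t_p` and `t₁`. -/
def DM (r : RealizationM P) : GSharp G → Submodule F (Real (F := F) (Ex (mParity F 1 1)) r.toKDecomp) :=
  realGrading (oBasis F) (fun ij => P.tp ^ (ij.1 : ℕ) * r.t₁ ^ (ij.2 : ℕ)) r.toKDecomp

/-- The superinvolution of the standard realization of type `M × Mˢᵒᵖ`. -/
def DMInv (r : RealizationM P) := realInv (exch (mParity F 1 1)) r.toKDecomp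

/-- The standard realization of type `Q × Qˢᵒᵖ`, `t_p ∈ T⁻`: it is `F[ℤ/4] ⊗ End(V)`, with the
standard generator of `ℤ/4` identified with `t_p`. -/
def DQ (r : KDecomp P) : GSharp G → Submodule F (Real (F := F) (Ex (qParity F 1)) r) :=
  realGrading (qBasis F) (fun j => P.tp ^ (j : ℕ)) r

/-- The superinvolution of the standard realization of type `Q × Qˢᵒᵖ`. -/
def DQInv (r : KDecomp P) := realInv (exch (qParity F 1)) r

end Standard

end GradedSuper

end

open scoped TensorProduct

noncomputable section

namespace GradedSuper

universe u v w

set_option linter.unusedSectionVars false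
set_option linter.unusedVariables false

/-! ### Homogeneous components -/

section Components

variable {F : Type*} [Field F] {R : Type*} [Ring R] [Algebra F R] {H : Type*} [Group H]
  {𝒜 : H → Submodule F R}

/-! Everything is read off from one idempotent. A graded-simple algebra `R` is graded-prime, and a
right ideal `aR` of least dimension with `a ≠ 0` homogeneous contains an idempotent `ε` of degree
`e` whose corner `εRε` is graded-division with one-dimensional components, supported on a subgroup
`T` (`IsGradedPrime.exists_isDivIdem`). The space `εRφ(ε)` has a homogeneous generator `b`, which
can be taken even because the corner has an odd unit. The map `d ↦ bφ(d)b⁻¹` preserves degrees, so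
it acts on the line of degree `t` by a scalar, which turns out to be a sign `η(t)`. Applying `φ` to
`X_s X_t` shows that the commutation factor of the corner is `(-1)^{p(s)p(t)} β̃(s,t)` with `β̃(s,t)
= η(s)η(t)η(st)`. Thus `β̃` is the polarization of `η`, and it is a bicharacter because commutation
factors are multiplicative.

The centre of `R` gives the radical of `β̃`. Radical elements are even, since `β̃(t,t) =
(-1)^{p(t)}`, and correspond to homogeneous even central elements. The even centre of `S × Sˢᵒᵖ` is
spanned by `1` and the skew element `(1,-1̄)`, hence the radical is `{1,f}` and `η(f) = -1`. Then
`t²` is radical with `η(t²) = β̃(t,t)`, which forces `t² = 1` or `t² = f` according to parity. The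
parity character is trivial on the radical, so it is `β̃(t_p,·)`, and `η(t_p) = 1` selects one of
the two candidates (`exists_oddCorner`). An odd central element exists exactly when `t_p` is odd,
which separates `Q` from `M`.

Conversely `(T,β̃,t_p)` determines the corner. Two algebras with the same commutation factor differ
by a symmetric cocycle, which is a coboundary over an algebraically closed field
(`exists_coboundary`). Two sign functions with polarization `β̃` and value `-1` at `f` differ by a
character `β̃(t,·)`, which is absorbed by replacing `b` with `X_t b`. The result is a `Frame`: an
identification of the corner with the standard realization `D`, and a generator `b = φ(b)` carrying
`φ` to `φ₀`. The form `B(v,w) = bφ(v)w` on `Rε` is hermitian over `D`; on homogeneous components it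
is a scalar form that is symmetric, alternating or a pairing of two spaces, and the normal forms of
these assemble into `Φ` (`Frame.isAdmissible_and_gradedIso`).

For uniqueness, any two frames are compared. Moving a frame to another idempotent by an even element
of degree `s` multiplies its degree by `s²` and shifts the dimensions of the components of `Rε` by
`s`. Two frames at the same idempotent have the same triple, because `η` tells `t_p` from `f t_p`,
and then the same degree, because `η(f) = -1` (`Frame.triple_eq`, `Frame.invariants_eq`). A standard
model has a frame of degree `g₀ ξ(x)²` whose dimensions are the values of `κ`, so `(κ,g₀)` is
determined exactly up to the stated action of `G`. -/

theorem IsGrading.exists_proj (h : IsGrading 𝒜) :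
    ∃ p : H → R →ₗ[F] R, (∀ g x, p g x ∈ 𝒜 g) ∧ (∀ g x, x ∈ 𝒜 g → p g x = x) ∧
      (∀ g k x, x ∈ 𝒜 g → k ≠ g → p k x = 0) ∧ ∀ x, (∀ g, p g x = 0) → x = 0 := by
  classical
  have hi := DirectSum.isInternal_submodule_of_iSupIndep_of_iSup_eq_top h.indep h.span
  let _ := hi.chooseDecomposition
  refine ⟨fun g => (𝒜 g).subtype ∘ₗ DirectSum.component F H (fun i => 𝒜 i) g ∘ₗ
    (DirectSum.decomposeLinearEquiv 𝒜).toLinearMap, fun g x => ?_, fun g x hx => ?_,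
    fun g k x hx hk => ?_, fun x hx => ?_⟩
  · exact Subtype.prop _
  · exact DirectSum.decompose_of_mem_same 𝒜 hx
  · exact DirectSum.decompose_of_mem_ne 𝒜 hx hk.symm
  · apply (DirectSum.decompose 𝒜).injective
    rw [DirectSum.decompose_zero]
    ext g
    exact hx g

/-- The homogeneous component of degree `g`. -/
def IsGrading.proj (h : IsGrading 𝒜) : H → R →ₗ[F] R := h.exists_proj.choose

variable (h : IsGrading 𝒜)
include h

theorem IsGrading.proj_mem (g : H) (x : R) : h.proj g x ∈ 𝒜 g :=
  h.exists_proj.choose_spec.1 g x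

theorem IsGrading.proj_same {g : H} {x : R} (hx : x ∈ 𝒜 g) : h.proj g x = x :=
  h.exists_proj.choose_spec.2.1 g x hx

theorem IsGrading.proj_ne {g k : H} {x : R} (hx : x ∈ 𝒜 g) (hk : k ≠ g) : h.proj k x = 0 :=
  h.exists_proj.choose_spec.2.2.1 g k x hx hk

theorem IsGrading.eq_zero {x : R} (hx : ∀ g, h.proj g x = 0) : x = 0 :=
  h.exists_proj.choose_spec.2.2.2 x hx

theorem IsGrading.exists_proj_ne {x : R} (hx : x ≠ 0) : ∃ g, h.proj g x ≠ 0 := by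
  by_contra! hc
  exact hx (h.eq_zero hc)

theorem IsGrading.induction {p : R → Prop} (hom : ∀ g x, x ∈ 𝒜 g → p x)
    (zero : p 0) (add : ∀ x y, p x → p y → p (x + y)) (x : R) : p x := by
  have hx : x ∈ ⨆ g, 𝒜 g := h.span ▸ Submodule.mem_top
  exact Submodule.iSup_induction 𝒜 (motive := p) hx hom zero add

theorem IsGrading.ext_hom {M : Type*} [AddCommGroup M] [Module F M] {f g : R →ₗ[F] M}
    (hom : ∀ γ x, x ∈ 𝒜 γ → f x = g x) : f = g := by
  ext x
  refine h.induction (p := fun x => f x = g x) hom (by simp) (fun x y hx hy => ?_) x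
  simp [hx, hy]

theorem IsGrading.proj_mul_left {g : H} {a : R} (ha : a ∈ 𝒜 g) (k : H) (x : R) :
    h.proj (g * k) (a * x) = a * h.proj k x := by
  refine h.induction (p := fun x => h.proj (g * k) (a * x) = a * h.proj k x) ?_ (by simp)
    (fun x y hx hy => ?_) x
  · intro l x hx
    by_cases hl : k = l
    · subst hl
      rw [h.proj_same hx, h.proj_same (h.mul_mem _ _ _ _ ha hx)]
    · rw [h.proj_ne hx hl, mul_zero, h.proj_ne (h.mul_mem _ _ _ _ ha hx)]
      simpa using hl
  · simp only [mul_add, map_add, hx, hy]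

theorem IsGrading.proj_mul_right {g : H} {a : R} (ha : a ∈ 𝒜 g) (k : H) (x : R) :
    h.proj (k * g) (x * a) = h.proj k x * a := by
  refine h.induction (p := fun x => h.proj (k * g) (x * a) = h.proj k x * a) ?_ (by simp)
    (fun x y hx hy => ?_) x
  · intro l x hx
    by_cases hl : k = l
    · subst hl
      rw [h.proj_same hx, h.proj_same (h.mul_mem _ _ _ _ hx ha)]
    · rw [h.proj_ne hx hl, zero_mul, h.proj_ne (h.mul_mem _ _ _ _ hx ha)]
      simpa using hl
  · simp only [add_mul, map_add, hx, hy]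

/-- Comparing components of degree `g` in `x * 1 = x` for `x` of degree `g` shows that the identity
component of `1` is a right unit, hence equal to `1`. -/
theorem IsGrading.one_mem : (1 : R) ∈ 𝒜 1 := by
  have key : ∀ x, x * h.proj 1 1 = x := fun x => by
    refine h.induction (p := fun x => x * h.proj 1 1 = x) ?_ (by simp)
      (fun x y hx hy => by rw [add_mul, hx, hy]) x
    intro g x hx
    have := h.proj_mul_left hx 1 1
    rw [mul_one, mul_one, h.proj_same hx] at this
    exact this.symm
  have := key 1
  rw [one_mul] at this
  exact this ▸ h.proj_mem 1 1

theorem IsGrading.mul_mem' {g k l : H} {a b : R} (ha : a ∈ 𝒜 g) (hb : b ∈ 𝒜 k) (e : g * k = l) :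
    a * b ∈ 𝒜 l := e ▸ h.mul_mem _ _ _ _ ha hb

end Components

/-! ### Graded-prime algebras and division idempotents -/

section Prime

variable {F : Type*} [Field F] {R : Type*} [Ring R] [Algebra F R] {G : Type*} [CommGroup G]

/-- The product of two nonzero graded ideals is nonzero. -/
def IsGradedPrime (𝒜 : GSharp G → Submodule F R) : Prop :=
  ∀ g h a b, a ∈ 𝒜 g → b ∈ 𝒜 h → a ≠ 0 → b ≠ 0 → ∃ k, ∃ r ∈ 𝒜 k, a * r * b ≠ 0

/-- An idempotent of degree `e` whose corner is a graded-division algebra with identity component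
of dimension one. -/
structure IsDivIdem (𝒜 : GSharp G → Submodule F R) (ε : R) : Prop where
  mem : ε ∈ 𝒜 1
  idem : ε * ε = ε
  ne_zero : ε ≠ 0
  inv : ∀ g d, d ∈ 𝒜 g → ε * d = d → d * ε = d → d ≠ 0 →
    ∃ d' ∈ 𝒜 g⁻¹, ε * d' = d' ∧ d' * ε = d' ∧ d * d' = ε ∧ d' * d = ε
  scalar : ∀ d ∈ 𝒜 1, ε * d = d → d * ε = d → ∃ c : F, d = c • ε

variable {𝒜 : GSharp G → Submodule F R}

/-- Graded Schur lemma. Primeness yields a nonzero `a r ε` in the division corner at `ε`, and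
inverting it gives a right inverse `a'` of `a`. Then `a' a` is a nonzero idempotent of the division
corner at `ε'`, so it is `ε'`. -/
theorem IsDivIdem.exists_inv (h : IsGrading 𝒜) (hp : IsGradedPrime 𝒜) {ε ε' : R}
    (he : IsDivIdem 𝒜 ε) (he' : IsDivIdem 𝒜 ε') {g : GSharp G} {a : R} (ha : a ∈ 𝒜 g)
    (hl : ε * a = a) (hr : a * ε' = a) (h0 : a ≠ 0) :
    ∃ a' ∈ 𝒜 g⁻¹, ε' * a' = a' ∧ a' * ε = a' ∧ a * a' = ε ∧ a' * a = ε' := by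
  obtain ⟨k, r, hrk, hne⟩ := hp _ _ _ _ ha he.mem h0 he.ne_zero
  have hd : a * r * ε ∈ 𝒜 (g * k) := h.mul_mem' (h.mul_mem _ _ _ _ ha hrk) he.mem (mul_one _)
  obtain ⟨d', hd', h1, h2, h3, h4⟩ := he.inv _ _ hd (by rw [← mul_assoc, ← mul_assoc, hl])
    (by rw [mul_assoc, he.idem]) hne
  set a' := ε' * r * d' with ha'
  have hm : a' ∈ 𝒜 g⁻¹ :=
    h.mul_mem' (h.mul_mem' he'.mem hrk (one_mul k)) hd' (by rw [mul_inv]; simp)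
  have haa : a * a' = ε := by
    rw [ha', ← mul_assoc, ← mul_assoc, hr, ← h3, mul_assoc _ ε, h1]
  have hl' : ε' * a' = a' := by rw [ha', ← mul_assoc, ← mul_assoc, he'.idem]
  have hr' : a' * ε = a' := by rw [ha', mul_assoc, h2]
  refine ⟨a', hm, hl', hr', haa, ?_⟩
  clear_value a'
  have hne' : a' * a ≠ 0 := by
    intro hz
    apply h0
    rw [← hl, ← haa, mul_assoc, hz, mul_zero]
  obtain ⟨y, -, -, hy, hy1, -⟩ := he'.inv (g⁻¹ * g) (a' * a) (h.mul_mem _ _ _ _ hm ha)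
    (by rw [← mul_assoc, hl']) (by rw [mul_assoc, hr]) hne'
  calc a' * a = a' * a * ε' := by rw [mul_assoc, hr]
    _ = a' * a * (a' * a) * y := by rw [mul_assoc _ (a' * a), hy1]
    _ = a' * (a * a') * a * y := by simp only [mul_assoc]
    _ = ε' := by rw [haa, hr', hy1]

theorem IsGradedPrime.exists_corner (h : IsGrading 𝒜) (hp : IsGradedPrime 𝒜) {ε ε' : R}
    (he : IsDivIdem 𝒜 ε) (he' : IsDivIdem 𝒜 ε') :
    ∃ g, ∃ a ∈ 𝒜 g, ε * a = a ∧ a * ε' = a ∧ a ≠ 0 := by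
  obtain ⟨k, r, hr, hne⟩ := hp _ _ _ _ he.mem he'.mem he.ne_zero he'.ne_zero
  exact ⟨k, ε * r * ε', h.mul_mem' (h.mul_mem' he.mem hr (one_mul k)) he'.mem (mul_one k),
    by rw [← mul_assoc, ← mul_assoc, he.idem], by rw [mul_assoc, he'.idem], hne⟩

/-- This and the next lemma say that multiplication `εR × Rε → εRε` is nondegenerate on homogeneous
components. -/
theorem IsDivIdem.exists_left (h : IsGrading 𝒜) (hp : IsGradedPrime 𝒜) {ε : R}
    (he : IsDivIdem 𝒜 ε) {g : GSharp G} {v : R} (hv : v ∈ 𝒜 g) (hr : v * ε = v) (h0 : v ≠ 0) :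
    ∃ w ∈ 𝒜 g⁻¹, ε * w = w ∧ w * v = ε := by
  obtain ⟨k, r, hrk, hne⟩ := hp _ _ _ _ he.mem hv he.ne_zero h0
  obtain ⟨d', hd', h1, h2, h3, h4⟩ := he.inv (k * g) (ε * r * v)
    (h.mul_mem' (h.mul_mem' he.mem hrk (one_mul k)) hv rfl)
    (by rw [← mul_assoc, ← mul_assoc, he.idem]) (by rw [mul_assoc, hr]) hne
  refine ⟨d' * (ε * r), h.mul_mem' hd' (h.mul_mem' he.mem hrk (one_mul k)) (by
    rw [mul_inv]; simp [mul_comm]), by rw [← mul_assoc, h1], by rw [mul_assoc, h4]⟩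

theorem IsDivIdem.exists_right (h : IsGrading 𝒜) (hp : IsGradedPrime 𝒜) {ε : R}
    (he : IsDivIdem 𝒜 ε) {g : GSharp G} {v : R} (hv : v ∈ 𝒜 g) (hl : ε * v = v) (h0 : v ≠ 0) :
    ∃ w ∈ 𝒜 g⁻¹, w * ε = w ∧ v * w = ε := by
  obtain ⟨k, r, hrk, hne⟩ := hp _ _ _ _ hv he.mem h0 he.ne_zero
  obtain ⟨d', hd', h1, h2, h3, h4⟩ := he.inv (g * k) (v * r * ε)
    (h.mul_mem' (h.mul_mem' hv hrk rfl) he.mem (mul_one _))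
    (by rw [← mul_assoc, ← mul_assoc, hl]) (by rw [mul_assoc, he.idem]) hne
  refine ⟨r * ε * d', h.mul_mem' (h.mul_mem' hrk he.mem (mul_one k)) hd' (by
    rw [mul_inv]; simp), by rw [mul_assoc, h2], by rw [← mul_assoc, ← mul_assoc, h3]⟩

/-- In a graded-prime algebra, an element killed by `x ↦ a x ε` for all `a` is zero. -/
theorem IsDivIdem.faithful (h : IsGrading 𝒜) (hp : IsGradedPrime 𝒜) {ε : R}
    (he : IsDivIdem 𝒜 ε) {x : R} (hx : ∀ g, ∀ v ∈ 𝒜 g, v * ε = v → x * v = 0) : x = 0 := by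
  by_contra h0
  obtain ⟨g, hg⟩ := h.exists_proj_ne h0
  obtain ⟨k, r, hr, hne⟩ := hp _ _ _ _ (h.proj_mem g x) he.mem hg he.ne_zero
  have hre : r * ε ∈ 𝒜 k := h.mul_mem' hr he.mem (mul_one k)
  apply hne
  rw [mul_assoc, ← h.proj_mul_right hre, hx _ _ hre (by rw [mul_assoc, he.idem]), map_zero]

end Prime

/-! ### Graded superinvolutions -/

section SuperInv

variable {F : Type*} [Field F] {R : Type*} [Ring R] [Algebra F R] {G : Type*} [CommGroup G]

/-- `φ` is a degree-preserving superinvolution of the `G^#`-graded algebra `R`. -/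
structure IsGradedSuperinv (𝒜 : GSharp G → Submodule F R) (φ : R →ₗ[F] R) : Prop where
  map_mem : ∀ γ a, a ∈ 𝒜 γ → φ a ∈ 𝒜 γ
  invol : ∀ a, φ (φ a) = a
  map_mul : ∀ γ δ a b, a ∈ 𝒜 γ → b ∈ 𝒜 δ →
    φ (a * b) = ((-1 : ℤˣ) ^ (par γ * par δ)) • (φ b * φ a)

variable {𝒜 : GSharp G → Submodule F R} {φ : R →ₗ[F] R}

/-- The sign rule is trivial as soon as one factor is even. For this reason the generators `b`, the
linking elements and the bases of `Rε` are all taken even. -/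
theorem IsGradedSuperinv.mul_even_left (h : IsGrading 𝒜) (hφ : IsGradedSuperinv 𝒜 φ) {g : G}
    {a : R} (ha : a ∈ 𝒜 (g, 1)) (x : R) : φ (a * x) = φ x * φ a := by
  refine h.induction (p := fun x => φ (a * x) = φ x * φ a) (fun δ x hx => ?_) (by simp)
    (fun x y hx hy => by simp only [mul_add, map_add, add_mul, hx, hy]) x
  rw [hφ.map_mul _ _ _ _ ha hx]
  simp [par]

theorem IsGradedSuperinv.mul_even_right (h : IsGrading 𝒜) (hφ : IsGradedSuperinv 𝒜 φ) {g : G}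
    {a : R} (ha : a ∈ 𝒜 (g, 1)) (x : R) : φ (x * a) = φ a * φ x := by
  refine h.induction (p := fun x => φ (x * a) = φ a * φ x) (fun δ x hx => ?_) (by simp)
    (fun x y hx hy => by simp only [mul_add, map_add, add_mul, hx, hy]) x
  rw [hφ.map_mul _ _ _ _ hx ha]
  simp [par]

theorem IsGradedSuperinv.map_one (h : IsGrading 𝒜) (hφ : IsGradedSuperinv 𝒜 φ) : φ 1 = 1 := by
  have h1 : (1 : R) ∈ 𝒜 (1, 1) := h.one_mem
  have := hφ.mul_even_left h h1 (φ 1)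
  rwa [one_mul, hφ.invol, one_mul, eq_comm] at this

theorem IsGradedSuperinv.ne_zero (hφ : IsGradedSuperinv 𝒜 φ) {a : R} (ha : a ≠ 0) :
    φ a ≠ 0 := fun h => ha (by rw [← hφ.invol a, h, map_zero])

/-- `φ` exchanges the corners at `ε` and at `φ ε` and reverses products up to sign, so inverses and
scalars are carried over. -/
theorem IsGradedSuperinv.isDivIdem (h : IsGrading 𝒜) (hφ : IsGradedSuperinv 𝒜 φ) {ε : R}
    (he : IsDivIdem 𝒜 ε) : IsDivIdem 𝒜 (φ ε) := by
  have hL := hφ.mul_even_left h (g := 1) he.mem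
  have hR := hφ.mul_even_right h (g := 1) he.mem
  have hL' : ∀ d, φ ε * d = d → φ d * ε = φ d := fun d hd => by
    conv_rhs => rw [← hd, hφ.mul_even_left h (g := 1) (hφ.map_mem _ _ he.mem), hφ.invol]
  have hR' : ∀ d, d * φ ε = d → ε * φ d = φ d := fun d hd => by
    conv_rhs => rw [← hd, hφ.mul_even_right h (g := 1) (hφ.map_mem _ _ he.mem), hφ.invol]
  refine ⟨hφ.map_mem _ _ he.mem, by rw [← hL, he.idem], hφ.ne_zero he.ne_zero, ?_, ?_⟩
  · intro g d hd h1 h2 h0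
    obtain ⟨y, hy, hy1, hy2, hy3, hy4⟩ := he.inv g (φ d) (hφ.map_mem _ _ hd) (hR' d h2) (hL' d h1)
      (hφ.ne_zero h0)
    have s : ∀ x : R, ((-1 : ℤˣ) ^ (par g * par g)) • ((-1 : ℤˣ) ^ (par g * par g)) • x = x := by
      intro x
      rw [smul_smul, ← uzpow_add, CharTwo.add_self_eq_zero, uzpow_zero, one_smul]
    have pi : par g⁻¹ = par g := by
      simp [par]
    -- The superinvolution sends an inverse of `φ d` to an inverse of `d` only up to the sign
    -- `(-1)^{|d|}`, corrected here.
    refine ⟨((-1 : ℤˣ) ^ (par g * par g)) • φ y, ?_, ?_, ?_, ?_, ?_⟩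
    · rcases Int.units_eq_one_or ((-1 : ℤˣ) ^ (par g * par g)) with e | e <;> rw [e]
      · simpa using hφ.map_mem _ _ hy
      · simpa using hφ.map_mem _ _ hy
    · rw [mul_smul_comm, ← hR, hy2]
    · rw [smul_mul_assoc, ← hL, hy1]
    · have := hφ.map_mul _ _ _ _ hy (hφ.map_mem _ _ hd)
      rw [hy4, hφ.invol, pi] at this
      rw [mul_smul_comm, ← s (d * φ y), this, s]
    · have := hφ.map_mul _ _ _ _ (hφ.map_mem _ _ hd) hy
      rw [hy3, hφ.invol, pi] at this
      rw [smul_mul_assoc, ← s (φ y * d), this, s]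
  · intro d hd h1 h2
    obtain ⟨c, hc⟩ := he.scalar (φ d) (hφ.map_mem _ _ hd) (hR' d h2) (hL' d h1)
    exact ⟨c, by rw [← hφ.invol d, hc, map_smul]⟩

end SuperInv

/-! ### Graded-division superalgebras with superinvolution of a given type -/

section Std

variable {F : Type*} [Field F] {D : Type*} [Ring D] [Algebra F D] {G : Type*} [CommGroup G]

/-- This is where characteristic different from two enters: signs can be read off from their action
on a nonzero vector. -/
theorem units_smul_eq_iff {M : Type*} [AddCommGroup M] [Module F M] (h2 : (2 : F) ≠ 0) {x : M}
    (hx : x ≠ 0) {u v : ℤˣ} : u • x = v • x ↔ u = v := by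
  refine ⟨fun h => ?_, fun h => h ▸ rfl⟩
  have key : x ≠ -x := fun h => by
    have h3 : (2 : F) • x = 0 := by rw [two_smul]; nth_rw 1 [h]; simp
    exact (smul_ne_zero h2 hx) h3
  rcases Int.units_eq_one_or u with rfl | rfl <;> rcases Int.units_eq_one_or v with rfl | rfl
  · rfl
  · exact absurd (by simpa using h) key
  · exact absurd (by simpa using h.symm) key
  · rfl

theorem map_units_zsmul {M N : Type*} [AddCommGroup M] [Module F M] [AddCommGroup N] [Module F N]
    (f : M →ₗ[F] N) (u : ℤˣ) (x : M) : f (u • x) = u • f x := by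
  rcases Int.units_eq_one_or u with rfl | rfl <;> simp

theorem units_mul_self_smul {M : Type*} [AddCommGroup M] (u : ℤˣ) (x : M) : u • u • x = x := by
  rcases Int.units_eq_one_or u with rfl | rfl <;> simp

/-- The structure of a graded-division superalgebra `D = ⨁_{t ∈ T} F Y_t` with a degree-preserving
superinvolution given by signs `η`, normalized by `η(t_p) = 1` and `η(f) = -1`. -/
structure StdData (P : OddTriple G) (𝒟 : GSharp G → Submodule F D) (φ₀ : D →ₗ[F] D) where
  Y : Module.Basis P.T F D
  η : P.T → ℤˣ
  mem_iff : ∀ (t : P.T) d, d ∈ 𝒟 t ↔ ∃ c : F, d = c • Y t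
  eq_bot : ∀ γ, γ ∉ P.T → 𝒟 γ = ⊥
  one_mem : (1 : D) ∈ 𝒟 1
  mul : ∀ s t, ∃ c : F, c ≠ 0 ∧ Y s * Y t = c • Y (s * t)
  comm : ∀ s t, Y s * Y t =
    ((-1) ^ (par (s : GSharp G) * par (t : GSharp G)) * P.β s t) • (Y t * Y s)
  phi : ∀ t, φ₀ (Y t) = η t • Y t
  eta_mul : ∀ s t, η (s * t) = P.β s t * η s * η t
  eta_tp : η P.tp = 1
  eta_f : ∀ f, f ≠ 1 → (∀ s, P.β f s = 1) → η f = -1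

namespace StdData

variable {P : OddTriple G} {𝒟 : GSharp G → Submodule F D} {φ₀ : D →ₗ[F] D} (S : StdData P 𝒟 φ₀)
include S

theorem Y_mem (t : P.T) : S.Y t ∈ 𝒟 t := (S.mem_iff t _).2 ⟨1, (one_smul _ _).symm⟩

theorem Y_ne (t : P.T) : S.Y t ≠ 0 := by
  have : Nontrivial F := inferInstance
  exact S.Y.ne_zero t

theorem mem_T {γ : GSharp G} {d : D} (hd : d ∈ 𝒟 γ) (h0 : d ≠ 0) : γ ∈ P.T := by
  by_contra h
  rw [S.eq_bot γ h] at hd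
  exact h0 (by simpa using hd)

theorem exists_eq {γ : GSharp G} {d : D} (hd : d ∈ 𝒟 γ) (h0 : d ≠ 0) :
    ∃ t : P.T, (t : GSharp G) = γ ∧ ∃ c : F, c ≠ 0 ∧ d = c • S.Y t := by
  have hT := S.mem_T hd h0
  obtain ⟨c, hc⟩ := (S.mem_iff ⟨γ, hT⟩ d).1 hd
  refine ⟨⟨γ, hT⟩, rfl, c, ?_, hc⟩
  rintro rfl
  exact h0 (by simpa using hc)

theorem nontrivial : Nontrivial D := ⟨⟨S.Y 1, 0, S.Y_ne 1⟩⟩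

theorem isGrading : IsGrading 𝒟 where
  indep := by
    have hsub : ∀ γ, 𝒟 γ ≤ Submodule.span F (S.Y '' {t | (t : GSharp G) = γ}) := fun γ d hd => by
      by_cases h0 : d = 0
      · rw [h0]; exact zero_mem _
      · obtain ⟨t, ht, c, -, rfl⟩ := S.exists_eq hd h0
        exact Submodule.smul_mem _ _ (Submodule.subset_span ⟨t, ht, rfl⟩)
    rw [iSupIndep_def]
    intro γ
    have h2 : ⨆ δ, ⨆ (_ : δ ≠ γ), 𝒟 δ ≤
        Submodule.span F (S.Y '' {t | (t : GSharp G) ≠ γ}) :=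
      iSup₂_le fun δ hδ => (hsub δ).trans (Submodule.span_mono
        (Set.image_mono fun t ht => by rw [Set.mem_ofPred_eq] at ht ⊢; rwa [ht]))
    refine Disjoint.mono (hsub γ) h2 ?_
    refine S.Y.linearIndependent.disjoint_span_image ?_
    rw [Set.disjoint_left]
    exact fun t h h' => h' h
  span := by
    rw [eq_top_iff, ← S.Y.span_eq, Submodule.span_le]
    rintro _ ⟨t, rfl⟩
    exact Submodule.mem_iSup_of_mem (t : GSharp G) (S.Y_mem t)
  mul_mem := by
    intro g k a b ha hb
    by_cases h0 : a = 0
    · rw [h0, zero_mul]; exact zero_mem _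
    by_cases h1 : b = 0
    · rw [h1, mul_zero]; exact zero_mem _
    obtain ⟨s, rfl, c, -, rfl⟩ := S.exists_eq ha h0
    obtain ⟨t, rfl, c', -, rfl⟩ := S.exists_eq hb h1
    obtain ⟨x, -, hx⟩ := S.mul s t
    rw [smul_mul_smul_comm, hx]
    exact Submodule.smul_mem _ _ (Submodule.smul_mem _ _ (S.Y_mem (s * t)))

theorem exists_one : ∃ c : F, c ≠ 0 ∧ (1 : D) = c • S.Y 1 := by
  have := S.nontrivial
  obtain ⟨t, ht, c, hc, h⟩ := S.exists_eq S.one_mem one_ne_zero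
  obtain rfl : t = 1 := Subtype.ext ht
  exact ⟨c, hc, h⟩

theorem exists_inv (t : P.T) : ∃ z ∈ 𝒟 (t : GSharp G)⁻¹, S.Y t * z = 1 ∧ z * S.Y t = 1 := by
  obtain ⟨e, he, h1⟩ := S.exists_one
  obtain ⟨c, hc, hc'⟩ := S.mul t t⁻¹
  obtain ⟨k, hk, hk'⟩ := S.mul t⁻¹ t
  rw [mul_inv_cancel] at hc'
  rw [inv_mul_cancel] at hk'
  have hz : S.Y t * ((e * c⁻¹) • S.Y t⁻¹) = 1 := by
    rw [mul_smul_comm, hc', smul_smul, h1, mul_assoc, inv_mul_cancel₀ hc, mul_one]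
  have hz' : ((e * k⁻¹) • S.Y t⁻¹) * S.Y t = 1 := by
    rw [smul_mul_assoc, hk', smul_smul, h1, mul_assoc, inv_mul_cancel₀ hk, mul_one]
  refine ⟨_, ?_, hz, (left_inv_eq_right_inv hz' hz) ▸ hz'⟩
  exact Submodule.smul_mem _ _ (S.Y_mem t⁻¹)

theorem phi_mem {γ : GSharp G} {d : D} (hd : d ∈ 𝒟 γ) : φ₀ d ∈ 𝒟 γ := by
  by_cases h0 : d = 0
  · rw [h0, map_zero]; exact zero_mem _
  obtain ⟨t, rfl, c, -, rfl⟩ := S.exists_eq hd h0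
  rw [map_smul, S.phi]
  refine Submodule.smul_mem _ _ ?_
  rcases Int.units_eq_one_or (S.η t) with e | e <;> rw [e] <;> simp [S.Y_mem]

/-- On basis elements the super-antimultiplicativity of `φ₀` amounts to `η(st) = β̃(s,t)η(s)η(t)`,
given the commutation rule. -/
theorem isGradedSuperinv : IsGradedSuperinv 𝒟 φ₀ where
  map_mem γ a ha := S.phi_mem ha
  invol := by
    intro a
    have : φ₀ ∘ₗ φ₀ = LinearMap.id := S.Y.ext fun t => by
      simp only [LinearMap.comp_apply, S.phi, map_units_zsmul, units_mul_self_smul,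
        LinearMap.id_apply]
    exact LinearMap.congr_fun this a
  map_mul := by
    intro γ δ a b ha hb
    by_cases h0 : a = 0
    · simp [h0]
    by_cases h1 : b = 0
    · simp [h1]
    obtain ⟨s, rfl, c, -, rfl⟩ := S.exists_eq ha h0
    obtain ⟨t, rfl, c', -, rfl⟩ := S.exists_eq hb h1
    obtain ⟨x, -, hx⟩ := S.mul s t
    have key : φ₀ (S.Y s * S.Y t) =
        (-1 : ℤˣ) ^ (par (s : GSharp G) * par (t : GSharp G)) • (φ₀ (S.Y t) * φ₀ (S.Y s)) := by
      have hst : φ₀ (S.Y s * S.Y t) = S.η (s * t) • (S.Y s * S.Y t) := by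
        rw [hx, map_smul, S.phi, smul_comm]
      rw [hst, S.phi, S.phi, S.comm s t, S.eta_mul, smul_mul_smul_comm, smul_smul, smul_smul,
        (by decide : ∀ a b c p : ℤˣ, a * b * c * (p * a) = p * (c * b))]
    rw [smul_mul_smul_comm, map_smul, key, map_smul, map_smul, smul_mul_smul_comm, mul_comm c' c,
      smul_comm]

theorem eta_eq (h2 : (2 : F) ≠ 0) (t : P.T) : eta 𝒟 φ₀ (t : GSharp G) = S.η t := by
  unfold eta
  rcases Int.units_eq_one_or (S.η t) with e | e
  · rw [if_pos, e]
    intro d hd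
    obtain ⟨c, rfl⟩ := (S.mem_iff t d).1 hd
    rw [map_smul, S.phi, e, one_smul]
  · rw [if_neg, e]
    intro h
    have := h _ (S.Y_mem t)
    rw [S.phi, ← one_smul ℤˣ (S.Y t), smul_smul, units_smul_eq_iff h2 (S.Y_ne t), e] at this
    exact absurd this (by decide)

end StdData

end Std

/-! ### Frames -/

section Frame

variable {F : Type*} [Field F] {R : Type*} [Ring R] [Algebra F R] {G : Type*} [CommGroup G]
  {D : Type*} [Ring D] [Algebra F D]

/-- The component of degree `γ` of the left ideal `R ε`. -/
def col (𝒜 : GSharp G → Submodule F R) (ε : R) (γ : GSharp G) : Submodule F R :=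
  𝒜 γ ⊓ LinearMap.ker (LinearMap.mulRight F ε - LinearMap.id)

theorem mem_col {𝒜 : GSharp G → Submodule F R} {ε : R} {γ : GSharp G} {x : R} :
    x ∈ col 𝒜 ε γ ↔ x ∈ 𝒜 γ ∧ x * ε = x := by
  simp [col, sub_eq_zero]

/-- An identification `ι` of `D` with a corner `ε R ε`, where `ε = ι 1`, together with a generator
`b` of `ε R φ(ε)` through which `φ` induces `φ₀`. -/
structure Frame (𝒜 : GSharp G → Submodule F R) (φ : R →ₗ[F] R) (𝒟 : GSharp G → Submodule F D)
    (φ₀ : D →ₗ[F] D) where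
  ι : D →ₗ[F] R
  b : R
  deg : G
  ι_mul : ∀ x y, ι (x * y) = ι x * ι y
  ι_mem : ∀ γ d, d ∈ 𝒟 γ → ι d ∈ 𝒜 γ
  ι_inj : Function.Injective ι
  ι_surj : ∀ r, ι 1 * r = r → r * ι 1 = r → ∃ d, ι d = r
  b_mem : b ∈ 𝒜 (deg, 1)
  b_ne : b ≠ 0
  b_left : ι 1 * b = b
  b_phi : ∀ d, b * φ (ι d) = ι (φ₀ d) * b
  phi_b : φ b = b

namespace Frame

variable {𝒜 : GSharp G → Submodule F R} {φ : R →ₗ[F] R} {𝒟 : GSharp G → Submodule F D}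
  {φ₀ : D →ₗ[F] D} {P : OddTriple G}

theorem one_ι (f : Frame 𝒜 φ 𝒟 φ₀) (d : D) : f.ι 1 * f.ι d = f.ι d := by
  rw [← f.ι_mul, one_mul]

theorem ι_one (f : Frame 𝒜 φ 𝒟 φ₀) (d : D) : f.ι d * f.ι 1 = f.ι d := by
  rw [← f.ι_mul, mul_one]

/-- `ι` commutes with homogeneous projections and is injective, so it reflects degrees as well as
preserving them. -/
theorem mem_of_ι (h : IsGrading 𝒜) (S : StdData P 𝒟 φ₀) (f : Frame 𝒜 φ 𝒟 φ₀) {γ : GSharp G}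
    {d : D} (hd : f.ι d ∈ 𝒜 γ) : d ∈ 𝒟 γ := by
  have hD := S.isGrading
  have key : h.proj γ ∘ₗ f.ι = f.ι ∘ₗ hD.proj γ := hD.ext_hom fun δ x hx => by
    by_cases e : γ = δ
    · subst e
      simp [hD.proj_same hx, h.proj_same (f.ι_mem _ _ hx)]
    · simp [hD.proj_ne hx e, h.proj_ne (f.ι_mem _ _ hx) e]
  have := LinearMap.congr_fun key d
  simp only [LinearMap.comp_apply, h.proj_same hd] at this
  rw [f.ι_inj this]
  exact hD.proj_mem _ _

theorem isDivIdem (h : IsGrading 𝒜) (S : StdData P 𝒟 φ₀) (f : Frame 𝒜 φ 𝒟 φ₀) :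
    IsDivIdem 𝒜 (f.ι 1) where
  mem := f.ι_mem _ _ S.one_mem
  idem := f.one_ι 1
  ne_zero := by
    have := S.nontrivial
    rw [Ne, map_eq_zero_iff _ f.ι_inj]
    exact one_ne_zero
  inv := by
    intro g d hd h1 h2 h0
    obtain ⟨d, rfl⟩ := f.ι_surj d h1 h2
    obtain ⟨t, rfl, c, hc, rfl⟩ := S.exists_eq (f.mem_of_ι h S hd) (by rintro rfl; simp at h0)
    obtain ⟨z, hz, h3, h4⟩ := S.exists_inv t
    refine ⟨f.ι (c⁻¹ • z), f.ι_mem _ _ (Submodule.smul_mem _ _ hz), f.one_ι _, f.ι_one _, ?_, ?_⟩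
    · rw [← f.ι_mul, smul_mul_smul_comm, mul_inv_cancel₀ hc, h3, one_smul]
    · rw [← f.ι_mul, smul_mul_smul_comm, inv_mul_cancel₀ hc, h4, one_smul]
  scalar := by
    intro d hd h1 h2
    obtain ⟨d, rfl⟩ := f.ι_surj d h1 h2
    obtain ⟨e, he, h3⟩ := S.exists_one
    obtain ⟨c, rfl⟩ := (S.mem_iff 1 d).1 (f.mem_of_ι h S hd)
    refine ⟨c * e⁻¹, ?_⟩
    rw [h3, map_smul, map_smul, smul_smul, mul_assoc, inv_mul_cancel₀ he, mul_one]

theorem b_right (S : StdData P 𝒟 φ₀) (f : Frame 𝒜 φ 𝒟 φ₀) :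
    f.b * φ (f.ι 1) = f.b := by
  rw [f.b_phi, S.isGradedSuperinv.map_one S.isGrading, f.b_left]

/-- A frame can be moved to any other division idempotent. -/
theorem exists_transport (h : IsGrading 𝒜) (S : StdData P 𝒟 φ₀) (hφ : IsGradedSuperinv 𝒜 φ)
    (f : Frame 𝒜 φ 𝒟 φ₀) {ε a a' : R} {s : G}
    (ha : a ∈ 𝒜 (s, 1)) (ha' : a' ∈ 𝒜 (s, 1)⁻¹) (h1 : a * a' = ε) (h2 : a' * a = f.ι 1)
    (hl : ε * a = a) (hr : a * f.ι 1 = a) (hl' : f.ι 1 * a' = a') (hr' : a' * ε = a') :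
    ∃ f' : Frame 𝒜 φ 𝒟 φ₀, f'.ι 1 = ε ∧ f'.deg = s ^ 2 * f.deg := by
  have hx : ∀ x y, a * x * a' * (a * y * a') = a * (x * f.ι 1 * y) * a' := fun x y => by
    rw [← h2]; simp only [mul_assoc]
  have hy : ∀ x, a' * (a * x * a') * a = f.ι 1 * x * f.ι 1 := fun x => by
    rw [← h2]; simp only [mul_assoc]
  have hε : a * f.ι 1 * a' = ε := by rw [hr, h1]
  have ha'2 : a' ∈ 𝒜 (s⁻¹, 1) := by simpa using ha'
  have h3 : φ a * φ a' = φ (f.ι 1) := by rw [← h2, hφ.mul_even_left h ha'2]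
  -- The corner is conjugated by `a`, while the generator becomes `a b φ(a)`. Since `φ` preserves
  -- degrees, this has degree `s · deg · s`.
  refine ⟨⟨LinearMap.mulRight F a' ∘ₗ LinearMap.mulLeft F a ∘ₗ f.ι, a * f.b * φ a, s ^ 2 * f.deg,
    ?_, ?_, ?_, ?_, ?_, ?_, ?_, ?_, ?_⟩, ?_, rfl⟩
  · intro x y
    simp only [LinearMap.comp_apply, LinearMap.mulRight_apply, LinearMap.mulLeft_apply, hx,
      f.ι_one, f.ι_mul]
  · intro γ d hd
    exact h.mul_mem' (h.mul_mem _ _ _ _ ha (f.ι_mem _ _ hd)) ha' (mul_inv_cancel_comm _ _)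
  · intro x y hxy
    have := congrArg (fun x => a' * x * a) hxy
    simp only [LinearMap.comp_apply, LinearMap.mulRight_apply, LinearMap.mulLeft_apply, hy,
      f.ι_one, f.one_ι] at this
    exact f.ι_inj this
  · intro r
    simp only [LinearMap.comp_apply, LinearMap.mulRight_apply, LinearMap.mulLeft_apply, hε]
    intro h3 h4
    obtain ⟨d, hd⟩ := f.ι_surj (a' * r * a) (by rw [← mul_assoc, ← mul_assoc, hl'])
      (by rw [mul_assoc, hr])
    refine ⟨d, ?_⟩
    rw [hd]
    calc a * (a' * r * a) * a' = (a * a') * r * (a * a') := by simp only [mul_assoc]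
      _ = r := by rw [h1, h3, h4]
  · refine h.mul_mem' (h.mul_mem _ _ _ _ ha f.b_mem) (hφ.map_mem _ _ ha) ?_
    rw [Prod.mk_mul_mk, Prod.mk_mul_mk, one_mul, one_mul, sq, mul_right_comm]
  · intro h0
    apply f.b_ne
    calc f.b = (a' * a) * f.b * (φ a * φ a') := by rw [h3, h2, f.b_left, f.b_right S]
      _ = a' * (a * f.b * φ a) * φ a' := by simp only [mul_assoc]
      _ = 0 := by rw [h0]; simp
  · simp only [LinearMap.comp_apply, LinearMap.mulRight_apply, LinearMap.mulLeft_apply, hε]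
    rw [← mul_assoc, ← mul_assoc, hl]
  · intro d
    simp only [LinearMap.comp_apply, LinearMap.mulRight_apply, LinearMap.mulLeft_apply]
    rw [hφ.mul_even_right h ha'2, hφ.mul_even_left h ha]
    calc a * f.b * φ a * (φ a' * (φ (f.ι d) * φ a))
        = a * (f.b * ((φ a * φ a') * φ (f.ι d))) * φ a := by simp only [mul_assoc]
      _ = a * (f.ι (φ₀ d) * f.b) * φ a := by
        rw [h3, ← hφ.mul_even_right h (g := 1) (f.ι_mem _ _ S.one_mem), f.ι_one, f.b_phi]
      _ = a * f.ι (φ₀ d) * a' * (a * f.b * φ a) := by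
        calc _ = a * (f.ι (φ₀ d) * f.ι 1) * f.b * φ a := by rw [f.ι_one]; simp only [mul_assoc]
          _ = _ := by rw [← h2]; simp only [mul_assoc]
  · rw [hφ.mul_even_right h (hφ.map_mem _ _ ha), hφ.mul_even_left h ha, hφ.invol, f.phi_b,
      mul_assoc]
  · simp only [LinearMap.comp_apply, LinearMap.mulRight_apply, LinearMap.mulLeft_apply, hε]

/-- Since `b` is invertible between `ε` and `φ(ε)`, the product `c b⁻¹` is a homogeneous element of
the corner, and those lie on the lines spanned by the `Y_t`. -/
theorem exists_coeff (h : IsGrading 𝒜) (hp : IsGradedPrime 𝒜) (hφ : IsGradedSuperinv 𝒜 φ)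
    (S : StdData P 𝒟 φ₀) (f : Frame 𝒜 φ 𝒟 φ₀) {c : R} {g : G}
    (hc : c ∈ 𝒜 (g, 1)) (hl : f.ι 1 * c = c) (hr : c * φ (f.ι 1) = c) (h0 : c ≠ 0) :
    ∃ t : P.T, (t : GSharp G) = (g * f.deg⁻¹, 1) ∧ ∃ k : F, k ≠ 0 ∧ c = k • (f.ι (S.Y t) * f.b) := by
  have he := f.isDivIdem h S
  obtain ⟨b', hb', -, h1, h2, h3⟩ := he.exists_inv h hp (hφ.isDivIdem h he) f.b_mem f.b_left
    (f.b_right S) f.b_ne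
  have hcb : c * b' * f.b = c := by rw [mul_assoc, h3, hr]
  obtain ⟨d, hd⟩ := f.ι_surj (c * b') (by rw [← mul_assoc, hl]) (by rw [mul_assoc, h1])
  have hm : f.ι d ∈ 𝒜 (g * f.deg⁻¹, 1) := by
    rw [hd]; exact h.mul_mem' hc hb' (by simp)
  obtain ⟨t, ht, k, hk, rfl⟩ := S.exists_eq (f.mem_of_ι h S hm) (by
    rintro rfl
    rw [map_zero] at hd
    rw [← hd, zero_mul] at hcb
    exact h0 hcb.symm)
  exact ⟨t, ht, k, hk, by rw [← smul_mul_assoc, ← map_smul, hd, hcb]⟩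

/-- Replacing `b` by `Y_t b` twists the sign function by `β̃(t,·)`; this is the only freedom in the
choice of a generator. -/
theorem ι_Y_b_phi (S : StdData P 𝒟 φ₀) (f : Frame 𝒜 φ 𝒟 φ₀) (s t : P.T)
    (ht : par (t : GSharp G) = 0) :
    f.ι (S.Y t) * f.b * φ (f.ι (S.Y s)) = (P.β t s * S.η s) • (f.ι (S.Y s) * (f.ι (S.Y t) * f.b)) := by
  rw [mul_assoc, f.b_phi, S.phi, map_units_zsmul, smul_mul_assoc, mul_smul_comm, ← mul_assoc,
    ← f.ι_mul, S.comm, ht, zero_mul, uzpow_zero, one_mul, map_units_zsmul, f.ι_mul, smul_mul_assoc,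
    smul_smul, mul_comm, mul_assoc]

end Frame

theorem OddTriple.eq_of {P P' : OddTriple G} (hT : P.T = P'.T)
    (hβ : ∀ s hs hs' t ht ht', P.β ⟨s, hs⟩ ⟨t, ht⟩ = P'.β ⟨s, hs'⟩ ⟨t, ht'⟩)
    (htp : (P.tp : GSharp G) = P'.tp) : P = P' := by
  obtain ⟨T, fin, β, sk, di, ra, od, tp, tpp⟩ := P
  obtain ⟨T', fin', β', sk', di', ra', od', tp', tpp'⟩ := P'
  obtain rfl : T = T' := hT
  obtain rfl : β = β' := by
    ext s t
    exact congrArg _ (hβ s s.2 s.2 t t.2 t.2)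
  obtain rfl : tp = tp' := Subtype.ext htp
  rfl

variable {𝒜 : GSharp G → Submodule F R} {φ : R →ₗ[F] R} {𝒟 : GSharp G → Submodule F D}
  {φ₀ : D →ₗ[F] D} {P P' : OddTriple G} {D' : Type*} [Ring D'] [Algebra F D']
  {𝒟' : GSharp G → Submodule F D'} {φ₀' : D' →ₗ[F] D'}

theorem Frame.exists_Y_eq (h : IsGrading 𝒜) (S : StdData P 𝒟 φ₀) (f : Frame 𝒜 φ 𝒟 φ₀)
    (S' : StdData P' 𝒟' φ₀') (f' : Frame 𝒜 φ 𝒟' φ₀') (he : f.ι 1 = f'.ι 1) (t : P.T) :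
    ∃ t' : P'.T, (t' : GSharp G) = t ∧ ∃ c : F, c ≠ 0 ∧ f.ι (S.Y t) = c • f'.ι (S'.Y t') := by
  obtain ⟨d, hd⟩ := f'.ι_surj (f.ι (S.Y t)) (by rw [← he, f.one_ι]) (by rw [← he, f.ι_one])
  have h0 : f.ι (S.Y t) ≠ 0 := (map_ne_zero_iff _ f.ι_inj).2 (S.Y_ne t)
  obtain ⟨t', ht', c, hc, rfl⟩ := S'.exists_eq
    (f'.mem_of_ι h S' (γ := t) (hd ▸ f.ι_mem _ _ (S.Y_mem t))) (by
      rintro rfl; exact h0 (by rw [← hd, map_zero]))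
  exact ⟨t', ht', c, hc, by rw [← hd, map_smul]⟩

/-- Two frames with the same idempotent. -/
theorem Frame.eta_eq (h2 : (2 : F) ≠ 0) (h : IsGrading 𝒜) (hp : IsGradedPrime 𝒜)
    (hφ : IsGradedSuperinv 𝒜 φ) (S : StdData P 𝒟 φ₀) (f : Frame 𝒜 φ 𝒟 φ₀)
    (S' : StdData P' 𝒟' φ₀') (f' : Frame 𝒜 φ 𝒟' φ₀') (he : f.ι 1 = f'.ι 1) :
    ∃ t : P.T, (t : GSharp G) = (f'.deg * f.deg⁻¹, 1) ∧ S.η t = 1 ∧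
      ∀ (s : P.T) (s' : P'.T), (s : GSharp G) = s' → S'.η s' = P.β t s * S.η s := by
  -- The second generator is a multiple of `Y_t b` for some even `t`.
  obtain ⟨t, ht, k, hk, hb⟩ := f.exists_coeff h hp hφ S f'.b_mem (by rw [he, f'.b_left])
    (by rw [he, f'.b_right S']) f'.b_ne
  have hpt : par (t : GSharp G) = 0 := by rw [ht]; rfl
  refine ⟨t, ht, ?_, ?_⟩
  -- Both generators are fixed by `φ`, while `φ(Y_t b) = bφ(Y_t) = η(t) Y_t b`; hence `η(t) = 1`.
  · have h1 := f'.phi_b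
    have hYt : f.ι (S.Y t) ∈ 𝒜 (f'.deg * f.deg⁻¹, 1) := f.ι_mem _ _ (by rw [← ht]; exact S.Y_mem t)
    rw [hb, map_smul, hφ.mul_even_left h hYt, f.phi_b, f.b_phi, S.phi,
      map_units_zsmul, smul_mul_assoc, smul_comm, ← hb, ← one_smul ℤˣ f'.b, smul_smul,
      units_smul_eq_iff h2 f'.b_ne, mul_one] at h1
    exact h1
  · intro s s' hs
    obtain ⟨s'', hs'', c, hc, hY⟩ := f.exists_Y_eq h S S' f' he s
    obtain rfl : s'' = s' := Subtype.ext (hs''.trans hs)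
    have h1 := f.ι_Y_b_phi S s t hpt
    have h3 : f.ι (S.Y s) * f'.b ≠ 0 := by
      obtain ⟨z, -, -, hz⟩ := S.exists_inv s
      intro h0
      apply f'.b_ne
      rw [← f'.b_left, ← he, ← hz, f.ι_mul, mul_assoc, h0, mul_zero]
    have h4 : f'.b * φ (f.ι (S.Y s)) = S'.η s'' • (f.ι (S.Y s) * f'.b) := by
      rw [hY, map_smul, mul_smul_comm, f'.b_phi, S'.phi, map_units_zsmul, smul_mul_assoc,
        smul_mul_assoc, smul_comm]
    have h5 : f'.b * φ (f.ι (S.Y s)) = (P.β t s * S.η s) • (f.ι (S.Y s) * f'.b) := by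
      rw [hb, smul_mul_assoc, h1, mul_smul_comm, smul_comm]
    rwa [h4, units_smul_eq_iff h2 h3] at h5

/-- The corner determines `T` as its support and `β̃` through commutation. Then `t_p` is known up to
the radical, and the sign function settles the remaining ambiguity. -/
theorem Frame.triple_eq_of_same (h2 : (2 : F) ≠ 0) (h : IsGrading 𝒜) (hp : IsGradedPrime 𝒜)
    (hφ : IsGradedSuperinv 𝒜 φ) (S : StdData P 𝒟 φ₀) (f : Frame 𝒜 φ 𝒟 φ₀)
    (S' : StdData P' 𝒟' φ₀') (f' : Frame 𝒜 φ 𝒟' φ₀') (he : f.ι 1 = f'.ι 1) : P = P' := by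
  have hT : P.T = P'.T := by
    apply le_antisymm
    · intro t ht
      obtain ⟨t', ht', -⟩ := f.exists_Y_eq h S S' f' he ⟨t, ht⟩
      exact (show (t' : GSharp G) = t from ht') ▸ t'.2
    · intro t ht
      obtain ⟨t', ht', -⟩ := f'.exists_Y_eq h S' S f he.symm ⟨t, ht⟩
      exact (show (t' : GSharp G) = t from ht') ▸ t'.2
  have hβ : ∀ s hs hs' t ht ht', P.β ⟨s, hs⟩ ⟨t, ht⟩ = P'.β ⟨s, hs'⟩ ⟨t, ht'⟩ := by
    intro s hs hs' t ht ht'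
    obtain ⟨s', e, c, hc, h1⟩ := f.exists_Y_eq h S S' f' he ⟨s, hs⟩
    obtain rfl : s' = ⟨s, hs'⟩ := Subtype.ext e
    obtain ⟨t', e, k, hk, h3⟩ := f.exists_Y_eq h S S' f' he ⟨t, ht⟩
    obtain rfl : t' = ⟨t, ht'⟩ := Subtype.ext e
    have h4 := congrArg f.ι (S.comm ⟨s, hs⟩ ⟨t, ht⟩)
    have h5 := congrArg f'.ι (S'.comm ⟨s, hs'⟩ ⟨t, ht'⟩)
    have h0 : f.ι (S.Y ⟨t, ht⟩ * S.Y ⟨s, hs⟩) ≠ 0 := by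
      rw [map_ne_zero_iff _ f.ι_inj]
      obtain ⟨z, -, -, hz⟩ := S.exists_inv ⟨t, ht⟩
      intro h0
      apply S.Y_ne ⟨s, hs⟩
      rw [← one_mul (S.Y _), ← hz, mul_assoc, h0, mul_zero]
    rw [map_units_zsmul] at h4 h5
    rw [f'.ι_mul, f'.ι_mul] at h5
    have h6 : f.ι (S.Y ⟨s, hs⟩ * S.Y ⟨t, ht⟩) =
        ((-1) ^ (par s * par t) * P'.β ⟨s, hs'⟩ ⟨t, ht'⟩) • f.ι (S.Y ⟨t, ht⟩ * S.Y ⟨s, hs⟩) := by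
      rw [f.ι_mul, f.ι_mul, h1, h3, smul_mul_smul_comm, h5, smul_mul_smul_comm, smul_comm,
        mul_comm k c]
    rw [h4, units_smul_eq_iff h2 h0] at h6
    exact mul_left_cancel h6
  refine OddTriple.eq_of hT hβ ?_
  -- If `t_p'` differs from `t_p`, the quotient is a nontrivial radical element, where `η = -1`, so
  -- `η(t_p') = -1`. But the two sign functions differ by `β̃(t,·)` with `t` even, which is trivial
  -- at a parity element, so `η(t_p') = η'(t_p') = 1`.
  by_contra hne
  have htp' : (P'.tp : GSharp G) ∈ P.T := by rw [hT]; exact P'.tp.2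
  obtain ⟨t, ht, -, ht2⟩ := Frame.eta_eq h2 h hp hφ S f S' f' he
  have hpt : par (t : GSharp G) = 0 := by rw [ht]; rfl
  set u : P.T := ⟨P'.tp, htp'⟩ with hu
  have hup : ∀ x : P.T, P.β u x = (-1) ^ par (x : GSharp G) := fun x => by
    have hx' : (x : GSharp G) ∈ P'.T := hT ▸ x.2
    rw [← P'.tp_parity ⟨x, hx'⟩]
    exact hβ _ _ _ _ _ _
  have h1 := ht2 u P'.tp rfl
  rw [S'.eta_tp, P.skew, hup, hpt, uzpow_zero, inv_one, one_mul] at h1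
  have h3 := S.eta_f (u * P.tp⁻¹) (by
    intro h4
    rw [mul_inv_eq_one] at h4
    exact hne (congrArg Subtype.val h4.symm)) (fun s => by
      rw [map_mul, map_inv, MonoidHom.mul_apply, MonoidHom.inv_apply, hup, P.tp_parity,
        mul_inv_cancel])
  have h4 := S.eta_mul (u * P.tp⁻¹) P.tp
  rw [inv_mul_cancel_right, ← h1, h3, S.eta_tp, map_mul, map_inv, MonoidHom.mul_apply,
    MonoidHom.inv_apply, hup, P.tp_parity, mul_inv_cancel] at h4
  exact absurd h4 (by decide)

/-- The generators differ by `Y_t` with `β̃(t,·) = 1` and `η(t) = 1`. A nontrivial radical element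
has `η = -1`, so `t = 1`. -/
theorem Frame.deg_eq_of_same (h2 : (2 : F) ≠ 0) (h : IsGrading 𝒜) (hp : IsGradedPrime 𝒜)
    (hφ : IsGradedSuperinv 𝒜 φ) (S : StdData P 𝒟 φ₀) (f f' : Frame 𝒜 φ 𝒟 φ₀)
    (he : f.ι 1 = f'.ι 1) : f.deg = f'.deg := by
  obtain ⟨t, ht, ht1, ht2⟩ := Frame.eta_eq h2 h hp hφ S f S f' he
  have h1 : t = 1 := by
    by_contra hne
    have := S.eta_f t hne fun s => by
      have := ht2 s s rfl
      exact mul_eq_right.1 this.symm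
    rw [ht1] at this
    exact absurd this (by decide)
  rw [h1] at ht
  have := congrArg Prod.fst ht
  exact (mul_inv_eq_one.1 this.symm).symm

/-- An odd triple contains an odd element, so a corner contains even elements. -/
theorem Frame.exists_even (h : IsGrading 𝒜) (hp : IsGradedPrime 𝒜) (S : StdData P 𝒟 φ₀)
    (f : Frame 𝒜 φ 𝒟 φ₀) {ε : R} (he : IsDivIdem 𝒜 ε) :
    ∃ s : G, ∃ a ∈ 𝒜 (s, 1), ∃ a' ∈ 𝒜 (s, 1)⁻¹, a * a' = ε ∧ a' * a = f.ι 1 ∧ ε * a = a ∧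
      a * f.ι 1 = a ∧ f.ι 1 * a' = a' ∧ a' * ε = a' := by
  have hf := f.isDivIdem h S
  obtain ⟨⟨g, i⟩, a, ha, h1, h3, h0⟩ := hp.exists_corner h he hf
  suffices ∃ s : G, ∃ a ∈ 𝒜 (s, 1), ε * a = a ∧ a * f.ι 1 = a ∧ a ≠ 0 by
    obtain ⟨s, a, ha, h1, h3, h0⟩ := this
    obtain ⟨a', ha', h4, h5, h6, h7⟩ := he.exists_inv h hp hf ha h1 h3 h0
    exact ⟨s, a, ha, a', ha', h6, h7, h1, h3, h4, h5⟩
  by_cases hi : i = 1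
  · exact ⟨g, a, hi ▸ ha, h1, h3, h0⟩
  -- An odd link between the idempotents is made even by multiplying it with an odd unit of the
  -- corner.
  · obtain ⟨t, ht⟩ := P.odd
    refine ⟨g * (t : GSharp G).1, a * f.ι (S.Y t), h.mul_mem' ha (f.ι_mem _ _ (S.Y_mem t)) ?_,
      by rw [← mul_assoc, h1], by rw [mul_assoc, f.ι_one], ?_⟩
    · refine Prod.ext rfl ?_
      change Multiplicative.ofAdd (Multiplicative.toAdd i + par (t : GSharp G)) = 1
      rw [ht]
      have : Multiplicative.toAdd i ≠ 0 := hi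
      have h4 := (show ∀ k : ZMod 2, k ≠ 0 → k + 1 = 0 by decide) _ this
      rw [h4]; rfl
    · intro h4
      obtain ⟨z, -, hz, -⟩ := S.exists_inv t
      apply h0
      rw [← h3, ← hz, f.ι_mul, ← mul_assoc, h4, zero_mul]

/-- The type of a graded superalgebra with superinvolution is determined by any of its frames. -/
theorem Frame.triple_eq (h2 : (2 : F) ≠ 0) (h : IsGrading 𝒜) (hp : IsGradedPrime 𝒜)
    (hφ : IsGradedSuperinv 𝒜 φ) (S : StdData P 𝒟 φ₀) (f : Frame 𝒜 φ 𝒟 φ₀)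
    (S' : StdData P' 𝒟' φ₀') (f' : Frame 𝒜 φ 𝒟' φ₀') : P = P' := by
  obtain ⟨s, a, ha, a', ha', h1, h3, h4, h5, h6, h7⟩ :=
    f.exists_even h hp S (f'.isDivIdem h S')
  obtain ⟨f₁, hf₁, -⟩ := f.exists_transport h S hφ ha ha' h1 h3 h4 h5 h6 h7
  exact Frame.triple_eq_of_same h2 h hp hφ S f₁ S' f' hf₁

/-- After transport both frames sit at the same idempotent, where degrees agree. Right
multiplication by the linking element, of degree `s`, identifies the two left ideals with a shift by
`s`. -/
theorem Frame.invariants_eq (h2 : (2 : F) ≠ 0) (h : IsGrading 𝒜) (hp : IsGradedPrime 𝒜)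
    (hφ : IsGradedSuperinv 𝒜 φ) (S : StdData P 𝒟 φ₀) (f f' : Frame 𝒜 φ 𝒟 φ₀) :
    ∃ s : G, f'.deg = s ^ 2 * f.deg ∧ ∀ x : G, Module.finrank F (col 𝒜 (f'.ι 1) (x, 1)) =
      Module.finrank F (col 𝒜 (f.ι 1) (x * s, 1)) := by
  obtain ⟨s, a, ha, a', ha', h1, h3, h4, h5, h6, h7⟩ :=
    f.exists_even h hp S (f'.isDivIdem h S)
  obtain ⟨f₁, hf₁, hd⟩ := f.exists_transport h S hφ ha ha' h1 h3 h4 h5 h6 h7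
  refine ⟨s, by rw [← hd, Frame.deg_eq_of_same h2 h hp hφ S f₁ f' hf₁], fun x => ?_⟩
  have m1 : ∀ y : R, y ∈ col 𝒜 (f'.ι 1) (x, 1) → y * a ∈ col 𝒜 (f.ι 1) (x * s, 1) := fun y hy => by
    rw [mem_col] at hy ⊢
    exact ⟨h.mul_mem' hy.1 ha rfl, by rw [mul_assoc, h5]⟩
  have m2 : ∀ y : R, y ∈ col 𝒜 (f.ι 1) (x * s, 1) → y * a' ∈ col 𝒜 (f'.ι 1) (x, 1) := fun y hy => by
    rw [mem_col] at hy ⊢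
    exact ⟨h.mul_mem' hy.1 ha' (by simp), by rw [mul_assoc, h7]⟩
  refine LinearEquiv.finrank_eq (LinearEquiv.ofLinearMap
    ((LinearMap.mulRight F a).restrict m1) ((LinearMap.mulRight F a').restrict m2)
    (LinearMap.ext fun y => Subtype.ext ?_) (LinearMap.ext fun y => Subtype.ext ?_))
  · change (y : R) * a' * a = y
    rw [mul_assoc, h3, (mem_col.1 y.2).2]
  · change (y : R) * a * a' = y
    rw [mul_assoc, h1, (mem_col.1 y.2).2]

end Frame

/-! ### Matrix coordinates -/

section Coordinates

variable {F : Type*} [Field F] {R : Type*} [Ring R] [Algebra F R] {G : Type*} [CommGroup G]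
  {D : Type*} [Ring D] [Algebra F D] {I : Type*} [Fintype I] [DecidableEq I]

/-- A decomposition of `1` into idempotents equivalent to `ι 1`, with `ι : D ≅ ε R ε`, identifies
`R` with a matrix algebra over `D`. -/
theorem exists_matrix_coordinates (ι : D →ₗ[F] R) (ι_mul : ∀ x y, ι (x * y) = ι x * ι y)
    (ι_inj : Function.Injective ι) (ι_surj : ∀ r, ι 1 * r = r → r * ι 1 = r → ∃ d, ι d = r)
    (e e' : I → R) (he : ∀ i, e i * ι 1 = e i) (he' : ∀ i, ι 1 * e' i = e' i)
    (hdual : ∀ i j, e' i * e j = if i = j then ι 1 else 0) (hsum : ∑ i, e i * e' i = 1) :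
    ∃ θ : R ≃ₐ[F] Matrix I I D, ∀ r i j, ι (θ r i j) = e' i * r * e j := by
  have hs : ∀ r i j, ∃ d, ι d = e' i * r * e j := fun r i j =>
    ι_surj _ (by rw [← mul_assoc, ← mul_assoc, he']) (by rw [mul_assoc, he])
  choose m hm using hs
  -- Peirce decomposition: an element is recovered from its matrix entries.
  have hrec : ∀ r, r = ∑ i, ∑ j, e i * (e' i * r * e j) * e' j := fun r => by
    calc r = (∑ i, e i * e' i) * r * (∑ j, e j * e' j) := by rw [hsum, one_mul, mul_one]
      _ = _ := by
        simp only [Finset.sum_mul, Finset.mul_sum, mul_assoc]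
        exact Finset.sum_comm
  have hinj : ∀ r s, (∀ i j, e' i * r * e j = e' i * s * e j) → r = s := fun r s h => by
    rw [hrec r, hrec s]; simp only [h]
  let f : R →ₐ[F] Matrix I I D := AlgHom.ofLinearMap
    { toFun := fun r => Matrix.of (m r)
      map_add' := fun r s => by
        ext i j; apply ι_inj
        simp only [Matrix.of_apply, Matrix.add_apply, map_add, hm, mul_add, add_mul]
      map_smul' := fun c r => by
        ext i j; apply ι_inj
        simp only [Matrix.of_apply, Matrix.smul_apply, map_smul, hm, mul_smul_comm, smul_mul_assoc,
          RingHom.id_apply] }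
    (by
      ext i j; apply ι_inj
      change ι (m 1 i j) = _
      rw [hm, mul_one, hdual, Matrix.one_apply]
      split_ifs <;> simp)
    (fun r s => by
      ext i j; apply ι_inj
      change ι (m (r * s) i j) = ι (∑ k, m r i k * m s k j)
      simp only [map_sum, ι_mul, hm]
      calc e' i * (r * s) * e j = e' i * (r * (∑ k, e k * e' k) * s) * e j := by
            rw [hsum, mul_one]
        _ = _ := by simp only [Finset.sum_mul, Finset.mul_sum, mul_assoc])
  have hf : ∀ r i j, ι (f r i j) = e' i * r * e j := fun r i j => hm r i j
  refine ⟨AlgEquiv.ofBijective f ⟨fun r s hrs => hinj r s fun i j => ?_, fun M => ?_⟩, hf⟩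
  · rw [← hf, ← hf, hrs]
  · refine ⟨∑ i, ∑ j, e i * ι (M i j) * e' j, ?_⟩
    ext i j; apply ι_inj
    rw [hf]
    simp only [Finset.sum_mul, Finset.mul_sum]
    have : ∀ x y, e' i * (e x * ι (M x y) * e' y) * e j =
        if i = x then (if y = j then ι (M x y) else 0) else 0 := fun x y => by
      calc _ = (e' i * e x) * ι (M x y) * (e' y * e j) := by simp only [mul_assoc]
        _ = _ := by
          rw [hdual, hdual]
          split_ifs <;> simp [← ι_mul]
    simp [this]

variable {𝒜 : GSharp G → Submodule F R} {𝒟 : GSharp G → Submodule F D}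

theorem mem_iff_matGrading (h : IsGrading 𝒜) {ι : D →ₗ[F] R}
    (hι : ∀ γ d, ι d ∈ 𝒜 γ ↔ d ∈ 𝒟 γ) {e e' : I → R} {γ : I → GSharp G}
    (he : ∀ i, e i ∈ 𝒜 (γ i)) (he' : ∀ i, e' i ∈ 𝒜 (γ i)⁻¹) (hsum : ∑ i, e i * e' i = 1)
    {θ : R ≃ₐ[F] Matrix I I D} (hθ : ∀ r i j, ι (θ r i j) = e' i * r * e j) (g : GSharp G) (r : R) :
    r ∈ 𝒜 g ↔ θ r ∈ matGrading 𝒟 γ g := by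
  constructor
  · intro hr i j
    rw [← hι, hθ]
    exact h.mul_mem _ _ _ _ (h.mul_mem _ _ _ _ (he' i) hr) (he j)
  · intro hr
    have hrec : r = ∑ i, ∑ j, e i * ι (θ r i j) * e' j := by
      calc r = (∑ i, e i * e' i) * r * (∑ j, e j * e' j) := by rw [hsum, one_mul, mul_one]
        _ = _ := by
          simp only [Finset.sum_mul, Finset.mul_sum, mul_assoc, hθ]
          exact Finset.sum_comm
    rw [hrec]
    refine Submodule.sum_mem _ fun i _ => Submodule.sum_mem _ fun j _ => ?_
    refine h.mul_mem' (h.mul_mem _ _ _ _ (he i) ((hι _ _).2 (hr i j))) (he' j) ?_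
    group

variable {φ : R →ₗ[F] R} {φ₀ : D →ₗ[F] D} {P : OddTriple G}

/-- In the coordinates given by an even basis of `R ε`, the superinvolution is expressed through
the Gram matrix of that basis. -/
theorem Frame.gram_isUnit_and_phi (h : IsGrading 𝒜) (hp : IsGradedPrime 𝒜)
    (hφ : IsGradedSuperinv 𝒜 φ) (S : StdData P 𝒟 φ₀)
    (f : Frame 𝒜 φ 𝒟 φ₀) {e e' : I → R} {γ : I → G}
    (he : ∀ i, e i ∈ 𝒜 (γ i, 1)) (he' : ∀ i, e' i ∈ 𝒜 ((γ i)⁻¹, 1))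
    (hel : ∀ i, e i * f.ι 1 = e i) (hel' : ∀ i, f.ι 1 * e' i = e' i)
    (hdual : ∀ i j, e' i * e j = if i = j then f.ι 1 else 0)
    (hsum : ∑ i, e i * e' i = 1)
    {θ : R ≃ₐ[F] Matrix I I D} (hθ : ∀ r i j, f.ι (θ r i j) = e' i * r * e j)
    {Φ : Matrix I I D} (hΦ : ∀ i j, f.ι (Φ i j) = f.b * φ (e i) * e j) :
    IsUnit Φ ∧ ∀ r, Φ * θ (φ r) = ((θ r).transpose.map φ₀) * Φ := by
  have hε := f.isDivIdem h S
  have hεm : f.ι 1 ∈ 𝒜 ((1 : G), 1) := f.ι_mem _ _ S.one_mem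
  constructor
  · obtain ⟨b', hb', h1, h2, h3, h4⟩ := hε.exists_inv h hp (hφ.isDivIdem h hε) f.b_mem f.b_left
      (f.b_right S) f.b_ne
    -- The inverse of the Gram matrix is the Gram matrix of the dual family, formed with the inverse
    -- `b'` of `b`.
    have hex : ∀ i j, ∃ d, f.ι d = e' i * φ (e' j) * b' := fun i j =>
      f.ι_surj _ (by rw [← mul_assoc, ← mul_assoc, hel']) (by rw [mul_assoc, h2])
    choose m hm using hex
    have hr : ∀ i, φ (e' i) * φ (f.ι 1) = φ (e' i) := fun i => by
      rw [← hφ.mul_even_left h hεm, hel']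
    refine isUnit_iff_exists.2 ⟨Matrix.of m, ?_, ?_⟩
    · ext i k
      apply f.ι_inj
      simp only [Matrix.mul_apply, Matrix.of_apply, map_sum, f.ι_mul, hm, hΦ]
      calc ∑ j, f.b * φ (e i) * e j * (e' j * φ (e' k) * b')
          = f.b * φ (e i) * (∑ j, e j * e' j) * φ (e' k) * b' := by
            simp only [Finset.sum_mul, Finset.mul_sum, mul_assoc]
        _ = f.b * φ (e' k * e i) * b' := by
            rw [hsum, mul_one, hφ.mul_even_left h (he' k), mul_assoc f.b]
        _ = _ := by
            rw [hdual, Matrix.one_apply]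
            by_cases hik : i = k
            · rw [if_pos hik, if_pos hik.symm, f.b_right S, h3]
            · rw [if_neg hik, if_neg (Ne.symm hik)]; simp
    · ext i k
      apply f.ι_inj
      simp only [Matrix.mul_apply, Matrix.of_apply, map_sum, f.ι_mul, hm, hΦ]
      calc ∑ j, e' i * φ (e' j) * b' * (f.b * φ (e j) * e k)
          = ∑ j, e' i * ((φ (e' j) * (b' * f.b)) * φ (e j)) * e k := by
            simp only [mul_assoc]
        _ = e' i * φ (∑ j, e j * e' j) * e k := by
            simp only [h4, hr, map_sum, hφ.mul_even_left h (he _), Finset.sum_mul, Finset.mul_sum]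
        _ = _ := by
            rw [hsum, hφ.map_one h, mul_one, hdual, Matrix.one_apply]
            split_ifs <;> simp
  · intro r
    ext j k
    apply f.ι_inj
    simp only [Matrix.mul_apply, Matrix.transpose_apply, Matrix.map_apply, map_sum, f.ι_mul, hΦ, hθ]
    have h5 : r * e j = ∑ i, e i * f.ι (θ r i j) := by
      calc r * e j = (∑ i, e i * e' i) * r * e j := by rw [hsum, one_mul]
        _ = _ := by simp only [Finset.sum_mul, mul_assoc, hθ]
    -- With `B(v,w) = bφ(v)w` this is the adjunction `B(v, φ(r)w) = B(rv, w)`, written in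
    -- coordinates.
    calc ∑ i, f.b * φ (e j) * e i * (e' i * φ r * e k)
        = f.b * φ (e j) * (∑ i, e i * e' i) * φ r * e k := by
            simp only [Finset.sum_mul, Finset.mul_sum, mul_assoc]
      _ = f.b * φ (r * e j) * e k := by
            rw [hsum, mul_one, hφ.mul_even_right h (he j), mul_assoc f.b]
      _ = ∑ i, f.ι (φ₀ (θ r i j)) * (f.b * φ (e i) * e k) := by
            rw [h5, map_sum, Finset.mul_sum, Finset.sum_mul]
            refine Finset.sum_congr rfl fun i _ => ?_
            rw [hφ.mul_even_left h (he i), ← mul_assoc, f.b_phi]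
            simp only [mul_assoc]

end Coordinates

/-! ### Bilinear forms -/

section Bilinear

variable {F : Type*} [Field F] {W : Type*} [AddCommGroup W] [Module F W]

theorem exists_functional {x : W} (hx : x ≠ 0) : ∃ l : W →ₗ[F] F, l x = 1 := by
  obtain ⟨l, hl⟩ := Module.Projective.exists_dual_ne_zero F hx
  exact ⟨(l x)⁻¹ • l, by simp [hl]⟩

theorem linearIndependent_of_pairing {V : Type*} [AddCommGroup V] [Module F V] {J : Type*}
    [DecidableEq J] (B : V →ₗ[F] W →ₗ[F] F) (e : J → W) (e' : J → V) (c : J → F)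
    (hc : ∀ j, c j ≠ 0) (h : ∀ i j, B (e' i) (e j) = if i = j then c i else 0) :
    LinearIndependent F e := by
  rw [linearIndependent_iff']
  intro s g hg i hi
  have := congrArg (B (e' i)) hg
  rw [map_sum, map_zero] at this
  simp only [map_smul, h, smul_eq_mul, mul_ite, mul_zero, Finset.sum_ite_eq, if_pos hi] at this
  exact (mul_eq_zero.1 this).resolve_right (hc i)

/-- An orthogonal basis is rescaled by inverse square roots, which exist because the field is
algebraically closed. -/
theorem exists_orthonormal_family [IsAlgClosed F] [FiniteDimensional F W] (h2 : (2 : F) ≠ 0)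
    (B : W →ₗ[F] W →ₗ[F] F) (hB : ∀ v w, B v w = B w v) (hnd : ∀ v, (∀ w, B v w = 0) → v = 0)
    {n : ℕ} (hn : Module.finrank F W = n) :
    ∃ e : Fin n → W, ∀ i j, B (e i) (e j) = if i = j then 1 else 0 := by
  subst hn
  have : Invertible (2 : F) := invertibleOfNonzero h2
  obtain ⟨v, hv⟩ := LinearMap.BilinForm.exists_orthogonal_basis (B := B) ⟨fun x y => hB x y⟩
  have hne : ∀ i, B (v i) (v i) ≠ 0 := fun i h0 => by
    refine v.ne_zero i (hnd _ fun w => ?_)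
    have : B (v i) = 0 := v.ext fun j => by
      by_cases hij : i = j
      · rw [← hij, h0]; rfl
      · exact hv hij
    rw [this]; rfl
  have hs : ∀ i, ∃ z : F, z * z = B (v i) (v i) := fun i => by
    obtain ⟨z, hz⟩ := IsAlgClosed.exists_pow_nat_eq (B (v i) (v i)) (n := 2) (by norm_num)
    exact ⟨z, by rw [← hz, sq]⟩
  choose z hz using hs
  have hz0 : ∀ i, z i ≠ 0 := fun i h0 => hne i (by rw [← hz, h0, zero_mul])
  refine ⟨fun i => (z i)⁻¹ • v i, fun i j => ?_⟩
  simp only [map_smul, LinearMap.smul_apply, smul_eq_mul]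
  split_ifs with hij
  · subst hij
    rw [← hz]
    field_simp [hz0 i]
  · have : B (v i) (v j) = 0 := hv hij
    rw [this, mul_zero, mul_zero]

/-- Families of mutually orthogonal hyperbolic pairs are independent, and can be enlarged as long as
they do not fill the space. Listing the `p`'s before the `q`'s gives the block form of `Φ`. -/
theorem exists_symplectic_family [FiniteDimensional F W]
    (B : W →ₗ[F] W →ₗ[F] F) (hB : ∀ v, B v v = 0) (hnd : ∀ v, (∀ w, B v w = 0) → v = 0)
    {n : ℕ} (hn : Module.finrank F W = n) :
    Even n ∧ ∃ e : Fin n → W, ∀ i j, B (e i) (e j) =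
      if (j : ℕ) = i + n / 2 then 1 else if (i : ℕ) = j + n / 2 then -1 else 0 := by
  have hskew : ∀ v w, B v w = - B w v := fun v w => by
    have := hB (v + w)
    simp only [map_add, LinearMap.add_apply, hB, zero_add, add_zero] at this
    linear_combination this
  let Hyp : ℕ → Prop := fun m => ∃ p q : Fin m → W, (∀ i j, B (p i) (p j) = 0) ∧
    (∀ i j, B (q i) (q j) = 0) ∧ ∀ i j, B (p i) (q j) = if i = j then 1 else 0
  have hli : ∀ m (p q : Fin m → W), (∀ i j, B (p i) (p j) = 0) →
      (∀ i j, B (q i) (q j) = 0) → (∀ i j, B (p i) (q j) = if i = j then 1 else 0) →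
      LinearIndependent F (Sum.elim p q) := by
    intro m p q hp hq hpq
    refine linearIndependent_of_pairing B _ (Sum.elim q p) (Sum.elim (fun _ => -1) (fun _ => 1))
      ?_ ?_
    · rintro (i | i) <;> simp
    · rintro (i | i) (j | j)
      · simp only [Sum.elim_inl, hskew (q i), hpq, Sum.inl.injEq, eq_comm]
        split_ifs <;> simp
      · simp [hq]
      · simp [hp]
      · simp [hpq]
  have hle : ∀ m, Hyp m → 2 * m ≤ n := fun m ⟨p, q, hp, hq, hpq⟩ => by
    have := (hli m p q hp hq hpq).fintype_card_le_finrank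
    simp only [Fintype.card_sum, Fintype.card_fin] at this
    omega
  have hstep : ∀ m, Hyp m → 2 * m < n → Hyp (m + 1) := by
    rintro m ⟨p, q, hp, hq, hpq⟩ hlt
    -- The projection onto the orthogonal complement of the pairs found so far.
    let π : W →ₗ[F] W := LinearMap.id - ∑ i, (B.flip (q i)).smulRight (p i)
      + ∑ i, (B.flip (p i)).smulRight (q i)
    have hπ : ∀ x, π x = x - ∑ i, B x (q i) • p i + ∑ i, B x (p i) • q i := fun x => by
      simp [π, LinearMap.sum_apply]
    have hπp : ∀ x i, B (π x) (p i) = 0 := fun x i => by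
      rw [hπ]
      simp [LinearMap.sum_apply, hp, hskew (q _) (p i), hpq]
    have hπq : ∀ x i, B (π x) (q i) = 0 := fun x i => by
      rw [hπ]
      simp [LinearMap.sum_apply, hq, hpq]
    have hπ2 : ∀ x y, B (π x) (π y) = B (π x) y := fun x y => by
      rw [hπ y]
      simp [map_sum, hπp, hπq]
    -- If the projection vanished, the `2m` vectors would span a space of dimension `n > 2m`.
    obtain ⟨x, hx⟩ : ∃ x, π x ≠ 0 := by
      by_contra! hall
      have hspan : Submodule.span F (Set.range (Sum.elim p q)) = ⊤ := by
        rw [eq_top_iff]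
        intro x _
        have : x = ∑ i, B x (q i) • p i - ∑ i, B x (p i) • q i := by
          have := hall x
          rw [hπ] at this
          rw [← sub_eq_zero, ← this]; abel
        rw [this]
        refine Submodule.sub_mem _ (Submodule.sum_mem _ fun i _ => ?_)
          (Submodule.sum_mem _ fun i _ => ?_)
        · exact Submodule.smul_mem _ _ (Submodule.subset_span ⟨Sum.inl i, rfl⟩)
        · exact Submodule.smul_mem _ _ (Submodule.subset_span ⟨Sum.inr i, rfl⟩)
      have h3 := finrank_range_le_card (R := F) (Sum.elim p q)
      rw [Set.finrank, hspan, finrank_top, hn] at h3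
      simp only [Fintype.card_sum, Fintype.card_fin] at h3
      omega
    obtain ⟨y, hy⟩ : ∃ y, B (π x) y ≠ 0 := by
      by_contra! hall
      exact hx (hnd _ hall)
    refine ⟨Fin.cons (π x) p, Fin.cons ((B (π x) y)⁻¹ • π y) q, ?_, ?_, ?_⟩
    · intro i j
      refine Fin.cases ?_ (fun i => ?_) i <;> refine Fin.cases ?_ (fun j => ?_) j
      · simp [hB]
      · simp [hπp]
      · simp [hskew (p i), hπp]
      · simp [hp]
    · intro i j
      refine Fin.cases ?_ (fun i => ?_) i <;> refine Fin.cases ?_ (fun j => ?_) j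
      · simp [hB]
      · simp [hπq]
      · simp [hskew (q i), hπq]
      · simp [hq]
    · intro i j
      refine Fin.cases ?_ (fun i => ?_) i <;> refine Fin.cases ?_ (fun j => ?_) j
      · simp [hπ2, hy]
      · simp [hπq, Fin.succ_ne_zero, eq_comm]
      · simp [hskew (p i), hπp, Fin.succ_ne_zero]
      · simp [hpq]
  have hex : ∃ m, Hyp m ∧ 2 * m = n := by
    have key : ∀ m, 2 * m ≤ n + 1 → (∃ k, Hyp k ∧ 2 * k = n) ∨ Hyp m := by
      intro m
      induction m with
      | zero => exact fun _ => Or.inr ⟨Fin.elim0, Fin.elim0, fun i => i.elim0, fun i => i.elim0,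
          fun i => i.elim0⟩
      | succ m ih =>
        intro hm
        rcases ih (by omega) with h | h
        · exact Or.inl h
        · by_cases h3 : 2 * m < n
          · exact Or.inr (hstep m h h3)
          · exact Or.inl ⟨m, h, by have := hle m h; omega⟩
    -- Rounding up, `(n + 1) / 2` pairs contain at least `n` vectors; independence allows at most
    -- `n`, so equality holds and `n` is even.
    rcases key ((n + 1) / 2) (by omega) with h | h
    · exact h
    · exact ⟨_, h, by have := hle _ h; omega⟩
  obtain ⟨m, ⟨p, q, hp, hq, hpq⟩, rfl⟩ := hex
  refine ⟨even_two_mul m, fun i => if h : (i : ℕ) < m then p ⟨i, h⟩ else q ⟨i - m, by omega⟩, ?_⟩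
  intro i j
  have hm : 2 * m / 2 = m := by omega
  rw [hm]
  beta_reduce
  have hi := i.2
  have hj := j.2
  by_cases h1 : (i : ℕ) < m <;> by_cases h3 : (j : ℕ) < m
  · rw [dif_pos h1, dif_pos h3, hp, if_neg (by omega), if_neg (by omega)]
  · rw [dif_pos h1, dif_neg h3, hpq]
    simp only [Fin.mk.injEq]
    by_cases h4 : (j : ℕ) = i + m
    · rw [if_pos h4, if_pos (by omega)]
    · rw [if_neg h4, if_neg (by omega), if_neg (by omega)]
  · rw [dif_neg h1, dif_pos h3, hskew, hpq]
    simp only [Fin.mk.injEq]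
    by_cases h4 : (i : ℕ) = j + m
    · rw [if_pos (by omega), if_neg (by omega), if_pos h4]
    · rw [if_neg (by omega), if_neg (by omega), if_neg h4, neg_zero]
  · rw [dif_neg h1, dif_neg h3, hq, if_neg (by omega), if_neg (by omega)]

/-- A pairing nondegenerate on both sides embeds each space in the dual of the other, so the
dimensions agree and both embeddings are bijective. -/
theorem exists_dual_family_of_pairing {V : Type*} [AddCommGroup V] [Module F V]
    [FiniteDimensional F V] [FiniteDimensional F W] (B : V →ₗ[F] W →ₗ[F] F)
    (hl : ∀ v, (∀ w, B v w = 0) → v = 0) (hr : ∀ w, (∀ v, B v w = 0) → w = 0) :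
    Module.finrank F V = Module.finrank F W ∧
      ∀ (n : ℕ) (u : Fin n → V), LinearIndependent F u → Module.finrank F V = n →
        ∃ e : Fin n → W, ∀ i j, B (u i) (e j) = if i = j then 1 else 0 := by
  have h1 : Function.Injective B := (injective_iff_map_eq_zero B).2 fun v hv =>
    hl v fun w => by rw [hv]; rfl
  have h2 : Function.Injective B.flip := (injective_iff_map_eq_zero B.flip).2 fun w hw =>
    hr w fun v => LinearMap.congr_fun hw v
  have h3 : Module.finrank F V = Module.finrank F W := by
    apply le_antisymm
    · exact (LinearMap.finrank_le_finrank_of_injective h1).trans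
        (Subspace.dual_finrank_eq (K := F) (V := W)).le
    · exact (LinearMap.finrank_le_finrank_of_injective h2).trans
        (Subspace.dual_finrank_eq (K := F) (V := V)).le
  refine ⟨h3, fun n u hu hn => ?_⟩
  have hsurj : Function.Surjective B.flip :=
    (LinearMap.injective_iff_surjective_of_finrank_eq_finrank
      (h3.symm.trans (Subspace.dual_finrank_eq (K := F) (V := V)).symm)).1 h2
  let bs := basisOfLinearIndependentOfCardEqFinrank' u hu (by simp [hn])
  choose e he using fun j => hsurj (bs.coord j)
  refine ⟨e, fun i j => ?_⟩
  have h4 : B (u i) (e j) = bs.coord j (u i) := LinearMap.congr_fun (he j) (u i)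
  have h5 : bs i = u i := by simp [bs]
  rw [h4, ← h5, Module.Basis.coord_apply, Module.Basis.repr_self, Finsupp.single_apply]

/-- Normal forms for a family of subspaces in duality. -/
theorem exists_gram_families [IsAlgClosed F] [FiniteDimensional F W] (h2 : (2 : F) ≠ 0)
    {X : Type*} (lt : X → X → Prop) (lt_tri : ∀ x y, lt x y ∨ x = y ∨ lt y x)
    (lt_asymm : ∀ x y, lt x y → ¬ lt y x)
    (V : X → Submodule F W) (n : X → ℕ) (hn : ∀ x, Module.finrank F (V x) = n x)
    (B : X → X → W →ₗ[F] W →ₗ[F] F) (rel : X → X → Prop) (s : X → X → ℤˣ)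
    (rel_symm : ∀ x y, rel x y → rel y x) (rel_unique : ∀ x y y', rel x y → rel x y' → y = y')
    (hnd : ∀ x y, rel x y → ∀ v ∈ V x, (∀ w ∈ V y, B x y v w = 0) → v = 0)
    (hs : ∀ x y, rel x y → ∀ v ∈ V x, ∀ w ∈ V y, B y x w v = ((s x y : ℤ) : F) * B x y v w) :
    (∀ x y, rel x y → n x = n y) ∧ (∀ x, rel x x → s x x = -1 → Even (n x)) ∧
    ∃ e : ∀ x, Fin (n x) → W, (∀ x i, e x i ∈ V x) ∧ (∀ x, LinearIndependent F (e x)) ∧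
      (∀ x, rel x x → s x x = 1 → ∀ i j, B x x (e x i) (e x j) = if i = j then 1 else 0) ∧
      (∀ x, rel x x → s x x = -1 → ∀ i j, B x x (e x i) (e x j) =
        if (j : ℕ) = i + n x / 2 then 1 else if (i : ℕ) = j + n x / 2 then -1 else 0) ∧
      (∀ x y, rel x y → lt x y → ∀ i j, B x y (e x i) (e y j) =
        if (i : ℕ) = j then 1 else 0) := by
  let B' : ∀ x y, V x →ₗ[F] V y →ₗ[F] F := fun x y => (B x y).domRestrict₁₂ (V x) (V y)
  have hB' : ∀ x y v w, B' x y v w = B x y v w := fun x y v w => rfl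
  have hs0 : ∀ u : ℤˣ, ((u : ℤ) : F) ≠ 0 := fun u => by
    rcases Int.units_eq_one_or u with rfl | rfl <;> simp
  have hl : ∀ x y, rel x y → ∀ v : V x, (∀ w, B' x y v w = 0) → v = 0 := fun x y hxy v hv =>
    Subtype.ext (hnd x y hxy v v.2 fun w hw => hv ⟨w, hw⟩)
  have hr : ∀ x y, rel x y → ∀ w : V y, (∀ v, B' x y v w = 0) → w = 0 := fun x y hxy w hw =>
    Subtype.ext (hnd y x (rel_symm _ _ hxy) w w.2 fun v hv => by
      rw [hs x y hxy v hv w w.2]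
      exact mul_eq_zero_of_right _ (hw ⟨v, hv⟩))
  have hdim : ∀ x y, rel x y → n x = n y := fun x y hxy => by
    rw [← hn, ← hn]
    exact (exists_dual_family_of_pairing (B' x y) (hl x y hxy) (hr x y hxy)).1
  have halt : ∀ x, rel x x → s x x = -1 → ∀ v, B' x x v v = 0 := fun x hx h v => by
    have h3 := hs x x hx v v.2 v v.2
    rw [h] at h3
    have h4 : (2 : F) * B x x v v = 0 := by push_cast at h3; linear_combination h3
    exact (mul_eq_zero.1 h4).resolve_left h2
  refine ⟨hdim, fun x hx h =>
    (exists_symplectic_family (B' x x) (halt x hx h) (hl x x hx) (hn x)).1, ?_⟩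
  have hu : ∀ x, ∃ u : Fin (n x) → V x, LinearIndependent F u := fun x =>
    ⟨_, (Module.finBasisOfFinrankEq F (V x) (hn x)).linearIndependent⟩
  choose u hu using hu
  -- A space paired with itself receives a normal form. Of two distinct paired spaces, the one that
  -- comes first keeps its arbitrary basis `u` and the other receives the dual basis; uniqueness of
  -- the partner prevents conflicts.
  have key : ∀ x, ∃ e : Fin (n x) → V x, LinearIndependent F e ∧
      (rel x x → s x x = 1 → ∀ i j, B' x x (e i) (e j) = if i = j then 1 else 0) ∧
      (rel x x → s x x = -1 → ∀ i j, B' x x (e i) (e j) =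
        if (j : ℕ) = i + n x / 2 then 1 else if (i : ℕ) = j + n x / 2 then -1 else 0) ∧
      (∀ y, rel x y → lt x y → e = u x) ∧
      (∀ y, rel x y → lt y x → ∀ i j, B' y x (u y i) (e j) = if (i : ℕ) = j then 1 else 0) := by
    intro x
    by_cases hex : ∃ y, rel x y
    · obtain ⟨y, hy⟩ := hex
      rcases lt_tri x y with hlt | rfl | hlt
      · have hne : ¬ rel x x := fun h => by
          rw [rel_unique x _ _ h hy] at hlt
          exact lt_asymm _ _ hlt hlt
        refine ⟨u x, hu x, fun h => absurd h hne, fun h => absurd h hne, fun _ _ _ => rfl,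
          fun y' hy' hlt' => ?_⟩
        rw [rel_unique x _ _ hy' hy] at hlt'
        exact absurd hlt' (lt_asymm _ _ hlt)
      · have hirr : ¬ lt x x := fun h => lt_asymm _ _ h h
        have hno : ∀ y, rel x y → ¬ lt x y ∧ ¬ lt y x := fun y h => by
          rw [← rel_unique x _ _ hy h]
          exact ⟨hirr, hirr⟩
        rcases Int.units_eq_one_or (s x x) with h1 | h1
        · obtain ⟨e, he⟩ := exists_orthonormal_family h2 (B' x x) (fun v w => by
            have := hs x x hy v v.2 w w.2
            rw [h1] at this
            simpa [hB'] using this.symm) (hl x x hy) (hn x)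
          refine ⟨e, linearIndependent_of_pairing (B' x x) e e (fun _ => 1)
            (fun _ => one_ne_zero) he, fun _ _ => he, fun _ h => ?_,
            fun y h h' => absurd h' (hno y h).1, fun y h h' => absurd h' (hno y h).2⟩
          rw [h1] at h
          exact absurd h (by decide)
        · obtain ⟨hev, e, he⟩ := exists_symplectic_family (B' x x) (halt x hy h1) (hl x x hy) (hn x)
          have hli : LinearIndependent F e := by
            obtain ⟨m, hm⟩ := hev
            have hm2 : n x / 2 = m := by omega
            -- A symplectic basis is dual to itself after exchanging its halves, with the sign `-1`
            -- on the first half.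
            refine linearIndependent_of_pairing (B' x x) e (fun i => if h : (i : ℕ) < m then
              e ⟨i + m, by omega⟩ else e ⟨i - m, by omega⟩)
              (fun i => if (i : ℕ) < m then -1 else 1) (fun i => by split_ifs <;> simp) ?_
            intro i j
            have hi := i.2
            have hj := j.2
            by_cases h3 : (i : ℕ) < m
            · rw [dif_pos h3, if_pos h3, he, hm2, if_neg (by simp only; omega)]
              by_cases h4 : i = j
              · rw [if_pos h4, if_pos (by subst h4; rfl)]
              · rw [if_neg h4, if_neg (by simp only [Fin.ext_iff] at h4 ⊢; omega)]
            · rw [dif_neg h3, if_neg h3, he, hm2]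
              by_cases h4 : i = j
              · rw [if_pos h4, if_pos (by subst h4; simp only; omega)]
              · rw [if_neg h4, if_neg (by simp only [Fin.ext_iff] at h4 ⊢; omega),
                  if_neg (by simp only; omega)]
          refine ⟨e, hli, fun _ h => ?_, fun _ _ => he,
            fun y h h' => absurd h' (hno y h).1, fun y h h' => absurd h' (hno y h).2⟩
          rw [h1] at h
          exact absurd h (by decide)
      · have hne : ¬ rel x x := fun h => by
          rw [rel_unique x _ _ h hy] at hlt
          exact lt_asymm _ _ hlt hlt
        have hyx := rel_symm _ _ hy
        obtain ⟨e, he⟩ := (exists_dual_family_of_pairing (B' y x) (hl y x hyx) (hr y x hyx)).2 _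
          (u y) (hu y) (hn y)
        have hxy := hdim x y hy
        refine ⟨fun i => e (Fin.cast hxy i), ?_, fun h => absurd h hne, fun h => absurd h hne,
          fun y' hy' hlt' => ?_, fun y' hy' _ => ?_⟩
        · refine linearIndependent_of_pairing (B' y x) _ (fun i => u y (Fin.cast hxy i))
            (fun _ => 1) (fun _ => one_ne_zero) fun i j => ?_
          simp [he]
        · rw [rel_unique x _ _ hy' hy] at hlt'
          exact absurd hlt' (lt_asymm _ _ hlt)
        · obtain rfl := rel_unique x _ _ hy' hy
          intro i j
          rw [he]
          simp [Fin.ext_iff]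
    · refine ⟨u x, hu x, fun h => absurd ⟨x, h⟩ hex, fun h => absurd ⟨x, h⟩ hex,
        fun y h => absurd ⟨y, h⟩ hex, fun y h => absurd ⟨y, h⟩ hex⟩
  choose e he1 he2 he3 he4 he5 using key
  refine ⟨fun x i => e x i, fun x i => (e x i).2, fun x => ?_, fun x hx h i j => he2 x hx h i j,
    fun x hx h i j => he3 x hx h i j, fun x y hxy hlt i j => ?_⟩
  · exact (he1 x).map' (V x).subtype (Submodule.ker_subtype _)
  · have := he5 y x (rel_symm _ _ hxy) hlt i j
    rwa [← he4 x y hxy hlt] at this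

end Bilinear

/-! ### Homogeneous bases of `R ε` and their dual families -/

section DualFamilies

variable {F : Type*} [Field F] {R : Type*} [Ring R] [Algebra F R] {G : Type*} [CommGroup G]
  {𝒜 : GSharp G → Submodule F R} {ε : R}

/-- The product of `εR` in degree `γ⁻¹` with `Rε` in degree `γ` lands in the line `F ε`, so it is a
scalar pairing. It is nondegenerate by the one-sided inverses of `exists_left` and `exists_right`.
-/
theorem exists_dual_family [FiniteDimensional F R] (h : IsGrading 𝒜) (hp : IsGradedPrime 𝒜)
    (he : IsDivIdem 𝒜 ε) {γ : GSharp G} {n : ℕ} (hn : Module.finrank F (col 𝒜 ε γ) = n)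
    (e : Fin n → R) (hm : ∀ i, e i ∈ col 𝒜 ε γ) (hli : LinearIndependent F e) :
    ∃ e' : Fin n → R, (∀ i, e' i ∈ 𝒜 γ⁻¹) ∧ (∀ i, ε * e' i = e' i) ∧
      ∀ i j, e' i * e j = if i = j then ε else 0 := by
  obtain ⟨l, hl⟩ := exists_functional (F := F) he.ne_zero
  let V : Submodule F R := 𝒜 γ⁻¹ ⊓ LinearMap.ker (LinearMap.mulLeft F ε - LinearMap.id)
  have hV : ∀ x, x ∈ V ↔ x ∈ 𝒜 γ⁻¹ ∧ ε * x = x := fun x => by simp [V, sub_eq_zero]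
  have hprod : ∀ w ∈ V, ∀ v ∈ col 𝒜 ε γ, w * v = l (w * v) • ε := fun w hw v hv => by
    rw [hV] at hw
    rw [mem_col] at hv
    obtain ⟨c, hc⟩ := he.scalar (w * v) (h.mul_mem' hw.1 hv.1 (inv_mul_cancel γ))
      (by rw [← mul_assoc, hw.2]) (by rw [mul_assoc, hv.2])
    rw [hc, map_smul, hl, smul_eq_mul, mul_one]
  let B : col 𝒜 ε γ →ₗ[F] V →ₗ[F] F :=
    (((LinearMap.mul F R).compr₂ l).flip).domRestrict₁₂ (col 𝒜 ε γ) V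
  have hB : ∀ v w, B v w = l ((w : R) * v) := fun _ _ => rfl
  obtain ⟨-, h3⟩ := exists_dual_family_of_pairing B
    (fun v hv => by
      by_contra h0
      have h0' : (v : R) ≠ 0 := fun h1 => h0 (Subtype.ext h1)
      obtain ⟨hv1, hv2⟩ := mem_col.1 v.2
      obtain ⟨w, hw, hw1, hw2⟩ := he.exists_left h hp hv1 hv2 h0'
      have := hv ⟨w, (hV w).2 ⟨hw, hw1⟩⟩
      rw [hB, hw2, hl] at this
      exact one_ne_zero this)
    (fun w hw => by
      by_contra h0
      have h0' : (w : R) ≠ 0 := fun h1 => h0 (Subtype.ext h1)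
      obtain ⟨hw1, hw2⟩ := (hV _).1 w.2
      obtain ⟨v, hv, hv1, hv2⟩ := he.exists_right h hp hw1 hw2 h0'
      have := hw ⟨v, mem_col.2 ⟨inv_inv γ ▸ hv, hv1⟩⟩
      rw [hB, hv2, hl] at this
      exact one_ne_zero this)
  obtain ⟨e', he'⟩ := h3 n (fun i => ⟨e i, hm i⟩)
    (LinearIndependent.of_comp (col 𝒜 ε γ).subtype hli) hn
  refine ⟨fun i => e' i, fun i => ((hV _).1 (e' i).2).1, fun i => ((hV _).1 (e' i).2).2,
    fun i j => ?_⟩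
  have := he' j i
  rw [hB] at this
  rw [hprod _ (e' i).2 _ (hm j), this]
  by_cases hij : i = j
  · rw [if_pos hij, if_pos hij.symm, one_smul]
  · rw [if_neg hij, if_neg (Ne.symm hij), zero_smul]

/-- Bases of sufficiently many components of `R ε` yield a complete system of matrix units. -/
theorem exists_complete_dual_family [FiniteDimensional F R] (h : IsGrading 𝒜)
    (hp : IsGradedPrime 𝒜) (he : IsDivIdem 𝒜 ε) {J : Type*} [Fintype J] [DecidableEq J]
    {n : J → ℕ} {ρ : J → GSharp G} (hn : ∀ j, Module.finrank F (col 𝒜 ε (ρ j)) = n j)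
    (e : ∀ j, Fin (n j) → R) (hm : ∀ j i, e j i ∈ col 𝒜 ε (ρ j))
    (hli : ∀ j, LinearIndependent F (e j))
    (hsep : ∀ j k, j ≠ k → ∀ d ∈ 𝒜 ((ρ j)⁻¹ * ρ k), ε * d = d → d * ε = d → d = 0)
    (hgen : ∀ γ, ∀ v ∈ col 𝒜 ε γ, v ≠ 0 →
      ∃ j, ∃ d ∈ 𝒜 ((ρ j)⁻¹ * γ), ε * d = d ∧ d * ε = d ∧ d ≠ 0) :
    ∃ e' : (Σ j, Fin (n j)) → R, (∀ i, e' i ∈ 𝒜 (ρ i.1)⁻¹) ∧ (∀ i, ε * e' i = e' i) ∧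
      (∀ i j, e' i * e j.1 j.2 = if i = j then ε else 0) ∧ ∑ i, e i.1 i.2 * e' i = 1 := by
  choose e' h1 h2 h3 using fun j => exists_dual_family h hp he (hn j) (e j) (hm j) (hli j)
  have hdual : ∀ i j : Σ j, Fin (n j), e' i.1 i.2 * e j.1 j.2 = if i = j then ε else 0 := by
    rintro ⟨j, i⟩ ⟨k, l⟩
    by_cases hjk : j = k
    · subst hjk
      simp only [h3, Sigma.mk.injEq, heq_eq_eq, true_and]
    · rw [if_neg (fun h => hjk (congrArg Sigma.fst h))]
      obtain ⟨h4, h5⟩ := mem_col.1 (hm k l)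
      exact hsep j k hjk _ (h.mul_mem _ _ _ _ (h1 j i) h4) (by rw [← mul_assoc, h2])
        (by rw [mul_assoc, h5])
  refine ⟨fun i => e' i.1 i.2, fun i => h1 _ _, fun i => h2 _ _, hdual, ?_⟩
  -- By faithfulness it suffices that the difference kills `Rε`. Any homogeneous vector there is
  -- moved by a unit of the corner into a chosen component, where the sum acts as the identity.
  rw [← sub_eq_zero]
  refine he.faithful h hp fun γ v hv hvε => ?_
  by_cases hv0 : v = 0
  · rw [hv0, mul_zero]
  obtain ⟨j, d, hd, hd1, hd2, hd0⟩ := hgen γ v (mem_col.2 ⟨hv, hvε⟩) hv0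
  obtain ⟨d', hd', h4, h5, h6, h7⟩ := he.inv _ d hd hd1 hd2 hd0
  have hw : v * d' ∈ col 𝒜 ε (ρ j) := mem_col.2 ⟨h.mul_mem' hv hd' (by group), by
    rw [mul_assoc, h5]⟩
  let bs := basisOfLinearIndependentOfCardEqFinrank' (fun i => (⟨e j i, hm j i⟩ : col 𝒜 ε (ρ j)))
    (LinearIndependent.of_comp (col 𝒜 ε (ρ j)).subtype (hli j)) (by simp [hn])
  have hbs : ∀ i, (bs i : R) = e j i := fun i => by simp [bs]
  have hsumw : v * d' = ∑ i, bs.repr ⟨_, hw⟩ i • e j i := by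
    have := congrArg Subtype.val (bs.sum_repr ⟨_, hw⟩)
    rw [Submodule.coe_sum] at this
    simp only [Submodule.coe_smul, hbs] at this
    exact this.symm
  have hkill : (∑ i : Σ j, Fin (n j), e i.1 i.2 * e' i.1 i.2 - 1) * (v * d') = 0 := by
    rw [hsumw, Finset.mul_sum]
    refine Finset.sum_eq_zero fun i _ => ?_
    rw [mul_smul_comm, sub_mul, one_mul, Finset.sum_mul,
      Finset.sum_eq_single (⟨j, i⟩ : Σ j, Fin (n j))]
    · rw [mul_assoc, hdual ⟨j, i⟩ ⟨j, i⟩, if_pos rfl, (mem_col.1 (hm j i)).2, sub_self, smul_zero]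
    · intro k _ hk
      rw [mul_assoc, hdual k ⟨j, i⟩, if_neg hk, mul_zero]
    · simp
  calc _ = (∑ i : Σ j, Fin (n j), e i.1 i.2 * e' i.1 i.2 - 1) * (v * d') * d := by
        simp only [mul_assoc]; rw [h7, hvε]
    _ = 0 := by rw [hkill, zero_mul]

end DualFamilies

/-! ### Presentation by the standard models -/

section Presentation

variable {F : Type*} [Field F] {R : Type*} [Ring R] [Algebra F R] {G : Type*} [CommGroup G]
  {D : Type*} [Ring D] [Algebra F D]
  {𝒜 : GSharp G → Submodule F R} {φ : R →ₗ[F] R} {𝒟 : GSharp G → Submodule F D}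
  {φ₀ : D →ₗ[F] D} {P : OddTriple G}

theorem mem_plus {T : Subgroup (GSharp G)} {g : G} : g ∈ plus T ↔ ((g, 1) : GSharp G) ∈ T :=
  Iff.rfl

theorem OddTriple.sq_eq_one (P : OddTriple G) {g : G} (hg : g ∈ plus P.T) : g ^ 2 = 1 := by
  obtain ⟨f, -, -, -, h, -⟩ := P.rad
  have := congrArg (fun t : P.T => (t : GSharp G).1) (h ⟨(g, 1), hg⟩ rfl)
  simpa using this

/-- Hermitian symmetry `φ₀(B(v,w)) = B(w,v)` of `B(v,w) = bφ(v)w` on even vectors; it rests on `φ(b)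
= b`. -/
theorem Frame.phi_gram (h : IsGrading 𝒜) (hp : IsGradedPrime 𝒜) (hφ : IsGradedSuperinv 𝒜 φ)
    (S : StdData P 𝒟 φ₀) (f : Frame 𝒜 φ 𝒟 φ₀) {x y : G} {v w : R} (hv : v ∈ 𝒜 (x, 1))
    (hvε : v * f.ι 1 = v) (hw : w ∈ 𝒜 (y, 1)) {d : D} (hd : f.ι d = f.b * φ v * w) :
    f.ι (φ₀ d) = f.b * φ w * v := by
  have hε := f.isDivIdem h S
  obtain ⟨b', -, -, -, h3, -⟩ := hε.exists_inv h hp (hφ.isDivIdem h hε) f.b_mem f.b_left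
    (f.b_right S) f.b_ne
  have h4 := f.b_phi d
  rw [hd, hφ.mul_even_right h hw, hφ.mul_even_right h (hφ.map_mem _ _ hv), hφ.invol,
    f.phi_b] at h4
  calc f.ι (φ₀ d) = f.ι (φ₀ d) * f.b * b' := by rw [mul_assoc, h3, f.ι_one]
    _ = f.b * φ w * (v * (f.b * b')) := by rw [← h4]; simp only [mul_assoc]
    _ = _ := by rw [h3, hvε]

/-- `G` is abelian, so a common shift of the degrees of the basis cancels in `γ_i (deg d) γ_j⁻¹`. -/
theorem matGrading_congr {I : Type*} {γ γ' : I → GSharp G} (s : GSharp G)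
    (hγ : ∀ i, γ' i = γ i * s) (g : GSharp G) : matGrading 𝒟 γ' g = matGrading 𝒟 γ g := by
  have : ∀ i j, (γ' i)⁻¹ * g * γ' j = (γ i)⁻¹ * g * γ j := fun i j => by
    rw [hγ, hγ]
    exact Additive.ofMul.injective (by simp only [ofMul_mul, ofMul_inv]; abel)
  ext X
  change (∀ i j, X i j ∈ _) ↔ (∀ i j, X i j ∈ _)
  simp only [this]

variable [IsAlgClosed F] [FiniteDimensional F R]

/-- The form `B(v,w) = bφ(v)w` pairs the class `x` with the class `y` only if `g₀xy = T⁺`, and there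
it takes values in the line `D_t`, `t = g₀ξ(x)ξ(y)`. It thus becomes a scalar form with symmetry
sign `η(t)`. Bases in normal form have Gram matrix exactly `Φ`, and admissibility of `κ` is the
condition that such forms are nondegenerate. The parameter `s` lets one frame produce every model in
the orbit of `(κ,g₀)`. -/
theorem Frame.isAdmissible_and_gradedIso (h2 : (2 : F) ≠ 0) (h : IsGrading 𝒜)
    (hp : IsGradedPrime 𝒜) (hφ : IsGradedSuperinv 𝒜 φ) (S : StdData P 𝒟 φ₀)
    (f : Frame 𝒜 φ 𝒟 φ₀) (c : BlockChoice P.T 𝒟) (κ : (G ⧸ plus P.T) →₀ ℕ) (g₀ s : G)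
    (hdeg : f.deg = g₀ * s ^ 2)
    (hκ : ∀ x : G, Module.finrank F (col 𝒜 (f.ι 1) (x, 1)) = κ ((x * s : G) : G ⧸ plus P.T)) :
    IsAdmissible P.T 𝒟 φ₀ κ g₀ ∧ GradedIso 𝒜 φ (EGrading c κ) (EInv φ₀ c κ g₀) := by
  have hε := f.isDivIdem h S
  have hεm : f.ι 1 ∈ 𝒜 ((1 : G), 1) := f.ι_mem _ _ S.one_mem
  obtain ⟨b', hb', hb1, hb2, hb3, hb4⟩ := hε.exists_inv h hp (hφ.isDivIdem h hε) f.b_mem f.b_left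
    (f.b_right S) f.b_ne
  have hquot : ∀ x : G ⧸ plus P.T, (c.ξ x : G ⧸ plus P.T) = x := c.ξ_section
  -- The shift by `s⁻¹` cancels the factor `s²` in `deg b`, so `B` takes values in degree exactly
  -- `g₀ξ(x)ξ(y)`.
  let V : G ⧸ plus P.T → Submodule F R := fun x => col 𝒜 (f.ι 1) (c.ξ x * s⁻¹, 1)
  have hVn : ∀ x, Module.finrank F (V x) = κ x := fun x => by
    rw [hκ, inv_mul_cancel_right, hquot]
  let rel : G ⧸ plus P.T → G ⧸ plus P.T → Prop := fun x y => g₀ * c.ξ x * c.ξ y ∈ plus P.T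
  have hrel : ∀ x y, rel x y ↔ (g₀ : G ⧸ plus P.T) * x * y = 1 := fun x y => by
    change _ ∈ _ ↔ _
    rw [← QuotientGroup.eq_one_iff, QuotientGroup.mk_mul, QuotientGroup.mk_mul, hquot, hquot]
  have hsymm : ∀ x y, rel x y → rel y x := fun x y hxy => by
    rw [hrel] at hxy ⊢
    rwa [mul_right_comm]
  have hprod : ∀ x y, ∀ v ∈ V x, ∀ w ∈ V y,
      ∃ d ∈ 𝒟 (g₀ * c.ξ x * c.ξ y, 1), f.ι d = f.b * φ v * w := by
    intro x y v hv w hw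
    obtain ⟨hv1, hv2⟩ := mem_col.1 hv
    obtain ⟨hw1, hw2⟩ := mem_col.1 hw
    obtain ⟨d, hd⟩ := f.ι_surj (f.b * φ v * w) (by rw [← mul_assoc, ← mul_assoc, f.b_left])
      (by rw [mul_assoc, hw2])
    refine ⟨d, f.mem_of_ι h S ?_, hd⟩
    rw [hd]
    refine h.mul_mem' (h.mul_mem _ _ _ _ f.b_mem (hφ.map_mem _ _ hv1)) hw1 ?_
    rw [hdeg, Prod.mk_mul_mk, Prod.mk_mul_mk, mul_one, mul_one]
    congr 1
    exact Additive.ofMul.injective (by simp only [ofMul_mul, ofMul_inv, ofMul_pow]; abel)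
  have hXt : ∀ t : P.T, ∃ k : F, k ≠ 0 ∧ c.X t = k • S.Y t := fun t => by
    obtain ⟨t', ht', k, hk, hX⟩ := S.exists_eq (c.X_mem t) (c.X_ne t)
    obtain rfl : t' = t := Subtype.ext ht'
    exact ⟨k, hk, hX⟩
  have hphiX : ∀ t, φ₀ (c.X t) = eta 𝒟 φ₀ (t : GSharp G) • c.X t := fun t => by
    obtain ⟨k, -, hX⟩ := hXt t
    rw [hX, map_smul, S.phi, S.eta_eq h2, smul_comm]
  have hιX : ∀ t, f.ι (c.X t) ≠ 0 := fun t => (map_ne_zero_iff _ f.ι_inj).2 (c.X_ne t)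
  -- The coefficient of `X_t` is extracted by a functional equal to `1` at `ι(X_t)`; for unrelated
  -- classes the zero form serves as a default.
  have hB : ∀ x y, ∃ B : R →ₗ[F] R →ₗ[F] F, ∀ hxy : rel x y, ∀ v ∈ V x, ∀ w ∈ V y,
      f.b * φ v * w = B v w • f.ι (c.X ⟨(g₀ * c.ξ x * c.ξ y, 1), hxy⟩) := by
    intro x y
    by_cases hxy : rel x y
    · obtain ⟨l, hl⟩ := exists_functional (F := F) (hιX ⟨(g₀ * c.ξ x * c.ξ y, 1), hxy⟩)
      refine ⟨((LinearMap.mul F R).compr₂ l) ∘ₗ (LinearMap.mulLeft F f.b) ∘ₗ φ,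
        fun _ v hv w hw => ?_⟩
      obtain ⟨d, hd, hd'⟩ := hprod x y v hv w hw
      obtain ⟨k, hk, hX⟩ := hXt ⟨(g₀ * c.ξ x * c.ξ y, 1), hxy⟩
      obtain ⟨a, ha⟩ := (S.mem_iff ⟨(g₀ * c.ξ x * c.ξ y, 1), hxy⟩ d).1 hd
      have hd2 : d = (a * k⁻¹) • c.X ⟨(g₀ * c.ξ x * c.ξ y, 1), hxy⟩ := by
        rw [ha, hX, smul_smul, mul_assoc (a := a), inv_mul_cancel₀ hk, mul_one (M := F)]
      change f.b * φ v * w = l (f.b * φ v * w) • _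
      rw [← hd', hd2, map_smul, map_smul, hl, smul_eq_mul, mul_one]
    · exact ⟨0, fun h => absurd h hxy⟩
  choose B hB using hB
  -- Hermitian symmetry over `D` becomes symmetry with the sign `η(t)`, because `φ₀` is `η(t)` on
  -- `D_t`.
  have hs : ∀ x y, rel x y → ∀ v ∈ V x, ∀ w ∈ V y, B y x w v =
      ((eta 𝒟 φ₀ (g₀ * c.ξ x * c.ξ y, 1) : ℤ) : F) * B x y v w := by
    intro x y hxy v hv w hw
    have hyx : rel y x := hsymm _ _ hxy
    obtain ⟨d, hd, hd'⟩ := hprod x y v hv w hw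
    have h4 := f.phi_gram h hp hφ S (mem_col.1 hv).1 (mem_col.1 hv).2 (mem_col.1 hw).1 hd'
    rw [hB y x hyx w hw v hv] at h4
    rw [hB x y hxy v hv w hw, ← map_smul] at hd'
    rw [f.ι_inj hd', map_smul, hphiX, map_smul, map_units_zsmul, smul_comm] at h4
    have h5 : c.X ⟨(g₀ * c.ξ y * c.ξ x, 1), hyx⟩ = c.X ⟨(g₀ * c.ξ x * c.ξ y, 1), hxy⟩ := by
      congr 2
      rw [mul_right_comm]
    rw [h5, Units.smul_def, ← Int.cast_smul_eq_zsmul F, smul_smul] at h4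
    exact (smul_left_injective F (hιX _) h4).symm
  obtain ⟨hdim, heven, e, he1, he2, he3, he4, he5⟩ := exists_gram_families h2 c.ord.lt
    (fun x y => @lt_trichotomy _ c.ord x y) (fun x y h => @lt_asymm _ c.ord.toPreorder x y h) V κ hVn B rel
    (fun x y => eta 𝒟 φ₀ (g₀ * c.ξ x * c.ξ y, 1))
    hsymm
    (fun x y y' h h' => by
      rw [hrel] at h h'
      exact mul_left_cancel (h.trans h'.symm))
    (by
      intro x y hxy v hv hall
      -- For `v ≠ 0` the element `bφ(v)` of `εR` has a right inverse `w`, and `wX_t` is a vector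
      -- that `v` does not annihilate.
      by_contra h0
      obtain ⟨hv1, hv2⟩ := mem_col.1 hv
      have hφv : φ (f.ι 1) * φ v = φ v := by rw [← hφ.mul_even_right h hεm, hv2]
      have hbv : f.b * φ v ≠ 0 := fun h3 => hφ.ne_zero h0 (by
        rw [← hφv, ← hb4, mul_assoc, h3, mul_zero])
      obtain ⟨w, hw, hw1, hw2⟩ := hε.exists_right h hp
        (h.mul_mem _ _ _ _ f.b_mem (hφ.map_mem _ _ hv1)) (by rw [← mul_assoc, f.b_left]) hbv
      have hwV : w * f.ι (c.X ⟨(g₀ * c.ξ x * c.ξ y, 1), hxy⟩) ∈ V y := by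
        refine mem_col.2 ⟨h.mul_mem' hw (f.ι_mem _ _ (c.X_mem _)) ?_, by
          rw [mul_assoc, f.ι_one]⟩
        refine Prod.ext ?_ (by simp)
        simp only [Prod.fst_mul, Prod.fst_inv, hdeg]
        exact Additive.ofMul.injective (by simp only [ofMul_mul, ofMul_inv, ofMul_pow]; abel)
      have h4 := hB x y hxy v hv _ hwV
      rw [hall _ hwV, zero_smul, ← mul_assoc, hw2, f.one_ι] at h4
      exact hιX _ h4)
    hs
  constructor
  · refine ⟨?_, fun x => ?_, fun g hg hη => ?_⟩
    -- `ε` itself is a nonzero vector of degree `e`, so some multiplicity is positive.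
    · rintro rfl
      have h3 := hκ 1
      rw [Finsupp.zero_apply, Module.finrank_eq_zero_iff_of_free] at h3
      have h4 : (⟨f.ι 1, mem_col.2 ⟨hεm, hε.idem⟩⟩ : col 𝒜 (f.ι 1) ((1 : G), 1)) = 0 :=
        Subsingleton.elim _ _
      exact hε.ne_zero (congrArg Subtype.val h4)
    · exact hdim x _ ((hrel _ _).2 (by rw [← mul_inv, mul_inv_cancel]))
    · have hxx : rel g g := by
        rw [hrel, ← QuotientGroup.mk_mul, ← QuotientGroup.mk_mul, QuotientGroup.eq_one_iff,
          mul_assoc, ← sq]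
        exact hg
      refine heven g hxx ?_
      have h3 : (c.ξ g)⁻¹ * g ∈ plus P.T := QuotientGroup.eq.1 (hquot g)
      -- Since `T⁺` is an elementary 2-group, `g²` does not depend on the representative of the
      -- coset.
      have h4 : g₀ * c.ξ g * c.ξ g = g₀ * g ^ 2 := by
        have := P.sq_eq_one h3
        rw [mul_pow, inv_pow, inv_mul_eq_one] at this
        rw [mul_assoc, ← sq, this]
      rw [h4, hη]
  · classical
    obtain ⟨e', h3, h4, h5, h6⟩ := exists_complete_dual_family h hp hε
      (J := κ.support) (n := fun x => κ x) (ρ := fun x => (c.ξ x * s⁻¹, 1)) (fun x => hVn x)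
      (fun x i => e x i) (fun x i => he1 x i) (fun x => he2 x)
      (by
        intro x y hxy d hd hd1 hd2
        by_contra h0
        obtain ⟨d, rfl⟩ := f.ι_surj d hd1 hd2
        have h7 := S.mem_T (f.mem_of_ι h S hd) (by rintro rfl; simp at h0)
        apply hxy
        have h8 : (c.ξ x)⁻¹ * c.ξ y ∈ plus P.T := by
          rw [mem_plus]
          convert h7 using 1
          simp only [Prod.inv_mk, Prod.mk_mul_mk, inv_one, mul_one, mul_inv_rev, inv_inv]
          congr 1
          rw [mul_comm s, mul_assoc, mul_left_comm s, mul_inv_cancel, mul_one]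
        have h9 := QuotientGroup.eq.2 h8
        rw [hquot, hquot] at h9
        exact Subtype.ext h9)
      (by
        rintro ⟨g, i⟩ v hv hv0
        obtain ⟨hv1, hv2⟩ := mem_col.1 hv
        -- A vector of either parity becomes even after multiplication by a unit of the corner, so
        -- even components suffice to generate `Rε`.
        obtain ⟨t, ht⟩ : ∃ t : P.T, (t : GSharp G).2 = i⁻¹ := by
          by_cases hi : i = 1
          · exact ⟨1, by rw [hi]; rfl⟩
          · obtain ⟨t, ht⟩ := P.odd
            refine ⟨t, ?_⟩
            have : Multiplicative.toAdd i ≠ 0 := hi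
            have h7 := (show ∀ k : ZMod 2, k ≠ 0 → k = 1 by decide) _ this
            change par (t : GSharp G) = - Multiplicative.toAdd i
            rw [ht, h7]; decide
        obtain ⟨z, hz, hz1, hz2⟩ := S.exists_inv t
        have h7 : v * f.ι (S.Y t) ∈ col 𝒜 (f.ι 1) (g * (t : GSharp G).1, 1) := by
          refine mem_col.2 ⟨h.mul_mem' hv1 (f.ι_mem _ _ (S.Y_mem t)) ?_, by
            rw [mul_assoc, f.ι_one]⟩
          exact Prod.ext rfl (by simp [ht])
        have h8 : v * f.ι (S.Y t) ≠ 0 := fun h0 => hv0 (by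
          rw [← hv2, ← hz1, f.ι_mul, ← mul_assoc, h0, zero_mul])
        have h9 : ((g * (t : GSharp G).1 * s : G) : G ⧸ plus P.T) ∈ κ.support := by
          rw [Finsupp.mem_support_iff, ← hκ]
          intro h0
          rw [Module.finrank_eq_zero_iff_of_free] at h0
          have h10 : (⟨_, h7⟩ : col 𝒜 (f.ι 1) (g * (t : GSharp G).1, 1)) = 0 :=
            Subsingleton.elim _ _
          exact h8 (congrArg Subtype.val h10)
        have h10 : (c.ξ ((g * (t : GSharp G).1 * s : G) : G ⧸ plus P.T))⁻¹ *
            (g * (t : GSharp G).1 * s) ∈ plus P.T := QuotientGroup.eq.1 (hquot _)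
        set x := c.ξ ((g * (t : GSharp G).1 * s : G) : G ⧸ plus P.T) with hx
        have h11 : ((x * s⁻¹, 1) : GSharp G)⁻¹ * (g, i) ∈ P.T := by
          have : ((x * s⁻¹, 1) : GSharp G)⁻¹ * (g, i) =
              (x⁻¹ * (g * (t : GSharp G).1 * s), 1) * ((t⁻¹ : P.T) : GSharp G) := by
            refine Prod.ext ?_ ?_
            · simp only [Prod.fst_mul, Prod.fst_inv, Subgroup.coe_inv, mul_inv_rev, inv_inv]
              exact Additive.ofMul.injective (by simp only [ofMul_mul, ofMul_inv]; abel)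
            · simp [ht]
          rw [this]
          exact mul_mem h10 (t⁻¹).2
        refine ⟨⟨_, h9⟩, f.ι (S.Y ⟨_, h11⟩), f.ι_mem _ _ (S.Y_mem ⟨_, h11⟩), f.one_ι _, f.ι_one _,
          (map_ne_zero_iff _ f.ι_inj).2 (S.Y_ne _)⟩)
    have h5' : ∀ i j : Idx κ, e' i * e j.1 j.2 = if i = j then f.ι 1 else 0 := fun i j => by
      rw [h5]; congr
    obtain ⟨θ, hθ⟩ := exists_matrix_coordinates f.ι f.ι_mul f.ι_inj f.ι_surj
      (fun i : Idx κ => e i.1 i.2) e' (fun i => (mem_col.1 (he1 i.1 i.2)).2) h4 h5' h6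
    have hΦ : ∀ i j : Idx κ, f.ι (phi φ₀ c κ g₀ i j) = f.b * φ (e i.1 i.2) * e j.1 j.2 := by
      intro i j
      unfold phi
      rw [Matrix.of_apply]
      split_ifs with hij
      · rw [hB i.1 j.1 hij _ (he1 _ _) _ (he1 _ _), map_zsmul, ← Int.cast_smul_eq_zsmul F]
        congr 1
        obtain ⟨⟨x, hx⟩, i⟩ := i
        obtain ⟨⟨y, hy⟩, j⟩ := j
        unfold phiCoeff
        simp only [Subtype.mk.injEq] at hij ⊢
        have hirr : ∀ z, ¬ c.ord.lt z z := fun z => @lt_irrefl _ c.ord.toPreorder z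
        rcases @lt_trichotomy _ c.ord x y with hlt | rfl | hlt
        · have hne : x ≠ y := fun h => hirr y (h ▸ hlt)
          rw [he5 x y hij hlt, if_neg hne, if_pos hlt]
          split_ifs <;> simp
        · rw [if_pos rfl]
          rcases Int.units_eq_one_or (eta 𝒟 φ₀ (g₀ * c.ξ x * c.ξ x, 1)) with h7 | h7
          · rw [he3 x hij h7, if_pos h7]
            simp only [Fin.ext_iff]
            split_ifs <;> simp
          · rw [he4 x hij h7, if_neg (by rw [h7]; decide)]
            split_ifs <;> simp
        · have hne : x ≠ y := fun h => hirr y (h ▸ hlt)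
          have hyx : rel y x := hsymm _ _ hij
          have hnlt : ¬ c.ord.lt x y := @lt_asymm _ c.ord.toPreorder _ _ hlt
          rw [hs y x hyx _ (he1 y j) _ (he1 x i), he5 y x hyx hlt, if_neg hne, if_neg hnlt,
            mul_right_comm g₀]
          by_cases h8 : (i : ℕ) = j
          · rw [if_pos h8, if_pos h8.symm, mul_one]
          · rw [if_neg h8, if_neg (Ne.symm h8)]; simp
      -- For unrelated classes the value of `B` would have degree outside `T`, so it is zero.
      · obtain ⟨d, hd, hd'⟩ := hprod i.1 j.1 _ (he1 _ i.2) _ (he1 _ j.2)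
        have : d = 0 := by
          by_contra h0
          exact hij (S.mem_T hd h0)
        rw [← hd', this]
    obtain ⟨hu, hθφ⟩ := f.gram_isUnit_and_phi h hp hφ S (γ := fun i : Idx κ => c.ξ i.1 * s⁻¹)
      (fun i => (mem_col.1 (he1 i.1 i.2)).1) (fun i => by simpa using h3 i)
      (fun i => (mem_col.1 (he1 i.1 i.2)).2) h4 h5' h6 hθ hΦ
    refine ⟨θ, fun γ a => ?_, fun a => ?_⟩
    · rw [mem_iff_matGrading h (fun γ d => ⟨f.mem_of_ι h S, f.ι_mem γ d⟩)
        (γ := fun i : Idx κ => (c.ξ i.1 * s⁻¹, 1)) (fun i => (mem_col.1 (he1 i.1 i.2)).1) h3 h6 hθ,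
        matGrading_congr (γ := idxDegree c κ) (s⁻¹, 1)]
      · rfl
      · intro i
        exact Prod.ext rfl (mul_one _).symm
    · rw [EInv, mul_assoc, ← hθφ, Ring.inverse_mul_cancel_left _ _ hu]

end Presentation

/-! ### Graded matrix algebras -/

section MatGrading

variable {F : Type*} [Field F] {G : Type*} [CommGroup G] {D : Type*} [Ring D] [Algebra F D]
  {𝒟 : GSharp G → Submodule F D} {I : Type*} [Fintype I] [DecidableEq I]

theorem iSupIndep_of_projections {R H : Type*} [AddCommGroup R] [Module F R]
    {𝒜 : H → Submodule F R} (p : H → R →ₗ[F] R) (h1 : ∀ g, ∀ x ∈ 𝒜 g, p g x = x)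
    (h2 : ∀ g k, k ≠ g → ∀ x ∈ 𝒜 k, p g x = 0) : iSupIndep 𝒜 := by
  rw [iSupIndep_def]
  intro g
  rw [Submodule.disjoint_def]
  intro x hx hx'
  have h3 : ⨆ k, ⨆ (_ : k ≠ g), 𝒜 k ≤ LinearMap.ker (p g) := iSup₂_le fun k hk x hx => h2 g k hk x hx
  rw [← h1 g x hx]
  exact h3 hx'

theorem single_mem_matGrading (γ : I → GSharp G) {i j : I} {δ : GSharp G} {d : D} (hd : d ∈ 𝒟 δ) :
    Matrix.single i j d ∈ matGrading 𝒟 γ (γ i * δ * (γ j)⁻¹) := by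
  intro k l
  rw [Matrix.single_apply]
  split_ifs with hkl
  · obtain ⟨rfl, rfl⟩ := hkl
    have : (γ i)⁻¹ * (γ i * δ * (γ j)⁻¹) * γ j = δ := by group
    rwa [this]
  · exact zero_mem _

theorem isGrading_matGrading (hD : IsGrading 𝒟) (γ : I → GSharp G) :
    IsGrading (matGrading 𝒟 γ) where
  indep := by
    refine iSupIndep_of_projections (fun g =>
      { toFun := fun X => Matrix.of fun i j => hD.proj ((γ i)⁻¹ * g * γ j) (X i j)
        map_add' := fun X Y => by ext i j; simp
        map_smul' := fun c X => by ext i j; simp }) ?_ ?_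
    · intro g X hX
      ext i j
      exact hD.proj_same (hX i j)
    · intro g k hk X hX
      ext i j
      refine hD.proj_ne (hX i j) fun h => hk ?_
      exact (mul_left_cancel (mul_right_cancel h)).symm
  span := by
    rw [eq_top_iff]
    intro X _
    rw [Matrix.matrix_eq_sum_single X]
    refine Submodule.sum_mem _ fun i _ => Submodule.sum_mem _ fun j _ => ?_
    refine hD.induction (p := fun d => Matrix.single i j d ∈ ⨆ g, matGrading 𝒟 γ g)
      (fun δ d hd => Submodule.mem_iSup_of_mem _ (single_mem_matGrading γ hd)) ?_
      (fun x y hx hy => ?_) _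
    · rw [Matrix.single_zero]; exact zero_mem _
    · rw [Matrix.single_add]; exact add_mem hx hy
  mul_mem := by
    intro g k X Y hX hY i j
    rw [Matrix.mul_apply]
    refine Submodule.sum_mem _ fun l _ => hD.mul_mem' (hX i l) (hY l j) ?_
    group

/-- A matrix unit links a nonzero entry of `X` to a nonzero entry of `Y`; entries of homogeneous
matrices are homogeneous, hence units when nonzero. -/
theorem isGradedPrime_matGrading (hD : IsGrading 𝒟) (hu : ∀ γ, ∀ d ∈ 𝒟 γ, d ≠ 0 → IsUnit d)
    (γ : I → GSharp G) : IsGradedPrime (matGrading 𝒟 γ) := by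
  intro g h X Y hX hY hX0 hY0
  obtain ⟨i, j, hij⟩ : ∃ i j, X i j ≠ 0 := by
    by_contra! hall
    exact hX0 (Matrix.ext hall)
  obtain ⟨k, l, hkl⟩ : ∃ i j, Y i j ≠ 0 := by
    by_contra! hall
    exact hY0 (Matrix.ext hall)
  refine ⟨_, _, single_mem_matGrading γ (i := j) (j := k) hD.one_mem, fun h0 => ?_⟩
  have h1 := congrFun (congrFun h0 i) l
  rw [Matrix.mul_assoc, Matrix.mul_apply, Finset.sum_eq_single j] at h1
  · rw [Matrix.single_mul_apply_same, one_mul] at h1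
    exact hkl ((hu _ _ (hX i j) hij).mul_right_eq_zero.1 h1)
  · intro m _ hm
    rw [Matrix.single_mul_apply_of_ne _ _ _ _ _ hm, mul_zero]
  · simp

/-- For each `j` some row has its only nonzero entry, a unit, in column `j`. Left multiplication is
therefore injective, hence surjective by finite dimension. -/
theorem isUnit_of_monomial [FiniteDimensional F D] {Φ : Matrix I I D}
    (h : ∀ j, ∃ i, IsUnit (Φ i j) ∧ ∀ j', j' ≠ j → Φ i j' = 0) : IsUnit Φ := by
  have hinj : Function.Injective (LinearMap.mulLeft F Φ) := by
    refine (injective_iff_map_eq_zero _).2 fun Y hY => ?_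
    ext j k
    obtain ⟨i, hi, h0⟩ := h j
    have h1 := congrFun (congrFun hY i) k
    rw [LinearMap.mulLeft_apply, Matrix.mul_apply, Finset.sum_eq_single j] at h1
    · exact hi.mul_right_eq_zero.1 h1
    · intro m _ hm
      rw [h0 m hm, zero_mul]
    · simp
  obtain ⟨Ψ, hΨ⟩ := LinearMap.injective_iff_surjective.1 hinj 1
  have h2 : Φ * Ψ = 1 := hΨ
  have h3 : Ψ * Φ = 1 := hinj (by
    simp only [LinearMap.mulLeft_apply]
    rw [← mul_assoc, h2, one_mul, mul_one])
  exact isUnit_iff_exists.2 ⟨Ψ, h2, h3⟩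

/-- Projecting the entries of the inverse to the expected degrees again gives a right inverse, which
must be the inverse itself. -/
theorem inverse_mem_of_mem (hD : IsGrading 𝒟) {γ : I → GSharp G} {g : GSharp G}
    {Φ : Matrix I I D} (hΦ : ∀ i j, Φ i j ∈ 𝒟 (g * γ i * γ j)) (hu : IsUnit Φ) (i j : I) :
    Ring.inverse Φ i j ∈ 𝒟 (g⁻¹ * (γ i)⁻¹ * (γ j)⁻¹) := by
  let Ψ : Matrix I I D := Matrix.of fun i j =>
    hD.proj (g⁻¹ * (γ i)⁻¹ * (γ j)⁻¹) (Ring.inverse Φ i j)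
  have h1 : Φ * Ψ = 1 := by
    ext i k
    have h2 := congrFun (congrFun (Ring.mul_inverse_cancel Φ hu) i) k
    rw [Matrix.mul_apply] at h2 ⊢
    have h3 : ∀ j, Φ i j * Ψ j k = hD.proj (γ i * (γ k)⁻¹) (Φ i j * Ring.inverse Φ j k) := by
      intro j
      change Φ i j * hD.proj (g⁻¹ * (γ j)⁻¹ * (γ k)⁻¹) (Ring.inverse Φ j k) = _
      rw [← hD.proj_mul_left (hΦ i j)]
      congr 2
      exact Additive.ofMul.injective (by simp only [ofMul_mul, ofMul_inv]; abel)
    simp only [h3]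
    rw [← map_sum, h2, Matrix.one_apply]
    split_ifs with hik
    · rw [hik, mul_inv_cancel, hD.proj_same hD.one_mem]
    · rw [map_zero]
  have h4 : Ring.inverse Φ = Ψ := by
    rw [← Ring.inverse_mul_cancel_left Φ Ψ hu, h1, mul_one]
  rw [h4]
  exact hD.proj_mem _ _

end MatGrading

/-! ### The standard models -/

section Model

variable {F : Type*} [Field F] {G : Type*} [CommGroup G] {D : Type*} [Ring D] [Algebra F D]
  {𝒟 : GSharp G → Submodule F D} {φ₀ : D →ₗ[F] D} {P : OddTriple G}

theorem StdData.isUnit (S : StdData P 𝒟 φ₀) (γ : GSharp G) (d : D) (hd : d ∈ 𝒟 γ) (h0 : d ≠ 0) :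
    IsUnit d := by
  obtain ⟨t, rfl, c, hc, rfl⟩ := S.exists_eq hd h0
  obtain ⟨z, -, h1, h2⟩ := S.exists_inv t
  exact isUnit_iff_exists.2 ⟨c⁻¹ • z, by rw [smul_mul_smul_comm, mul_inv_cancel₀ hc, h1, one_smul],
    by rw [smul_mul_smul_comm, inv_mul_cancel₀ hc, h2, one_smul]⟩

theorem StdData.finiteDimensional (S : StdData P 𝒟 φ₀) : FiniteDimensional F D :=
  Module.Basis.finiteDimensional_of_finite S.Y

/-- Evenness matters: if `κ(x) = 1` and `s = -1`, the half `κ(x)/2` is `0` and the block would be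
`1`, which is not skew. -/
theorem phiCoeff_symm (c : BlockChoice P.T 𝒟) (κ : (G ⧸ plus P.T) →₀ ℕ) (s : ℤˣ) (i j : Idx κ)
    (hev : s = -1 → i.1 = j.1 → Even (κ i.1)) :
    phiCoeff c κ s i j = s * phiCoeff c κ s j i := by
  obtain ⟨⟨x, hx⟩, i⟩ := i
  obtain ⟨⟨y, hy⟩, j⟩ := j
  unfold phiCoeff
  have hi : (i : ℕ) < κ x := i.2
  have hj : (j : ℕ) < κ y := j.2
  have hirr : ∀ z, ¬ c.ord.lt z z := fun z => @lt_irrefl _ c.ord.toPreorder z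
  rcases @lt_trichotomy _ c.ord x y with hlt | rfl | hlt
  · have hne : x ≠ y := fun h => hirr y (h ▸ hlt)
    have hnlt : ¬ c.ord.lt y x := @lt_asymm _ c.ord.toPreorder _ _ hlt
    have hne' : (⟨x, hx⟩ : κ.support) ≠ ⟨y, hy⟩ := fun h => hne (congrArg Subtype.val h)
    rw [if_neg hne', if_neg hne'.symm, if_pos hlt, if_neg hnlt]
    by_cases h : (i : ℕ) = j
    · rw [if_pos h, if_pos h.symm]
      rcases Int.units_eq_one_or s with rfl | rfl <;> rfl
    · rw [if_neg h, if_neg (Ne.symm h), mul_zero]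
  · rw [if_pos rfl, if_pos rfl]
    rcases Int.units_eq_one_or s with rfl | rfl
    · simp [eq_comm]
    · have h1 : ¬ (-1 : ℤˣ) = 1 := by decide
      rw [if_neg h1, if_neg h1]
      obtain ⟨k, hk⟩ : Even (κ x) := hev rfl rfl
      simp only [Units.val_neg, Units.val_one]
      split_ifs <;> first | rfl | omega
  · have hne : x ≠ y := fun h => hirr y (h ▸ hlt)
    have hnlt : ¬ c.ord.lt x y := @lt_asymm _ c.ord.toPreorder _ _ hlt
    have hne' : (⟨x, hx⟩ : κ.support) ≠ ⟨y, hy⟩ := fun h => hne (congrArg Subtype.val h)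
    rw [if_neg hne', if_neg hne'.symm, if_pos hlt, if_neg hnlt]
    by_cases h : (i : ℕ) = j
    · rw [if_pos h, if_pos h.symm, mul_one]
    · rw [if_neg h, if_neg (Ne.symm h), mul_zero]

variable (S : StdData P 𝒟 φ₀) (c : BlockChoice P.T 𝒟) (κ : (G ⧸ plus P.T) →₀ ℕ) (g₀ : G)
include S

theorem StdData.phi_X (h2 : (2 : F) ≠ 0) (t : P.T) :
    φ₀ (c.X t) = eta 𝒟 φ₀ (t : GSharp G) • c.X t := by
  obtain ⟨t', ht', k, hk, hX⟩ := S.exists_eq (c.X_mem t) (c.X_ne t)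
  obtain rfl : t' = t := Subtype.ext ht'
  rw [hX, map_smul, S.phi, S.eta_eq h2, smul_comm]

theorem StdData.phi_mem_deg (i j : Idx κ) : GradedSuper.phi φ₀ c κ g₀ i j ∈
    𝒟 (((g₀, 1) : GSharp G) * idxDegree c κ i * idxDegree c κ j) := by
  unfold GradedSuper.phi
  rw [Matrix.of_apply]
  split_ifs with h
  · rw [← Int.cast_smul_eq_zsmul F]
    refine Submodule.smul_mem _ _ ?_
    have := c.X_mem ⟨(g₀ * c.ξ i.1 * c.ξ j.1, 1), h⟩
    simpa [idxDegree] using this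
  · exact zero_mem _

/-- The factor `η(t)` from `φ₀(X_t)` cancels the symmetry sign of the integer coefficients. -/
theorem StdData.phi_hermitian (h2 : (2 : F) ≠ 0) (hadm : IsAdmissible P.T 𝒟 φ₀ κ g₀) :
    (GradedSuper.phi φ₀ c κ g₀).transpose.map φ₀ = GradedSuper.phi φ₀ c κ g₀ := by
  ext i j
  rw [Matrix.map_apply, Matrix.transpose_apply]
  unfold GradedSuper.phi
  rw [Matrix.of_apply, Matrix.of_apply]
  have e : g₀ * c.ξ j.1 * c.ξ i.1 = g₀ * c.ξ i.1 * c.ξ j.1 := mul_right_comm _ _ _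
  by_cases h : g₀ * c.ξ i.1 * c.ξ j.1 ∈ plus P.T
  · have h' : g₀ * c.ξ j.1 * c.ξ i.1 ∈ plus P.T := by rwa [e]
    have hX : c.X ⟨(g₀ * c.ξ j.1 * c.ξ i.1, 1), h'⟩ = c.X ⟨(g₀ * c.ξ i.1 * c.ξ j.1, 1), h⟩ := by
      congr 2
      rw [e]
    rw [dif_pos h', dif_pos h, map_zsmul, hX, S.phi_X c h2, e, phiCoeff_symm c κ _ i j
      (fun h3 h4 => by
        have h5 := c.ξ_section i.1
        rw [← h4, mul_assoc, ← sq] at h h3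
        have := hadm.even (c.ξ i.1) h h3
        rwa [h5] at this),
      mul_comm ((eta 𝒟 φ₀ (g₀ * c.ξ i.1 * c.ξ j.1, 1) : ℤˣ) : ℤ), mul_smul, Units.smul_def]
  · rw [dif_neg (by rwa [e]), dif_neg h, map_zero]

/-- `Φ` is monomial: the columns of class `y` meet only the rows of class `g₀⁻¹y⁻¹`, which lies in
the support by the duality of `κ`. -/
theorem StdData.isUnit_phi (h2 : (2 : F) ≠ 0) (hadm : IsAdmissible P.T 𝒟 φ₀ κ g₀) :
    IsUnit (GradedSuper.phi φ₀ c κ g₀) := by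
  have hfin := S.finiteDimensional
  have hquot : ∀ x : G ⧸ plus P.T, (c.ξ x : G ⧸ plus P.T) = x := c.ξ_section
  have hrel : ∀ x y, g₀ * c.ξ x * c.ξ y ∈ plus P.T ↔ (g₀ : G ⧸ plus P.T) * x * y = 1 := fun x y => by
    rw [← QuotientGroup.eq_one_iff, QuotientGroup.mk_mul, QuotientGroup.mk_mul, hquot, hquot]
  have hirr : ∀ z, ¬ c.ord.lt z z := fun z => @lt_irrefl _ c.ord.toPreorder z
  refine isUnit_of_monomial (F := F) ?_
  rintro ⟨⟨y, hy⟩, m⟩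
  have hκ := hadm.dual y
  set x : G ⧸ plus P.T := (g₀ : G ⧸ plus P.T)⁻¹ * y⁻¹ with hx
  have hxs : x ∈ κ.support := by
    rw [Finsupp.mem_support_iff, ← hκ]
    exact Finsupp.mem_support_iff.1 hy
  have hxy : g₀ * c.ξ x * c.ξ y ∈ plus P.T := by
    rw [hrel, hx]; group
  have hcoef : ∀ n : ℤ, IsUnit n → IsUnit (n • c.X ⟨(g₀ * c.ξ x * c.ξ y, 1), hxy⟩) := fun n hn => by
    have := S.isUnit _ _ (c.X_mem ⟨(g₀ * c.ξ x * c.ξ y, 1), hxy⟩) (c.X_ne _)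
    rcases Int.isUnit_iff.1 hn with rfl | rfl
    · simpa
    · simpa using this.neg
  -- A class has only one partner, so it suffices to examine the integer coefficients in a single
  -- block.
  have hred : ∀ m' : Fin (κ x),
      (IsUnit (phiCoeff c κ (eta 𝒟 φ₀ (g₀ * c.ξ x * c.ξ y, 1)) ⟨⟨x, hxs⟩, m'⟩ ⟨⟨y, hy⟩, m⟩)) →
      (∀ m'', m'' ≠ m →
        phiCoeff c κ (eta 𝒟 φ₀ (g₀ * c.ξ x * c.ξ y, 1)) ⟨⟨x, hxs⟩, m'⟩ ⟨⟨y, hy⟩, m''⟩ = 0) →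
      ∃ i : Idx κ, IsUnit (GradedSuper.phi φ₀ c κ g₀ i ⟨⟨y, hy⟩, m⟩) ∧
        ∀ j', j' ≠ ⟨⟨y, hy⟩, m⟩ → GradedSuper.phi φ₀ c κ g₀ i j' = 0 := by
    intro m' h3 h4
    refine ⟨⟨⟨x, hxs⟩, m'⟩, ?_, ?_⟩
    · unfold GradedSuper.phi
      rw [Matrix.of_apply, dif_pos hxy]
      exact hcoef _ h3
    · rintro ⟨⟨y', hy'⟩, m''⟩ hne
      unfold GradedSuper.phi
      rw [Matrix.of_apply]
      split_ifs with h5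
      · have h6 : y' = y := by
          have h7 := (hrel _ _).1 h5
          have h8 := (hrel _ _).1 hxy
          exact mul_left_cancel (h7.trans h8.symm)
        subst h6
        rw [h4 m'' (fun h => hne (by rw [h])), zero_smul]
      · rfl
  by_cases hxy' : x = y
  · have hm : (m : ℕ) < κ y := m.2
    have hyy : g₀ * c.ξ y ^ 2 ∈ plus P.T := by
      rw [hxy', mul_assoc, ← sq] at hxy
      exact hxy
    have hxy2 : (⟨x, hxs⟩ : κ.support) = ⟨y, hy⟩ := Subtype.ext hxy'
    unfold phiCoeff at hred
    simp only [if_pos hxy2] at hred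
    rcases Int.units_eq_one_or (eta 𝒟 φ₀ (g₀ * c.ξ x * c.ξ y, 1)) with hη | hη
    · simp only [hη, if_true] at hred
      refine hred (Fin.cast hκ m) (by simp) fun m'' hne => ?_
      rw [if_neg]
      simp only [Fin.val_cast]
      exact fun h => hne (Fin.ext h.symm)
    · simp only [hη, if_neg (show ¬ (-1 : ℤˣ) = 1 by decide)] at hred
      have hev : Even (κ y) := by
        have := hadm.even (c.ξ y) hyy
        rw [hquot] at this
        refine this ?_
        rw [hxy', mul_assoc, ← sq] at hη
        exact hη
      obtain ⟨k, hk⟩ := hev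
      have hkx : κ x = k + k := hκ.symm.trans hk
      have hk2 : κ x / 2 = k := by omega
      simp only [hk2] at hred
      -- In the block `J`, a column of the first half meets the lower-left `-1`, and one of the
      -- second half the upper-right `1`.
      by_cases hmk : (m : ℕ) < k
      · refine hred ⟨m + k, by omega⟩ ?_ fun m'' hne => ?_
        · rw [if_neg (by simp only; omega), if_pos rfl]; decide
        · have h3 : (m'' : ℕ) < κ y := m''.2
          have h4 : (m'' : ℕ) ≠ m := fun h => hne (Fin.ext h)
          rw [if_neg (by simp only; omega), if_neg (by simp only; omega)]
      · refine hred ⟨m - k, by omega⟩ ?_ fun m'' hne => ?_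
        · rw [if_pos (by simp only; omega)]; decide
        · have h3 : (m'' : ℕ) < κ y := m''.2
          have h4 : (m'' : ℕ) ≠ m := fun h => hne (Fin.ext h)
          rw [if_neg (by simp only; omega), if_neg (by simp only; omega)]
  · have hxy2 : (⟨x, hxs⟩ : κ.support) ≠ ⟨y, hy⟩ := fun h => hxy' (congrArg Subtype.val h)
    refine hred (Fin.cast hκ m) ?_ fun m'' hne => ?_
    · unfold phiCoeff
      simp only [if_neg hxy2, Fin.val_cast, if_true]
      split_ifs
      · decide
      · exact Units.isUnit _
    · unfold phiCoeff
      simp only [if_neg hxy2, Fin.val_cast]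
      rw [if_neg (fun h => hne (Fin.ext h.symm))]

end Model

/-! ### Frames of the standard models -/

section ModelFrame

variable {F : Type*} [Field F] {G : Type*} [CommGroup G] {D : Type*} [Ring D] [Algebra F D]
  {𝒟 : GSharp G → Submodule F D} {φ₀ : D →ₗ[F] D} {P : OddTriple G} {I : Type*} [Fintype I]

theorem StdData.transpose_mul_even_left (S : StdData P 𝒟 φ₀) {A B : Matrix I I D}
    (hA : ∀ i j, ∃ g : G, A i j ∈ 𝒟 (g, 1)) :
    (A * B).transpose.map φ₀ = B.transpose.map φ₀ * A.transpose.map φ₀ := by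
  ext i j
  simp only [Matrix.map_apply, Matrix.transpose_apply, Matrix.mul_apply, map_sum]
  refine Finset.sum_congr rfl fun k _ => ?_
  obtain ⟨g, hg⟩ := hA j k
  exact S.isGradedSuperinv.mul_even_left S.isGrading hg _

theorem StdData.transpose_mul_even_right (S : StdData P 𝒟 φ₀) {A B : Matrix I I D}
    (hB : ∀ i j, ∃ g : G, B i j ∈ 𝒟 (g, 1)) :
    (A * B).transpose.map φ₀ = B.transpose.map φ₀ * A.transpose.map φ₀ := by
  ext i j
  simp only [Matrix.map_apply, Matrix.transpose_apply, Matrix.mul_apply, map_sum]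
  refine Finset.sum_congr rfl fun k _ => ?_
  obtain ⟨g, hg⟩ := hB k i
  exact S.isGradedSuperinv.mul_even_right S.isGrading hg _

variable (S : StdData P 𝒟 φ₀) (c : BlockChoice P.T 𝒟) (κ : (G ⧸ plus P.T) →₀ ℕ) (g₀ : G)

variable (φ₀) in
/-- `EInv` as a linear map. -/
def EInvL : Matrix (Idx κ) (Idx κ) D →ₗ[F] Matrix (Idx κ) (Idx κ) D where
  toFun := EInv φ₀ c κ g₀
  map_add' X Y := by
    unfold EInv
    rw [Matrix.transpose_add, Matrix.map_add φ₀ (map_add φ₀), mul_add, add_mul]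
  map_smul' a X := by
    unfold EInv
    rw [Matrix.transpose_smul, Matrix.map_smul φ₀ a (map_smul φ₀ a), mul_smul_comm, smul_mul_assoc,
      RingHom.id_apply]

variable {κ g₀}
include S

/-- `Φ` has even entries and is hermitian, and so is its inverse; hence `φ² = 1` and no signs arise
from `Φ`. The degrees `g₀` and `g₀⁻¹` of `Φ` and `Φ⁻¹` cancel. -/
theorem StdData.isGradedSuperinv_model (h2 : (2 : F) ≠ 0) (hadm : IsAdmissible P.T 𝒟 φ₀ κ g₀) :
    IsGradedSuperinv (EGrading c κ) (EInvL φ₀ c κ g₀) := by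
  set Φ := GradedSuper.phi φ₀ c κ g₀ with hΦ
  have hu : IsUnit Φ := S.isUnit_phi c κ g₀ h2 hadm
  have hΦm : ∀ i j, Φ i j ∈ 𝒟 (((g₀, 1) : GSharp G) * idxDegree c κ i * idxDegree c κ j) :=
    S.phi_mem_deg c κ g₀
  have hΨm := inverse_mem_of_mem S.isGrading hΦm hu
  have hΦe : ∀ i j, ∃ g : G, Φ i j ∈ 𝒟 (g, 1) := fun i j =>
    ⟨g₀ * c.ξ i.1 * c.ξ j.1, by simpa [idxDegree] using hΦm i j⟩
  have hΨe : ∀ i j, ∃ g : G, Ring.inverse Φ i j ∈ 𝒟 (g, 1) := fun i j =>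
    ⟨g₀⁻¹ * (c.ξ i.1)⁻¹ * (c.ξ j.1)⁻¹, by simpa [idxDegree] using hΨm i j⟩
  have hΦτ : Φ.transpose.map φ₀ = Φ := S.phi_hermitian c κ g₀ h2 hadm
  have hφ := S.isGradedSuperinv
  have hΨτ : (Ring.inverse Φ).transpose.map φ₀ = Ring.inverse Φ := by
    have h3 : (Ring.inverse Φ).transpose.map φ₀ * Φ = 1 := by
      conv_lhs => rw [← hΦτ, hΦτ]
      rw [show (Ring.inverse Φ).transpose.map φ₀ * Φ =
        (Ring.inverse Φ).transpose.map φ₀ * Φ.transpose.map φ₀ by rw [hΦτ],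
        ← S.transpose_mul_even_left hΦe, Ring.mul_inverse_cancel Φ hu, Matrix.transpose_one,
        Matrix.map_one φ₀ (map_zero _) (hφ.map_one S.isGrading)]
    rw [← Ring.mul_inverse_cancel_right Φ ((Ring.inverse Φ).transpose.map φ₀) hu, h3, one_mul]
  have hpar : ∀ (γ : GSharp G) (i j : Idx κ),
      par ((idxDegree c κ i)⁻¹ * γ * idxDegree c κ j) = par γ := fun γ i j => by
    simp [par, idxDegree]
  refine ⟨?_, ?_, ?_⟩
  · intro γ Y hY i j
    change (Ring.inverse Φ * (Y.transpose.map φ₀) * Φ) i j ∈ _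
    rw [Matrix.mul_apply]
    refine Submodule.sum_mem _ fun k _ => ?_
    rw [Matrix.mul_apply, Finset.sum_mul]
    refine Submodule.sum_mem _ fun l _ => ?_
    refine S.isGrading.mul_mem' (S.isGrading.mul_mem _ _ _ _ (hΨm i l)
      (hφ.map_mem _ _ (hY k l))) (hΦm k j) ?_
    exact Additive.ofMul.injective (by simp only [ofMul_mul, ofMul_inv]; abel)
  · intro Y
    change Ring.inverse Φ * ((Ring.inverse Φ * (Y.transpose.map φ₀) * Φ).transpose.map φ₀) * Φ = Y
    rw [S.transpose_mul_even_right hΦe, S.transpose_mul_even_left hΨe, hΦτ, hΨτ]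
    have h3 : (Y.transpose.map φ₀).transpose.map φ₀ = Y := by
      ext i j
      exact hφ.invol _
    rw [h3, ← mul_assoc, Ring.inverse_mul_cancel _ hu, one_mul, mul_assoc,
      Ring.inverse_mul_cancel _ hu, mul_one]
  · intro γ δ Y Z hY hZ
    have h3 : (Y * Z).transpose.map φ₀ =
        ((-1 : ℤˣ) ^ (par γ * par δ)) • (Z.transpose.map φ₀ * Y.transpose.map φ₀) := by
      ext i j
      simp only [Matrix.map_apply, Matrix.transpose_apply, Matrix.mul_apply, map_sum,
        Matrix.smul_apply, Finset.smul_sum]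
      refine Finset.sum_congr rfl fun k _ => ?_
      rw [hφ.map_mul _ _ _ _ (hY j k) (hZ k i), hpar, hpar]
    change Ring.inverse Φ * ((Y * Z).transpose.map φ₀) * Φ = _ •
      ((Ring.inverse Φ * (Z.transpose.map φ₀) * Φ) * (Ring.inverse Φ * (Y.transpose.map φ₀) * Φ))
    rw [h3, mul_smul_comm, smul_mul_assoc]
    congr 1
    calc Ring.inverse Φ * (Z.transpose.map φ₀ * Y.transpose.map φ₀) * Φ
        = Ring.inverse Φ * Z.transpose.map φ₀ * (Φ * Ring.inverse Φ) * Y.transpose.map φ₀ * Φ := by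
          rw [Ring.mul_inverse_cancel _ hu]; simp only [mul_assoc, one_mul]
      _ = _ := by simp only [mul_assoc]

theorem StdData.isGrading_model : IsGrading (EGrading c κ) :=
  isGrading_matGrading S.isGrading _

theorem StdData.isGradedPrime_model : IsGradedPrime (EGrading c κ) :=
  isGradedPrime_matGrading S.isGrading S.isUnit _

/-- The frame of a standard model at a basis element of `U`. -/
theorem StdData.exists_frame (h2 : (2 : F) ≠ 0) (hadm : IsAdmissible P.T 𝒟 φ₀ κ g₀) (j₀ : Idx κ) :
    ∃ f : Frame (EGrading c κ) (EInvL φ₀ c κ g₀) 𝒟 φ₀, f.ι 1 = Matrix.single j₀ j₀ 1 ∧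
      f.deg = g₀ * c.ξ j₀.1 ^ 2 := by
  set Φ := GradedSuper.phi φ₀ c κ g₀ with hΦ
  have hu : IsUnit Φ := S.isUnit_phi c κ g₀ h2 hadm
  have hΦm : ∀ i j, Φ i j ∈ 𝒟 (((g₀, 1) : GSharp G) * idxDegree c κ i * idxDegree c κ j) :=
    S.phi_mem_deg c κ g₀
  have hΦτ : Φ.transpose.map φ₀ = Φ := S.phi_hermitian c κ g₀ h2 hadm
  have hφ := S.isGradedSuperinv
  have hone : φ₀ 1 = 1 := hφ.map_one S.isGrading
  have hE : ∀ Y, EInvL φ₀ c κ g₀ Y = Ring.inverse Φ * Y.transpose.map φ₀ * Φ := fun _ => rfl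
  have hnt := S.nontrivial
  have hsτ : ∀ d : D, (Matrix.single j₀ j₀ d).transpose.map φ₀ = Matrix.single j₀ j₀ (φ₀ d) := by
    intro d
    rw [Matrix.transpose_single, Matrix.map_single]
  -- Since `φ(E d) = Φ⁻¹ E φ₀(d) Φ` for the diagonal unit `E` at `j₀`, the product `E Φ` is a
  -- generator. The degrees `g₀γ_{j₀}γ_j` in row `j₀` of `Φ` make it homogeneous of degree
  -- `g₀γ_{j₀}²`.
  refine ⟨⟨Matrix.singleLinearMap F j₀ j₀, Matrix.single j₀ j₀ 1 * Φ, g₀ * c.ξ j₀.1 ^ 2,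
    ?_, ?_, ?_, ?_, ?_, ?_, ?_, ?_, ?_⟩, rfl, rfl⟩
  · intro x y
    simp
  · intro γ d hd
    have h3 := single_mem_matGrading (idxDegree c κ) (i := j₀) (j := j₀) hd
    rwa [mul_inv_cancel_comm] at h3
  · intro x y hxy
    have := congrFun (congrFun hxy j₀) j₀
    simpa using this
  · intro r h3 h4
    refine ⟨r j₀ j₀, ?_⟩
    rw [← h4, ← h3]
    simp only [Matrix.singleLinearMap_apply]
    ext i j
    by_cases hi : i = j₀ <;> by_cases hj : j = j₀
    · subst hi; subst hj; simp
    · subst hi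
      simp [hj, Ne.symm hj]
    · subst hj
      simp [hi, Ne.symm hi]
    · simp [hj, Ne.symm hi, Ne.symm hj]
  · intro i j
    by_cases hi : i = j₀
    · subst hi
      rw [Matrix.single_mul_apply_same, one_mul]
      have h3 := hΦm i j
      have h4 : ((g₀, 1) : GSharp G) * idxDegree c κ i * idxDegree c κ j =
          (idxDegree c κ i)⁻¹ * (g₀ * c.ξ i.1 ^ 2, 1) * idxDegree c κ j := by
        simp only [idxDegree, Prod.inv_mk, Prod.mk_mul_mk, inv_one, mul_one]
        refine Prod.ext (Additive.ofMul.injective ?_) rfl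
        simp only [ofMul_mul, ofMul_inv, ofMul_pow]
        abel
      rwa [h4] at h3
    · rw [Matrix.single_mul_apply_of_ne _ _ _ _ _ hi]
      exact zero_mem _
  · intro h0
    have : Matrix.single j₀ j₀ (1 : D) = 0 := by
      rw [← Ring.mul_inverse_cancel_right Φ (Matrix.single j₀ j₀ (1 : D)) hu, h0, zero_mul]
    have := congrFun (congrFun this j₀) j₀
    simp at this
  · rw [Matrix.singleLinearMap_apply, ← mul_assoc, Matrix.single_mul_single_same, one_mul]
  · intro d
    rw [hE, Matrix.singleLinearMap_apply, Matrix.singleLinearMap_apply, hsτ]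
    calc _ = Matrix.single j₀ j₀ 1 * (Φ * Ring.inverse Φ) * Matrix.single j₀ j₀ (φ₀ d) * Φ := by
          simp only [mul_assoc]
      _ = _ := by
          rw [Ring.mul_inverse_cancel _ hu, mul_one, Matrix.single_mul_single_same, one_mul,
            ← mul_assoc, Matrix.single_mul_single_same, mul_one]
  · have hse : ∀ i j, ∃ g : G, Matrix.single j₀ j₀ (1 : D) i j ∈ 𝒟 (g, 1) := fun i j => by
      refine ⟨1, ?_⟩
      rw [Matrix.single_apply]
      split_ifs
      · exact S.one_mem
      · exact zero_mem _
    rw [hE, S.transpose_mul_even_left hse, hΦτ, hsτ, hone, Ring.inverse_mul_cancel_left _ _ hu]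

/-- A homogeneous matrix in column `j₀` has nonzero entries only in the rows of one class `y`, each
ranging over a single line `D_t`; there are `κ(y)` such rows. -/
theorem StdData.finrank_col (j₀ : Idx κ) (x : G) :
    Module.finrank F (col (EGrading c κ) (Matrix.single j₀ j₀ 1) (x, 1)) =
      κ ((x * c.ξ j₀.1 : G) : G ⧸ plus P.T) := by
  set y : G ⧸ plus P.T := ((x * c.ξ j₀.1 : G) : G ⧸ plus P.T) with hy
  have hquot : ∀ x : G ⧸ plus P.T, (c.ξ x : G ⧸ plus P.T) = x := c.ξ_section
  have hT : (c.ξ y)⁻¹ * (x * c.ξ j₀.1) ∈ plus P.T := QuotientGroup.eq.1 (hquot _)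
  have hsupp : ∀ m : Fin (κ y), y ∈ κ.support := fun m =>
    Finsupp.mem_support_iff.2 (fun h => by have := m.2; omega)
  let t : P.T := ⟨((c.ξ y)⁻¹ * (x * c.ξ j₀.1), 1), hT⟩
  let L : (Fin (κ y) → F) →ₗ[F] Matrix (Idx κ) (Idx κ) D :=
    ∑ m, (LinearMap.proj m).smulRight (Matrix.single ⟨⟨y, hsupp m⟩, m⟩ j₀ (S.Y t))
  have hL : ∀ a, L a = ∑ m, a m • Matrix.single ⟨⟨y, hsupp m⟩, m⟩ j₀ (S.Y t) := fun a => by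
    simp [L, LinearMap.sum_apply]
  have hLe : ∀ a m, L a ⟨⟨y, hsupp m⟩, m⟩ j₀ = a m • S.Y t := fun a m => by
    rw [hL, Matrix.sum_apply, Finset.sum_eq_single m]
    · simp
    · intro k _ hk
      rw [Matrix.smul_apply, Matrix.single_apply_of_row_ne, smul_zero]
      intro h
      apply hk
      simpa using h
    · simp
  have hinj : Function.Injective L := (injective_iff_map_eq_zero L).2 fun a ha => by
    ext m
    have := hLe a m
    rw [ha, Matrix.zero_apply, eq_comm, smul_eq_zero] at this
    exact this.resolve_right (S.Y_ne t)
  have hrange : LinearMap.range L = col (EGrading c κ) (Matrix.single j₀ j₀ 1) (x, 1) := by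
    apply le_antisymm
    · rintro _ ⟨a, rfl⟩
      rw [hL]
      refine Submodule.sum_mem _ fun m _ => Submodule.smul_mem _ _ (mem_col.2 ⟨?_, ?_⟩)
      · have h3 := single_mem_matGrading (idxDegree c κ) (i := ⟨⟨y, hsupp m⟩, m⟩) (j := j₀)
          (S.Y_mem t)
        have h4 : idxDegree c κ ⟨⟨y, hsupp m⟩, m⟩ * (t : GSharp G) * (idxDegree c κ j₀)⁻¹ =
            (x, 1) := by
          refine Prod.ext ?_ (by simp [t, idxDegree])
          simp only [t, idxDegree, Prod.fst_mul, Prod.fst_inv]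
          group
        rwa [h4] at h3
      · rw [Matrix.single_mul_single_same, mul_one]
    · intro X hX
      obtain ⟨h3, h4⟩ := mem_col.1 hX
      have hcol : ∀ i j, j ≠ j₀ → X i j = 0 := fun i j hj => by
        rw [← h4, Matrix.mul_single_apply_of_ne _ _ _ _ _ hj]
      have hex : ∀ m : Fin (κ y), ∃ a : F, X ⟨⟨y, hsupp m⟩, m⟩ j₀ = a • S.Y t := fun m => by
        refine (S.mem_iff t _).1 ?_
        have h5 := h3 ⟨⟨y, hsupp m⟩, m⟩ j₀
        have h6 : (idxDegree c κ ⟨⟨y, hsupp m⟩, m⟩)⁻¹ * (x, 1) * idxDegree c κ j₀ =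
            (t : GSharp G) := Prod.ext (by simp [t, idxDegree, mul_assoc]) (by simp [t, idxDegree])
        rwa [h6] at h5
      choose a ha using hex
      refine ⟨a, ?_⟩
      ext i j
      by_cases hj : j = j₀
      · subst hj
        by_cases hi : (i.1 : G ⧸ plus P.T) = y
        · obtain ⟨⟨z, hz⟩, m⟩ := i
          obtain rfl : z = y := hi
          rw [ha m]
          exact hLe a m
        · have h5 : X i j = 0 := by
            by_contra h0
            have h6 := S.mem_T (h3 i j) h0
            apply hi
            have h7 : (c.ξ i.1)⁻¹ * (x * c.ξ j.1) ∈ plus P.T := by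
              rw [mem_plus]
              convert h6 using 1
              exact Prod.ext (by simp [idxDegree, mul_assoc]) (by simp [idxDegree])
            have h8 := QuotientGroup.eq.2 h7
            rw [hquot] at h8
            exact h8
          rw [h5, hL, Matrix.sum_apply]
          refine Finset.sum_eq_zero fun m _ => ?_
          rw [Matrix.smul_apply, Matrix.single_apply_of_row_ne, smul_zero]
          rintro rfl
          exact hi rfl
      · rw [hcol i j hj, hL, Matrix.sum_apply]
        refine Finset.sum_eq_zero fun m _ => ?_
        rw [Matrix.smul_apply, Matrix.single_apply_of_col_ne _ _ (Ne.symm hj), smul_zero]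
  rw [← hrange, LinearMap.finrank_range_of_inj hinj, Module.finrank_fin_fun]

end ModelFrame

/-! ### The isomorphism problem for the standard models -/

section Iso

variable {F : Type*} [Field F] {G : Type*} [CommGroup G]

theorem GradedIso.symm {A B : Type*} [Ring A] [Algebra F A] [Ring B] [Algebra F B]
    {𝒜 : GSharp G → Submodule F A} {φ : A → A} {ℬ : GSharp G → Submodule F B} {ψ : B → B}
    (h : GradedIso 𝒜 φ ℬ ψ) : GradedIso ℬ ψ 𝒜 φ := by
  obtain ⟨θ, h1, h2⟩ := h
  refine ⟨θ.symm, fun γ b => ?_, fun b => ?_⟩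
  · rw [h1, θ.apply_symm_apply]
  · rw [θ.symm_apply_eq, h2, θ.apply_symm_apply]

/-- A frame transported along an isomorphism of graded superalgebras with superinvolution. -/
theorem Frame.exists_map {R R' D : Type*} [Ring R] [Algebra F R] [Ring R'] [Algebra F R']
    [Ring D] [Algebra F D] {𝒜 : GSharp G → Submodule F R} {φ : R →ₗ[F] R}
    {ℬ : GSharp G → Submodule F R'} {ψ : R' →ₗ[F] R'}
    {𝒟 : GSharp G → Submodule F D} {φ₀ : D →ₗ[F] D} (f : Frame 𝒜 φ 𝒟 φ₀) (θ : R ≃ₐ[F] R')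
    (h1 : ∀ γ a, a ∈ 𝒜 γ ↔ θ a ∈ ℬ γ) (h2 : ∀ a, θ (φ a) = ψ (θ a)) :
    ∃ f' : Frame ℬ ψ 𝒟 φ₀, f'.deg = f.deg ∧ ∀ γ, Module.finrank F (col ℬ (f'.ι 1) γ) =
      Module.finrank F (col 𝒜 (f.ι 1) γ) := by
  refine ⟨⟨θ.toLinearMap ∘ₗ f.ι, θ f.b, f.deg, fun x y => ?_, fun γ d hd => ?_, ?_,
    fun r hl hr => ?_, ?_, ?_, ?_, fun d => ?_, ?_⟩, rfl, fun γ => ?_⟩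
  · simp [f.ι_mul]
  · exact (h1 _ _).1 (f.ι_mem _ _ hd)
  · exact θ.injective.comp f.ι_inj
  · obtain ⟨d, hd⟩ := f.ι_surj (θ.symm r) (by
      apply θ.injective; rw [map_mul, θ.apply_symm_apply]; exact hl) (by
      apply θ.injective; rw [map_mul, θ.apply_symm_apply]; exact hr)
    exact ⟨d, by simp [hd]⟩
  · exact (h1 _ _).1 f.b_mem
  · exact (map_ne_zero_iff _ θ.injective).2 f.b_ne
  · simp [← map_mul, f.b_left]
  · simp [← map_mul, ← h2, f.b_phi]
  · rw [← h2, f.phi_b]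
  · symm
    refine LinearEquiv.finrank_eq (LinearEquiv.ofSubmodules θ.toLinearEquiv _ _ ?_)
    ext x
    simp only [Submodule.mem_map, mem_col]
    constructor
    · rintro ⟨y, ⟨hy, hy'⟩, rfl⟩
      refine ⟨(h1 _ _).1 hy, ?_⟩
      change θ y * θ (f.ι 1) = θ y
      rw [← map_mul, hy']
    · rintro ⟨hx, hx'⟩
      refine ⟨θ.symm x, ⟨?_, ?_⟩, θ.apply_symm_apply x⟩
      · rw [h1, θ.apply_symm_apply]; exact hx
      · apply θ.injective; rw [map_mul, θ.apply_symm_apply]; exact hx'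

theorem exists_idx {T : Subgroup (GSharp G)} {κ : (G ⧸ plus T) →₀ ℕ} (h : κ ≠ 0) :
    Nonempty (Idx κ) := by
  obtain ⟨x, hx⟩ := Finsupp.ne_iff.1 h
  exact ⟨⟨⟨x, Finsupp.mem_support_iff.2 hx⟩, ⟨0, Nat.pos_of_ne_zero hx⟩⟩⟩

variable {D D' : Type*} [Ring D] [Algebra F D] [Ring D']
  [Algebra F D'] {𝒟 : GSharp G → Submodule F D} {φ₀ : D →ₗ[F] D} {P P' : OddTriple G}
  {𝒟' : GSharp G → Submodule F D'} {φ₀' : D' →ₗ[F] D'}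

/-- Isomorphic models have the same parameters `(T, β̃, t_p)`. -/
theorem StdData.triple_eq (h2 : (2 : F) ≠ 0) (S : StdData P 𝒟 φ₀) (S' : StdData P' 𝒟' φ₀')
    {c : BlockChoice P.T 𝒟} {c' : BlockChoice P'.T 𝒟'} {κ : (G ⧸ plus P.T) →₀ ℕ}
    {κ' : (G ⧸ plus P'.T) →₀ ℕ} {g₀ g₀' : G} (hadm : IsAdmissible P.T 𝒟 φ₀ κ g₀)
    (hadm' : IsAdmissible P'.T 𝒟' φ₀' κ' g₀')
    (hiso : GradedIso (EGrading c κ) (EInv φ₀ c κ g₀) (EGrading c' κ') (EInv φ₀' c' κ' g₀')) :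
    P = P' := by
  obtain ⟨θ, h3, h4⟩ := hiso
  obtain ⟨j⟩ := exists_idx hadm.ne_zero
  obtain ⟨j'⟩ := exists_idx hadm'.ne_zero
  obtain ⟨f, -, -⟩ := S.exists_frame c h2 hadm j
  obtain ⟨f', -, -⟩ := S'.exists_frame c' h2 hadm' j'
  obtain ⟨f₁, -, -⟩ := f.exists_map (ψ := EInvL φ₀' c' κ' g₀') θ h3 h4
  exact Frame.triple_eq h2 (S'.isGrading_model c') (S'.isGradedPrime_model c')
    (S'.isGradedSuperinv_model c' h2 hadm') S f₁ S' f'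

/-- The degree of a frame together with the dimensions of the components of `Rε` is a complete
invariant up to a shift, and both are known for the models. -/
theorem StdData.gradedIso_iff (h2 : (2 : F) ≠ 0) [IsAlgClosed F] (S : StdData P 𝒟 φ₀)
    {c c' : BlockChoice P.T 𝒟} {κ κ' : (G ⧸ plus P.T) →₀ ℕ}
    {g₀ g₀' : G} (hadm : IsAdmissible P.T 𝒟 φ₀ κ g₀) (hadm' : IsAdmissible P.T 𝒟 φ₀ κ' g₀') :
    GradedIso (EGrading c κ) (EInv φ₀ c κ g₀) (EGrading c' κ') (EInv φ₀ c' κ' g₀') ↔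
      ∃ g : G, (∀ x : G, κ' (x : G ⧸ plus P.T) = κ ((g⁻¹ * x : G) : G ⧸ plus P.T)) ∧
        g₀' = g ^ (-2 : ℤ) * g₀ := by
  obtain ⟨j'⟩ := exists_idx hadm'.ne_zero
  obtain ⟨f', hf', hd'⟩ := S.exists_frame c' h2 hadm' j'
  have hfin' := S.finrank_col c' j'
  rw [← hf'] at hfin'
  constructor
  · rintro ⟨θ, h3, h4⟩
    obtain ⟨j⟩ := exists_idx hadm.ne_zero
    obtain ⟨f, hf, hd⟩ := S.exists_frame c h2 hadm j
    have hfin := S.finrank_col c j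
    rw [← hf] at hfin
    obtain ⟨f₁, hd₁, hfin₁⟩ := f.exists_map (ψ := EInvL φ₀ c' κ' g₀') θ h3 h4
    obtain ⟨s, hs, hs'⟩ := Frame.invariants_eq h2 (S.isGrading_model c')
      (S.isGradedPrime_model c') (S.isGradedSuperinv_model c' h2 hadm') S f₁ f'
    set a := c.ξ j.1
    set a' := c'.ξ j'.1
    -- The shift `s` compares the two basis elements; the degrees `a` and `a'` of those elements
    -- must be removed to compare the classes.
    refine ⟨a' * s⁻¹ * a⁻¹, fun x => ?_, ?_⟩
    · have h5 := hs' (x * a'⁻¹)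
      rw [hfin', hfin₁, hfin, inv_mul_cancel_right] at h5
      rw [h5]
      congr 2
      exact Additive.ofMul.injective (by simp only [ofMul_mul, ofMul_inv]; abel)
    · rw [hd', hd₁, hd, ← eq_mul_inv_iff_mul_eq] at hs
      rw [hs]
      exact Additive.ofMul.injective (by
        simp only [ofMul_mul, ofMul_inv, ofMul_pow, ofMul_zpow]; abel)
  · rintro ⟨g, hκ, rfl⟩
    have hD := S.finiteDimensional
    -- The second model is presented with the parameters of the first: the shift `g⁻¹ξ'(j')` is
    -- chosen so that `g₀'ξ'(j')²` equals `g₀` times its square.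
    refine (Frame.isAdmissible_and_gradedIso h2 (S.isGrading_model c')
      (S.isGradedPrime_model c') (S.isGradedSuperinv_model c' h2 hadm') S f' c κ g₀
      (g⁻¹ * c'.ξ j'.1) ?_ fun x => ?_).2.symm
    · rw [hd']
      exact Additive.ofMul.injective (by
        simp only [ofMul_mul, ofMul_inv, ofMul_pow, ofMul_zpow]; abel)
    · rw [hfin', hκ]
      congr 2
      exact Additive.ofMul.injective (by simp only [ofMul_mul, ofMul_inv]; abel)

end Iso

/-! ### Graded-simple algebras -/

section Simple

variable {F : Type*} [Field F] {R : Type*} [Ring R] [Algebra F R] {G : Type*} [CommGroup G]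
  {𝒜 : GSharp G → Submodule F R}

theorem IsGrading.mem_iSup_proj {H : Type*} [Group H] {𝒜 : H → Submodule F R} (h : IsGrading 𝒜)
    (x : R) : x ∈ ⨆ γ, Submodule.span F {h.proj γ x} := by
  have hx : x ∈ ⨆ g, 𝒜 g := h.span ▸ Submodule.mem_top
  obtain ⟨f, hf, hs⟩ := (Submodule.mem_iSup_iff_exists_finsupp _ _).1 hx
  have hp : ∀ γ, h.proj γ x = f γ := fun γ => by
    rw [← hs, Finsupp.sum, map_sum, Finset.sum_eq_single γ]
    · exact h.proj_same (hf γ)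
    · exact fun δ _ hδ => h.proj_ne (hf δ) hδ.symm
    · intro h0
      rw [Finsupp.notMem_support_iff.1 h0, map_zero]
  simp only [hp]
  rw [← hs]
  exact Submodule.sum_mem _ fun γ _ =>
    Submodule.mem_iSup_of_mem γ (Submodule.mem_span_singleton_self _)

/-- A subspace containing all components of an element contains the element. -/
theorem IsGrading.mem_of_proj_mem {H : Type*} [Group H] {𝒜 : H → Submodule F R}
    (h : IsGrading 𝒜) {V : Submodule F R} {x : R} (hx : ∀ γ, h.proj γ x ∈ V) : x ∈ V := by
  have : ⨆ γ, Submodule.span F {h.proj γ x} ≤ V :=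
    iSup_le fun γ => (Submodule.span_singleton_le_iff_mem _ _).2 (hx γ)
  exact this (h.mem_iSup_proj x)

/-- If `aRb = 0`, then `{x | xRb = 0}` is a graded ideal that contains `a` but, as `b ≠ 0`, not `1`.
-/
theorem IsGradedSimple.isGradedPrime (hs : IsGradedSimple 𝒜) (h : IsGrading 𝒜) :
    IsGradedPrime 𝒜 := by
  intro g k a b ha hb ha0 hb0
  by_contra! hc
  have hc' : ∀ s, a * s * b = 0 := fun s =>
    h.induction (p := fun s => a * s * b = 0) (fun δ s hs => hc δ s hs) (by simp)
      (fun x y hx hy => by rw [mul_add, add_mul, hx, hy, add_zero]) s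
  let I : Submodule F R :=
    { carrier := {x | ∀ s, x * s * b = 0}
      add_mem' := fun hx hy s => by rw [add_mul, add_mul, hx, hy, add_zero]
      zero_mem' := fun s => by simp
      smul_mem' := fun c x hx s => by rw [smul_mul_assoc, smul_mul_assoc, hx, smul_zero] }
  have hI : ∀ x, x ∈ I ↔ ∀ s, x * s * b = 0 := fun _ => Iff.rfl
  have hgr : I = ⨆ γ, I ⊓ 𝒜 γ := by
    refine le_antisymm (fun x hx => ?_) (iSup_le fun γ => inf_le_left)
    refine h.mem_of_proj_mem fun γ => Submodule.mem_iSup_of_mem γ ⟨fun s => ?_, h.proj_mem _ _⟩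
    refine h.induction (p := fun s => h.proj γ x * s * b = 0) (fun δ s hs => ?_) (by simp)
      (fun y z hy hz => by rw [mul_add, add_mul, hy, hz, add_zero]) s
    rw [mul_assoc, ← h.proj_mul_right (h.mul_mem _ _ _ _ hs hb), ← mul_assoc x, hx s, map_zero]
  rcases hs.2 I (fun r x hx => ⟨fun s => by rw [mul_assoc r, mul_assoc r, hx, mul_zero],
    fun s => by rw [mul_assoc x, hx]⟩) hgr with h1 | h1
  · have : a ∈ I := hc'
    rw [h1] at this
    exact ha0 (by simpa using this)
  · have : (1 : R) ∈ I := h1 ▸ Submodule.mem_top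
    have := this 1
    rw [one_mul, one_mul] at this
    exact hb0 this

/-- A finite-dimensional graded-prime algebra over an algebraically closed field contains a division
idempotent. -/
theorem IsGradedPrime.exists_isDivIdem [IsAlgClosed F] [FiniteDimensional F R] [Nontrivial R]
    (h : IsGrading 𝒜) (hp : IsGradedPrime 𝒜) : ∃ ε, IsDivIdem 𝒜 ε := by
  classical
  let L : R → Submodule F R := fun a => LinearMap.range (LinearMap.mulLeft F a)
  have hL : ∀ a x, x ∈ L a ↔ ∃ y, a * y = x := fun a x => Iff.rfl
  have hLm : ∀ a y, L (a * y) ≤ L a := by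
    rintro a y _ ⟨z, rfl⟩
    exact ⟨y * z, (mul_assoc a y z).symm⟩
  -- Choose `a ≠ 0` homogeneous with the right ideal `aR` of least dimension.
  have hex : ∃ n, ∃ γ, ∃ a ∈ 𝒜 γ, a ≠ 0 ∧ Module.finrank F (L a) = n :=
    ⟨_, 1, 1, h.one_mem, one_ne_zero, rfl⟩
  obtain ⟨g, a, ha, ha0, hn⟩ := Nat.find_spec hex
  have hmin : ∀ γ x, x ∈ 𝒜 γ → x ≠ 0 → L x ≤ L a → L x = L a := fun γ x hx hx0 hle =>
    Submodule.eq_of_le_of_finrank_le hle (by rw [hn]; exact Nat.find_min' hex ⟨γ, x, hx, hx0, rfl⟩)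
  -- Primeness gives `a r a ≠ 0`. By minimality `araR = aR`, so multiplication by `ar` is bijective
  -- on `aR`.
  obtain ⟨k, r, hr, hne⟩ := hp _ _ _ _ ha ha ha0 ha0
  have ham : a * r ∈ 𝒜 (g * k) := h.mul_mem _ _ _ _ ha hr
  have har0 : a * r ≠ 0 := fun h0 => hne (by rw [h0, zero_mul])
  have h1 : L (a * r) = L a := hmin _ _ ham har0 (hLm a r)
  have h2 : L (a * r * a) = L a :=
    hmin _ _ (h.mul_mem _ _ _ _ ham ha) hne ((hLm _ a).trans h1.le)
  have hmaps : ∀ x ∈ L a, LinearMap.mulLeft F (a * r) x ∈ L a := fun x hx =>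
    h1.le ⟨x, rfl⟩
  have hsurj : Function.Surjective ((LinearMap.mulLeft F (a * r)).restrict hmaps) := by
    rintro ⟨x, hx⟩
    rw [← h2] at hx
    obtain ⟨y, rfl⟩ := hx
    exact ⟨⟨a * y, y, rfl⟩, Subtype.ext (mul_assoc (a * r) a y).symm⟩
  have hinj := LinearMap.injective_iff_surjective.2 hsurj
  -- Solve `ar · x = ar` inside `aR`; the identity component of the solution will be the idempotent.
  obtain ⟨⟨x, y, hy⟩, hx⟩ := hsurj ⟨a * r, r, rfl⟩
  have hx' : a * r * (a * y) = a * r := by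
    have h3 := congrArg Subtype.val hx
    change a * y = x at hy
    rw [hy]
    exact h3
  have hεm : h.proj 1 (a * y) ∈ 𝒜 1 := h.proj_mem _ _
  have hεL : h.proj 1 (a * y) ∈ L a := ⟨h.proj g⁻¹ y, by
    rw [LinearMap.mulLeft_apply, ← h.proj_mul_left ha, mul_inv_cancel]⟩
  have hεa : a * r * h.proj 1 (a * y) = a * r := by
    rw [← h.proj_mul_left ham, hx', mul_one, h.proj_same ham]
  set ε := h.proj 1 (a * y) with hε
  -- `ε²` and `ε` have the same image under the injective multiplication by `ar`.
  have hεε : ε * ε = ε := by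
    have h3 : ε * ε ∈ L a := by
      obtain ⟨z, hz⟩ := hεL
      change a * z = ε at hz
      exact ⟨z * ε, by rw [LinearMap.mulLeft_apply, ← mul_assoc, hz]⟩
    have := @hinj ⟨ε * ε, h3⟩ ⟨ε, hεL⟩ (Subtype.ext (by
      change a * r * (ε * ε) = a * r * ε
      rw [← mul_assoc, hεa, hεa]))
    exact congrArg Subtype.val this
  have hε0 : ε ≠ 0 := fun h0 => har0 (by rw [← hεa, h0, mul_zero])
  have hLε : L ε = L a := by
    refine hmin _ _ hεm hε0 ?_
    obtain ⟨z, hz⟩ := hεL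
    change a * z = ε at hz
    rw [← hz]
    exact hLm a z
  -- By minimality `dR = aR`, which contains `ε`; this yields a right inverse of `d`.
  have hright : ∀ γ d, d ∈ 𝒜 γ → ε * d = d → d * ε = d → d ≠ 0 →
      ∃ d' ∈ 𝒜 γ⁻¹, ε * d' = d' ∧ d' * ε = d' ∧ d * d' = ε := by
    intro γ d hd hl hr h0
    have h3 : L d = L a := hmin _ _ hd h0 (by rw [← hLε, ← hl]; exact hLm ε d)
    have h4 : ε ∈ L d := h3 ▸ hεL
    obtain ⟨z, hz⟩ := h4
    change d * z = ε at hz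
    refine ⟨ε * h.proj γ⁻¹ z * ε, h.mul_mem' (h.mul_mem' hεm (h.proj_mem _ _) (one_mul _)) hεm
      (mul_one _), by rw [← mul_assoc, ← mul_assoc, hεε], by rw [mul_assoc, hεε], ?_⟩
    rw [← mul_assoc, ← mul_assoc, hr, ← h.proj_mul_left hd, mul_inv_cancel, hz, h.proj_same hεm,
      hεε]
  have hinv : ∀ γ d, d ∈ 𝒜 γ → ε * d = d → d * ε = d → d ≠ 0 →
      ∃ d' ∈ 𝒜 γ⁻¹, ε * d' = d' ∧ d' * ε = d' ∧ d * d' = ε ∧ d' * d = ε := by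
    intro γ d hd hl hr h0
    obtain ⟨d', hd', h3, h4, h5⟩ := hright γ d hd hl hr h0
    obtain ⟨d'', -, h6, -, h7⟩ := hright _ d' hd' h3 h4 (by
      rintro rfl
      exact hε0 (by rw [← h5, mul_zero]))
    have : d = d'' := by rw [← hr, ← h7, ← mul_assoc, h5, h6]
    exact ⟨d', hd', h3, h4, h5, by rw [this, h7]⟩
  refine ⟨ε, hεm, hεε, hε0, hinv, fun d hd hl hr => ?_⟩
  -- Multiplication by `d` on the identity component of the corner has an eigenvalue `c`; then `d -
  -- cε` is not invertible, hence zero.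
  let W : Submodule F R := 𝒜 1 ⊓ LinearMap.ker (LinearMap.mulLeft F ε - LinearMap.id) ⊓
    LinearMap.ker (LinearMap.mulRight F ε - LinearMap.id)
  have hW : ∀ x, x ∈ W ↔ (x ∈ 𝒜 1 ∧ ε * x = x) ∧ x * ε = x := fun x => by
    simp [W, sub_eq_zero]
  have hdW : ∀ x ∈ W, LinearMap.mulLeft F d x ∈ W := fun x hx => by
    rw [hW] at hx ⊢
    exact ⟨⟨h.mul_mem' hd hx.1.1 (one_mul 1), by rw [LinearMap.mulLeft_apply, ← mul_assoc, hl]⟩,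
      by rw [LinearMap.mulLeft_apply, mul_assoc, hx.2]⟩
  have : Nontrivial W := ⟨⟨⟨ε, (hW _).2 ⟨⟨hεm, hεε⟩, hεε⟩⟩, 0, fun h0 =>
    hε0 (congrArg Subtype.val h0)⟩⟩
  obtain ⟨c, hc⟩ := Module.End.exists_eigenvalue ((LinearMap.mulLeft F d).restrict hdW)
  obtain ⟨v, hv⟩ := hc.exists_hasEigenvector
  have hv1 : d * v = c • (v : R) := congrArg Subtype.val hv.apply_eq_smul
  refine ⟨c, ?_⟩
  by_contra hne
  obtain ⟨d', -, -, -, -, h3⟩ := hinv 1 (d - c • ε)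
    (sub_mem hd (Submodule.smul_mem _ _ hεm)) (by rw [mul_sub, hl, mul_smul_comm, hεε])
    (by rw [sub_mul, hr, smul_mul_assoc, hεε]) (sub_ne_zero.2 hne)
  obtain ⟨⟨-, h4⟩, -⟩ := (hW _).1 v.2
  apply hv.2
  apply Subtype.ext
  change (v : R) = 0
  rw [← h4, ← h3, mul_assoc, sub_mul, hv1, smul_mul_assoc, h4, sub_self, mul_zero]

end Simple

/-! ### The structure of a graded-prime algebra around a division idempotent -/

section Corner

variable {F : Type*} [Field F] {R : Type*} [Ring R] [Algebra F R] {G : Type*} [CommGroup G]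
  {𝒜 : GSharp G → Submodule F R} {ε : R}

theorem IsGrading.finite_support [FiniteDimensional F R] (h : IsGrading 𝒜) :
    {γ | 𝒜 γ ≠ ⊥}.Finite :=
  WellFoundedGT.finite_ne_bot_of_iSupIndep h.indep

theorem IsDivIdem.mul_ne_zero (he : IsDivIdem 𝒜 ε) {γ : GSharp G} {x d : R} (hx : x * ε = x)
    (hx0 : x ≠ 0) (hd : d ∈ 𝒜 γ) (hl : ε * d = d) (hr : d * ε = d) (h0 : d ≠ 0) : x * d ≠ 0 := by
  obtain ⟨d', -, -, -, h1, -⟩ := he.inv _ _ hd hl hr h0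
  intro h2
  apply hx0
  rw [← hx, ← h1, ← mul_assoc, h2, zero_mul]

theorem IsDivIdem.mul_ne_zero' (he : IsDivIdem 𝒜 ε) {γ : GSharp G} {x d : R} (hx : ε * x = x)
    (hx0 : x ≠ 0) (hd : d ∈ 𝒜 γ) (hl : ε * d = d) (hr : d * ε = d) (h0 : d ≠ 0) : d * x ≠ 0 := by
  obtain ⟨d', -, -, -, -, h1⟩ := he.inv _ _ hd hl hr h0
  intro h2
  apply hx0
  rw [← hx, ← h1, mul_assoc, h2, mul_zero]

/-- The support of the corner at a division idempotent. -/
def cornerSupport (h : IsGrading 𝒜) (he : IsDivIdem 𝒜 ε) : Subgroup (GSharp G) where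
  carrier := {γ | ∃ d ∈ 𝒜 γ, ε * d = d ∧ d * ε = d ∧ d ≠ 0}
  mul_mem' := by
    rintro _ _ ⟨d, hd, h1, h2, h3⟩ ⟨d', hd', h1', h2', h3'⟩
    exact ⟨d * d', h.mul_mem _ _ _ _ hd hd', by rw [← mul_assoc, h1], by rw [mul_assoc, h2'],
      he.mul_ne_zero h2 h3 hd' h1' h2' h3'⟩
  one_mem' := ⟨ε, he.mem, he.idem, he.idem, he.ne_zero⟩
  inv_mem' := by
    rintro _ ⟨d, hd, h1, h2, h3⟩
    obtain ⟨d', hd', h4, h5, h6, -⟩ := he.inv _ _ hd h1 h2 h3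
    exact ⟨d', hd', h4, h5, by rintro rfl; exact he.ne_zero (by rw [← h6, mul_zero])⟩

theorem mem_cornerSupport (h : IsGrading 𝒜) (he : IsDivIdem 𝒜 ε) {γ : GSharp G} :
    γ ∈ cornerSupport h he ↔ ∃ d ∈ 𝒜 γ, ε * d = d ∧ d * ε = d ∧ d ≠ 0 := Iff.rfl

theorem finite_cornerSupport [FiniteDimensional F R] (h : IsGrading 𝒜) (he : IsDivIdem 𝒜 ε) :
    Finite (cornerSupport h he) :=
  (h.finite_support.subset (fun γ hγ h0 => by
    obtain ⟨d, hd, -, -, h3⟩ := (mem_cornerSupport h he).1 hγ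
    rw [h0] at hd
    exact h3 (by simpa using hd))).to_subtype

/-- A graded-prime algebra has a complete system of matrix units at every division idempotent. -/
theorem IsDivIdem.exists_decomposition [FiniteDimensional F R] (h : IsGrading 𝒜)
    (hp : IsGradedPrime 𝒜) (he : IsDivIdem 𝒜 ε) :
    ∃ (k : ℕ) (γ : Fin k → GSharp G) (e e' : Fin k → R), (∀ i, e i ∈ 𝒜 (γ i)) ∧
      (∀ i, e' i ∈ 𝒜 (γ i)⁻¹) ∧ (∀ i, e i * ε = e i) ∧ (∀ i, ε * e' i = e' i) ∧
      (∀ i j, e' i * e j = if i = j then ε else 0) ∧ ∑ i, e i * e' i = 1 := by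
  classical
  set T := cornerSupport h he with hT
  -- Components of `Rε` whose degrees agree modulo `T` are carried to each other by units of the
  -- corner, so one representative per coset is enough.
  let J := {x : GSharp G ⧸ T // col 𝒜 ε x.out ≠ ⊥}
  have : Finite J := by
    have h1 : Finite {γ | 𝒜 γ ≠ ⊥} := h.finite_support.to_subtype
    refine Finite.of_injective (fun j : J => (⟨j.1.out, fun h0 => j.2 ?_⟩ : {γ | 𝒜 γ ≠ ⊥}))
      fun j k hjk => Subtype.ext (Quotient.out_injective (congrArg Subtype.val hjk))
    exact le_bot_iff.1 ((inf_le_left (a := 𝒜 j.1.out)).trans h0.le)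
  let _ : Fintype J := Fintype.ofFinite J
  let n : J → ℕ := fun j => Module.finrank F (col 𝒜 ε j.1.out)
  let bs := fun j : J => Module.finBasis F (col 𝒜 ε j.1.out)
  have hm : ∀ (j : J) (i : Fin (n j)), ((bs j i : col 𝒜 ε j.1.out) : R) ∈ col 𝒜 ε j.1.out :=
    fun j i => (bs j i).2
  have hli : ∀ j : J, LinearIndependent F fun i : Fin (n j) => ((bs j i : col 𝒜 ε j.1.out) : R) :=
    fun j => (bs j).linearIndependent.map' (Submodule.subtype _) (Submodule.ker_subtype _)
  obtain ⟨e', h1, h2, h3, h4⟩ := exists_complete_dual_family h hp he (J := J)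
    (n := n) (ρ := fun j => j.1.out) (fun j => rfl) (fun j i => bs j i) hm hli
    (fun j k hjk d hd h5 h6 => by
      by_contra h0
      apply hjk
      apply Subtype.ext
      have h7 : (j.1.out)⁻¹ * k.1.out ∈ T := ⟨d, hd, h5, h6, h0⟩
      have := QuotientGroup.eq.2 h7
      rwa [QuotientGroup.out_eq', QuotientGroup.out_eq'] at this)
    (fun γ v hv h0 => by
      have h5 : ((γ : GSharp G ⧸ T).out)⁻¹ * γ ∈ T := QuotientGroup.eq.1 (QuotientGroup.out_eq' _)
      obtain ⟨d, hd, h6, h7, h8⟩ := T.inv_mem h5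
      obtain ⟨d', hd', h9, h10, h11⟩ := h5
      rw [mul_inv, inv_inv] at hd
      obtain ⟨hv1, hv2⟩ := mem_col.1 hv
      refine ⟨⟨γ, fun hb => ?_⟩, d', hd', h9, h10, h11⟩
      have h12 : v * d ∈ col 𝒜 ε (γ : GSharp G ⧸ T).out := mem_col.2
        ⟨h.mul_mem' hv1 hd (by rw [mul_comm, mul_assoc, inv_mul_cancel, mul_one]),
          by rw [mul_assoc, h7]⟩
      rw [hb] at h12
      exact he.mul_ne_zero hv2 h0 hd h6 h7 h8 (by simpa using h12))
  let E := (Fintype.equivFin (Σ j, Fin (n j))).symm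
  refine ⟨_, fun i => (E i).1.1.out, fun i => bs (E i).1 (E i).2, fun i => e' (E i),
    fun i => (mem_col.1 (hm _ _)).1, fun i => h1 _, fun i => (mem_col.1 (hm _ _)).2, fun i => h2 _,
    fun i j => ?_, ?_⟩
  · rw [h3]
    simp only [E.injective.eq_iff]
  · rw [← h4]
    exact E.sum_comp (fun i => ((bs i.1 i.2 : col 𝒜 ε i.1.1.out) : R) * e' i)

/-- An element of the center of the corner extends to a central element. -/
theorem IsDivIdem.exists_central [FiniteDimensional F R] (h : IsGrading 𝒜)
    (hp : IsGradedPrime 𝒜) (he : IsDivIdem 𝒜 ε) {γ : GSharp G} {d : R} (hd : d ∈ 𝒜 γ)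
    (hl : ε * d = d) (hr : d * ε = d) (hc : ∀ x, ε * x = x → x * ε = x → d * x = x * d) :
    ∃ z ∈ 𝒜 γ, (∀ r, z * r = r * z) ∧ ε * z = d := by
  obtain ⟨k, ρ, e, e', h1, h2, h3, h4, h5, h6⟩ := he.exists_decomposition h hp
  -- The scalar matrix with diagonal entry `d`, in the coordinates given by the matrix units.
  refine ⟨∑ i, e i * d * e' i, Submodule.sum_mem _ fun i _ => h.mul_mem' (h.mul_mem _ _ _ _ (h1 i)
    hd) (h2 i) (by rw [mul_comm, inv_mul_cancel_left]), fun r => ?_, ?_⟩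
  · have key : ∀ i j, d * (e' i * r * e j) = e' i * r * e j * d := fun i j =>
      hc _ (by rw [← mul_assoc, ← mul_assoc, h4]) (by rw [mul_assoc, h3])
    calc (∑ i, e i * d * e' i) * r = (∑ i, e i * d * e' i) * r * ∑ j, e j * e' j := by
          rw [h6, mul_one]
      _ = ∑ i, ∑ j, e i * (d * (e' i * r * e j)) * e' j := by
          simp only [Finset.sum_mul, Finset.mul_sum, mul_assoc]
          exact Finset.sum_comm
      _ = ∑ i, ∑ j, e i * (e' i * r * e j * d) * e' j := by simp only [key]
      _ = (∑ i, e i * e' i) * r * ∑ j, e j * d * e' j := by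
          simp only [Finset.sum_mul, Finset.mul_sum, mul_assoc]
          exact Finset.sum_comm
      _ = r * ∑ j, e j * d * e' j := by rw [h6, one_mul]
  · calc ε * ∑ i, e i * d * e' i = ∑ i, ε * e i * d * e' i := by
          simp only [Finset.mul_sum, mul_assoc]
      _ = ∑ i, d * (ε * e i) * e' i := by
          refine Finset.sum_congr rfl fun i _ => ?_
          rw [hc (ε * e i) (by rw [← mul_assoc, he.idem]) (by rw [mul_assoc, h3])]
      _ = d * ε * ∑ i, e i * e' i := by
          simp only [Finset.mul_sum, mul_assoc]
      _ = d := by rw [h6, mul_one, hr]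

/-- The corner is made a ring in the universe of `R`, so that it is among the algebras `D` over
which `IsOddlyGraded` quantifies. -/
theorem exists_corner_algebra {R : Type w} [Ring R] [Algebra F R] {ε : R} (hε : ε * ε = ε) :
    ∃ (D : Type w) (_ : Ring D) (_ : Algebra F D) (ι : D →ₗ[F] R), ι 1 = ε ∧
      (∀ x y, ι (x * y) = ι x * ι y) ∧ Function.Injective ι ∧
      (∀ d, ε * ι d = ι d ∧ ι d * ε = ι d) ∧ ∀ r, ε * r = r → r * ε = r → ∃ d, ι d = r := by
  have hi : IsIdempotentElem ε := hε
  let W : Submodule F R := LinearMap.ker (LinearMap.mulLeft F ε - LinearMap.id) ⊓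
    LinearMap.ker (LinearMap.mulRight F ε - LinearMap.id)
  have hW : ∀ x, x ∈ W ↔ ε * x = x ∧ x * ε = x := fun x => by simp [W, sub_eq_zero]
  let _ : Mul W := ⟨fun x y => ⟨x * y, (hW _).2
    ⟨by rw [← mul_assoc, ((hW _).1 x.2).1], by rw [mul_assoc, ((hW _).1 y.2).2]⟩⟩⟩
  let _ : One W := ⟨⟨ε, (hW _).2 ⟨hε, hε⟩⟩⟩
  let ring : Ring W :=
    { (inferInstance : AddCommGroup W) with
      left_distrib := fun x y z => Subtype.ext (mul_add (x : R) y z)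
      right_distrib := fun x y z => Subtype.ext (add_mul (x : R) y z)
      zero_mul := fun x => Subtype.ext (zero_mul (x : R))
      mul_zero := fun x => Subtype.ext (mul_zero (x : R))
      mul_assoc := fun x y z => Subtype.ext (mul_assoc (x : R) y z)
      one_mul := fun x => Subtype.ext ((hW _).1 x.2).1
      mul_one := fun x => Subtype.ext ((hW _).1 x.2).2 }
  let alg : Algebra F W := Algebra.ofModule
    (fun c x y => Subtype.ext (smul_mul_assoc c (x : R) y))
    (fun c x y => Subtype.ext (mul_smul_comm c (x : R) y))
  exact ⟨W, ring, alg, W.subtype, rfl, fun x y => rfl, Subtype.val_injective,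
    fun d => (hW _).1 d.2, fun r h1 h2 => ⟨⟨r, (hW _).2 ⟨h1, h2⟩⟩, rfl⟩⟩

end Corner

/-! ### Odd elements in the corner of an oddly graded algebra -/

section Odd

variable {F : Type u} [Field F] {R : Type u} [Ring R] [Algebra F R] {G : Type v} [CommGroup G]
  {𝒜 : GSharp G → Submodule F R} {ε : R}

/-- The corner of an oddly graded algebra contains an odd element. -/
theorem IsOddlyGraded.exists_odd [FiniteDimensional F R] (ho : IsOddlyGraded 𝒜) (h : IsGrading 𝒜)
    (hp : IsGradedPrime 𝒜) (he : IsDivIdem 𝒜 ε) :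
    ∃ γ, par γ = 1 ∧ ∃ d ∈ 𝒜 γ, ε * d = d ∧ d * ε = d ∧ d ≠ 0 := by
  obtain ⟨k, ρ, e, e', h1, h2, h3, h4, h5, h6⟩ := he.exists_decomposition h hp
  obtain ⟨D, _, _, ι, hι1, hιm, hιi, hιc, hιs⟩ := exists_corner_algebra (F := F) he.idem
  obtain ⟨θ, hθ⟩ := exists_matrix_coordinates ι hιm hιi (by rwa [hι1]) e e' (by rwa [hι1])
    (by rwa [hι1]) (by rwa [hι1]) h6
  -- With the pulled-back grading the corner is graded-division and presents the algebra as a graded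
  -- matrix algebra, so oddness applies to it.
  let 𝒟 : GSharp G → Submodule F D := fun γ => (𝒜 γ).comap ι
  have hιd : ∀ γ d, ι d ∈ 𝒜 γ ↔ d ∈ 𝒟 γ := fun _ _ => Iff.rfl
  have hD : IsGradedDivision 𝒟 := by
    refine ⟨⟨?_, ?_, fun g k a b ha hb => ?_⟩, fun h0 => ?_, fun γ d hd h0 => ?_⟩
    · rw [iSupIndep_def]
      intro γ
      rw [Submodule.disjoint_def]
      intro d hd hd'
      have h7 : ⨆ k, ⨆ (_ : k ≠ γ), 𝒟 k ≤ LinearMap.ker (h.proj γ ∘ₗ ι) :=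
        iSup₂_le fun k hk x hx => h.proj_ne hx hk.symm
      apply hιi
      rw [map_zero, ← h.proj_same hd]
      exact h7 hd'
    · rw [eq_top_iff]
      intro d _
      have hpr : ∀ γ, ∃ d', ι d' = h.proj γ (ι d) := fun γ => by
        refine hιs _ ?_ ?_
        · have := h.proj_mul_left he.mem γ (ι d)
          rwa [(hιc d).1, one_mul, eq_comm] at this
        · have := h.proj_mul_right he.mem γ (ι d)
          rwa [(hιc d).2, mul_one, eq_comm] at this
      have : ι d ∈ (⨆ γ, 𝒟 γ).map ι := h.mem_of_proj_mem fun γ => by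
        obtain ⟨d', hd'⟩ := hpr γ
        rw [← hd']
        refine Submodule.mem_map_of_mem (Submodule.mem_iSup_of_mem γ ?_)
        rw [← hιd, hd']
        exact h.proj_mem _ _
      obtain ⟨d', hd', h7⟩ := this
      rwa [← hιi h7]
    · rw [← hιd] at ha hb ⊢
      rw [hιm]
      exact h.mul_mem _ _ _ _ ha hb
    · apply he.ne_zero
      rw [← hι1, h0, map_zero]
    · rw [← hιd] at hd
      obtain ⟨y, -, h7, h8, h9, h10⟩ := he.inv γ _ hd (hιc d).1 (hιc d).2
        ((map_ne_zero_iff _ hιi).2 h0)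
      obtain ⟨y, rfl⟩ := hιs y h7 h8
      exact isUnit_iff_exists.2 ⟨y, hιi (by rw [hιm, h9, hι1]), hιi (by rw [hιm, h10, hι1])⟩
  obtain ⟨γ, hγ, hne⟩ := ho D 𝒟 hD k ρ θ (fun g r =>
    mem_iff_matGrading h hιd h1 h2 h6 hθ g r)
  obtain ⟨d, hd, h0⟩ := Submodule.exists_mem_ne_zero_of_ne_bot hne
  exact ⟨γ, hγ, ι d, hd, (hιc d).1, (hιc d).2, (map_ne_zero_iff _ hιi).2 h0⟩

end Odd

/-! ### The bicharacter of a corner -/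

/-- A sign character that is trivial on the radical of a bicharacter is induced by it. -/
theorem exists_eq_of_trivial_on_radical {T : Type*} [CommGroup T] [Finite T] (β : T →* T →* ℤˣ)
    (χ : T →* ℤˣ) (hχ : ∀ t, (∀ s, β s t = 1) → χ t = 1) : ∃ s, β s = χ := by
  classical
  have := Fintype.ofFinite T
  by_contra! hne
  -- Double counting. If no `β(s,·)` equals `χ`, orthogonality makes every sum over `t` vanish.
  -- Summing over `s` first leaves `|T|` times a sum of `χ` over the radical, which is positive
  -- since `χ = 1` there.
  have h1 : ∑ t, ∑ s, ((χ t * β s t : ℤˣ) : ℤ) = 0 := by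
    rw [Finset.sum_comm]
    refine Finset.sum_eq_zero fun s _ => ?_
    have h3 := sum_hom_units ((Units.coeHom ℤ).comp (χ * β s))
    rw [if_neg] at h3
    · simpa using h3
    · intro h4
      apply hne s
      ext t
      have h5 := DFunLike.congr_fun h4 t
      simp only [MonoidHom.comp_apply, MonoidHom.mul_apply, Units.coeHom_apply,
        MonoidHom.one_apply, Units.val_eq_one] at h5
      rw [(by decide : ∀ a b : ℤˣ, a * b = 1 → b = a) _ _ h5]
  have h2 : ∀ t, 0 ≤ ∑ s, ((χ t * β s t : ℤˣ) : ℤ) ∧ (t = 1 → 0 < ∑ s, ((χ t * β s t : ℤˣ) : ℤ)) := by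
    intro t
    have h3 := sum_hom_units ((Units.coeHom ℤ).comp (β.flip t))
    simp only [MonoidHom.comp_apply, MonoidHom.flip_apply, Units.coeHom_apply] at h3
    have h4 : ∑ s, ((χ t * β s t : ℤˣ) : ℤ) = (χ t : ℤ) * ∑ s, (β s t : ℤ) := by
      rw [Finset.mul_sum]
      exact Finset.sum_congr rfl fun s _ => Units.val_mul _ _
    rw [h4, h3]
    split_ifs with h5
    · have h6 : ∀ s, β s t = 1 := fun s => by
        have := DFunLike.congr_fun h5 s
        simpa using this
      rw [hχ t h6]
      have : 0 < Fintype.card T := Fintype.card_pos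
      simp only [Units.val_one, one_mul, Nat.cast_nonneg, Nat.cast_pos, true_and]
      exact fun _ => this
    · refine ⟨by simp, fun h6 => absurd ?_ h5⟩
      subst h6
      ext s
      simp
  have h3 := Finset.sum_pos' (fun t _ => (h2 t).1) ⟨1, Finset.mem_univ _, (h2 1).2 rfl⟩
  omega

section Signs

variable {F : Type*} [Field F] {R : Type*} [Ring R] [Algebra F R] {G : Type*} [CommGroup G]

/-- The corner at a division idempotent `ε`, with a homogeneous basis `X`, an even generator `b` of
`ε R φ(ε)`, and the signs through which `φ` acts. -/
structure SignedCorner (𝒜 : GSharp G → Submodule F R) (φ : R →ₗ[F] R) (ε : R)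
    (T : Subgroup (GSharp G)) where
  X : T → R
  η : T → ℤˣ
  b : R
  deg : G
  δ : ℤˣ
  X_mem : ∀ t : T, X t ∈ 𝒜 t
  X_left : ∀ t, ε * X t = X t
  X_right : ∀ t, X t * ε = X t
  X_ne : ∀ t, X t ≠ 0
  exists_coeff : ∀ (t : T) d, d ∈ 𝒜 t → ε * d = d → d * ε = d → ∃ c : F, d = c • X t
  mem_T : ∀ γ d, d ∈ 𝒜 γ → ε * d = d → d * ε = d → d ≠ 0 → γ ∈ T
  b_mem : b ∈ 𝒜 (deg, 1)
  b_ne : b ≠ 0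
  b_left : ε * b = b
  phi_b : φ b = δ • b
  b_phi : ∀ t, b * φ (X t) = η t • (X t * b)

variable {𝒜 : GSharp G → Submodule F R} {φ : R →ₗ[F] R} {ε : R} {T : Subgroup (GSharp G)}

/-- The components of the corner and of `εRφ(ε)` are lines, by dividing by a unit. Degree-preserving
maps act on lines by scalars, and these scalars square to `1` because `φ` is an involution. -/
theorem exists_signedCorner (h : IsGrading 𝒜) (hp : IsGradedPrime 𝒜)
    (hφ : IsGradedSuperinv 𝒜 φ) (he : IsDivIdem 𝒜 ε)
    (hodd : ∃ γ, par γ = 1 ∧ ∃ d ∈ 𝒜 γ, ε * d = d ∧ d * ε = d ∧ d ≠ 0) :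
    Nonempty (SignedCorner 𝒜 φ ε (cornerSupport h he)) := by
  set T := cornerSupport h he
  have hX : ∀ t : T, ∃ d ∈ 𝒜 (t : GSharp G), ε * d = d ∧ d * ε = d ∧ d ≠ 0 := fun t => t.2
  choose X hXm hXl hXr hX0 using hX
  have hco : ∀ (t : T) d, d ∈ 𝒜 (t : GSharp G) → ε * d = d → d * ε = d → ∃ c : F, d = c • X t := by
    intro t d hd h1 h2
    obtain ⟨y, hy, h3, h4, h5, h6⟩ := he.inv _ _ (hXm t) (hXl t) (hXr t) (hX0 t)
    obtain ⟨c, hc⟩ := he.scalar (d * y) (h.mul_mem' hd hy (mul_inv_cancel _))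
      (by rw [← mul_assoc, h1]) (by rw [mul_assoc, h4])
    exact ⟨c, by rw [← h2, ← h6, ← mul_assoc, hc, smul_mul_assoc, hXl]⟩
  have hεm : ε ∈ 𝒜 ((1 : G), 1) := he.mem
  have heφ := hφ.isDivIdem h he
  obtain ⟨g, b, hbm, hbl, hbr, hb0⟩ : ∃ g : G, ∃ b ∈ 𝒜 (g, 1), ε * b = b ∧ b * φ ε = b ∧ b ≠ 0 := by
    obtain ⟨⟨g, i⟩, b, hb, h1, h2, h0⟩ := hp.exists_corner h he heφ
    by_cases hi : i = 1
    · exact ⟨g, b, hi ▸ hb, h1, h2, h0⟩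
    -- The odd unit of the corner turns an odd generator into an even one.
    · obtain ⟨γ, hγ, d, hd, h3, h4, h5⟩ := hodd
      refine ⟨γ.1 * g, d * b, h.mul_mem' hd hb ?_, by rw [← mul_assoc, h3],
        by rw [mul_assoc, h2], he.mul_ne_zero' h1 h0 hd h3 h4 h5⟩
      refine Prod.ext rfl ?_
      change Multiplicative.ofAdd (par γ + Multiplicative.toAdd i) = 1
      have : Multiplicative.toAdd i ≠ 0 := hi
      rw [hγ, (show ∀ k : ZMod 2, k ≠ 0 → 1 + k = 0 by decide) _ this]
      rfl
  obtain ⟨b', hb', h1, h2, h3, h4⟩ := he.exists_inv h hp heφ hbm hbl hbr hb0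
  have hφb : φ b ∈ 𝒜 (g, 1) := hφ.map_mem _ _ hbm
  have hφbl : ε * φ b = φ b := by
    conv_rhs => rw [← hbr, hφ.mul_even_left h hbm, hφ.invol]
  have hφbr : φ b * φ ε = φ b := by
    rw [← hφ.mul_even_left h hεm, hbl]
  obtain ⟨δ, hδ⟩ : ∃ δ : ℤˣ, φ b = δ • b := by
    obtain ⟨c, hc⟩ := he.scalar (φ b * b') (h.mul_mem' hφb hb' (mul_inv_cancel _))
      (by rw [← mul_assoc, hφbl]) (by rw [mul_assoc, h2])
    have h5 : φ b = c • b := by rw [← hφbr, ← h4, ← mul_assoc, hc, smul_mul_assoc, hbl]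
    have h6 : (c * c) • b = (1 : F) • b := by
      conv_rhs => rw [one_smul, ← hφ.invol b, h5, map_smul, h5]
      rw [smul_smul]
    rcases mul_self_eq_one_iff.1 (smul_left_injective F hb0 h6) with rfl | rfl
    · exact ⟨1, by rw [h5]; simp⟩
    · exact ⟨-1, by rw [h5]; simp⟩
  have hη : ∀ t, ∃ η : ℤˣ, b * φ (X t) = η • (X t * b) := by
    intro t
    have hXφ : φ (X t) * φ ε = φ (X t) := by rw [← hφ.mul_even_left h hεm, hXl]
    obtain ⟨c, hc⟩ := hco t (b * φ (X t) * b')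
      (h.mul_mem' (h.mul_mem _ _ _ _ hbm (hφ.map_mem _ _ (hXm t))) hb'
        (by rw [mul_comm, inv_mul_cancel_left]))
      (by rw [← mul_assoc, ← mul_assoc, hbl]) (by rw [mul_assoc, h2])
    have h5 : b * φ (X t) = c • (X t * b) := by
      rw [← hXφ, ← h4, ← mul_assoc, ← mul_assoc, hc, smul_mul_assoc]
    have hne : X t * b ≠ 0 := he.mul_ne_zero' hbl hb0 (hXm t) (hXl t) (hXr t) (hX0 t)
    -- Applying `φ` to `bφ(X_t) = cX_t b` and using `φ(b) = δb` gives the same relation read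
    -- backwards, whence `c² = 1`.
    have h6 : δ • (X t * b) = δ • ((c * c) • (X t * b)) := by
      have h7 := congrArg φ h5
      rw [hφ.mul_even_left h hbm, hφ.invol, hδ, map_smul, hφ.mul_even_right h hbm, hδ,
        mul_smul_comm, smul_mul_assoc, h5] at h7
      rw [h7, smul_comm c δ, smul_smul]
    have h7 : (c * c) • (X t * b) = (1 : F) • (X t * b) := by
      rw [one_smul]
      have := congrArg (fun x => δ • x) h6
      simpa only [units_mul_self_smul] using this.symm
    rcases mul_self_eq_one_iff.1 (smul_left_injective F hne h7) with rfl | rfl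
    · exact ⟨1, by rw [h5]; simp⟩
    · exact ⟨-1, by rw [h5]; simp⟩
  choose η hη using hη
  exact ⟨⟨X, η, b, g, δ, hXm, hXl, hXr, hX0, hco, fun γ d hd h5 h6 h7 => ⟨d, hd, h5, h6, h7⟩,
    hbm, hb0, hbl, hδ, hη⟩⟩

namespace SignedCorner

variable (C : SignedCorner 𝒜 φ ε T)
include C

theorem X_mul_ne (he : IsDivIdem 𝒜 ε) (s t : T) : C.X s * C.X t ≠ 0 :=
  he.mul_ne_zero (C.X_right s) (C.X_ne s) (C.X_mem t) (C.X_left t) (C.X_right t) (C.X_ne t)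

theorem exists_mul (h : IsGrading 𝒜) (he : IsDivIdem 𝒜 ε) (s t : T) :
    ∃ c : F, c ≠ 0 ∧ C.X s * C.X t = c • C.X (s * t) := by
  obtain ⟨c, hc⟩ := C.exists_coeff (s * t) (C.X s * C.X t)
    (h.mul_mem _ _ _ _ (C.X_mem s) (C.X_mem t))
    (by rw [← mul_assoc, C.X_left]) (by rw [mul_assoc, C.X_right])
  refine ⟨c, ?_, hc⟩
  rintro rfl
  exact C.X_mul_ne he s t (by rw [hc, zero_smul])

theorem b_right (h : IsGrading 𝒜) (hφ : IsGradedSuperinv 𝒜 φ) (he : IsDivIdem 𝒜 ε) :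
    C.b * φ ε = C.b := by
  have h1 : φ C.b * φ ε = φ C.b := by
    rw [← hφ.mul_even_left h (g := 1) he.mem, C.b_left]
  rw [C.phi_b, smul_mul_assoc] at h1
  have := congrArg (fun x => C.δ • x) h1
  simpa only [units_mul_self_smul] using this

theorem mul_b_cancel (h : IsGrading 𝒜) (hp : IsGradedPrime 𝒜) (hφ : IsGradedSuperinv 𝒜 φ)
    (he : IsDivIdem 𝒜 ε) {x y : R} (hx : x * ε = x) (hy : y * ε = y) (hxy : x * C.b = y * C.b) :
    x = y := by
  obtain ⟨b', -, -, -, h3, -⟩ := he.exists_inv h hp (hφ.isDivIdem h he) C.b_mem C.b_left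
    (C.b_right h hφ he) C.b_ne
  rw [← hx, ← hy, ← h3, ← mul_assoc, hxy, mul_assoc]

/-- Compute `bφ(X_s X_t)` twice: as `η(st)X_s X_t b`, since `X_s X_t` lies on the line of `X_{st}`,
and as the super-sign times `η(s)η(t)X_t X_s b`. Then cancel `b`. -/
theorem comm (h : IsGrading 𝒜) (hp : IsGradedPrime 𝒜) (hφ : IsGradedSuperinv 𝒜 φ)
    (he : IsDivIdem 𝒜 ε) (s t : T) :
    C.X s * C.X t = ((-1) ^ (par (s : GSharp G) * par (t : GSharp G)) *
      (C.η s * C.η t * C.η (s * t))) • (C.X t * C.X s) := by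
  obtain ⟨c, hc, h1⟩ := C.exists_mul h he s t
  have h2 : C.b * φ (C.X s * C.X t) = C.η (s * t) • (C.X s * C.X t * C.b) := by
    rw [h1, map_smul, mul_smul_comm, C.b_phi, smul_mul_assoc, smul_comm]
  rw [hφ.map_mul _ _ _ _ (C.X_mem s) (C.X_mem t), mul_smul_comm, ← mul_assoc, C.b_phi,
    smul_mul_assoc, mul_assoc, C.b_phi, mul_smul_comm, ← mul_assoc, smul_smul, smul_smul] at h2
  have h3 := congrArg (fun x => C.η (s * t) • x) h2
  simp only [smul_smul, Int.units_mul_self, one_smul] at h3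
  refine C.mul_b_cancel h hp hφ he (by rw [mul_assoc, C.X_right])
    (by rw [smul_mul_assoc, mul_assoc (C.X t), C.X_right]) ?_
  rw [← h3, smul_mul_assoc]
  congr 1
  exact (by decide : ∀ a b c d : ℤˣ, d * (a * b * c) = a * (c * b * d)) _ _ _ _

theorem eta_one (h2 : (2 : F) ≠ 0) (h : IsGrading 𝒜) (hφ : IsGradedSuperinv 𝒜 φ)
    (he : IsDivIdem 𝒜 ε) : C.η 1 = 1 := by
  obtain ⟨c, hc⟩ := C.exists_coeff 1 ε he.mem he.idem he.idem
  have hc0 : c ≠ 0 := by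
    rintro rfl
    exact he.ne_zero (by rw [hc, zero_smul])
  have h1 : C.b * φ ε = C.η 1 • C.b := by
    have h3 := C.b_phi 1
    have h4 : C.X 1 = c⁻¹ • ε := by
      have h5 := congrArg (fun x => c⁻¹ • x) hc
      simpa only [smul_smul, inv_mul_cancel₀ hc0, one_smul] using h5.symm
    rw [h4, map_smul, mul_smul_comm, smul_mul_assoc, C.b_left, smul_comm] at h3
    exact smul_right_injective R (inv_ne_zero hc0) h3
  rw [C.b_right h hφ he] at h1
  have h3 : (1 : ℤˣ) • C.b = C.η 1 • C.b := by rw [one_smul]; exact h1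
  exact ((units_smul_eq_iff h2 C.b_ne).1 h3).symm

variable (h2 : (2 : F) ≠ 0) (h : IsGrading 𝒜) (hp : IsGradedPrime 𝒜)
  (hφ : IsGradedSuperinv 𝒜 φ) (he : IsDivIdem 𝒜 ε)
include h2 h hp hφ he

/-- Commutation factors are multiplicative because `X_{ss'}` is proportional to `X_s X_{s'}`; so is
the parity sign, and their quotient inherits this. -/
theorem sign_mul (s s' t : T) : C.η (s * s') * C.η t * C.η (s * s' * t) =
    (C.η s * C.η t * C.η (s * t)) * (C.η s' * C.η t * C.η (s' * t)) := by
  obtain ⟨c, hc, h1⟩ := C.exists_mul h he s s'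
  have h3 : c • (C.X (s * s') * C.X t) = ((-1) ^ (par (s : GSharp G) * par (t : GSharp G)) *
      (C.η s * C.η t * C.η (s * t)) * ((-1) ^ (par (s' : GSharp G) * par (t : GSharp G)) *
      (C.η s' * C.η t * C.η (s' * t)))) • c • (C.X t * C.X (s * s')) := by
    rw [← smul_mul_assoc, ← h1, mul_assoc, C.comm h hp hφ he s' t, mul_smul_comm,
      ← mul_assoc (C.X s), C.comm h hp hφ he s t, smul_mul_assoc, mul_assoc (C.X t), h1,
      mul_smul_comm, smul_smul]
    congr 1
    exact mul_comm _ _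
  rw [C.comm h hp hφ he (s * s') t, smul_comm, units_smul_eq_iff h2
    (smul_ne_zero hc (C.X_mul_ne he _ _))] at h3
  have h4 : ((-1 : ℤˣ)) ^ (par ((s * s' : T) : GSharp G) * par (t : GSharp G)) =
      (-1) ^ (par (s : GSharp G) * par (t : GSharp G)) *
        (-1) ^ (par (s' : GSharp G) * par (t : GSharp G)) := by
    rw [← uzpow_add, ← add_mul]
    rfl
  rw [h4] at h3
  exact (by decide : ∀ a b x y z : ℤˣ, a * b * x = a * y * (b * z) → x = y * z) _ _ _ _ _ h3

/-- The bicharacter `β̃` of the corner. -/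
def bichar : T →* T →* ℤˣ :=
  MonoidHom.mk' (fun s => MonoidHom.mk' (fun t => C.η s * C.η t * C.η (s * t)) fun t t' => by
    simpa only [mul_comm s, mul_comm (C.η s)] using C.sign_mul h2 h hp hφ he t t' s) fun s s' => by
    ext t
    exact congrArg _ (C.sign_mul h2 h hp hφ he s s' t)

/-- `X_t` commutes with itself, so the two factors of its commutation sign agree. -/
theorem bichar_self (t : T) : C.bichar h2 h hp hφ he t t = (-1) ^ par (t : GSharp G) := by
  have h1 := C.comm h hp hφ he t t
  have h3 : (1 : ℤˣ) • (C.X t * C.X t) = _ := (one_smul _ _).trans h1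
  rw [units_smul_eq_iff h2 (C.X_mul_ne he t t),
    (by decide : ∀ a : ZMod 2, a * a = a)] at h3
  exact (by decide : ∀ a b : ℤˣ, 1 = a * b → b = a) _ _ h3

end SignedCorner

end Signs

/-! ### The triple of a graded superalgebra with superinvolution -/

section OddCorner

variable {F : Type*} [Field F] {R : Type*} [Ring R] [Algebra F R] {G : Type*} [CommGroup G]

/-- A signed corner whose support and bicharacter form a triple `(T, β̃, t_p)`. -/
structure OddCorner (𝒜 : GSharp G → Submodule F R) (φ : R →ₗ[F] R) (ε : R) where
  P : OddTriple G
  C : SignedCorner 𝒜 φ ε P.T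
  beta : ∀ s t, P.β s t = C.η s * C.η t * C.η (s * t)
  eta_tp : C.η P.tp = 1
  eta_f : ∀ f, f ≠ 1 → (∀ s, P.β f s = 1) → C.η f = -1

variable {𝒜 : GSharp G → Submodule F R} {φ : R →ₗ[F] R} {ε : R} {T : Subgroup (GSharp G)}

theorem SignedCorner.mem_span (C : SignedCorner 𝒜 φ ε T) (h : IsGrading 𝒜) (he : IsDivIdem 𝒜 ε)
    {x : R} (hl : ε * x = x) (hr : x * ε = x) : x ∈ Submodule.span F (Set.range C.X) := by
  refine h.mem_of_proj_mem fun γ => ?_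
  have h1 : ε * h.proj γ x = h.proj γ x := by
    rw [← h.proj_mul_left he.mem, one_mul, hl]
  have h2 : h.proj γ x * ε = h.proj γ x := by
    rw [← h.proj_mul_right he.mem, mul_one, hr]
  by_cases h0 : h.proj γ x = 0
  · rw [h0]; exact zero_mem _
  · have hγ := C.mem_T γ _ (h.proj_mem γ x) h1 h2 h0
    obtain ⟨c, hc⟩ := C.exists_coeff ⟨γ, hγ⟩ _ (h.proj_mem γ x) h1 h2
    rw [hc]
    exact Submodule.smul_mem _ _ (Submodule.subset_span ⟨_, rfl⟩)

/-- An element of the corner that commutes with its homogeneous basis is a corner of a central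
element. -/
theorem SignedCorner.exists_central [FiniteDimensional F R] (C : SignedCorner 𝒜 φ ε T)
    (h : IsGrading 𝒜) (hp : IsGradedPrime 𝒜) (he : IsDivIdem 𝒜 ε) {t : T}
    (hc : ∀ s, C.X t * C.X s = C.X s * C.X t) :
    ∃ z ∈ 𝒜 (t : GSharp G), (∀ r, z * r = r * z) ∧ z ≠ 0 := by
  obtain ⟨z, hz, h1, h2⟩ := he.exists_central h hp (C.X_mem t) (C.X_left t) (C.X_right t)
    fun x hl hr => by
      have hx := C.mem_span h he hl hr
      clear hl hr
      induction hx using Submodule.span_induction with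
      | mem x hx => obtain ⟨s, rfl⟩ := hx; exact hc s
      | zero => simp
      | add x y _ _ hx hy => rw [mul_add, add_mul, hx, hy]
      | smul c x _ hx => rw [mul_smul_comm, smul_mul_assoc, hx]
  refine ⟨z, hz, h1, ?_⟩
  rintro rfl
  exact C.X_ne t (by rw [← h2, mul_zero])

/-- A nonzero homogeneous central element has a nonzero component in every corner. -/
theorem SignedCorner.exists_of_central (C : SignedCorner 𝒜 φ ε T) (hp : IsGradedPrime 𝒜)
    (h : IsGrading 𝒜) (he : IsDivIdem 𝒜 ε) {γ : GSharp G} {z : R} (hz : z ∈ 𝒜 γ) (hz0 : z ≠ 0)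
    (hc : ∀ r, z * r = r * z) : ∃ t : T, (t : GSharp G) = γ ∧ ∃ c : F, c ≠ 0 ∧
      ε * z = c • C.X t ∧ ∀ s, C.X t * C.X s = C.X s * C.X t := by
  have h0 : ε * z ≠ 0 := by
    intro h0
    obtain ⟨k, r, -, h1⟩ := hp _ _ _ _ he.mem hz he.ne_zero hz0
    exact h1 (by rw [mul_assoc, ← hc, ← mul_assoc, h0, zero_mul])
  have hm : ε * z ∈ 𝒜 γ := h.mul_mem' he.mem hz (one_mul γ)
  have hl : ε * (ε * z) = ε * z := by rw [← mul_assoc, he.idem]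
  have hr : ε * z * ε = ε * z := by rw [mul_assoc, hc, ← mul_assoc, he.idem]
  obtain ⟨c, hc'⟩ := C.exists_coeff ⟨γ, C.mem_T γ _ hm hl hr h0⟩ _ hm hl hr
  have hc0 : c ≠ 0 := by
    rintro rfl
    exact h0 (by rw [hc', zero_smul])
  refine ⟨_, rfl, c, hc0, hc', fun s => ?_⟩
  have h1 : ε * z * C.X s = C.X s * (ε * z) := by
    rw [mul_assoc, hc, ← mul_assoc, C.X_left, ← mul_assoc, C.X_right]
  rw [hc', smul_mul_assoc, mul_smul_comm] at h1
  exact smul_right_injective R hc0 h1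

/-- The parity character. -/
def parityChar (T : Subgroup (GSharp G)) : T →* ℤˣ :=
  MonoidHom.mk' (fun t => (-1) ^ par (t : GSharp G)) fun s t => by
    rw [← uzpow_add]; rfl

/-- The even centre controls the radical: `w` contributes `f`, and nothing else is left. The
relations for `t²` and the normalization of `t_p` then follow from `η(f) = -1`. -/
theorem exists_oddCorner [FiniteDimensional F R] (h2 : (2 : F) ≠ 0) (h : IsGrading 𝒜)
    (hp : IsGradedPrime 𝒜) (hφ : IsGradedSuperinv 𝒜 φ) (he : IsDivIdem 𝒜 ε)
    (hodd : ∃ γ, par γ = 1 ∧ ∃ d ∈ 𝒜 γ, ε * d = d ∧ d * ε = d ∧ d ≠ 0)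
    {w : R} {f : G} (hw : w ∈ 𝒜 (f, 1)) (hw0 : w ≠ 0) (hwc : ∀ r, w * r = r * w)
    (hφw : φ w = -w) (hZ : ∀ γ z, par γ = 0 → z ∈ 𝒜 γ → (∀ r, z * r = r * z) →
      ∃ a b : F, z = a • 1 + b • w) : Nonempty (OddCorner 𝒜 φ ε) := by
  obtain ⟨C⟩ := exists_signedCorner h hp hφ he hodd
  have hfin := finite_cornerSupport h he
  set T := cornerSupport h he
  set β := C.bichar h2 h hp hφ he with hβ
  have hβa : ∀ s t, β s t = C.η s * C.η t * C.η (s * t) := fun s t => rfl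
  have hsymm : ∀ s t, β s t = β t s := fun s t => by
    rw [hβa, hβa, mul_comm s t, mul_comm (C.η s)]
  have hself : ∀ t : T, β t t = (-1) ^ par (t : GSharp G) := C.bichar_self h2 h hp hφ he
  obtain ⟨f, hf, c, hc0, hfX, hfc⟩ := C.exists_of_central hp h he hw hw0 hwc
  have hfp : par (f : GSharp G) = 0 := by rw [hf]; rfl
  have hβf : ∀ s, β f s = 1 := fun s => by
    have h1 := (C.comm h hp hφ he f s).symm.trans (hfc s)
    rw [hfp, zero_mul, uzpow_zero, one_mul] at h1
    exact (units_smul_eq_iff h2 (C.X_mul_ne he s f)).1 (h1.trans (one_smul _ _).symm)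
  -- `X_f` is a multiple of `εw`; because `w` is central and skew, passing `φ(w)` across `b` changes
  -- the sign.
  have hηf : C.η f = -1 := by
    have h1 := C.b_phi f
    have h3 : C.X f = c⁻¹ • (ε * w) := by
      rw [hfX, smul_smul, inv_mul_cancel₀ hc0, one_smul]
    have h4 : C.b * φ (ε * w) = -(w * C.b) := by
      rw [hφ.mul_even_left h (g := 1) he.mem, hφw, neg_mul, mul_neg, hwc (φ ε), ← mul_assoc,
        C.b_right h hφ he, hwc]
    have h5 : ε * w * C.b = w * C.b := by rw [← hwc, mul_assoc, C.b_left]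
    have h6 : w * C.b ≠ 0 := by
      rw [← h5, hfX, smul_mul_assoc]
      exact smul_ne_zero hc0 (he.mul_ne_zero' C.b_left C.b_ne (C.X_mem f) (C.X_left f)
        (C.X_right f) (C.X_ne f))
    rw [h3, map_smul, mul_smul_comm, h4, smul_mul_assoc, h5, smul_comm] at h1
    have h7 := smul_right_injective R (inv_ne_zero hc0) h1
    have h8 : (-1 : ℤˣ) • (w * C.b) = C.η f • (w * C.b) := by
      rw [← h7, Units.neg_smul, one_smul]
    exact ((units_smul_eq_iff h2 h6).1 h8).symm
  have hη1 := C.eta_one h2 h hφ he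
  have hf1 : f ≠ 1 := by
    rintro rfl
    rw [hη1] at hηf
    exact absurd hηf (by decide)
  -- A radical element is even by `β̃(t,t) = (-1)^{p(t)}`, hence comes from a homogeneous central
  -- element, which lies in the span of `1` and `w`.
  have hrad : ∀ t, (∀ s, β t s = 1) → t = 1 ∨ t = f := by
    intro t ht
    have htp : par (t : GSharp G) = 0 := by
      have h1 := hself t
      rw [ht t] at h1
      exact (by decide : ∀ k : ZMod 2, (1 : ℤˣ) = (-1) ^ k → k = 0) _ h1
    obtain ⟨z, hz, hzc, hz0⟩ := C.exists_central h hp he (t := t) fun s => by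
      rw [C.comm h hp hφ he t s, htp, zero_mul, uzpow_zero, one_mul, ← hβa, ht s, one_smul]
    obtain ⟨a, b, hab⟩ := hZ _ z htp hz hzc
    by_contra! hne
    apply hz0
    rw [← h.proj_same hz, hab, map_add, map_smul, map_smul, h.proj_ne h.one_mem, h.proj_ne hw]
    · simp
    · rw [← hf]
      exact fun h1 => hne.2 (Subtype.ext h1)
    · exact fun h1 => hne.1 (Subtype.ext h1)
  have hff : f ^ 2 = 1 := by
    rcases hrad (f ^ 2) (fun s => by rw [map_pow, MonoidHom.pow_apply, hβf, one_pow]) with h1 | h1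
    · exact h1
    · rw [pow_two, mul_eq_left] at h1
      exact absurd h1 hf1
  have hsq : ∀ t : T, (par (t : GSharp G) = 0 → t ^ 2 = 1) ∧
      (par (t : GSharp G) = 1 → t ^ 2 = f) := by
    intro t
    -- Signs square to one, so `t²` is radical, and its `η` decides between `1` and `f`.
    have h1 : C.η (t ^ 2) = (-1) ^ par (t : GSharp G) := by
      rw [← hself, hβa, Int.units_mul_self, one_mul, pow_two]
    rcases hrad (t ^ 2) (fun s => by rw [map_pow, MonoidHom.pow_apply, Int.units_sq]) with h3 | h3
    · refine ⟨fun _ => h3, fun h4 => ?_⟩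
      rw [h3, hη1, h4] at h1
      exact absurd h1 (by decide)
    · refine ⟨fun h4 => ?_, fun _ => h3⟩
      rw [h3, hηf, h4] at h1
      exact absurd h1 (by decide)
  have hzp : ∀ t, (∀ s, β t s = 1) ↔ t ∈ Subgroup.zpowers f := by
    intro t
    constructor
    · intro ht
      rcases hrad t ht with rfl | rfl
      · exact one_mem _
      · exact Subgroup.mem_zpowers _
    · rintro ⟨k, rfl⟩ s
      change β (f ^ k) s = 1
      rw [map_zpow]
      change (β f s) ^ k = 1
      rw [hβf, one_zpow]
  obtain ⟨t₀, ht₀⟩ := exists_eq_of_trivial_on_radical β (parityChar T) fun t ht => by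
    rcases hrad t fun s => by rw [hsymm, ht s] with rfl | rfl
    · exact map_one _
    · change (-1) ^ par (t : GSharp G) = (1 : ℤˣ)
      rw [hfp, uzpow_zero]
  -- The two parity elements differ by `f`, and `η(f) = -1`, so exactly one has `η = 1`.
  obtain ⟨tp, htp, htp1⟩ : ∃ tp, β tp = parityChar T ∧ C.η tp = 1 := by
    rcases Int.units_eq_one_or (C.η t₀) with h1 | h1
    · exact ⟨t₀, ht₀, h1⟩
    · refine ⟨f * t₀, ?_, ?_⟩
      · rw [map_mul, ht₀]
        ext s
        simp [hβf]
      · have h3 := hβf t₀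
        rw [hβa, hηf, h1] at h3
        exact (by decide : ∀ a : ℤˣ, (-1) * (-1) * a = 1 → a = 1) _ h3
  obtain ⟨γ, hγ, d, hd⟩ := hodd
  let P : OddTriple G :=
    { T := T
      finite := hfin
      β := β
      skew := fun s t => by rw [hsymm]; exact (Int.units_inv_eq_self _).symm
      diag := hself
      rad := ⟨f, hf1, hfp, hzp, fun t => (hsq t).1, fun t => (hsq t).2⟩
      odd := ⟨⟨γ, d, hd⟩, hγ⟩
      tp := tp
      tp_parity := fun t => DFunLike.congr_fun htp t }
  exact ⟨⟨P, C, hβa, htp1, fun t ht1 ht => by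
    rcases hrad t ht with h1 | h1
    · exact absurd h1 ht1
    · exact (congrArg C.η h1).trans hηf⟩⟩

end OddCorner

/-! ### Comparison with the standard graded-division superalgebra -/

/-- A nonzero commutative finite-dimensional algebra over an algebraically closed field has a
character. -/
theorem exists_algHom_of_finiteDimensional (F : Type*) [Field F] [IsAlgClosed F] (A : Type*)
    [CommRing A] [Algebra F A] [Nontrivial A] [FiniteDimensional F A] : Nonempty (A →ₐ[F] F) := by
  obtain ⟨m, hm⟩ := Ideal.exists_maximal A
  let _ := Ideal.Quotient.field m
  exact ⟨(IsAlgClosed.lift (M := F) (R := F) (S := A ⧸ m)).comp (Ideal.Quotient.mkₐ F m)⟩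

/-- A symmetric 2-cocycle of a finite abelian group with values in the multiplicative group of an
algebraically closed field is a coboundary. -/
theorem exists_coboundary {F : Type*} [Field F] [IsAlgClosed F] {T : Type*} [CommGroup T]
    [Finite T] (k : T → T → F) (h0 : ∀ s t, k s t ≠ 0) (hsymm : ∀ s t, k s t = k t s)
    (hk : ∀ s t u, k s t * k (s * t) u = k s (t * u) * k t u) :
    ∃ μ : T → F, (∀ t, μ t ≠ 0) ∧ ∀ s t, μ s * μ t = k s t * μ (s * t) := by
  classical
  have := Fintype.ofFinite T
  -- Regular representation of the twisted group algebra. Symmetry of `k` makes the operators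
  -- commute, so the algebra they generate has a character, whose values are `μ`.
  let L : T → Module.End F (T → F) := fun s =>
    { toFun := fun g u => k s (s⁻¹ * u) * g (s⁻¹ * u)
      map_add' := fun g g' => by ext u; simp [mul_add]
      map_smul' := fun c g => by ext u; simp; ring }
  have hL : ∀ s g u, L s g u = k s (s⁻¹ * u) * g (s⁻¹ * u) := fun _ _ _ => rfl
  have hmul : ∀ s t, L s * L t = k s t • L (s * t) := fun s t => by
    refine LinearMap.ext fun g => funext fun u => ?_
    have h1 := hk s t (t⁻¹ * (s⁻¹ * u))
    rw [mul_inv_cancel_left] at h1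
    have e : (s * t)⁻¹ * u = t⁻¹ * (s⁻¹ * u) := by rw [mul_inv, mul_comm s⁻¹, mul_assoc]
    rw [Module.End.mul_apply, LinearMap.smul_apply, Pi.smul_apply, hL, hL, hL, e, smul_eq_mul,
      ← mul_assoc, ← h1, mul_assoc]
  have hcomm : ∀ a ∈ Set.range L, ∀ b ∈ Set.range L, a * b = b * a := by
    rintro _ ⟨s, rfl⟩ _ ⟨t, rfl⟩
    rw [hmul, hmul, hsymm, mul_comm]
  let _ := Algebra.adjoinCommRingOfComm F hcomm
  obtain ⟨ψ⟩ := exists_algHom_of_finiteDimensional F (Algebra.adjoin F (Set.range L))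
  let M : T → Algebra.adjoin F (Set.range L) := fun t => ⟨L t, Algebra.subset_adjoin ⟨t, rfl⟩⟩
  have hM : ∀ s t, M s * M t = k s t • M (s * t) := fun s t => Subtype.ext (hmul s t)
  have hk1 : ∀ u, k 1 u = k 1 1 := fun u => by
    have := hk 1 1 u
    rw [one_mul, one_mul] at this
    exact (mul_right_cancel₀ (h0 1 u) this).symm
  have hM1 : M 1 = k 1 1 • 1 := by
    apply Subtype.ext
    refine LinearMap.ext fun g => funext fun u => ?_
    change L 1 g u = k 1 1 * g u
    rw [hL, hk1, inv_one, one_mul]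
  have hψ : ∀ s t, ψ (M s) * ψ (M t) = k s t * ψ (M (s * t)) := fun s t => by
    rw [← map_mul, hM, map_smul, smul_eq_mul]
  refine ⟨fun t => ψ (M t), fun t ht => ?_, hψ⟩
  -- `L_t L_{t⁻¹}` is a nonzero multiple of the identity, so no value of the character vanishes.
  have h1 := hψ t t⁻¹
  change ψ (M t) = 0 at ht
  rw [ht, zero_mul, mul_inv_cancel, hM1, map_smul, map_one, smul_eq_mul, mul_one] at h1
  exact mul_ne_zero (h0 _ _) (h0 1 1) h1.symm

section Compare

variable {F : Type*} [Field F] {R : Type*} [Ring R] [Algebra F R] {G : Type*} [CommGroup G]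
  {𝒜 : GSharp G → Submodule F R} {φ : R →ₗ[F] R} {ε : R}
  {D : Type*} [Ring D] [Algebra F D] {𝒟 : GSharp G → Submodule F D} {φ₀ : D →ₗ[F] D}

/-- The structure constants of a multiplicative family of lines form a 2-cocycle. -/
theorem structure_constants_cocycle {T : Type*} [CommGroup T] (X : T → R) (hX : ∀ t, X t ≠ 0)
    {c : T → T → F} (hc : ∀ s t, X s * X t = c s t • X (s * t)) (s t u : T) :
    c s t * c (s * t) u = c s (t * u) * c t u := by
  have h1 := mul_assoc (X s) (X t) (X u)
  rw [hc s t, hc t u, smul_mul_assoc, mul_smul_comm, hc, hc, smul_smul, smul_smul, mul_assoc,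
    mul_comm (c t u)] at h1
  exact smul_left_injective F (hX _) h1

theorem structure_constants_symm {T : Type*} [CommGroup T] (X : T → R) (hX : ∀ t, X t ≠ 0)
    {c : T → T → F} (hc : ∀ s t, X s * X t = c s t • X (s * t)) {σ : T → T → ℤˣ}
    (hσ : ∀ s t, X s * X t = σ s t • (X t * X s)) (s t : T) : c s t = σ s t • c t s := by
  have h4 := hσ s t
  rw [hc s t, hc t s, mul_comm t s, ← smul_assoc] at h4
  exact smul_left_injective F (hX _) h4

/-- The corner of a graded superalgebra is isomorphic to any graded-division superalgebra with the
same bicharacter. -/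
theorem SignedCorner.exists_iso [IsAlgClosed F] (h2 : (2 : F) ≠ 0) (h : IsGrading 𝒜)
    (he : IsDivIdem 𝒜 ε) {P : OddTriple G} (C : SignedCorner 𝒜 φ ε P.T)
    (hcomm : ∀ s t, C.X s * C.X t =
      ((-1) ^ (par (s : GSharp G) * par (t : GSharp G)) * P.β s t) • (C.X t * C.X s))
    (S : StdData P 𝒟 φ₀) :
    ∃ (ι : D →ₗ[F] R) (ν : P.T → F), (∀ x y, ι (x * y) = ι x * ι y) ∧ (∀ t, ν t ≠ 0) ∧
      ∀ t, ι (S.Y t) = ν t • C.X t := by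
  choose c hc0 hc using S.mul
  choose c' hc0' hc' using C.exists_mul h he
  have s1 := structure_constants_symm S.Y S.Y_ne hc S.comm
  have s2 := structure_constants_symm C.X C.X_ne hc' hcomm
  have k1 := structure_constants_cocycle S.Y S.Y_ne hc
  have k2 := structure_constants_cocycle C.X C.X_ne hc'
  -- The two algebras have the same commutation factor, so the ratio of their structure constants is
  -- a symmetric cocycle.
  obtain ⟨μ, hμ0, hμ⟩ := exists_coboundary (fun s t => c s t / c' s t)
    (fun s t => div_ne_zero (hc0 s t) (hc0' s t)) (fun s t => by
      rw [s1 s t, s2 s t]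
      rcases Int.units_eq_one_or
        ((-1) ^ (par (s : GSharp G) * par (t : GSharp G)) * P.β s t) with e | e <;> rw [e] <;> simp)
    (fun s t u => by
      rw [div_mul_div_comm, div_mul_div_comm, k1, k2])
  refine ⟨S.Y.constr F fun t => μ t • C.X t, μ, ?_, hμ0, fun t => by simp⟩
  set ι := S.Y.constr F fun t => μ t • C.X t with hι
  have hιY : ∀ t, ι (S.Y t) = μ t • C.X t := fun t => by simp [hι]
  have key : (LinearMap.mul F D).compr₂ ι = (LinearMap.mul F R).compl₁₂ ι ι := by
    refine S.Y.ext fun s => S.Y.ext fun t => ?_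
    change ι (S.Y s * S.Y t) = ι (S.Y s) * ι (S.Y t)
    rw [hc, map_smul, hιY, hιY, hιY, smul_mul_smul_comm, hc', smul_smul, smul_smul, hμ]
    congr 1
    field_simp [hc0' s t]
  exact fun x y => LinearMap.congr_fun₂ key x y

/-- A frame at `ε` modelled on a given graded-division superalgebra with superinvolution. -/
theorem OddCorner.exists_frame [IsAlgClosed F] (h2 : (2 : F) ≠ 0) (h : IsGrading 𝒜)
    (hp : IsGradedPrime 𝒜) (hφ : IsGradedSuperinv 𝒜 φ) (he : IsDivIdem 𝒜 ε)
    (O : OddCorner 𝒜 φ ε) (S : StdData O.P 𝒟 φ₀) :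
    ∃ f : Frame 𝒜 φ 𝒟 φ₀, f.ι 1 = ε := by
  classical
  obtain ⟨P, C, hβ, hηtp, hηf⟩ := O
  change StdData P 𝒟 φ₀ at S
  have hcomm : ∀ s t, C.X s * C.X t =
      ((-1) ^ (par (s : GSharp G) * par (t : GSharp G)) * P.β s t) • (C.X t * C.X s) :=
    fun s t => by rw [hβ]; exact C.comm h hp hφ he s t
  have hηmul : ∀ s t, C.η (s * t) = P.β s t * C.η s * C.η t := fun s t => by
    rw [hβ]
    exact (by decide : ∀ a b c : ℤˣ, c = a * b * c * a * b) _ _ _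
  have hsymm : ∀ s t, P.β s t = P.β t s := fun s t => by
    rw [hβ, hβ, mul_comm s t, mul_comm (C.η s)]
  obtain ⟨ι, ν, hιm, hν, hιY⟩ := C.exists_iso h2 h he hcomm S
  have hι1 : ι 1 = ε := by
    obtain ⟨e, he0, h1⟩ := S.exists_one
    obtain ⟨c, hc⟩ := C.exists_coeff 1 ε he.mem he.idem he.idem
    have hc0 : c ≠ 0 := by
      rintro rfl
      exact he.ne_zero (by rw [hc, zero_smul])
    have h3 : ι 1 = (e * ν 1 * c⁻¹) • ε := by
      have h4 := congrArg (fun x => c⁻¹ • x) hc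
      simp only [smul_smul, inv_mul_cancel₀ hc0, one_smul] at h4
      rw [h1, map_smul, hιY, ← h4, smul_smul, smul_smul, mul_assoc]
    have h4 : e * ν 1 * c⁻¹ ≠ 0 := mul_ne_zero (mul_ne_zero he0 (hν 1)) (inv_ne_zero hc0)
    have h5 := hιm 1 1
    rw [mul_one, h3, smul_mul_smul_comm, he.idem] at h5
    have h6 := smul_left_injective F he.ne_zero h5
    rw [h3, mul_eq_left₀ h4 |>.1 h6.symm, one_smul]
  -- Both sign functions have polarization `β̃`, so their product is a character; it is trivial on
  -- the radical because both equal `-1` at `f`.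
  let ρ : P.T →* ℤˣ := MonoidHom.mk' (fun t => C.η t * S.η t) fun s t => by
    rw [hηmul, S.eta_mul]
    exact (by decide : ∀ a b c d e : ℤˣ, a * b * c * (a * d * e) = b * d * (c * e)) _ _ _ _ _
  have hρ : ∀ t, ρ t = C.η t * S.η t := fun t => rfl
  obtain ⟨t, ht, htδ⟩ : ∃ t, P.β t = ρ ∧ C.δ * C.η t = 1 := by
    obtain ⟨t, ht⟩ := exists_eq_of_trivial_on_radical P.β ρ fun t ht => by
      by_cases h1 : t = 1
      · rw [h1, map_one]
      · have h3 : ∀ s, P.β t s = 1 := fun s => by rw [hsymm, ht]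
        rw [hρ, hηf t h1 h3, S.eta_f t h1 h3]
        rfl
    by_cases h1 : C.δ * C.η t = 1
    · exact ⟨t, ht, h1⟩
    -- Passing from `t` to `ft` leaves `β̃(t,·)` unchanged but flips `η(t)`, so the new generator
    -- `X_t b` can be made fixed by `φ`.
    · obtain ⟨f, hf1, hfp, hfr, -, -⟩ := P.rad
      have hf : ∀ s, P.β f s = 1 := (hfr f).2 (Subgroup.mem_zpowers f)
      refine ⟨f * t, ?_, ?_⟩
      · rw [map_mul, ht]
        ext s
        simp [hf]
      · rw [hηmul, hf, hηf f hf1 hf, one_mul, neg_one_mul]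
        exact (by decide : ∀ a b : ℤˣ, ¬ a * b = 1 → a * -b = 1) _ _ h1
  -- Both sign functions are normalized to `1` at `t_p`, so `β̃(t,t_p) = 1`, which means that `t` is
  -- even.
  have htp : par (t : GSharp G) = 0 := by
    have h1 := P.tp_parity t
    rw [hsymm, ht, hρ, hηtp, S.eta_tp] at h1
    exact (by decide : ∀ k : ZMod 2, (1 : ℤˣ) * 1 = (-1) ^ k → k = 0) _ h1
  have hXm : C.X t ∈ 𝒜 ((t : GSharp G).1, 1) := by
    have h1 : (t : GSharp G) = ((t : GSharp G).1, 1) := Prod.ext rfl htp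
    rw [← h1]
    exact C.X_mem t
  refine ⟨⟨ι, C.X t * C.b, (t : GSharp G).1 * C.deg, hιm, ?_, ?_, ?_, h.mul_mem' hXm C.b_mem rfl,
    he.mul_ne_zero' C.b_left C.b_ne hXm (C.X_left t) (C.X_right t) (C.X_ne t),
    by rw [hι1, ← mul_assoc, C.X_left], ?_, ?_⟩, hι1⟩
  · intro γ d hd
    by_cases h0 : d = 0
    · rw [h0, map_zero]; exact zero_mem _
    · obtain ⟨s, rfl, c, -, rfl⟩ := S.exists_eq hd h0
      rw [map_smul, hιY]
      exact Submodule.smul_mem _ _ (Submodule.smul_mem _ _ (C.X_mem s))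
  · refine (injective_iff_map_eq_zero ι).2 fun d hd => S.Y.ext_elem fun s => ?_
    have h1 : h.proj s ∘ₗ ι = (S.Y.coord s).smulRight (ν s • C.X s) := S.Y.ext fun u => by
      rw [LinearMap.comp_apply, hιY, map_smul, LinearMap.smulRight_apply, Module.Basis.coord_apply,
        S.Y.repr_self, Finsupp.single_apply]
      split_ifs with hus
      · subst hus
        rw [h.proj_same (C.X_mem u), one_smul]
      · rw [h.proj_ne (C.X_mem u) (fun e => hus (Subtype.ext e.symm)), smul_zero, zero_smul]
    have h3 := LinearMap.congr_fun h1 d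
    rw [LinearMap.comp_apply, hd, map_zero, LinearMap.smulRight_apply, eq_comm, smul_eq_zero] at h3
    rw [map_zero]
    exact h3.resolve_right (smul_ne_zero (hν s) (C.X_ne s))
  · intro r hl hr
    rw [hι1] at hl hr
    have h1 : Submodule.span F (Set.range C.X) ≤ LinearMap.range ι := by
      rw [Submodule.span_le]
      rintro _ ⟨s, rfl⟩
      refine ⟨(ν s)⁻¹ • S.Y s, ?_⟩
      rw [map_smul, hιY, smul_smul, inv_mul_cancel₀ (hν s), one_smul]
    exact h1 (C.mem_span h he hl hr)
  · have key : LinearMap.mulLeft F (C.X t * C.b) ∘ₗ φ ∘ₗ ι =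
        LinearMap.mulRight F (C.X t * C.b) ∘ₗ ι ∘ₗ φ₀ := S.Y.ext fun s => by
      change C.X t * C.b * φ (ι (S.Y s)) = ι (φ₀ (S.Y s)) * (C.X t * C.b)
      rw [S.phi, map_units_zsmul, hιY, map_smul, mul_smul_comm, mul_assoc, C.b_phi, mul_smul_comm,
        ← mul_assoc, hcomm t s, htp, zero_mul, uzpow_zero, one_mul, ht, hρ, smul_mul_assoc,
        smul_smul, smul_mul_assoc, smul_mul_assoc, ← mul_assoc, smul_comm (S.η s),
        ← mul_assoc, Int.units_mul_self, one_mul]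
    exact fun d => LinearMap.congr_fun key d
  · rw [hφ.mul_even_left h hXm, C.phi_b, smul_mul_assoc, C.b_phi, smul_smul, htδ, one_smul]

end Compare

/-! ### Existence of a standard model -/

section Existence

variable {F : Type*} [Field F] {R : Type*} [Ring R] [Algebra F R] {G : Type*} [CommGroup G]
  {𝒜 : GSharp G → Submodule F R} {φ : R →ₗ[F] R} {ε : R}
  {D : Type*} [Ring D] [Algebra F D] {𝒟 : GSharp G → Submodule F D} {φ₀ : D →ₗ[F] D}
  {P : OddTriple G}

/-- Right multiplication by a unit of the corner is injective. Used in both directions, it makes the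
dimension depend only on the class modulo `T⁺`. -/
theorem Frame.finrank_col_le [FiniteDimensional F R] (h : IsGrading 𝒜) (S : StdData P 𝒟 φ₀)
    (f : Frame 𝒜 φ 𝒟 φ₀) {x y : G} (hxy : x⁻¹ * y ∈ plus P.T) :
    Module.finrank F (col 𝒜 (f.ι 1) (x, 1)) ≤ Module.finrank F (col 𝒜 (f.ι 1) (y, 1)) := by
  set t : P.T := ⟨(x⁻¹ * y, 1), hxy⟩ with ht
  have m1 : ∀ v ∈ col 𝒜 (f.ι 1) (x, 1), v * f.ι (S.Y t) ∈ col 𝒜 (f.ι 1) (y, 1) := fun v hv => by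
    rw [mem_col] at hv ⊢
    refine ⟨h.mul_mem' hv.1 (f.ι_mem _ _ (S.Y_mem t)) (by simp [ht]), by rw [mul_assoc, f.ι_one]⟩
  refine LinearMap.finrank_le_finrank_of_injective
    (f := (LinearMap.mulRight F (f.ι (S.Y t))).restrict m1) ((injective_iff_map_eq_zero _).2 ?_)
  intro v hv
  obtain ⟨z, -, hz, -⟩ := S.exists_inv t
  have h1 : (v : R) * f.ι (S.Y t) = 0 := congrArg Subtype.val hv
  apply Subtype.ext
  have h3 : ∀ r : R, r * f.ι (S.Y t) = 0 → r * f.ι 1 = 0 := fun r hr => by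
    rw [← hz, f.ι_mul, ← mul_assoc, hr, zero_mul]
  exact (mem_col.1 v.2).2.symm.trans (h3 _ h1)

/-- A graded superalgebra with superinvolution that has a frame is isomorphic to a standard
model. -/
theorem Frame.exists_model [IsAlgClosed F] [FiniteDimensional F R] (h2 : (2 : F) ≠ 0)
    (h : IsGrading 𝒜) (hp : IsGradedPrime 𝒜) (hφ : IsGradedSuperinv 𝒜 φ) (S : StdData P 𝒟 φ₀)
    (f : Frame 𝒜 φ 𝒟 φ₀) :
    ∃ (κ : (G ⧸ plus P.T) →₀ ℕ) (g₀ : G) (c : BlockChoice P.T 𝒟),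
      IsAdmissible P.T 𝒟 φ₀ κ g₀ ∧ GradedIso 𝒜 φ (EGrading c κ) (EInv φ₀ c κ g₀) := by
  classical
  have hfin : {x : G ⧸ plus P.T | Module.finrank F (col 𝒜 (f.ι 1) (x.out, 1)) ≠ 0}.Finite := by
    refine Set.Finite.of_injOn (f := fun x : G ⧸ plus P.T => ((x.out, 1) : GSharp G))
      (t := {γ | 𝒜 γ ≠ ⊥}) (fun x hx h0 => hx ?_)
      (fun x _ y _ hxy => Quotient.out_injective (congrArg Prod.fst hxy)) h.finite_support
    have h1 : col 𝒜 (f.ι 1) (x.out, 1) = ⊥ :=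
      le_bot_iff.1 ((inf_le_left (a := 𝒜 (x.out, 1))).trans (le_of_eq h0))
    rw [h1, finrank_bot]
  let κ : (G ⧸ plus P.T) →₀ ℕ :=
    Finsupp.ofSupportFinite (fun x => Module.finrank F (col 𝒜 (f.ι 1) (x.out, 1))) hfin
  let c : BlockChoice P.T 𝒟 :=
    ⟨S.Y, S.Y_mem, S.Y_ne, Quotient.out, QuotientGroup.out_eq', IsWellOrder.linearOrder WellOrderingRel⟩
  refine ⟨κ, f.deg, c, f.isAdmissible_and_gradedIso h2 h hp hφ S c κ f.deg 1 (by simp) fun x => ?_⟩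
  rw [mul_one]
  change _ = Module.finrank F (col 𝒜 (f.ι 1) ((x : G ⧸ plus P.T).out, 1))
  have h1 : x⁻¹ * (x : G ⧸ plus P.T).out ∈ plus P.T :=
    QuotientGroup.eq.1 (QuotientGroup.out_eq' (x : G ⧸ plus P.T)).symm
  refine le_antisymm (f.finrank_col_le h S h1) (f.finrank_col_le h S ?_)
  have h3 := inv_mem h1
  rwa [mul_inv, inv_inv, mul_comm] at h3

/-- `X_{t_p}` and `X_s` commute up to `(-1)^{(p(t_p)+1)p(s)}`, so an odd `t_p` would yield a nonzero
odd central element. -/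
theorem OddCorner.par_tp_eq_zero [FiniteDimensional F R] (h : IsGrading 𝒜)
    (hp : IsGradedPrime 𝒜) (hφ : IsGradedSuperinv 𝒜 φ) (he : IsDivIdem 𝒜 ε)
    (O : OddCorner 𝒜 φ ε)
    (hc : ∀ γ z, par γ = 1 → z ∈ 𝒜 γ → (∀ r, z * r = r * z) → z = 0) :
    par (O.P.tp : GSharp G) = 0 := by
  by_contra h0
  have h1 : par (O.P.tp : GSharp G) = 1 := (by decide : ∀ k : ZMod 2, k ≠ 0 → k = 1) _ h0
  obtain ⟨z, hz, hzc, hz0⟩ := O.C.exists_central h hp he (t := O.P.tp) fun s => by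
    rw [O.C.comm h hp hφ he, ← O.beta, O.P.tp_parity, h1, one_mul, Int.units_mul_self, one_smul]
  exact hz0 (hc _ z h1 hz hzc)

/-- An odd central element yields a central `X_t` with `t` odd; its commutation sign with `X_{t_p}`
is `(-1)^{p(t_p)+1}`, which must be `1`. -/
theorem OddCorner.par_tp_eq_one (h2 : (2 : F) ≠ 0) (h : IsGrading 𝒜)
    (hp : IsGradedPrime 𝒜) (hφ : IsGradedSuperinv 𝒜 φ) (he : IsDivIdem 𝒜 ε)
    (O : OddCorner 𝒜 φ ε) {γ : GSharp G} {z : R} (hγ : par γ = 1) (hz : z ∈ 𝒜 γ) (hz0 : z ≠ 0)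
    (hc : ∀ r, z * r = r * z) : par (O.P.tp : GSharp G) = 1 := by
  obtain ⟨t, rfl, -, -, -, ht⟩ := O.C.exists_of_central hp h he hz hz0 hc
  have h1 := O.C.comm h hp hφ he t O.P.tp
  rw [ht, ← O.beta, O.P.skew, O.P.tp_parity, hγ, one_mul] at h1
  have h3 := (units_smul_eq_iff h2 (O.C.X_mul_ne he _ _)).1 ((one_smul ℤˣ _).trans h1)
  exact (by decide : ∀ k : ZMod 2, (1 : ℤˣ) = (-1) ^ k * ((-1) ^ (1 : ZMod 2))⁻¹ → k = 1) _ h3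

end Existence

/-- An oddly graded-simple superalgebra with superinvolution whose even center is spanned by `1` and
an even skew element `w`. -/
theorem IsGradedSimple.exists_oddCorner {F : Type u} [Field F] [IsAlgClosed F] {R : Type u}
    [Ring R] [Algebra F R] {G : Type v} [CommGroup G] {𝒜 : GSharp G → Submodule F R}
    {φ : R →ₗ[F] R} [FiniteDimensional F R] (h2 : (2 : F) ≠ 0) (h : IsGrading 𝒜)
    (hs : IsGradedSimple 𝒜) (ho : IsOddlyGraded 𝒜) (hφ : IsGradedSuperinv 𝒜 φ) {w : R}
    (hw : ∀ γ, par γ = 1 → h.proj γ w = 0) (hw0 : w ≠ 0)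
    (hwc : ∀ r, w * r = r * w) (hφw : φ w = -w)
    (hZ : ∀ γ z, par γ = 0 → z ∈ 𝒜 γ → (∀ r, z * r = r * z) →
      ∃ a b : F, z = a • 1 + b • w) :
    ∃ ε, IsDivIdem 𝒜 ε ∧ Nonempty (OddCorner 𝒜 φ ε) := by
  have hp := hs.isGradedPrime h
  obtain ⟨x, y, hxy⟩ := hs.1
  have : Nontrivial R := ⟨⟨_, _, hxy⟩⟩
  obtain ⟨ε, he⟩ := hp.exists_isDivIdem h
  obtain ⟨⟨f, i⟩, hγ⟩ := h.exists_proj_ne hw0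
  have hi : i = 1 := by
    by_contra hi
    exact hγ (hw _ ((by decide : ∀ k : ZMod 2, k ≠ 0 → k = 1) _ hi))
  subst hi
  have hv := h.proj_mem (f, 1) w
  set v := h.proj (f, 1) w with hvdef
  -- `w` is not assumed homogeneous. A nonzero even component of it is again central and skew.
  have hvc : ∀ r, v * r = r * v := fun r => by
    refine h.induction (p := fun r => v * r = r * v) (fun δ r hr => ?_) (by simp)
      (fun x y hx hy => by rw [mul_add, add_mul, hx, hy]) r
    rw [hvdef, ← h.proj_mul_right hr, ← h.proj_mul_left hr, hwc, mul_comm]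
  have hφv : φ v = -v := by
    have key : h.proj (f, 1) ∘ₗ φ = φ ∘ₗ h.proj (f, 1) := h.ext_hom fun δ x hx => by
      by_cases e : ((f, 1) : GSharp G) = δ
      · subst e
        simp [h.proj_same hx, h.proj_same (hφ.map_mem _ _ hx)]
      · simp [h.proj_ne hx e, h.proj_ne (hφ.map_mem _ _ hx) e]
    have h1 := LinearMap.congr_fun key w
    rw [LinearMap.comp_apply, LinearMap.comp_apply, hφw, map_neg] at h1
    exact h1.symm
  obtain ⟨a, b, hab⟩ := hZ _ v rfl hv hvc
  -- The coefficient of `1` vanishes because `1` is symmetric and `v` is skew. Hence `v` is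
  -- proportional to `w`, and `w` is homogeneous after all.
  have ha : a = 0 := by
    have h1 := hφv
    rw [hab, map_add, map_smul, map_smul, hφ.map_one h, hφw] at h1
    have h3 : (2 * a) • (1 : R) = 0 := by
      rw [two_mul, add_smul]
      have := congrArg (fun x => x + (a • 1 + b • w)) h1
      simp only [smul_neg, neg_add_cancel] at this
      rw [← this]
      abel
    exact (mul_eq_zero.1 ((smul_eq_zero.1 h3).resolve_right one_ne_zero)).resolve_left h2
  rw [ha, zero_smul, zero_add] at hab
  have hb : b ≠ 0 := by
    rintro rfl
    exact hγ (by rw [hab, zero_smul])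
  have hwm : w ∈ 𝒜 (f, 1) := by
    have h1 : w = b⁻¹ • v := by rw [hab, smul_smul, inv_mul_cancel₀ hb, one_smul]
    rw [h1]
    exact Submodule.smul_mem _ _ hv
  exact ⟨ε, he, GradedSuper.exists_oddCorner h2 h hp hφ he (ho.exists_odd h hp he) hwm hw0 hwc hφw
    hZ⟩

/-! ### Gradings on `S × Sˢᵒᵖ` -/

section Exchange

variable {F : Type u} [Field F] {S : Type w} [Ring S] [Algebra F S] {𝒮 : ZMod 2 → Submodule F S}
  [GradedAlgebra 𝒮] {G : Type v} [CommGroup G]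

instance [FiniteDimensional F S] : FiniteDimensional F (SOp 𝒮) :=
  Module.Finite.equiv (toSOp 𝒮)

theorem mem_exParity {i : ZMod 2} {x : Ex 𝒮} :
    x ∈ exParity 𝒮 i ↔ x.1 ∈ 𝒮 i ∧ (toSOp 𝒮).symm x.2 ∈ 𝒮 i := by
  rw [exParity, Submodule.mem_prod]
  refine and_congr_right fun _ => ⟨?_, fun h => ⟨_, h, rfl⟩⟩
  rintro ⟨y, hy, h⟩
  rw [← h]
  exact hy

theorem SOp.mul_of_mem {i j : ZMod 2} {x y : SOp 𝒮} (hx : (toSOp 𝒮).symm x ∈ 𝒮 i)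
    (hy : (toSOp 𝒮).symm y ∈ 𝒮 j) : (toSOp 𝒮).symm (x * y) =
      ((-1 : ℤˣ) ^ (i * j)) • ((toSOp 𝒮).symm y * (toSOp 𝒮).symm x) :=
  sopMul_of_mem 𝒮 hx hy

theorem units_smul_mem {M : Type*} [AddCommGroup M] [Module F M] (V : Submodule F M) (c : ℤˣ)
    {x : M} (hx : x ∈ V) : c • x ∈ V := by
  rcases Int.units_eq_one_or c with rfl | rfl
  · simpa
  · simpa using hx

theorem exParity_mul_mem {i j : ZMod 2} {x y : Ex 𝒮} (hx : x ∈ exParity 𝒮 i)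
    (hy : y ∈ exParity 𝒮 j) : x * y ∈ exParity 𝒮 (i + j) := by
  rw [mem_exParity] at hx hy ⊢
  refine ⟨SetLike.mul_mem_graded hx.1 hy.1, ?_⟩
  rw [Prod.snd_mul, SOp.mul_of_mem hx.2 hy.2]
  refine units_smul_mem _ _ ?_
  rw [add_comm]
  exact SetLike.mul_mem_graded hy.2 hx.2

/-- The homogeneous projections of `S × Sˢᵒᵖ`. -/
def exProj (i : ZMod 2) : Ex 𝒮 →ₗ[F] Ex 𝒮 :=
  (GradedAlgebra.proj 𝒮 i).prodMap
    ((toSOp 𝒮).toLinearMap ∘ₗ GradedAlgebra.proj 𝒮 i ∘ₗ (toSOp 𝒮).symm.toLinearMap)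

theorem exProj_same {i : ZMod 2} {x : Ex 𝒮} (hx : x ∈ exParity 𝒮 i) : exProj i x = x := by
  rw [mem_exParity] at hx
  refine Prod.ext ?_ ((toSOp 𝒮).symm.injective ?_)
  · exact DirectSum.decompose_of_mem_same _ hx.1
  · exact DirectSum.decompose_of_mem_same _ hx.2

theorem exProj_ne {i j : ZMod 2} {x : Ex 𝒮} (hx : x ∈ exParity 𝒮 i) (hj : i ≠ j) :
    exProj j x = 0 := by
  rw [mem_exParity] at hx
  refine Prod.ext ?_ ((toSOp 𝒮).symm.injective ?_)
  · exact DirectSum.decompose_of_mem_ne _ hx.1 hj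
  · exact DirectSum.decompose_of_mem_ne _ hx.2 hj

variable {Γ : G → Submodule F (Ex 𝒮)}

theorem isGrading_sharp (hΓ : IsGradingOfSuperinv (exParity 𝒮) (exch 𝒮) Γ) :
    IsGrading (sharp (exParity 𝒮) Γ) where
  indep := by
    refine iSupIndep_of_projections
      (fun γ => hΓ.toIsGrading.proj γ.1 ∘ₗ exProj (par γ)) ?_ ?_
    · intro γ x hx
      rw [LinearMap.comp_apply, exProj_same hx.2, hΓ.toIsGrading.proj_same hx.1]
    · intro γ δ hne x hx
      by_cases h : par δ = par γ
      · have h1 : γ.1 ≠ δ.1 := fun h1 => hne (Prod.ext h1.symm h)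
        rw [LinearMap.comp_apply, ← h, exProj_same hx.2, hΓ.toIsGrading.proj_ne hx.1 h1]
      · rw [LinearMap.comp_apply, exProj_ne hx.2 h, map_zero]
  span := by
    rw [eq_top_iff, ← hΓ.span]
    refine iSup_le fun g => ?_
    rw [hΓ.compat g]
    exact sup_le (le_iSup (sharp (exParity 𝒮) Γ) (g, Multiplicative.ofAdd 0))
      (le_iSup (sharp (exParity 𝒮) Γ) (g, Multiplicative.ofAdd 1))
  mul_mem := fun γ δ x y hx hy => ⟨hΓ.mul_mem _ _ _ _ hx.1 hy.1, exParity_mul_mem hx.2 hy.2⟩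

/-- The sign in the product of the superopposite is exactly the one required of a superinvolution.
-/
theorem exch_mul {i j : ZMod 2} {x y : Ex 𝒮} (hx : x ∈ exParity 𝒮 i) (hy : y ∈ exParity 𝒮 j) :
    exch 𝒮 (x * y) = ((-1 : ℤˣ) ^ (i * j)) • (exch 𝒮 y * exch 𝒮 x) := by
  have h1 := mem_exParity.1 hx
  have h2 := mem_exParity.1 hy
  refine Prod.ext ?_ ((toSOp 𝒮).symm.injective ?_)
  · exact SOp.mul_of_mem h1.2 h2.2
  · change x.1 * y.1 = (toSOp 𝒮).symm (((-1 : ℤˣ) ^ (i * j)) • ((exch 𝒮 y).2 * (exch 𝒮 x).2))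
    have h3 := SOp.mul_of_mem (x := (exch 𝒮 y).2) (y := (exch 𝒮 x).2) h2.1 h1.1
    rw [← LinearEquiv.coe_toLinearMap, map_units_zsmul, LinearEquiv.coe_toLinearMap, h3,
      mul_comm j, units_mul_self_smul]
    rfl

theorem isGradedSuperinv_exch (hΓ : IsGradingOfSuperinv (exParity 𝒮) (exch 𝒮) Γ) :
    IsGradedSuperinv (sharp (exParity 𝒮) Γ) (exch 𝒮) where
  map_mem := fun γ x hx => by
    refine ⟨hΓ.map_mem _ _ hx.1, ?_⟩
    have := mem_exParity.1 hx.2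
    exact mem_exParity.2 ⟨this.2, this.1⟩
  invol := fun x => rfl
  map_mul := fun γ δ x y hx hy => exch_mul hx.2 hy.2

theorem proj_sharp_eq_zero (hΓ : IsGradingOfSuperinv (exParity 𝒮) (exch 𝒮) Γ) {i : ZMod 2}
    {x : Ex 𝒮} (hx : x ∈ exParity 𝒮 i) {γ : GSharp G} (hγ : i ≠ par γ) :
    (isGrading_sharp hΓ).proj γ x = 0 := by
  have h := isGrading_sharp hΓ
  have key : h.proj γ = h.proj γ ∘ₗ exProj (par γ) := h.ext_hom fun δ y hy => by
    by_cases e : par δ = par γ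
    · rw [LinearMap.comp_apply, ← e, exProj_same hy.2]
    · rw [LinearMap.comp_apply, exProj_ne hy.2 e, map_zero,
        h.proj_ne hy (fun e' => e (congrArg par e'.symm))]
  rw [key, LinearMap.comp_apply, exProj_ne hx hγ, map_zero]

/-- The components of a homogeneous central element of `S × Sˢᵒᵖ` are central in `S`. -/
theorem central_of_central_ex {i : ZMod 2} {z : Ex 𝒮} (hz : z ∈ exParity 𝒮 i)
    (hc : ∀ r, z * r = r * z) :
    (∀ s, z.1 * s = s * z.1) ∧ ∀ s, (toSOp 𝒮).symm z.2 * s = s * (toSOp 𝒮).symm z.2 := by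
  refine ⟨fun s => congrArg Prod.fst (hc (s, 0)), fun s => ?_⟩
  have hz2 := (mem_exParity.1 hz).2
  induction s using DirectSum.Decomposition.inductionOn 𝒮 with
  | zero => simp
  | add s s' h h' => rw [mul_add, add_mul, h, h']
  | @homogeneous j s =>
    have h1 := congrArg (fun x => (toSOp 𝒮).symm x.2) (hc (0, toSOp 𝒮 s))
    have hs : (toSOp 𝒮).symm (toSOp 𝒮 (s : S)) ∈ 𝒮 j := s.2
    simp only [Prod.snd_mul] at h1
    rw [SOp.mul_of_mem hz2 hs, SOp.mul_of_mem hs hz2, mul_comm j] at h1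
    have h3 := congrArg (fun x => ((-1 : ℤˣ) ^ (i * j)) • x) h1
    simp only [units_mul_self_smul] at h3
    exact h3.symm

theorem exMinus_one_central (r : Ex 𝒮) : exMinus 𝒮 1 * r = r * exMinus 𝒮 1 := by
  change ((1 : S) * r.1, -(1 : SOp 𝒮) * r.2) = (r.1 * 1, r.2 * -(1 : SOp 𝒮))
  rw [one_mul, mul_one, neg_mul, mul_neg, one_mul, mul_one]

theorem exch_exMinus_one : exch 𝒮 (exMinus 𝒮 1) = -exMinus 𝒮 1 := by
  refine Prod.ext rfl ?_
  change (1 : SOp 𝒮) = - -(1 : SOp 𝒮)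
  rw [neg_neg]

theorem exMinus_one_mem : exMinus 𝒮 1 ∈ exParity 𝒮 0 :=
  mem_exParity.2 ⟨SetLike.GradedOne.one_mem, by
    change -(1 : S) ∈ 𝒮 0
    exact neg_mem SetLike.GradedOne.one_mem⟩

/-- A pair `(a, b̄)` of scalars is split into its symmetric and skew halves. -/
theorem exists_even_central (h2 : (2 : F) ≠ 0)
    (hS : ∀ z ∈ 𝒮 0, (∀ s, z * s = s * z) → ∃ a : F, z = a • 1) {z : Ex 𝒮}
    (hz : z ∈ exParity 𝒮 0) (hc : ∀ r, z * r = r * z) :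
    ∃ a b : F, z = a • 1 + b • exMinus 𝒮 1 := by
  obtain ⟨h3, h4⟩ := central_of_central_ex hz hc
  obtain ⟨h5, h6⟩ := mem_exParity.1 hz
  obtain ⟨a, ha⟩ := hS _ h5 h3
  obtain ⟨b, hb⟩ := hS _ h6 h4
  refine ⟨(a + b) / 2, (a - b) / 2, Prod.ext ?_ ((toSOp 𝒮).symm.injective ?_)⟩
  · rw [ha]
    change a • (1 : S) = ((a + b) / 2) • (1 : S) + ((a - b) / 2) • (1 : S)
    rw [← add_smul]
    congr 1
    field_simp
    ring
  · rw [hb]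
    change b • (1 : S) = ((a + b) / 2) • (1 : S) + ((a - b) / 2) • -(1 : S)
    rw [smul_neg, ← sub_eq_add_neg, ← sub_smul]
    congr 1
    field_simp
    ring

theorem exMinus_one_ne_zero [Nontrivial (Ex 𝒮)] : exMinus 𝒮 1 ≠ 0 := fun h0 => by
  have h1 : (1 : S) = 0 := congrArg Prod.fst h0
  apply one_ne_zero (α := Ex 𝒮)
  exact Prod.ext h1 ((toSOp 𝒮).symm.injective h1)

end Exchange

/-! ### The triple attached to a grading on the exchange superalgebra -/

section ExchangeCorner

variable {F : Type u} [Field F] [IsAlgClosed F] {S : Type u} [Ring S] [Algebra F S]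
  [FiniteDimensional F S] {𝒮 : ZMod 2 → Submodule F S} [GradedAlgebra 𝒮] {G : Type v} [CommGroup G]
  {Γ : G → Submodule F (Ex 𝒮)}

theorem exists_oddCorner_ex (h2 : (2 : F) ≠ 0)
    (hS : ∀ z ∈ 𝒮 0, (∀ s, z * s = s * z) → ∃ a : F, z = a • 1)
    (hΓ : IsGradingOfSuperinv (exParity 𝒮) (exch 𝒮) Γ)
    (hs : IsGradedSimple (sharp (exParity 𝒮) Γ)) (ho : IsOddlyGraded (sharp (exParity 𝒮) Γ)) :
    ∃ ε, IsDivIdem (sharp (exParity 𝒮) Γ) ε ∧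
      Nonempty (OddCorner (sharp (exParity 𝒮) Γ) (exch 𝒮) ε) := by
  obtain ⟨x, y, hxy⟩ := hs.1
  have : Nontrivial (Ex 𝒮) := ⟨⟨_, _, hxy⟩⟩
  exact hs.exists_oddCorner h2 (isGrading_sharp hΓ) ho (isGradedSuperinv_exch hΓ)
    (w := exMinus 𝒮 1)
    (fun γ hγ => proj_sharp_eq_zero hΓ exMinus_one_mem (by rw [hγ]; decide))
    exMinus_one_ne_zero exMinus_one_central exch_exMinus_one
    (fun γ z hγ hz hc => exists_even_central h2 hS (by rw [← hγ]; exact hz.2) hc)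

theorem par_tp_eq_zero_ex (hS : ∀ z ∈ 𝒮 1, (∀ s, z * s = s * z) → z = 0)
    (hΓ : IsGradingOfSuperinv (exParity 𝒮) (exch 𝒮) Γ)
    (hs : IsGradedSimple (sharp (exParity 𝒮) Γ)) {ε : Ex 𝒮}
    (he : IsDivIdem (sharp (exParity 𝒮) Γ) ε)
    (O : OddCorner (sharp (exParity 𝒮) Γ) (exch 𝒮) ε) : par (O.P.tp : GSharp G) = 0 := by
  have h := isGrading_sharp hΓ
  refine O.par_tp_eq_zero h (hs.isGradedPrime h) (isGradedSuperinv_exch hΓ) he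
    fun γ z hγ hz hc => ?_
  have hz' : z ∈ exParity 𝒮 1 := by rw [← hγ]; exact hz.2
  obtain ⟨h3, h4⟩ := central_of_central_ex hz' hc
  obtain ⟨h5, h6⟩ := mem_exParity.1 hz'
  exact Prod.ext (hS _ h5 h3) ((toSOp 𝒮).symm.injective (hS _ h6 h4))

theorem par_tp_eq_one_ex (h2 : (2 : F) ≠ 0) {u : S} (hu : u ∈ 𝒮 1) (hu1 : u * u = 1)
    (huc : ∀ s, u * s = s * u) (hΓ : IsGradingOfSuperinv (exParity 𝒮) (exch 𝒮) Γ)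
    (hs : IsGradedSimple (sharp (exParity 𝒮) Γ)) {ε : Ex 𝒮}
    (he : IsDivIdem (sharp (exParity 𝒮) Γ) ε)
    (O : OddCorner (sharp (exParity 𝒮) Γ) (exch 𝒮) ε) : par (O.P.tp : GSharp G) = 1 := by
  have h := isGrading_sharp hΓ
  obtain ⟨x, y, hxy⟩ := hs.1
  have : Nontrivial (Ex 𝒮) := ⟨⟨_, _, hxy⟩⟩
  have hv0 : (u, (0 : SOp 𝒮)) ≠ 0 := fun h0 => by
    have h3 : u = 0 := congrArg Prod.fst h0
    rw [h3, mul_zero] at hu1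
    exact exMinus_one_ne_zero (𝒮 := 𝒮)
      (Prod.ext hu1.symm ((toSOp 𝒮).symm.injective (neg_eq_zero.2 hu1.symm)))
  have hv1 : (u, (0 : SOp 𝒮)) ∈ exParity 𝒮 1 := mem_exParity.2 ⟨hu, zero_mem (𝒮 1)⟩
  have hvc : ∀ r : Ex 𝒮, (u, (0 : SOp 𝒮)) * r = r * (u, 0) := fun r =>
    Prod.ext (huc r.1) ((zero_mul r.2).trans (mul_zero r.2).symm)
  generalize (u, (0 : SOp 𝒮)) = v at hv0 hv1 hvc
  -- The odd central element `(u, 0)` need not be homogeneous, but any nonzero component of it is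
  -- odd and central.
  obtain ⟨γ, hγ⟩ := h.exists_proj_ne hv0
  have hγ1 : par γ = 1 := by
    by_contra h0
    exact hγ (proj_sharp_eq_zero hΓ hv1 (fun e => h0 e.symm))
  refine O.par_tp_eq_one h2 h (hs.isGradedPrime h) (isGradedSuperinv_exch hΓ) he hγ1
    (h.proj_mem γ v) hγ fun r => ?_
  refine h.induction (p := fun r => h.proj γ v * r = r * h.proj γ v) (fun δ r hr => ?_) (by simp)
    (fun x y hx hy => by rw [mul_add, add_mul, hx, hy]) r
  rw [← h.proj_mul_right hr, ← h.proj_mul_left hr, hvc, mul_comm]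

end ExchangeCorner

/-! ### Odd gradings on `M(n,n) × M(n,n)ˢᵒᵖ` and `Q(n) × Q(n)ˢᵒᵖ` -/

section MQCenter

variable {F : Type u} [Field F]

theorem exists_smul_one_of_central {n : Type*} [Fintype n] [DecidableEq n]
    {z : Matrix n n F} (hz : ∀ s, z * s = s * z) : ∃ a : F, z = a • 1 := by
  obtain ⟨a, ha⟩ := Matrix.mem_range_scalar_iff_commute_single'.2 fun i j => (hz _).symm
  exact ⟨a, by rw [← ha, Matrix.scalar_apply, Matrix.smul_one_eq_diagonal]⟩

/-- Central matrices are scalar, and scalar matrices are even. -/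
theorem mParity_odd_central {n : ℕ} {z : M F n n} (hz : z ∈ mParity F n n 1)
    (hc : ∀ s, z * s = s * z) : z = 0 := by
  obtain ⟨a, rfl⟩ := exists_smul_one_of_central hc
  ext i j
  by_cases hij : i = j
  · subst hij
    exact hz i i (by rw [CharTwo.add_self_eq_zero]; decide)
  · simp [hij]

theorem qParity_even_central {n : ℕ} {z : Q F n} (hz : z ∈ qParity F n 0)
    (hc : ∀ s, z * s = s * z) : ∃ a : F, z = a • 1 := by
  obtain ⟨z, A, B, rfl⟩ := z
  have hB : B = 0 := by
    ext i j
    exact hz (Sum.inl i) (Sum.inr j) (by simp [vecParity])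
  subst hB
  obtain ⟨a, rfl⟩ := exists_smul_one_of_central (z := A) fun s => by
    have h1 := congrArg Subtype.val (hc ⟨Matrix.fromBlocks s 0 0 s, s, 0, rfl⟩)
    change Matrix.fromBlocks A 0 0 A * Matrix.fromBlocks s 0 0 s =
      Matrix.fromBlocks s 0 0 s * Matrix.fromBlocks A 0 0 A at h1
    rw [Matrix.fromBlocks_multiply, Matrix.fromBlocks_multiply, Matrix.fromBlocks_inj] at h1
    simpa using h1.1
  refine ⟨a, Subtype.ext ?_⟩
  change _ = a • (1 : M F n n)
  rw [← Matrix.fromBlocks_one, Matrix.fromBlocks_smul, smul_zero]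

variable (F) in
/-- The odd central element of `Q(n)`. -/
def qCentral (n : ℕ) : Q F n := ⟨Matrix.fromBlocks 0 1 1 0, 0, 1, rfl⟩

theorem qCentral_mem (n : ℕ) : qCentral F n ∈ qParity F n 1 := by
  rintro (i | i) (j | j) h
  · rfl
  · exact absurd (by simp [vecParity]) h
  · exact absurd (by simp [vecParity]) h
  · rfl

theorem qCentral_sq (n : ℕ) : qCentral F n * qCentral F n = 1 := by
  apply Subtype.ext
  change Matrix.fromBlocks 0 1 1 0 * Matrix.fromBlocks 0 1 1 0 = (1 : M F n n)
  rw [Matrix.fromBlocks_multiply, ← Matrix.fromBlocks_one]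
  simp

theorem qCentral_central (n : ℕ) (s : Q F n) : qCentral F n * s = s * qCentral F n := by
  obtain ⟨_, A, B, rfl⟩ := s
  apply Subtype.ext
  change Matrix.fromBlocks 0 1 1 0 * Matrix.fromBlocks A B B A =
    Matrix.fromBlocks A B B A * Matrix.fromBlocks 0 1 1 0
  rw [Matrix.fromBlocks_multiply, Matrix.fromBlocks_multiply]
  simp

end MQCenter

/-! ### Clock and shift matrices -/

section ClockShift

variable {G : Type v} [CommGroup G] {P : OddTriple G} (d : KDecomp P)

theorem OddTriple.mem_even {t : P.T} : t ∈ P.even ↔ par (t : GSharp G) = 0 := Iff.rfl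

theorem OddTriple.beta_symm (P : OddTriple G) (s t : P.T) : P.β s t = P.β t s := by
  rw [P.skew, Int.units_inv_eq_self]

namespace KDecomp

theorem A_le : d.A ≤ d.K := le_sup_left.trans d.AB_sup.le

theorem B_le : d.B ≤ d.K := le_sup_right.trans d.AB_sup.le

theorem par_K {k : P.T} (hk : k ∈ d.K) : par (k : GSharp G) = 0 :=
  OddTriple.mem_even.1 (d.K_sup.le ((le_sup_right : d.K ≤ P.radPlus ⊔ d.K) hk))

theorem exists_ab {k : P.T} (hk : k ∈ d.K) : ∃ (a : d.A) (b : d.B), (a : P.T) * b = k := by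
  rw [← d.AB_sup] at hk
  obtain ⟨a, ha, b, hb, h⟩ := Subgroup.mem_sup.1 hk
  exact ⟨⟨a, ha⟩, ⟨b, hb⟩, h⟩

theorem ab_inj {a a' : d.A} {b b' : d.B} (h : (a : P.T) * b = a' * b') : a = a' ∧ b = b' := by
  have h1 : ((a' : P.T)⁻¹ * a : P.T) = b' * (b : P.T)⁻¹ := by
    rw [eq_mul_inv_iff_mul_eq, mul_assoc, h, inv_mul_cancel_left]
  have h2 : ((a' : P.T)⁻¹ * a : P.T) ∈ d.A ⊓ d.B := Subgroup.mem_inf.2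
    ⟨mul_mem (inv_mem a'.2) a.2, h1 ▸ mul_mem b'.2 (inv_mem b.2)⟩
  rw [d.AB_inf, Subgroup.mem_bot] at h2
  have h3 : (a : P.T) = a' := (inv_mul_eq_one.1 h2).symm
  rw [h3] at h
  exact ⟨Subtype.ext h3, Subtype.ext (mul_left_cancel h)⟩

/-- `K` is a complement of the radical of `β⁺`, so the restriction of `β` to it is nondegenerate. -/
theorem eq_one_of_orthogonal {k : P.T} (hk : k ∈ d.K) (h : ∀ k' ∈ d.K, P.β k k' = 1) : k = 1 := by
  have h1 : k ∈ P.radPlus ⊓ d.K := by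
    refine ⟨⟨OddTriple.mem_even.2 (d.par_K hk), fun s hs => ?_⟩, hk⟩
    rw [← d.K_sup] at hs
    obtain ⟨r, hr, k', hk', rfl⟩ := Subgroup.mem_sup.1 hs
    rw [map_mul, h k' hk', mul_one, P.beta_symm]
    exact hr.2 k (OddTriple.mem_even.2 (d.par_K hk))
  rwa [d.K_inf, Subgroup.mem_bot] at h1

theorem A_injective {a a' : d.A} (h : ∀ b : d.B, P.β a b = P.β a' b) : a = a' := by
  have h1 : (a * (a' : P.T)⁻¹ : P.T) = 1 := by
    refine d.eq_one_of_orthogonal (mul_mem (d.A_le a.2) (inv_mem (d.A_le a'.2))) fun k hk => ?_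
    obtain ⟨x, b, rfl⟩ := d.exists_ab hk
    rw [map_mul P.β, map_inv P.β, MonoidHom.mul_apply, MonoidHom.inv_apply, map_mul, map_mul, h b,
      d.A_triv a a.2 x x.2, d.A_triv a' a'.2 x x.2, mul_inv_cancel]
  exact Subtype.ext (mul_inv_eq_one.1 h1)

theorem B_injective {b b' : d.B} (h : ∀ a : d.A, P.β a b = P.β a b') : b = b' := by
  have h1 : (b * (b' : P.T)⁻¹ : P.T) = 1 := by
    refine d.eq_one_of_orthogonal (mul_mem (d.B_le b.2) (inv_mem (d.B_le b'.2))) fun k hk => ?_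
    obtain ⟨x, y, rfl⟩ := d.exists_ab hk
    rw [map_mul P.β, map_inv P.β, MonoidHom.mul_apply, MonoidHom.inv_apply, map_mul, map_mul,
      P.beta_symm b x, P.beta_symm b' x, h x,
      d.B_triv b b.2 y y.2, d.B_triv b' b'.2 y y.2, mul_inv_cancel]
  exact Subtype.ext (mul_inv_eq_one.1 h1)

end KDecomp

variable (F : Type u) [Field F]

/-- The sign character of `B` given by `a ∈ A`, with values in `F`. -/
def signChar {T : Type*} [Group T] (χ : T →* ℤˣ) : T →* F :=
  ((Int.castRingHom F).toMonoidHom.comp (Units.coeHom ℤ)).comp χ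

variable {F}

theorem units_cast_injective (h2 : (2 : F) ≠ 0) {u v : ℤˣ} (h : ((u : ℤ) : F) = ((v : ℤ) : F)) :
    u = v := by
  refine (units_smul_eq_iff (F := F) h2 (one_ne_zero (α := F))).1 ?_
  rcases Int.units_eq_one_or u with rfl | rfl <;> rcases Int.units_eq_one_or v with rfl | rfl <;>
    first | rfl | simpa using h

theorem linearIndependent_signChar (h2 : (2 : F) ≠ 0) {T ι : Type*} [Group T]
    (χ : ι → T →* ℤˣ) (hχ : Function.Injective χ) :
    LinearIndependent F fun i => (signChar F (χ i) : T → F) := by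
  refine (linearIndependent_monoidHom T F).comp (fun i => signChar F (χ i)) fun i j h => hχ ?_
  ext t
  exact congrArg _ (units_cast_injective h2 (DFunLike.congr_fun h t))

/-- `A` and `B` embed in each other's characters by nondegeneracy, and distinct characters are
linearly independent, so each order bounds the other. This makes `|A||B|` equal to the dimension of
`End(V)`. -/
theorem KDecomp.card_eq (h2 : (2 : F) ≠ 0) : Nat.card d.A = Nat.card d.B := by
  have := Fintype.ofFinite d.A
  have := Fintype.ofFinite d.B
  rw [Nat.card_eq_fintype_card, Nat.card_eq_fintype_card]
  apply le_antisymm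
  · have h := (linearIndependent_signChar h2 (fun a : d.A => (P.β a).comp d.B.subtype)
      fun a a' h => d.A_injective fun b => DFunLike.congr_fun h b).fintype_card_le_finrank
    rwa [Module.finrank_fintype_fun_eq_card] at h
  · have h := (linearIndependent_signChar h2 (fun b : d.B => (P.β.flip b).comp d.A.subtype)
      fun a a' h => d.B_injective fun b => DFunLike.congr_fun h b).fintype_card_le_finrank
    rwa [Module.finrank_fintype_fun_eq_card] at h

theorem clock_mul_shift_apply (a : d.A) (b x y : d.B) :
    (clock F d a * shift F d b) x y = if x = b * y then ((P.β a x : ℤ) : F) else 0 := by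
  rw [clock, Matrix.diagonal_mul, shift, Matrix.of_apply, mul_ite, mul_one, mul_zero]

theorem clock_mul (a a' : d.A) : clock F d a * clock F d a' = clock F d (a * a') := by
  rw [clock, clock, clock, Matrix.diagonal_mul_diagonal]
  congr 1
  ext b
  simp

theorem shift_mul (b b' : d.B) : shift F d b * shift F d b' = shift F d (b * b') := by
  ext x y
  rw [Matrix.mul_apply, Finset.sum_eq_single (b' * y)]
  · simp [shift, mul_assoc]
  · intro z _ hz
    simp [shift, hz]
  · simp

theorem shift_mul_clock (a : d.A) (b : d.B) :
    shift F d b * clock F d a = P.β a b • (clock F d a * shift F d b) := by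
  ext x y
  rw [Matrix.smul_apply, clock_mul_shift_apply, clock, Matrix.mul_diagonal, shift,
    Matrix.of_apply]
  split_ifs with h
  · subst h
    rw [one_mul, Subgroup.coe_mul, map_mul]
    rcases Int.units_eq_one_or (P.β a b) with e | e <;> rw [e] <;> simp
  · simp

theorem clock_one : clock F d 1 = 1 := by
  simp [clock]

theorem shift_one : shift F d 1 = 1 := by
  ext x y
  simp [shift, Matrix.one_apply]

theorem clockShift_mul (a a' : d.A) (b b' : d.B) :
    (clock F d a * shift F d b) * (clock F d a' * shift F d b') =
      P.β a' b • (clock F d (a * a') * shift F d (b * b')) := by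
  rw [mul_assoc, ← mul_assoc (shift F d b), shift_mul_clock, smul_mul_assoc, mul_smul_comm,
    ← clock_mul, ← shift_mul]
  simp only [mul_assoc]

theorem KDecomp.sq_eq_one {k : P.T} (hk : k ∈ d.K) : k * k = 1 := by
  obtain ⟨f, -, -, -, h, -⟩ := P.rad
  rw [← pow_two]
  exact h k (d.par_K hk)

/-- Clocks are diagonal, and shifts are symmetric because `b² = 1`; transposition only reverses the
product, at the cost of `β(a,b)`. -/
theorem transpose_clockShift (a : d.A) (b : d.B) : (clock F d a * shift F d b).transpose =
    P.β a b • (clock F d a * shift F d b) := by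
  have hb : (shift F d b).transpose = shift F d b := by
    ext x y
    have h1 : b * b = 1 := Subtype.ext (d.sq_eq_one (d.B_le b.2))
    have h3 : y = b * x ↔ x = b * y :=
      ⟨fun h => by rw [h, ← mul_assoc, h1, one_mul], fun h => by rw [h, ← mul_assoc, h1, one_mul]⟩
    simp only [shift, Matrix.transpose_apply, Matrix.of_apply, h3]
  rw [Matrix.transpose_mul, hb, clock, Matrix.diagonal_transpose]
  exact shift_mul_clock d a b

theorem linearIndependent_clockShift (h2 : (2 : F) ≠ 0) :
    LinearIndependent F fun ab : d.A × d.B => clock F d ab.1 * shift F d ab.2 := by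
  classical
  have := Fintype.ofFinite d.A
  rw [Fintype.linearIndependent_iff]
  rintro g hg ⟨a, b⟩
  have hli := linearIndependent_signChar h2 (fun a : d.A => (P.β a).comp d.B.subtype)
      fun a a' h => d.A_injective fun b => DFunLike.congr_fun h b
  rw [Fintype.linearIndependent_iff] at hli
  refine hli (fun a => g (a, b)) ?_ a
  ext x
  -- The entry at `(x, b⁻¹x)` sees only the shift by `b`; what remains is a relation between
  -- characters of `B`.
  have h1 := congrFun (congrFun hg x) (b⁻¹ * x)
  rw [Matrix.sum_apply, Fintype.sum_prod_type] at h1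
  rw [Finset.sum_apply]
  refine Eq.trans (Finset.sum_congr rfl fun a _ => ?_) h1
  rw [Finset.sum_eq_single b]
  · rw [Matrix.smul_apply, clock_mul_shift_apply, if_pos (by rw [mul_inv_cancel_left])]
    rfl
  · intro b' _ hb'
    rw [Matrix.smul_apply, clock_mul_shift_apply, if_neg, smul_zero]
    intro h
    rw [← mul_assoc, eq_comm, mul_eq_right, mul_inv_eq_one] at h
    exact hb' h
  · simp

/-- The basis `X_a X_b` of `End(V)`. -/
def clockShiftBasis (h2 : (2 : F) ≠ 0) : Module.Basis (d.A × d.B) F (Matrix d.B d.B F) :=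
  have := Fintype.ofFinite d.A
  basisOfLinearIndependentOfCardEqFinrank (linearIndependent_clockShift d h2) (by
    rw [Module.finrank_matrix, Module.finrank_self, mul_one, ← Nat.card_eq_fintype_card,
      Nat.card_prod, d.card_eq h2, Nat.card_eq_fintype_card])

theorem clockShiftBasis_apply (h2 : (2 : F) ≠ 0) (a : d.A) (b : d.B) :
    clockShiftBasis d h2 (a, b) = clock F d a * shift F d b := by
  simp [clockShiftBasis]

end ClockShift

/-! ### The standard realizations -/

section Realization

variable {F : Type u} [Field F] {G : Type v} [CommGroup G] {P : OddTriple G}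
  {C : Type u} [Ring C] [Algebra F C] {φC : C →ₗ[F] C} {d : KDecomp P}

/-- The part `C` of a standard realization `C ⊗ End(V)`: a basis `W` with degrees `deg`
representing `T / K`. -/
structure IsCore {J : Type} (W : Module.Basis J F C) (deg : J → P.T) (φC : C →ₗ[F] C)
    (ηC : J → ℤˣ) (d : KDecomp P) : Prop where
  one : ∃ j, deg j = 1 ∧ W j = 1
  mul : ∀ i j, ∃ k, deg k = deg i * deg j ∧ ∃ c : F, c ≠ 0 ∧ W i * W j = c • W k
  comm : ∀ i j, W i * W j = ((-1) ^ (par (deg i : GSharp G) * par (deg j : GSharp G)) *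
    P.β (deg i) (deg j)) • (W j * W i)
  phi : ∀ j, φC (W j) = ηC j • W j
  phi_mul : ∀ i j, φC (W i * W j) =
    ((-1 : ℤˣ) ^ (par (deg i : GSharp G) * par (deg j : GSharp G))) • (φC (W j) * φC (W i))
  inj : ∀ i j, (deg i)⁻¹ * deg j ∈ d.K → i = j
  surj : ∀ t, ∃ j, (deg j)⁻¹ * t ∈ d.K
  orth : ∀ j, ∀ k ∈ d.K, P.β (deg j) k = 1
  tp : ∃ j, deg j = P.tp ∧ ηC j = 1
  rad : ∀ f, f ≠ 1 → (∀ s, P.β f s = 1) → ∃ j, deg j = f ∧ ηC j = -1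

/-- The degrees of the homogeneous basis of `C ⊗ End(V)`. -/
def realDeg {J : Type} (deg : J → P.T) (d : KDecomp P) (x : J × d.A × d.B) : P.T :=
  deg x.1 * x.2.1 * x.2.2

variable {J : Type} {W : Module.Basis J F C} {deg : J → P.T} {ηC : J → ℤˣ}

/-- The degrees of the core represent `T/K`, and `K` is the direct product of `A` and `B`. -/
theorem IsCore.bijective (h : IsCore W deg φC ηC d) : Function.Bijective (realDeg deg d) := by
  constructor
  · rintro ⟨i, a, b⟩ ⟨j, a', b'⟩ hij
    change deg i * a * b = deg j * a' * b' at hij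
    have h1 : (deg i)⁻¹ * deg j = a * b * ((a' : P.T) * b')⁻¹ := by
      rw [inv_mul_eq_iff_eq_mul, eq_comm, ← mul_assoc, mul_inv_eq_iff_eq_mul, ← mul_assoc,
        ← mul_assoc, hij]
    have h2 : (deg i)⁻¹ * deg j ∈ d.K := by
      rw [h1]
      exact mul_mem (mul_mem (d.A_le a.2) (d.B_le b.2))
        (inv_mem (mul_mem (d.A_le a'.2) (d.B_le b'.2)))
    obtain rfl := h.inj i j h2
    rw [mul_assoc, mul_assoc] at hij
    obtain ⟨rfl, rfl⟩ := d.ab_inj (mul_left_cancel hij)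
    rfl
  · intro t
    obtain ⟨j, hj⟩ := h.surj t
    obtain ⟨a, b, hab⟩ := d.exists_ab hj
    refine ⟨(j, a, b), ?_⟩
    change deg j * a * b = t
    rw [mul_assoc, hab, mul_inv_cancel_left]

theorem units_smul_tmul {M N : Type*} [AddCommGroup M] [Module F M] [AddCommGroup N] [Module F N]
    (u v : ℤˣ) (m : M) (n : N) : (u • m) ⊗ₜ[F] (v • n) = (u * v) • (m ⊗ₜ[F] n) := by
  rcases Int.units_eq_one_or u with rfl | rfl <;> rcases Int.units_eq_one_or v with rfl | rfl <;>
    simp [TensorProduct.neg_tmul, TensorProduct.tmul_neg]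

theorem smul_units_smul {M : Type*} [AddCommGroup M] [Module F M] (c : F) (u : ℤˣ) (m : M) :
    c • u • m = u • c • m := by
  rcases Int.units_eq_one_or u with rfl | rfl <;> simp

theorem units_smul_mul_units_smul {R : Type*} [Ring R] (u v : ℤˣ) (x y : R) :
    (u • x) * (v • y) = (u * v) • (x * y) := by
  rcases Int.units_eq_one_or u with rfl | rfl <;> rcases Int.units_eq_one_or v with rfl | rfl <;>
    simp

/-- The homogeneous basis of `C ⊗ End(V)`. -/
def IsCore.basis (h2 : (2 : F) ≠ 0) (h : IsCore W deg φC ηC d) :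
    Module.Basis P.T F (Real (F := F) C d) :=
  (W.tensorProduct (clockShiftBasis d h2)).reindex (Equiv.ofBijective _ h.bijective)

theorem IsCore.basis_realDeg (h2 : (2 : F) ≠ 0) (h : IsCore W deg φC ηC d) (x : J × d.A × d.B) :
    h.basis h2 (realDeg deg d x) = W x.1 ⊗ₜ[F] (clock F d x.2.1 * shift F d x.2.2) := by
  have h1 : (Equiv.ofBijective _ h.bijective).symm (realDeg deg d x) = x :=
    (Equiv.ofBijective _ h.bijective).symm_apply_apply x
  rw [IsCore.basis, Module.Basis.reindex_apply, h1, Module.Basis.tensorProduct_apply',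
    clockShiftBasis_apply]

theorem IsCore.par_realDeg (deg : J → P.T) (x : J × d.A × d.B) :
    par (realDeg deg d x : GSharp G) = par (deg x.1 : GSharp G) := by
  change par (deg x.1 : GSharp G) + par ((x.2.1 : P.T) : GSharp G) +
    par ((x.2.2 : P.T) : GSharp G) = _
  rw [d.par_K (d.A_le x.2.1.2), d.par_K (d.B_le x.2.2.2), add_zero, add_zero]

theorem IsCore.beta_realDeg (h : IsCore W deg φC ηC d) (x y : J × d.A × d.B) :
    P.β (realDeg deg d x) (realDeg deg d y) =
      P.β (deg x.1) (deg y.1) * (P.β x.2.1 y.2.2 * P.β y.2.1 x.2.2) := by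
  obtain ⟨i, a, b⟩ := x
  obtain ⟨j, a', b'⟩ := y
  change P.β (deg i * a * b) (deg j * a' * b') = _
  have hA := d.A_le
  have hB := d.B_le
  simp only [map_mul, MonoidHom.mul_apply]
  rw [h.orth i _ (hA a'.2), h.orth i _ (hB b'.2), P.beta_symm a (deg j), P.beta_symm b (deg j),
    h.orth j _ (hA a.2), h.orth j _ (hB b.2), d.A_triv a a.2 a' a'.2, d.B_triv b b.2 b' b'.2,
    P.beta_symm b a']
  exact (by decide : ∀ x y z : ℤˣ, x * 1 * 1 * (1 * 1 * y) * (1 * z * 1) = x * (z * y)) _ _ _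

theorem IsCore.tmul_mul (x y : J × d.A × d.B) :
    (W x.1 ⊗ₜ[F] (clock F d x.2.1 * shift F d x.2.2)) *
      (W y.1 ⊗ₜ[F] (clock F d y.2.1 * shift F d y.2.2)) =
    P.β y.2.1 x.2.2 • ((W x.1 * W y.1) ⊗ₜ[F]
      (clock F d (x.2.1 * y.2.1) * shift F d (x.2.2 * y.2.2))) := by
  rw [Algebra.TensorProduct.tmul_mul_tmul, clockShift_mul, ← one_smul ℤˣ (W x.1 * W y.1),
    units_smul_tmul, one_smul, one_mul]

/-- A standard realization is a graded-division superalgebra with superinvolution of type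
`(T, β̃, t_p)`. -/
theorem IsCore.nonempty_stdData (h2 : (2 : F) ≠ 0) (h : IsCore W deg φC ηC d) :
    Nonempty (StdData P (realGrading W deg d)
      (TensorProduct.map φC (Matrix.transposeLinearEquiv d.B d.B F F).toLinearMap)) := by
  set Y := h.basis h2 with hY
  have hYx : ∀ x, Y (realDeg deg d x) = W x.1 ⊗ₜ[F] (clock F d x.2.1 * shift F d x.2.2) :=
    h.basis_realDeg h2
  have hsurj : ∀ t, ∃ x, realDeg deg d x = t := h.bijective.2
  set φ₀ := TensorProduct.map φC (Matrix.transposeLinearEquiv d.B d.B F F).toLinearMap with hφ₀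
  have hgr : ∀ γ, realGrading W deg d γ =
      Submodule.span F {y | ∃ t : P.T, (t : GSharp G) = γ ∧ y = Y t} := by
    intro γ
    rw [realGrading]
    congr 1
    ext y
    constructor
    · rintro ⟨j, a, b, h1, rfl⟩
      exact ⟨realDeg deg d (j, a, b), h1, (hYx (j, a, b)).symm⟩
    · rintro ⟨t, h1, rfl⟩
      obtain ⟨⟨j, a, b⟩, rfl⟩ := hsurj t
      exact ⟨j, a, b, h1, hYx (j, a, b)⟩
  have hmem : ∀ (t : P.T) y, y ∈ realGrading W deg d t ↔ ∃ c : F, y = c • Y t := by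
    intro t y
    have h1 : {y | ∃ s : P.T, (s : GSharp G) = t ∧ y = Y s} = {Y t} := by
      ext y
      constructor
      · rintro ⟨s, hs, rfl⟩
        rw [Subtype.ext hs]
        rfl
      · rintro rfl
        exact ⟨t, rfl, rfl⟩
    rw [hgr, h1, Submodule.mem_span_singleton]
    exact ⟨fun ⟨c, hc⟩ => ⟨c, hc.symm⟩, fun ⟨c, hc⟩ => ⟨c, hc.symm⟩⟩
  have hmul : ∀ s t, ∃ c : F, c ≠ 0 ∧ Y s * Y t = c • Y (s * t) := by
    intro s t
    obtain ⟨x, rfl⟩ := hsurj s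
    obtain ⟨y, rfl⟩ := hsurj t
    obtain ⟨k, hk, c, hc, hc'⟩ := h.mul x.1 y.1
    have h1 : realDeg deg d x * realDeg deg d y =
        realDeg deg d (k, x.2.1 * y.2.1, x.2.2 * y.2.2) := by
      simp only [realDeg, hk, Subgroup.coe_mul]
      exact Additive.ofMul.injective (by simp only [ofMul_mul]; abel)
    refine ⟨((P.β y.2.1 x.2.2 : ℤ) : F) * c, ?_, ?_⟩
    · rcases Int.units_eq_one_or (P.β y.2.1 x.2.2) with e | e <;> rw [e] <;> simpa
    · rw [hYx, hYx, IsCore.tmul_mul, hc', h1, hYx, TensorProduct.smul_tmul', mul_smul,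
        Int.cast_smul_eq_zsmul]
      rfl
  have hcomm : ∀ s t, Y s * Y t = ((-1) ^ (par (s : GSharp G) * par (t : GSharp G)) * P.β s t) •
      (Y t * Y s) := by
    intro s t
    obtain ⟨x, rfl⟩ := hsurj s
    obtain ⟨y, rfl⟩ := hsurj t
    rw [hYx, hYx, IsCore.tmul_mul, IsCore.tmul_mul, h.comm, IsCore.par_realDeg, IsCore.par_realDeg,
      h.beta_realDeg, mul_comm y.2.1, mul_comm y.2.2, ← one_smul ℤˣ (clock F d _ * shift F d _),
      units_smul_tmul, one_smul, smul_smul, smul_smul]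
    congr 1
    exact (by decide : ∀ a b c d : ℤˣ, a * (b * c * 1) = b * (c * (d * a)) * d) _ _ _ _
  have hφx : ∀ x, φ₀ (Y (realDeg deg d x)) =
      (ηC x.1 * P.β x.2.1 x.2.2) • Y (realDeg deg d x) := by
    intro x
    rw [hYx, hφ₀, TensorProduct.map_tmul, h.phi]
    change _ ⊗ₜ[F] (clock F d x.2.1 * shift F d x.2.2).transpose = _
    rw [transpose_clockShift, units_smul_tmul]
  have hφ : ∀ t, ∃ η : ℤˣ, φ₀ (Y t) = η • Y t := by
    intro t
    obtain ⟨x, rfl⟩ := hsurj t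
    exact ⟨_, hφx x⟩
  choose η hη using hφ
  have hYne : ∀ t, Y t ≠ 0 := fun t => Y.ne_zero t
  have hηx : ∀ x, η (realDeg deg d x) = ηC x.1 * P.β x.2.1 x.2.2 := fun x =>
    (units_smul_eq_iff h2 (hYne _)).1 ((hη _).symm.trans (hφx x))
  have hηj : ∀ j, η (deg j) = ηC j := fun j => by
    have h1 := hηx (j, 1, 1)
    simpa [realDeg] using h1
  -- The elements of `K` are even, so the whole super-sign comes from the factor `C`; transposition
  -- is an ordinary anti-automorphism.
  have hφmul : ∀ s t, φ₀ (Y s * Y t) =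
      ((-1 : ℤˣ) ^ (par (s : GSharp G) * par (t : GSharp G))) • (φ₀ (Y t) * φ₀ (Y s)) := by
    intro s t
    obtain ⟨x, rfl⟩ := hsurj s
    obtain ⟨y, rfl⟩ := hsurj t
    have hφt : ∀ (c : C) (M : Matrix d.B d.B F), φ₀ (c ⊗ₜ[F] M) = φC c ⊗ₜ[F] M.transpose :=
      fun c M => rfl
    rw [hYx, hYx, Algebra.TensorProduct.tmul_mul_tmul, hφt, hφt, hφt,
      Algebra.TensorProduct.tmul_mul_tmul, h.phi_mul, Matrix.transpose_mul, IsCore.par_realDeg,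
      IsCore.par_realDeg]
    nth_rw 1 [← one_smul ℤˣ (Matrix.transpose _ * Matrix.transpose _)]
    rw [units_smul_tmul, mul_one]
  refine ⟨⟨Y, η, hmem, fun γ hγ => ?_, ?_, hmul, hcomm, hη, fun s t => ?_, ?_, fun f hf hf' => ?_⟩⟩
  · rw [hgr, Submodule.span_eq_bot]
    rintro y ⟨t, rfl, -⟩
    exact absurd t.2 hγ
  · obtain ⟨j, hj, hj'⟩ := h.one
    rw [hgr]
    refine Submodule.subset_span ⟨realDeg deg d (j, 1, 1), by simp [realDeg, hj], ?_⟩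
    rw [hYx, hj', clock_one, shift_one, mul_one]
    rfl
  -- Evaluating `φ₀(Y_s Y_t)` as `η(st)Y_s Y_t` and by super-antimultiplicativity yields the
  -- polarization identity.
  · obtain ⟨c, hc, h1⟩ := hmul s t
    have h3 := hφmul s t
    have hne : Y t * Y s ≠ 0 := by
      obtain ⟨c', hc', h1'⟩ := hmul t s
      rw [h1']
      exact smul_ne_zero hc' (hYne _)
    rw [h1, map_smul, hη, smul_units_smul, ← h1, hcomm, smul_smul, hη, hη, units_smul_mul_units_smul,
      smul_smul, units_smul_eq_iff h2 hne] at h3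
    exact (by decide : ∀ a b c x y : ℤˣ, a * (b * c) = b * (y * x) → a = c * x * y) _ _ _ _ _ h3
  · obtain ⟨j, hj, hj'⟩ := h.tp
    rw [← hj, hηj, hj']
  · obtain ⟨j, hj, hj'⟩ := h.rad f hf hf'
    rw [← hj, hηj, hj']

end Realization

/-! ### The radicals of the two bicharacters -/

section Radical

variable {G : Type v} [CommGroup G] {P : OddTriple G}

theorem OddTriple.exists_radical (P : OddTriple G) : ∃ f : P.T, f ≠ 1 ∧ par (f : GSharp G) = 0 ∧
    (∀ t, (∀ s, P.β t s = 1) ↔ t = 1 ∨ t = f) ∧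
    (∀ t : P.T, par (t : GSharp G) = 0 → t ^ 2 = 1) ∧
    (∀ t : P.T, par (t : GSharp G) = 1 → t ^ 2 = f) := by
  obtain ⟨f, hf, hpf, hrad, h0, h1⟩ := P.rad
  refine ⟨f, hf, hpf, fun t => (hrad t).trans ⟨?_, ?_⟩, h0, h1⟩
  · rintro ⟨n, rfl⟩
    have h3 : f ^ (2 : ℤ) = 1 := by exact_mod_cast h0 f hpf
    rcases Int.even_or_odd' n with ⟨m, rfl | rfl⟩
    · left
      change f ^ (2 * m) = 1
      rw [zpow_mul, h3, one_zpow]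
    · right
      change f ^ (2 * m + 1) = f
      rw [zpow_add, zpow_mul, h3, one_zpow, zpow_one, one_mul]
  · rintro (rfl | rfl)
    · exact one_mem _
    · exact Subgroup.mem_zpowers _

theorem OddTriple.par_mul (s t : P.T) :
    par ((s * t : P.T) : GSharp G) = par (s : GSharp G) + par (t : GSharp G) := rfl

theorem OddTriple.par_inv (t : P.T) : par ((t⁻¹ : P.T) : GSharp G) = par (t : GSharp G) :=
  CharTwo.neg_eq _

theorem OddTriple.par_pow (t : P.T) (n : ℕ) :
    par ((t ^ n : P.T) : GSharp G) = n * par (t : GSharp G) := by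
  induction n with
  | zero => simp; rfl
  | succ n ih => rw [pow_succ, OddTriple.par_mul, ih, Nat.cast_succ, add_mul, one_mul]

/-- Any odd element is `t₁` times an even one, so a single odd test decides whether an element of
`rad β⁺` lies in `rad β̃`. -/
theorem OddTriple.beta_eq_one_of_odd {r t₁ : P.T} (hr : r ∈ P.radPlus)
    (ht : par (t₁ : GSharp G) = 1) (h : P.β r t₁ = 1) (s : P.T) : P.β r s = 1 := by
  rcases (show ∀ k : ZMod 2, k = 0 ∨ k = 1 by decide) (par (s : GSharp G)) with hs | hs
  · exact hr.2 s hs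
  · have h1 : P.β r (s * t₁⁻¹) = 1 := hr.2 _ <| OddTriple.mem_even.2 <| by
      rw [OddTriple.par_mul, OddTriple.par_inv, hs, ht]; rfl
    rwa [map_mul, map_inv, h, inv_one, mul_one] at h1

theorem OddTriple.beta_tp_odd {t : P.T} (ht : par (t : GSharp G) = 1) : P.β P.tp t = -1 := by
  rw [P.tp_parity, ht, uzpow_one]

theorem OddTriple.beta_tp_even {t : P.T} (ht : par (t : GSharp G) = 0) : P.β P.tp t = 1 := by
  rw [P.tp_parity, ht, uzpow_zero]

theorem KDecomp.eq_one_of_mem (d : KDecomp P) {t : P.T} (h : t ∈ P.radPlus) (h' : t ∈ d.K) :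
    t = 1 := by
  have h1 : t ∈ P.radPlus ⊓ d.K := ⟨h, h'⟩
  rwa [d.K_inf, Subgroup.mem_bot] at h1

theorem OddTriple.mem_radPlus_of_rad {t : P.T} (h0 : par (t : GSharp G) = 0)
    (h : ∀ s, P.β t s = 1) : t ∈ P.radPlus := ⟨h0, fun s _ => h s⟩

/-- A map `deg` that represents `rad β⁺` and has an odd value represents `T / K`. -/
theorem KDecomp.exists_deg (d : KDecomp P) {J : Type} [Add J] {deg : J → P.T}
    (hadd : ∀ i j, deg (i + j) = deg i * deg j) {j₁ : J} (h1 : par (deg j₁ : GSharp G) = 1)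
    (hr : ∀ r ∈ P.radPlus, ∃ j, deg j = r) (t : P.T) : ∃ j, (deg j)⁻¹ * t ∈ d.K := by
  have heven : ∀ t : P.T, par (t : GSharp G) = 0 → ∃ j, (deg j)⁻¹ * t ∈ d.K := by
    intro t ht
    have h2 : t ∈ P.radPlus ⊔ d.K := d.K_sup.ge (OddTriple.mem_even.2 ht)
    obtain ⟨r, hr', k, hk, rfl⟩ := Subgroup.mem_sup.1 h2
    obtain ⟨j, rfl⟩ := hr r hr'
    exact ⟨j, by rwa [inv_mul_cancel_left]⟩
  rcases (show ∀ k : ZMod 2, k = 0 ∨ k = 1 by decide) (par (t : GSharp G)) with ht | ht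
  · exact heven t ht
  -- An odd element is first made even by the odd degree `deg j₁`.
  · obtain ⟨j, hj⟩ := heven ((deg j₁)⁻¹ * t) (by
      rw [OddTriple.par_mul, OddTriple.par_inv, h1, ht]; rfl)
    refine ⟨j₁ + j, ?_⟩
    rwa [hadd, mul_inv_rev, mul_assoc]

end Radical

/-! ### Elements of `S × Sˢᵒᵖ` -/

section ExElements

variable {F : Type u} [Field F] {S : Type w} [Ring S] [Algebra F S] {𝒮 : ZMod 2 → Submodule F S}
  [GradedAlgebra 𝒮]

theorem exPlus_one : exPlus 𝒮 1 = 1 := rfl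

theorem exch_exPlus (s : S) : exch 𝒮 (exPlus 𝒮 s) = exPlus 𝒮 s := rfl

theorem exch_exMinus (s : S) : exch 𝒮 (exMinus 𝒮 s) = -exMinus 𝒮 s :=
  Prod.ext rfl (neg_neg (toSOp 𝒮 s)).symm

theorem exMinus_one_mul_exPlus (s : S) : exMinus 𝒮 1 * exPlus 𝒮 s = exMinus 𝒮 s := by
  refine Prod.ext (one_mul s) ?_
  change (-1 : SOp 𝒮) * toSOp 𝒮 s = -toSOp 𝒮 s
  rw [neg_one_mul]

theorem exMinus_one_mul_exMinus (s : S) : exMinus 𝒮 1 * exMinus 𝒮 s = exPlus 𝒮 s := by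
  refine Prod.ext (one_mul s) ?_
  change (-1 : SOp 𝒮) * -toSOp 𝒮 s = toSOp 𝒮 s
  rw [neg_one_mul, neg_neg]

theorem exPlus_mem {i : ZMod 2} {s : S} (hs : s ∈ 𝒮 i) : exPlus 𝒮 s ∈ exParity 𝒮 i :=
  mem_exParity.2 ⟨hs, hs⟩

/-- The sign in the superopposite turns an odd square root of `1` into a generator of order four,
with square `(1,-1̄)`. -/
theorem exPlus_odd_mul_self {u : S} (hu : u ∈ 𝒮 1) (hu1 : u * u = 1) :
    exPlus 𝒮 u * exPlus 𝒮 u = exMinus 𝒮 1 := by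
  refine Prod.ext hu1 ?_
  change toSOp 𝒮 (sopMul 𝒮 u u) = -toSOp 𝒮 1
  rw [sopMul_of_mem 𝒮 hu hu, hu1, one_mul, uzpow_one, Units.neg_smul, one_smul, map_neg]

theorem exPlus_even_mul {i : ZMod 2} {s t : S} (hs : s ∈ 𝒮 0) (ht : t ∈ 𝒮 i) :
    exPlus 𝒮 s * exPlus 𝒮 t = (s * t, toSOp 𝒮 (t * s)) := by
  refine Prod.ext rfl ?_
  change toSOp 𝒮 (sopMul 𝒮 s t) = _
  rw [sopMul_of_mem 𝒮 hs ht, zero_mul, uzpow_zero, one_smul]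

theorem exPlus_mul_even {i : ZMod 2} {s t : S} (hs : s ∈ 𝒮 i) (ht : t ∈ 𝒮 0) :
    exPlus 𝒮 s * exPlus 𝒮 t = (s * t, toSOp 𝒮 (t * s)) := by
  refine Prod.ext rfl ?_
  change toSOp 𝒮 (sopMul 𝒮 s t) = _
  rw [sopMul_of_mem 𝒮 hs ht, mul_zero, uzpow_zero, one_smul]

theorem exPlus_pow_mem {u : S} (hu : u ∈ 𝒮 1) (n : ℕ) :
    exPlus 𝒮 u ^ n ∈ exParity 𝒮 (n : ZMod 2) := by
  induction n with
  | zero =>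
    rw [pow_zero, ← exPlus_one, Nat.cast_zero]
    exact exPlus_mem SetLike.GradedOne.one_mem
  | succ n ih =>
    rw [pow_succ, Nat.cast_succ]
    exact exParity_mul_mem ih (exPlus_mem hu)

theorem pow_mul_pow_of_anticomm {R : Type*} [Ring R] {x y : R} (h : x * y = -(y * x)) (i l : ℕ) :
    x ^ i * y ^ l = ((-1 : ℤˣ) ^ (i * l)) • (y ^ l * x ^ i) := by
  have h1 : ∀ l, x * y ^ l = ((-1 : ℤˣ) ^ l) • (y ^ l * x) := by
    intro l
    induction l with
    | zero => simp
    | succ l ih =>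
      rw [pow_succ', ← mul_assoc, h, neg_mul, mul_assoc, ih, mul_smul_comm, pow_succ' (-1 : ℤˣ),
        mul_smul, Units.neg_smul, one_smul, mul_assoc]
  induction i with
  | zero => simp
  | succ i ih =>
    rw [pow_succ, mul_assoc, h1, mul_smul_comm, ← mul_assoc, ih, smul_mul_assoc, smul_smul,
      ← pow_add, mul_assoc]
    congr 2
    ring

end ExElements

/-! ### The standard realizations of type `M` -/

section RealM

variable (F : Type u) [Field F] {G : Type v} [CommGroup G] {P : OddTriple G}

/-- The element `τ ∈ M(1,1)`. -/
def mTau : M F 1 1 := Matrix.fromBlocks 1 0 0 (-1)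

/-- The element `u ∈ M(1,1)`. -/
def mU : M F 1 1 := Matrix.fromBlocks 0 1 1 0

theorem mTau_mem : mTau F ∈ mParity F 1 1 0 := by
  rintro (i | i) (j | j) h
  · exact absurd (by simp [vecParity]) h
  · rfl
  · rfl
  · exact absurd (by simp [vecParity]; rfl) h

theorem mU_mem : mU F ∈ mParity F 1 1 1 := by
  rintro (i | i) (j | j) h
  · rfl
  · exact absurd (by simp [vecParity]) h
  · exact absurd (by simp [vecParity]) h
  · rfl

theorem mU_sq : mU F * mU F = 1 := by
  rw [mU, Matrix.fromBlocks_multiply, ← Matrix.fromBlocks_one]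
  simp

theorem mTau_sq : mTau F * mTau F = 1 := by
  rw [mTau, Matrix.fromBlocks_multiply, ← Matrix.fromBlocks_one]
  simp

theorem mU_mul_mTau : mU F * mTau F = Matrix.fromBlocks 0 (-1) 1 0 := by
  rw [mU, mTau, Matrix.fromBlocks_multiply]
  simp

theorem mTau_mul_mU : mTau F * mU F = -Matrix.fromBlocks 0 (-1) 1 0 := by
  rw [mU, mTau, Matrix.fromBlocks_multiply, Matrix.fromBlocks_neg]
  simp

/-- The element `(τ, τ̄)`. -/
def oX : Ex (mParity F 1 1) := exPlus _ (mTau F)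

/-- The element `(u, ū)`. -/
def oY : Ex (mParity F 1 1) := exPlus _ (mU F)

theorem oX_sq : oX F * oX F = 1 := by
  rw [oX, exPlus_even_mul (mTau_mem F) (mTau_mem F), mTau_sq]
  rfl

theorem oY_sq : oY F * oY F = exMinus _ 1 := exPlus_odd_mul_self (mU_mem F) (mU_sq F)

theorem oY_pow_four : oY F ^ 4 = 1 := by
  rw [(show 4 = 2 + 2 from rfl), pow_add, pow_two, oY_sq, exMinus_one_mul_exMinus, exPlus_one]

theorem oY_mul_oX : oY F * oX F = exMinus _ (Matrix.fromBlocks 0 (-1) 1 0) := by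
  rw [oX, oY, exPlus_mul_even (mU_mem F) (mTau_mem F), mU_mul_mTau, mTau_mul_mU, map_neg]
  rfl

theorem oX_mul_oY : oX F * oY F = -(oY F * oX F) := by
  rw [oY_mul_oX, oX, oY, exPlus_even_mul (mTau_mem F) (mU_mem F), mU_mul_mTau, mTau_mul_mU]
  exact Prod.ext rfl (neg_neg _).symm

/-- The prescribed basis consists of the ordered monomials in `Y = (u,ū)` and `X = (τ,τ̄)`. Its
multiplication table then follows from `X² = 1`, `Y⁴ = 1` and `XY = -YX`; the order `Y` before `X`
matches the prescribed signs. -/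
theorem oBasis_eq (x : Fin 2 × Fin 4) : oBasis F x = oY F ^ (x.2 : ℕ) * oX F ^ (x.1 : ℕ) := by
  have h1 : Matrix.fromBlocks 1 0 0 1 = (1 : M F 1 1) := Matrix.fromBlocks_one
  have h3 : oY F ^ 3 = exMinus _ (mU F) := by
    rw [pow_succ, pow_two, oY_sq, oY, exMinus_one_mul_exPlus]
  have h4 : oY F ^ 3 * oX F = exPlus _ (Matrix.fromBlocks 0 (-1) 1 0) := by
    rw [pow_succ, pow_two, oY_sq, mul_assoc, oY_mul_oX, exMinus_one_mul_exMinus]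
  have h5 : oY F ^ 2 * oX F = exMinus _ (mTau F) := by
    rw [pow_two, oY_sq, oX, exMinus_one_mul_exPlus]
  obtain ⟨i, j⟩ := x
  fin_cases i <;> fin_cases j
  · simp [oBasis, h1, exPlus_one]
  · simp [oBasis]; rfl
  · simp [oBasis, h1, pow_two, oY_sq]
  · simp [oBasis, h3]; rfl
  · simp [oBasis]; rfl
  · simp [oBasis, oY_mul_oX]
  · simp [oBasis, h5]; rfl
  · simp [oBasis, h4]

variable {F}

theorem oBasis_mul (x y : Fin 2 × Fin 4) :
    oBasis F x * oBasis F y = ((-1 : ℤˣ) ^ ((x.1 : ℕ) * y.2)) • oBasis F (x + y) := by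
  have h : oBasis F (x + y) = oY F ^ ((x.2 : ℕ) + y.2) * oX F ^ ((x.1 : ℕ) + y.1) := by
    rw [oBasis_eq, Prod.snd_add, Prod.fst_add, Fin.val_add, Fin.val_add,
      ← pow_eq_pow_mod _ (oY_pow_four F), ← pow_eq_pow_mod _ ((pow_two _).trans (oX_sq F))]
  rw [h, oBasis_eq, oBasis_eq, mul_assoc, ← mul_assoc (oX F ^ _),
    pow_mul_pow_of_anticomm (oX_mul_oY F), smul_mul_assoc, mul_smul_comm, pow_add, pow_add]
  simp only [mul_assoc]

theorem oBasis_mem (x : Fin 2 × Fin 4) : oBasis F x ∈ exParity (mParity F 1 1) (x.2 : ℕ) := by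
  rw [oBasis_eq, ← add_zero (((x.2 : ℕ) : ZMod 2))]
  refine exParity_mul_mem (exPlus_pow_mem (mU_mem F) _) ?_
  induction (x.1 : ℕ) with
  | zero => exact exPlus_mem SetLike.GradedOne.one_mem
  | succ n ih =>
    rw [pow_succ, ← add_zero (0 : ZMod 2)]
    exact exParity_mul_mem ih (exPlus_mem (mTau_mem F))

/-- The signs of the exchange superinvolution on `oBasis`. -/
def oSign (x : Fin 2 × Fin 4) : ℤˣ := ![![1, 1, -1, -1], ![1, -1, -1, 1]] x.1 x.2

theorem exch_oBasis (x : Fin 2 × Fin 4) :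
    exch (mParity F 1 1) (oBasis F x) = oSign x • oBasis F x := by
  obtain ⟨i, j⟩ := x
  fin_cases i <;> fin_cases j <;>
    simp [oBasis, oSign, exch_exPlus, exch_exMinus]

theorem oBasis_linearIndependent (h2 : (2 : F) ≠ 0) : LinearIndependent F (oBasis F) := by
  rw [Fintype.linearIndependent_iff]
  intro c hc
  rw [Fintype.sum_prod_type] at hc
  simp only [Fin.sum_univ_succ, Fin.sum_univ_zero] at hc
  have h1 := congrArg Prod.fst hc
  have h3 : _ = (0 : M F 1 1) := congrArg (fun z => (toSOp (mParity F 1 1)).symm z.2) hc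
  have e := fun a b => congrFun (congrFun h1 a) b
  have e' := fun a b => congrFun (congrFun h3 a) b
  have e1 := e (Sum.inl 0) (Sum.inl 0)
  have e2 := e (Sum.inr 0) (Sum.inr 0)
  have e3 := e (Sum.inl 0) (Sum.inr 0)
  have e4 := e (Sum.inr 0) (Sum.inl 0)
  have e5 := e' (Sum.inl 0) (Sum.inl 0)
  have e6 := e' (Sum.inr 0) (Sum.inr 0)
  have e7 := e' (Sum.inl 0) (Sum.inr 0)
  have e8 := e' (Sum.inr 0) (Sum.inl 0)
  simp [oBasis, exPlus, exMinus] at e1 e2 e3 e4 e5 e6 e7 e8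
  have h4 : (4 : F) ≠ 0 := by
    rw [(by norm_num : (4 : F) = 2 * 2)]
    exact mul_ne_zero h2 h2
  have key : ∀ x : F, 4 * x = 0 → x = 0 := fun x hx => (mul_eq_zero.1 hx).resolve_left h4
  rintro ⟨i, j⟩
  -- Four times each coefficient is a signed sum of four matrix entries taken from the two factors.
  apply key
  fin_cases i <;> fin_cases j <;> simp only [Fin.zero_eta, Fin.mk_one, Fin.reduceFinMk]
  · linear_combination e1 + e2 + e5 + e6
  · linear_combination e3 + e4 + e7 + e8
  · linear_combination e1 + e2 - e5 - e6
  · linear_combination e3 + e4 - e7 - e8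
  · linear_combination e1 - e2 + e5 - e6
  · linear_combination -e3 + e4 + e7 - e8
  · linear_combination e1 - e2 - e5 + e6
  · linear_combination -e3 + e4 - e7 + e8

/-- `oBasis` as a basis. -/
def mBasis (h2 : (2 : F) ≠ 0) : Module.Basis (Fin 2 × Fin 4) F (Ex (mParity F 1 1)) :=
  have : Nonempty (Fin 2 × Fin 4) := ⟨0⟩
  basisOfLinearIndependentOfCardEqFinrank (oBasis_linearIndependent h2) (by
    rw [Module.finrank_prod, ← (toSOp (mParity F 1 1)).finrank_eq, Module.finrank_matrix]
    simp)

theorem coe_mBasis (h2 : (2 : F) ≠ 0) : ⇑(mBasis h2) = oBasis F := by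
  simp [mBasis]

/-- The degrees of `oBasis`. -/
def mDeg (r : RealizationM P) (x : Fin 2 × Fin 4) : P.T := P.tp ^ (x.1 : ℕ) * r.t₁ ^ (x.2 : ℕ)

theorem RealizationM.t₁_pow_four (r : RealizationM P) : r.t₁ ^ 4 = 1 := by
  obtain ⟨f, -, hpf, -, h0, h1⟩ := P.exists_radical
  rw [(show 4 = 2 * 2 from rfl), pow_mul, h1 _ r.t₁_odd, h0 _ hpf]

theorem OddTriple.tp_sq (hp : par (P.tp : GSharp G) = 0) : P.tp ^ 2 = 1 := by
  obtain ⟨f, -, -, -, h0, -⟩ := P.exists_radical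
  exact h0 _ hp

variable (r : RealizationM P)

theorem mDeg_add (hp : par (P.tp : GSharp G) = 0) (x y : Fin 2 × Fin 4) :
    mDeg r (x + y) = mDeg r x * mDeg r y := by
  rw [mDeg, Prod.snd_add, Prod.fst_add, Fin.val_add, Fin.val_add,
    ← pow_eq_pow_mod _ r.t₁_pow_four, ← pow_eq_pow_mod _ (OddTriple.tp_sq hp), pow_add, pow_add]
  exact mul_mul_mul_comm _ _ _ _

theorem par_mDeg (hp : par (P.tp : GSharp G) = 0) (x : Fin 2 × Fin 4) :
    par (mDeg r x : GSharp G) = (x.2 : ℕ) := by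
  rw [mDeg, OddTriple.par_mul, OddTriple.par_pow, OddTriple.par_pow, hp, r.t₁_odd]
  simp

/-- The exponent records `β̃(t_p,t_p) = 1` and `β̃(t_p,t₁) = β̃(t₁,t₁) = -1`. -/
theorem beta_mDeg (hp : par (P.tp : GSharp G) = 0) (x y : Fin 2 × Fin 4) :
    P.β (mDeg r x) (mDeg r y) =
      (-1) ^ ((x.1 : ℕ) * y.2 + x.2 * y.1 + x.2 * y.2) := by
  rw [mDeg, mDeg]
  simp only [map_mul, map_pow, MonoidHom.mul_apply, MonoidHom.pow_apply]
  rw [P.beta_symm r.t₁ P.tp, OddTriple.beta_tp_even hp, OddTriple.beta_tp_odd r.t₁_odd,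
    P.diag r.t₁, r.t₁_odd, uzpow_one]
  simp only [one_pow, one_mul, ← pow_mul, ← pow_add]
  congr 1
  ring

/-- An element of `rad β⁺` orthogonal to `t₁` is radical, hence `1` or `f = t₁²`; otherwise
multiplication by `t_p` makes it orthogonal. -/
theorem mDeg_surj (hp : par (P.tp : GSharp G) = 0) {t : P.T} (ht : t ∈ P.radPlus) :
    ∃ x, mDeg r x = t := by
  obtain ⟨f, -, hpf, hrad, h0, h1⟩ := P.exists_radical
  have hr : ∀ t ∈ P.radPlus, P.β t r.t₁ = 1 → ∃ j : Fin 4, mDeg r (0, j) = t := by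
    intro t ht h
    rcases (hrad t).1 (OddTriple.beta_eq_one_of_odd ht r.t₁_odd h) with rfl | rfl
    · exact ⟨0, by simp [mDeg]⟩
    · exact ⟨2, by simpa [mDeg] using h1 _ r.t₁_odd⟩
  rcases Int.units_eq_one_or (P.β t r.t₁) with h | h
  · obtain ⟨j, hj⟩ := hr t ht h
    exact ⟨_, hj⟩
  · have htp : P.tp ∈ P.radPlus := ⟨hp, fun s hs => OddTriple.beta_tp_even hs⟩
    obtain ⟨j, hj⟩ := hr (P.tp * t) (mul_mem htp ht) (by
      rw [map_mul, MonoidHom.mul_apply, h, OddTriple.beta_tp_odd r.t₁_odd]; rfl)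
    refine ⟨(1, j), ?_⟩
    rw [← mul_right_inj P.tp, ← hj]
    simp only [mDeg, Fin.val_one, Fin.val_zero, pow_zero, pow_one, one_mul]
    rw [← mul_assoc, ← pow_two, OddTriple.tp_sq hp, one_mul]

/-- Evenness of `K` excludes odd powers of `t₁`, orthogonality to `t₁` excludes the factor `t_p`,
and `f = t₁²` is excluded because `K` meets `rad β⁺` trivially. -/
theorem eq_zero_of_mDeg_mem (hp : par (P.tp : GSharp G) = 0) {x : Fin 2 × Fin 4}
    (hx : mDeg r x ∈ r.K) : x = 0 := by
  obtain ⟨f, hf, hpf, hrad, h0, h1⟩ := P.exists_radical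
  have e1 := r.par_K hx
  rw [par_mDeg r hp] at e1
  have e2 : P.β (mDeg r (0, 1)) (mDeg r x) = 1 := by
    have h3 : mDeg r (0, 1) = r.t₁ := by simp [mDeg]
    rw [h3, r.t₁_K _ hx]
  rw [beta_mDeg r hp] at e2
  obtain ⟨i, j⟩ := x
  have e3 : (i, j) ≠ ((0, 2) : Fin 2 × Fin 4) := fun h => by
    have h3 : mDeg r (i, j) = f := by rw [h]; simpa [mDeg] using h1 _ r.t₁_odd
    rw [h3] at hx
    exact hf (r.eq_one_of_mem (OddTriple.mem_radPlus_of_rad hpf ((hrad f).2 (Or.inr rfl))) hx)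
  revert e1 e2 e3
  fin_cases i <;> fin_cases j <;> decide

theorem RealizationM.isCore (hp : par (P.tp : GSharp G) = 0) (h2 : (2 : F) ≠ 0) :
    IsCore (mBasis h2) (mDeg r) (exch (mParity F 1 1)) oSign r.toKDecomp := by
  obtain ⟨f, hf, hpf, hrad, h0, h1⟩ := P.exists_radical
  have hadd := mDeg_add r hp
  refine ⟨⟨0, by simp [mDeg], ?_⟩, fun i j => ⟨i + j, hadd i j, ?_⟩, fun i j => ?_, fun j => ?_,
    fun i j => ?_, fun i j h => ?_, r.exists_deg hadd (j₁ := (0, 1)) ?_ fun t => mDeg_surj r hp,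
    fun j k hk => ?_, ⟨(1, 0), by simp [mDeg], rfl⟩, fun t ht ht' => ⟨(0, 2), ?_, rfl⟩⟩
  · rw [coe_mBasis, oBasis_eq]
    simp
  · rw [coe_mBasis, oBasis_mul]
    rcases Int.units_eq_one_or ((-1) ^ ((i.1 : ℕ) * j.2)) with h | h <;> rw [h]
    · exact ⟨1, one_ne_zero, by simp⟩
    · exact ⟨-1, neg_ne_zero.2 one_ne_zero, by simp⟩
  · rw [coe_mBasis, oBasis_mul, oBasis_mul, beta_mDeg r hp, par_mDeg r hp, par_mDeg r hp,
      add_comm j i, smul_smul]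
    congr 1
    rw [← Nat.cast_mul, uzpow_natCast, ← pow_add, ← pow_add]
    rw [(by ring : (i.2 : ℕ) * j.2 + (i.1 * j.2 + i.2 * j.1 + i.2 * j.2) + j.1 * i.2 =
      i.1 * j.2 + 2 * (i.2 * j.2 + i.2 * j.1)), pow_add, pow_mul]
    simp
  · rw [coe_mBasis, exch_oBasis]
  · rw [coe_mBasis, par_mDeg r hp, par_mDeg r hp]
    exact exch_mul (oBasis_mem i) (oBasis_mem j)
  · have h3 : mDeg r i * mDeg r (j - i) = mDeg r j := by rw [← hadd, add_sub_cancel]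
    rw [← h3, inv_mul_cancel_left] at h
    exact (sub_eq_zero.1 (eq_zero_of_mDeg_mem r hp h)).symm
  · rw [par_mDeg r hp]
    rfl
  · rw [mDeg, map_mul, map_pow, map_pow, MonoidHom.mul_apply, MonoidHom.pow_apply,
      MonoidHom.pow_apply, r.t₁_K k hk, OddTriple.beta_tp_even (r.par_K hk), one_pow, one_pow,
      one_mul]
  · rw [((hrad t).1 ht').resolve_left ht]
    simpa [mDeg] using h1 _ r.t₁_odd

theorem RealizationM.exists_stdData (hp : par (P.tp : GSharp G) = 0) (h2 : (2 : F) ≠ 0) :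
    ∃ φ₀ : Real (F := F) (Ex (mParity F 1 1)) r.toKDecomp →ₗ[F] Real (Ex (mParity F 1 1))
      r.toKDecomp, ⇑φ₀ = DMInv F r ∧ Nonempty (StdData P (DM F r) φ₀) := by
  have h := (r.isCore hp h2).nonempty_stdData h2
  rw [coe_mBasis] at h
  exact ⟨_, rfl, h⟩

end RealM

/-! ### The standard realizations of type `Q` -/

section RealQ

variable {F : Type u} [Field F] {G : Type v} [CommGroup G] {P : OddTriple G}

variable (F) in
/-- The element `(u, ū)`. -/
def qY : Ex (qParity F 1) := exPlus _ (qCentral F 1)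

theorem qY_sq : qY F * qY F = exMinus _ 1 := exPlus_odd_mul_self (qCentral_mem 1) (qCentral_sq 1)

theorem qY_pow_four : qY F ^ 4 = 1 := by
  rw [(show 4 = 2 + 2 from rfl), pow_add, pow_two, qY_sq, exMinus_one_mul_exMinus, exPlus_one]

theorem qBasis_eq (j : Fin 4) : qBasis F j = qY F ^ (j : ℕ) := by
  have h3 : qY F ^ 3 = exMinus _ (qCentral F 1) := by
    rw [pow_succ, pow_two, qY_sq, qY, exMinus_one_mul_exPlus]
  fin_cases j
  · simp [qBasis, exPlus_one]
  · simp [qBasis]; rfl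
  · simp [qBasis, pow_two, qY_sq]
  · simp [qBasis, h3]; rfl

theorem qBasis_mul (i j : Fin 4) : qBasis F i * qBasis F j = qBasis F (i + j) := by
  rw [qBasis_eq, qBasis_eq, qBasis_eq, Fin.val_add, ← pow_eq_pow_mod _ (qY_pow_four (F := F)), pow_add]

theorem qBasis_mem (j : Fin 4) : qBasis F j ∈ exParity (qParity F 1) (j : ℕ) := by
  rw [qBasis_eq]
  exact exPlus_pow_mem (𝒮 := qParity F 1) (qCentral_mem 1) _

/-- The signs of the exchange superinvolution on `qBasis`. -/
def qSign : Fin 4 → ℤˣ := ![1, 1, -1, -1]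

theorem exch_qBasis (j : Fin 4) : exch (qParity F 1) (qBasis F j) = qSign j • qBasis F j := by
  fin_cases j <;> simp [qBasis, qSign, exch_exPlus, exch_exMinus]

theorem qU_apply : ((qU F : Q F 1) : M F 1 1) = Matrix.fromBlocks 0 1 1 0 := rfl

theorem qBasis_linearIndependent (h2 : (2 : F) ≠ 0) : LinearIndependent F (qBasis F) := by
  rw [Fintype.linearIndependent_iff]
  intro c hc
  simp only [Fin.sum_univ_succ, Fin.sum_univ_zero] at hc
  have h1 := congrArg (fun z => ((Prod.fst z : Q F 1) : M F 1 1)) hc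
  have h3 : _ = (0 : M F 1 1) :=
    congrArg (fun z => (((toSOp (qParity F 1)).symm z.2 : Q F 1) : M F 1 1)) hc
  have e := fun a b => congrFun (congrFun h1 a) b
  have e' := fun a b => congrFun (congrFun h3 a) b
  have e1 := e (Sum.inl 0) (Sum.inl 0)
  have e2 := e (Sum.inl 0) (Sum.inr 0)
  have e3 := e' (Sum.inl 0) (Sum.inl 0)
  have e4 := e' (Sum.inl 0) (Sum.inr 0)
  simp [qBasis, exPlus, exMinus, qU_apply] at e1 e2 e3 e4
  have key : ∀ x : F, 2 * x = 0 → x = 0 := fun x hx => (mul_eq_zero.1 hx).resolve_left h2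
  intro j
  apply key
  fin_cases j <;> simp only [Fin.zero_eta, Fin.mk_one, Fin.reduceFinMk]
  · linear_combination e1 + e3
  · linear_combination e2 + e4
  · linear_combination e1 - e3
  · linear_combination e2 - e4

theorem Q_one_eq (s : Q F 1) : ∃ a b : F, s = a • 1 + b • qU F := by
  obtain ⟨_, A, B, rfl⟩ := s
  refine ⟨A 0 0, B 0 0, Subtype.ext ?_⟩
  change Matrix.fromBlocks A B B A =
    A 0 0 • (1 : M F 1 1) + B 0 0 • Matrix.fromBlocks 0 1 1 0
  rw [← Matrix.fromBlocks_one, Matrix.fromBlocks_smul, Matrix.fromBlocks_smul,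
    Matrix.fromBlocks_add]
  congr 1 <;> ext i j <;> simp [Subsingleton.elim i 0, Subsingleton.elim j 0]

theorem qBasis_span (h2 : (2 : F) ≠ 0) : ⊤ ≤ Submodule.span F (Set.range (qBasis F)) := by
  have hmem : ∀ j, qBasis F j ∈ Submodule.span F (Set.range (qBasis F)) :=
    fun j => Submodule.subset_span ⟨j, rfl⟩
  have hplus : ∀ s, exPlus (qParity F 1) s ∈ Submodule.span F (Set.range (qBasis F)) := by
    intro s
    obtain ⟨a, b, rfl⟩ := Q_one_eq s
    exact add_mem (Submodule.smul_mem _ a (hmem 0)) (Submodule.smul_mem _ b (hmem 1))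
  have hminus : ∀ s, exMinus (qParity F 1) s ∈ Submodule.span F (Set.range (qBasis F)) := by
    intro s
    obtain ⟨a, b, rfl⟩ := Q_one_eq s
    have h1 : exMinus (qParity F 1) (a • 1 + b • qU F) =
        a • qBasis F 2 + b • qBasis F 3 := by
      refine Prod.ext rfl ?_
      change -(toSOp (qParity F 1) (a • 1 + b • qU F)) =
        a • -toSOp (qParity F 1) 1 + b • -toSOp (qParity F 1) (qU F)
      rw [map_add, map_smul, map_smul, smul_neg, smul_neg, neg_add]
    rw [h1]
    exact add_mem (Submodule.smul_mem _ a (hmem 2)) (Submodule.smul_mem _ b (hmem 3))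
  rintro ⟨s, t⟩ -
  have h1 : ((s, t) : Ex (qParity F 1)) = (2⁻¹ : F) • (exPlus _ s + exMinus _ s +
      (exPlus _ ((toSOp _).symm t) - exMinus _ ((toSOp _).symm t))) := by
    rw [eq_inv_smul_iff₀ h2, two_smul]
    refine Prod.ext ?_ ?_
    · change s + s = s + s + ((toSOp (qParity F 1)).symm t - (toSOp (qParity F 1)).symm t)
      rw [sub_self, add_zero]
    · change t + t = toSOp _ s + -toSOp _ s + (t - -t)
      rw [add_neg_cancel, zero_add, sub_neg_eq_add]
  rw [h1]
  exact Submodule.smul_mem _ _ (add_mem (add_mem (hplus _) (hminus _))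
    (sub_mem (hplus _) (hminus _)))

/-- `qBasis` as a basis. -/
def exQBasis (h2 : (2 : F) ≠ 0) : Module.Basis (Fin 4) F (Ex (qParity F 1)) :=
  Module.Basis.mk (qBasis_linearIndependent h2) (qBasis_span h2)

theorem coe_exQBasis (h2 : (2 : F) ≠ 0) : ⇑(exQBasis h2) = qBasis F := Module.Basis.coe_mk _ _

theorem OddTriple.tp_pow_four (hp : par (P.tp : GSharp G) = 1) : P.tp ^ 4 = 1 := by
  obtain ⟨f, -, hpf, -, h0, h1⟩ := P.exists_radical
  rw [(show 4 = 2 * 2 from rfl), pow_mul, h1 _ hp, h0 _ hpf]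

theorem tp_pow_add (hp : par (P.tp : GSharp G) = 1) (i j : Fin 4) :
    P.tp ^ ((i + j : Fin 4) : ℕ) = P.tp ^ (i : ℕ) * P.tp ^ (j : ℕ) := by
  rw [Fin.val_add, ← pow_eq_pow_mod _ (OddTriple.tp_pow_four hp), pow_add]

/-- Parity excludes odd powers, and `t_p² = f` is a nontrivial element of `rad β⁺`, so it is not in
`K`. -/
theorem eq_zero_of_tp_pow_mem (hp : par (P.tp : GSharp G) = 1) (d : KDecomp P) {j : Fin 4}
    (hj : P.tp ^ (j : ℕ) ∈ d.K) :
    j = 0 := by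
  obtain ⟨f, hf, hpf, hrad, h0, h1⟩ := P.exists_radical
  have e1 := d.par_K hj
  rw [OddTriple.par_pow, hp, mul_one] at e1
  have e3 : j ≠ 2 := fun h => by
    rw [h, Fin.val_two, h1 _ hp] at hj
    exact hf (d.eq_one_of_mem (OddTriple.mem_radPlus_of_rad hpf ((hrad f).2 (Or.inr rfl))) hj)
  revert e1 e3
  fin_cases j <;> decide

theorem KDecomp.isCore (d : KDecomp P) (hp : par (P.tp : GSharp G) = 1) (h2 : (2 : F) ≠ 0) :
    IsCore (exQBasis h2) (fun j => P.tp ^ (j : ℕ)) (exch (qParity F 1)) qSign d := by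
  obtain ⟨f, hf, hpf, hrad, h0, h1⟩ := P.exists_radical
  have hadd := tp_pow_add hp
  have hpar : ∀ j : Fin 4, par ((P.tp ^ (j : ℕ) : P.T) : GSharp G) = (j : ℕ) := fun j => by
    rw [OddTriple.par_pow, hp, mul_one]
  have hsurj : ∀ t ∈ P.radPlus, ∃ j : Fin 4, P.tp ^ (j : ℕ) = t := by
    intro t ht
    have h3 : P.β t P.tp = 1 := by rw [P.beta_symm]; exact OddTriple.beta_tp_even ht.1
    rcases (hrad t).1 (OddTriple.beta_eq_one_of_odd ht hp h3) with rfl | rfl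
    · exact ⟨0, by simp⟩
    · exact ⟨2, h1 _ hp⟩
  refine ⟨⟨0, by simp, ?_⟩, fun i j => ⟨i + j, hadd i j, 1, one_ne_zero, ?_⟩, fun i j => ?_,
    fun j => ?_, fun i j => ?_, fun i j h => ?_, d.exists_deg hadd (j₁ := 1) ?_ hsurj,
    fun j k hk => ?_, ⟨1, by simp, rfl⟩, fun t ht ht' => ⟨2, ?_, rfl⟩⟩
  · rw [coe_exQBasis, qBasis_eq]
    simp
  · rw [coe_exQBasis, qBasis_mul, one_smul]
  · rw [coe_exQBasis, qBasis_mul, qBasis_mul, add_comm j i, hpar, hpar, ← Nat.cast_mul,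
      uzpow_natCast]
    simp only [map_pow, MonoidHom.pow_apply]
    rw [P.tp_parity, hp, uzpow_one, ← pow_mul, ← pow_add, ← two_mul, pow_mul]
    simp
  · rw [coe_exQBasis, exch_qBasis]
  · rw [coe_exQBasis, hpar, hpar]
    exact exch_mul (qBasis_mem i) (qBasis_mem j)
  · have h3 := hadd i (j - i)
    rw [add_sub_cancel] at h3
    rw [h3, inv_mul_cancel_left] at h
    exact (sub_eq_zero.1 (eq_zero_of_tp_pow_mem hp d h)).symm
  · rw [hpar]
    rfl
  · rw [map_pow, MonoidHom.pow_apply, OddTriple.beta_tp_even (d.par_K hk), one_pow]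
  · rw [((hrad t).1 ht').resolve_left ht]
    exact h1 _ hp

theorem KDecomp.exists_stdData (d : KDecomp P) (hp : par (P.tp : GSharp G) = 1)
    (h2 : (2 : F) ≠ 0) :
    ∃ φ₀ : Real (F := F) (Ex (qParity F 1)) d →ₗ[F] Real (Ex (qParity F 1)) d,
      ⇑φ₀ = DQInv F d ∧ Nonempty (StdData P (DQ F d) φ₀) := by
  have h := (d.isCore hp h2).nonempty_stdData h2
  rw [coe_exQBasis] at h
  exact ⟨_, rfl, h⟩

end RealQ

/-! ### Standard models for gradings on the exchange superalgebra -/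

section Existence

variable {F : Type u} [Field F] [IsAlgClosed F] {S : Type w} [Ring S] [Algebra F S]
  [FiniteDimensional F S] {𝒮 : ZMod 2 → Submodule F S} [GradedAlgebra 𝒮] {G : Type v} [CommGroup G]
  {Γ : G → Submodule F (Ex 𝒮)} {D : Type*} [Ring D] [Algebra F D] {𝒟 : GSharp G → Submodule F D}
  {φ₀ : D →ₗ[F] D}

theorem OddCorner.exists_model_ex (h2 : (2 : F) ≠ 0)
    (hΓ : IsGradingOfSuperinv (exParity 𝒮) (exch 𝒮) Γ)
    (hs : IsGradedSimple (sharp (exParity 𝒮) Γ)) {ε : Ex 𝒮}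
    (he : IsDivIdem (sharp (exParity 𝒮) Γ) ε)
    (O : OddCorner (sharp (exParity 𝒮) Γ) (exch 𝒮) ε) (S : StdData O.P 𝒟 φ₀) :
    ∃ (κ : (G ⧸ plus O.P.T) →₀ ℕ) (g₀ : G) (c : BlockChoice O.P.T 𝒟),
      IsAdmissible O.P.T 𝒟 φ₀ κ g₀ ∧
        GradedIso (sharp (exParity 𝒮) Γ) (exch 𝒮) (EGrading c κ) (EInv φ₀ c κ g₀) := by
  have h := isGrading_sharp hΓ
  have hpr := hs.isGradedPrime h
  obtain ⟨f, -⟩ := O.exists_frame h2 h hpr (isGradedSuperinv_exch hΓ) he S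
  exact f.exists_model h2 h hpr (isGradedSuperinv_exch hΓ) S

end Existence

end GradedSuper

end

/-! ### The classification theorem -/

set_option maxHeartbeats 1000000 in
open GradedSuper in
theorem mainTheorem9 {F : Type*} [Field F] [IsAlgClosed F] (hF : (2 : F) ≠ 0)
    {G : Type*} [CommGroup G]
    (rM : ∀ P : OddTripleM G, RealizationM P.1) (rQ : ∀ P : OddTripleQ G, KDecomp P.1) :
    -- odd gradings on `M(n,n) × M(n,n)ˢᵒᵖ`
    (∀ (n : ℕ) (Γ : G → Submodule F (Ex (mParity F n n))),
      IsGradingOfSuperinv (exParity (mParity F n n)) (exch (mParity F n n)) Γ →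
      IsGradedSimple (sharp (exParity (mParity F n n)) Γ) →
      IsOddlyGraded (sharp (exParity (mParity F n n)) Γ) →
      ∃ (P : OddTripleM G) (κ : (G ⧸ plus P.1.T) →₀ ℕ) (g₀ : G)
        (c : BlockChoice P.1.T (DM F (rM P))),
        IsAdmissible P.1.T (DM F (rM P)) (DMInv F (rM P)) κ g₀ ∧
        GradedIso (sharp (exParity (mParity F n n)) Γ) (exch (mParity F n n))
          (EGrading c κ) (EInv (DMInv F (rM P)) c κ g₀)) ∧
    (∀ (P P' : OddTripleM G) (κ : (G ⧸ plus P.1.T) →₀ ℕ) (κ' : (G ⧸ plus P'.1.T) →₀ ℕ)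
      (g₀ g₀' : G)
      (c : BlockChoice P.1.T (DM F (rM P))) (c' : BlockChoice P'.1.T (DM F (rM P'))),
      IsAdmissible P.1.T (DM F (rM P)) (DMInv F (rM P)) κ g₀ →
      IsAdmissible P'.1.T (DM F (rM P')) (DMInv F (rM P')) κ' g₀' →
      (GradedIso (EGrading c κ) (EInv (DMInv F (rM P)) c κ g₀)
          (EGrading c' κ') (EInv (DMInv F (rM P')) c' κ' g₀') ↔
        P = P' ∧ ∃ g : G,
          (∀ x : G, κ' (x : G ⧸ plus P'.1.T) = κ ((g⁻¹ * x : G) : G ⧸ plus P.1.T)) ∧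
          g₀' = g ^ (-2 : ℤ) * g₀)) ∧
    -- odd gradings on `Q(n) × Q(n)ˢᵒᵖ`
    (∀ (n : ℕ) (Γ : G → Submodule F (Ex (qParity F n))),
      IsGradingOfSuperinv (exParity (qParity F n)) (exch (qParity F n)) Γ →
      IsGradedSimple (sharp (exParity (qParity F n)) Γ) →
      IsOddlyGraded (sharp (exParity (qParity F n)) Γ) →
      ∃ (P : OddTripleQ G) (κ : (G ⧸ plus P.1.T) →₀ ℕ) (g₀ : G)
        (c : BlockChoice P.1.T (DQ F (rQ P))),
        IsAdmissible P.1.T (DQ F (rQ P)) (DQInv F (rQ P)) κ g₀ ∧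
        GradedIso (sharp (exParity (qParity F n)) Γ) (exch (qParity F n))
          (EGrading c κ) (EInv (DQInv F (rQ P)) c κ g₀)) ∧
    (∀ (P P' : OddTripleQ G) (κ : (G ⧸ plus P.1.T) →₀ ℕ) (κ' : (G ⧸ plus P'.1.T) →₀ ℕ)
      (g₀ g₀' : G)
      (c : BlockChoice P.1.T (DQ F (rQ P))) (c' : BlockChoice P'.1.T (DQ F (rQ P'))),
      IsAdmissible P.1.T (DQ F (rQ P)) (DQInv F (rQ P)) κ g₀ →
      IsAdmissible P'.1.T (DQ F (rQ P')) (DQInv F (rQ P')) κ' g₀' →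
      (GradedIso (EGrading c κ) (EInv (DQInv F (rQ P)) c κ g₀)
          (EGrading c' κ') (EInv (DQInv F (rQ P')) c' κ' g₀') ↔
        P = P' ∧ ∃ g : G,
          (∀ x : G, κ' (x : G ⧸ plus P'.1.T) = κ ((g⁻¹ * x : G) : G ⧸ plus P.1.T)) ∧
          g₀' = g ^ (-2 : ℤ) * g₀)) := by
  refine ⟨fun n Γ hΓ hs ho => ?_, fun P P' κ κ' g₀ g₀' c c' hadm hadm' => ⟨fun hiso => ?_, ?_⟩,
    fun n Γ hΓ hs ho => ?_, fun P P' κ κ' g₀ g₀' c c' hadm hadm' => ⟨fun hiso => ?_, ?_⟩⟩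
  · obtain ⟨ε, he, ⟨O⟩⟩ := exists_oddCorner_ex (𝒮 := mParity F n n) hF
      (fun z _ hz => exists_smul_one_of_central hz) hΓ hs ho
    -- Odd central elements decide the parity of `t_p`: `M(n,n)` has no nonzero ones, while `Q(n)`
    -- below has one of square `1`.
    have hp := par_tp_eq_zero_ex (𝒮 := mParity F n n) (fun z hz hc => mParity_odd_central hz hc) hΓ hs he O
    obtain ⟨φ₀, hφ₀, ⟨S⟩⟩ := (rM ⟨O.P, hp⟩).exists_stdData hp hF
    obtain ⟨κ, g₀, c, ha, hi⟩ := OddCorner.exists_model_ex (𝒮 := mParity F n n) hF hΓ hs he O S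
    rw [hφ₀] at ha hi
    exact ⟨⟨O.P, hp⟩, κ, g₀, c, ha, hi⟩
  · obtain ⟨φ₀, hφ₀, ⟨S⟩⟩ := (rM P).exists_stdData P.2 hF
    obtain ⟨φ₀', hφ₀', ⟨S'⟩⟩ := (rM P').exists_stdData P'.2 hF
    -- The triples are identified first; only then do both models use the same realization and the
    -- parameters become comparable.
    have h1 : P = P' := by
      rw [← hφ₀] at hadm hiso
      rw [← hφ₀'] at hadm' hiso
      exact Subtype.ext (S.triple_eq hF S' hadm hadm' hiso)
    subst h1
    rw [← hφ₀] at hadm hadm' hiso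
    exact ⟨rfl, (S.gradedIso_iff hF hadm hadm').1 hiso⟩
  · rintro ⟨rfl, hg⟩
    obtain ⟨φ₀, hφ₀, ⟨S⟩⟩ := (rM P).exists_stdData P.2 hF
    rw [← hφ₀] at hadm hadm' ⊢
    exact (S.gradedIso_iff hF hadm hadm').2 hg
  · obtain ⟨ε, he, ⟨O⟩⟩ := exists_oddCorner_ex (𝒮 := qParity F n) hF
      (fun z hz hc => qParity_even_central hz hc) hΓ hs ho
    have hp := par_tp_eq_one_ex (𝒮 := qParity F n) hF (qCentral_mem n) (qCentral_sq n) (qCentral_central n)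
      hΓ hs he O
    obtain ⟨φ₀, hφ₀, ⟨S⟩⟩ := (rQ ⟨O.P, hp⟩).exists_stdData hp hF
    obtain ⟨κ, g₀, c, ha, hi⟩ := OddCorner.exists_model_ex (𝒮 := qParity F n) hF hΓ hs he O S
    rw [hφ₀] at ha hi
    exact ⟨⟨O.P, hp⟩, κ, g₀, c, ha, hi⟩
  · obtain ⟨φ₀, hφ₀, ⟨S⟩⟩ := (rQ P).exists_stdData P.2 hF
    obtain ⟨φ₀', hφ₀', ⟨S'⟩⟩ := (rQ P').exists_stdData P'.2 hF
    have h1 : P = P' := by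
      rw [← hφ₀] at hadm hiso
      rw [← hφ₀'] at hadm' hiso
      exact Subtype.ext (S.triple_eq hF S' hadm hadm' hiso)
    subst h1
    rw [← hφ₀] at hadm hadm' hiso
    exact ⟨rfl, (S.gradedIso_iff hF hadm hadm').1 hiso⟩
  · rintro ⟨rfl, hg⟩
    obtain ⟨φ₀, hφ₀, ⟨S⟩⟩ := (rQ P).exists_stdData P.2 hF
    rw [← hφ₀] at hadm hadm' ⊢
    exact (S.gradedIso_iff hF hadm hadm').2 hg
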